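/- Let $X$ be a complex manifold of dimension $n$ (Hausdorff, $\sigma$-compact), let $(E,h_E)$ be a holomorphic vector bundle of finite rank over $X$ with a smooth Hermitian metric, let $0\le m\le n$, and let $\omega,\alpha_{m+1},\dots,\alpha_n$ be smooth positive $(1,1)$-forms on $X$. Put $T:=\alpha_{m+1}\wedge\cdots\wedge\alpha_n$ ($T:=1$ if $m=n$). Let $V^k$ be the space of smooth $E$-valued $k$-forms with compact support on $X$, $V:=\bigoplus_k V^k$, $f_T(u):=T\wedge u$ for $u\in V$, $V_T^k:=f_T(V^k)$, $V_T:=f_T(V)=\bigoplus_{k=0}^{2m}V_T^k$. Let $Lu:=\omega\wedge u$ on $V_T$, $L_r:=L^r/r!$; an element $u\in V_T^k$ is primitive if $k\le m$ and $L^{m-k+1}u=0$. Let $*_s$ be the $\mathbb C$-linear automorphism of $V_T$ with $*_s(L_ru)=(-1)^{k+\cdots+1}L_{m-r-k}u$ for $u\in V_T^k$ primitive and $0\le r\le m-k$; let $\Lambda:=*_s^{-1}L*_s$ and $*:=*_s\circ J$, where $J$ is the Weil operator $(Ju)(v_1,\dots,v_k)=u(Jv_1,\dots,Jv_k)$. With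 $\{u,v\}_{h_E}:=\sum h_E(e_\alpha,e_\beta)\,u^\alpha\wedge\bar v^\beta$ for $u=\sum u^\alpha\otimes e_\alpha$, $v=\sum v^\beta\otimes e_\beta$ in a local frame $(e_\alpha)$, equip $V_T$ with the inner product for which the $V_T^k$ are mutually orthogonal and $$(u,v)=\int_X\{f_T^{-1}(u),*v\}_{h_E}\ (u,v\in V_T^k,\ k\le m),\qquad (u,v)=\int_X\{u,f_T^{-1}(*v)\}_{h_E}\ (u,v\in V_T^k,\ m\le k\le 2m).$$ (Here $f_T^{-1}(w)$ denotes the preimage of $w$ in $V^j$ for $w \in V_T^j$, $j\le m$.) Let $D=\bar\partial+\partial^E$ be the Chern connection of $(E,h_E)$, $D^c:=i\bar\partial-i\partial^E$, $\Theta(E,h_E):=D^2$. Assume that $T$ and $\omega$ are $d$-closed. Then $L$, $J$, $\bar\partial$ and $\partial^E$ map $V_T$ to itself, the operator $*_s$ exists and is unique, and $\bar\partial,\partial^E,D,D^c\colon V_T\to V_T$ have unique adjoints $\bar\partial^*,(\partial^E)^*,D^*,(D^c)^*\colon V_T\to V_T$ (that is, $(Pu,v)=(u,P^*v)$ for all $u,v\in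 V_T$). They satisfy the Kähler identities $$D^*=[\Lambda,D^c],\qquad (D^c)^*=[D,\Lambda]\qquad\text{on }V_T.$$ Moreover, with $\Box_P:=PP^*+P^*P$, the Bochner–Kodaira–Nakano identity $$\Box_{\bar\partial}=\Box_{\partial^E}+[i\Theta(E,h_E),\Lambda]\qquad\text{on }V_T$$ holds, and $$\Box_{D^c}=\Box_D=\Box_{\bar\partial}+\Box_{\partial^E}\qquad\text{on }V_T.$$ -/

import Mathlib

open scoped Manifold ContDiff Bundle ComplexConjugate

noncomputable section

namespace THodge

/-! ## Multilinear algebra: graded alternating forms -/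

/-- Inhomogeneous alternating forms on a real vector space `M` with values in `N`; the component
of degree `k` of `a` is `a k`.  (If `M` has finite dimension, all components of large degree
vanish, so this is the finite direct sum of the spaces of alternating `k`-forms.) -/
abbrev GForm (M N : Type*) [AddCommGroup M] [Module ℝ M] [AddCommGroup N] [Module ℝ N] : Type _ :=
  ∀ k : ℕ, M [⋀^Fin k]→ₗ[ℝ] N

section Algebra

variable {M N₁ N₂ N₃ : Type*} [AddCommGroup M] [Module ℝ M]
  [AddCommGroup N₁] [Module ℝ N₁] [AddCommGroup N₂] [Module ℝ N₂] [AddCommGroup N₃] [Module ℝ N₃]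

/-- The exterior product of a `p`-form and a `q`-form whose values are multiplied by `B`
(a sum over `(p, q)`-shuffles, so that `(a ∧ b) (v, w) = B (a v) (b w) - B (a w) (b v)` for
one-forms). -/
def wedgeHom (B : N₁ →ₗ[ℝ] N₂ →ₗ[ℝ] N₃) {p q : ℕ} (a : M [⋀^Fin p]→ₗ[ℝ] N₁)
    (b : M [⋀^Fin q]→ₗ[ℝ] N₂) : M [⋀^Fin (p + q)]→ₗ[ℝ] N₃ :=
  ((TensorProduct.lift B).compAlternatingMap (a.domCoprod b)).domDomCongr finSumFinEquiv

/-- The exterior product of inhomogeneous forms whose values are multiplied by `B`. -/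
def wedge (B : N₁ →ₗ[ℝ] N₂ →ₗ[ℝ] N₃) (a : GForm M N₁) (b : GForm M N₂) : GForm M N₃ :=
  fun k => ∑ pq ∈ (Finset.HasAntidiagonal.antidiagonal k).attach,
    (wedgeHom B (a pq.1.1) (b pq.1.2)).domDomCongr (finCongr (Finset.HasAntidiagonal.mem_antidiagonal.1 pq.2))

theorem wedgeHom_add_right (B : N₁ →ₗ[ℝ] N₂ →ₗ[ℝ] N₃) {p q : ℕ} (a : M [⋀^Fin p]→ₗ[ℝ] N₁)
    (b b' : M [⋀^Fin q]→ₗ[ℝ] N₂) :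
    wedgeHom B a (b + b') = wedgeHom B a b + wedgeHom B a b' := by
  have h : a.domCoprod (b + b') = a.domCoprod b + a.domCoprod b' := by
    simp only [← AlternatingMap.domCoprod'_apply, TensorProduct.tmul_add, map_add]
  ext v
  simp [wedgeHom, h]

theorem wedge_add_right (B : N₁ →ₗ[ℝ] N₂ →ₗ[ℝ] N₃) (a : GForm M N₁) (b b' : GForm M N₂) :
    wedge B a (b + b') = wedge B a b + wedge B a b' := by
  funext k
  ext v
  simp [wedge, wedgeHom_add_right, Finset.sum_add_distrib]

theorem wedgeHom_smul_right (B : N₁ →ₗ[ℝ] N₂ →ₗ[ℝ] N₃) {p q : ℕ} (f : N₂ →ₗ[ℝ] N₂)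
    (g : N₃ →ₗ[ℝ] N₃) (hfg : ∀ s t, B s (f t) = g (B s t)) (a : M [⋀^Fin p]→ₗ[ℝ] N₁)
    (b : M [⋀^Fin q]→ₗ[ℝ] N₂) :
    wedgeHom B a (f.compAlternatingMap b) = g.compAlternatingMap (wedgeHom B a b) := by
  have h2 : TensorProduct.lift B ∘ₗ TensorProduct.map LinearMap.id f = g ∘ₗ TensorProduct.lift B := by
    ext s t
    simp [hfg]
  have h3 : a.domCoprod (f.compAlternatingMap b)
      = (TensorProduct.map LinearMap.id f).compAlternatingMap (a.domCoprod b) := by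
    ext v
    simp only [LinearMap.compAlternatingMap_apply, AlternatingMap.domCoprod_apply,
      _root_.sum_apply, map_sum]
    refine Finset.sum_congr rfl fun σ _ => ?_
    induction σ using Quotient.inductionOn'
    simp [AlternatingMap.domCoprod.summand_mk'', MultilinearMap.domCoprod_apply]
  ext v
  have := LinearMap.congr_fun h2 ((a.domCoprod b) (v ∘ finSumFinEquiv))
  simpa [wedgeHom, h3, Function.comp_def] using this

/-- Multiplication of values by complex scalars, as a real bilinear map. -/
def smulBilin (N : Type*) [AddCommGroup N] [Module ℂ N] : ℂ →ₗ[ℝ] N →ₗ[ℝ] N :=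
  LinearMap.mk₂ ℝ (fun c s => c • s) (fun _ _ _ => add_smul _ _ _)
    (fun r c s => by rw [smul_assoc]) (fun _ _ _ => smul_add _ _ _)
    (fun r c s => by rw [smul_comm])

theorem wedge_smul_right {N : Type*} [AddCommGroup N] [Module ℂ N] (a : GForm M ℂ) (c : ℂ)
    (b : GForm M N) : wedge (smulBilin N) a (c • b) = c • wedge (smulBilin N) a b := by
  funext k
  have key : ∀ pq : {x // x ∈ Finset.HasAntidiagonal.antidiagonal k},
      wedgeHom (smulBilin N) (a pq.1.1) (c • b pq.1.2)
        = c • wedgeHom (smulBilin N) (a pq.1.1) (b pq.1.2) := fun pq =>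
    wedgeHom_smul_right (smulBilin N) (smulBilin N c) (smulBilin N c)
      (fun s t => smul_comm s c t) (a pq.1.1) (b pq.1.2)
  ext v
  simp [wedge, key, Finset.smul_sum]

/-- The scalar `0`-form `1`. -/
def oneForm (M : Type*) [AddCommGroup M] [Module ℝ M] : GForm M ℂ :=
  Pi.single 0 (AlternatingMap.constOfIsEmpty ℝ M (Fin 0) (1 : ℂ))

/-- A real `2`-form regarded as a complex valued inhomogeneous form. -/
def ofTwoForm (a : M [⋀^Fin 2]→ₗ[ℝ] ℝ) : GForm M ℂ :=
  Pi.single 2 (Complex.ofRealLI.toLinearMap.compAlternatingMap a)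

end Algebra

/-! ## Forms on open subsets of `W ≅ ℂⁿ` -/

section Local

variable {W : Type*} [NormedAddCommGroup W] [NormedSpace ℂ W]
  {G : Type*} [NormedAddCommGroup G] [NormedSpace ℂ G]

theorem continuous_alternatingMap [FiniteDimensional ℂ W] {k : ℕ} (a : W [⋀^Fin k]→ₗ[ℝ] G) :
    Continuous fun v : Fin k → W => a v := by
  have h : ∀ v : Fin k → W, a v = ∑ r : Fin k → Fin (Module.finrank ℝ W),
      (∏ i, (Module.finBasis ℝ W).equivFun (v i) (r i)) •
        a fun i => Module.finBasis ℝ W (r i) := by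
    intro v
    have hv : v = fun i => ∑ j, (Module.finBasis ℝ W).equivFun (v i) j •
        Module.finBasis ℝ W j := by
      funext i
      exact ((Module.finBasis ℝ W).sum_equivFun (v i)).symm
    conv_lhs => rw [hv]
    rw [← AlternatingMap.coe_multilinearMap, MultilinearMap.map_sum]
    exact Finset.sum_congr rfl fun r _ => MultilinearMap.map_smul_univ _ _ _
  have hc : ∀ j, Continuous fun w : W => (Module.finBasis ℝ W).equivFun w j :=
    fun j => (continuous_apply j).comp
      (Module.finBasis ℝ W).equivFun.toLinearMap.continuous_of_finiteDimensional
  have hp : ∀ r : Fin k → Fin (Module.finrank ℝ W), Continuous fun v : Fin k → W =>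
      ∏ i, (Module.finBasis ℝ W).equivFun (v i) (r i) := fun r =>
    continuous_finsetProd _ fun i _ => (hc (r i)).comp (continuous_apply i)
  rw [show (fun v : Fin k → W => a v) = _ from funext h]
  exact continuous_finsetSum _ fun r _ => (hp r).smul continuous_const

/-- On a finite dimensional space every alternating map is continuous. -/
def toCont [FiniteDimensional ℂ W] {k : ℕ} (a : W [⋀^Fin k]→ₗ[ℝ] G) : W [⋀^Fin k]→L[ℝ] G :=
  { a with cont := continuous_alternatingMap a }

/-- The complex structure of `W`, as a real linear map. -/
def mulI (W : Type*) [NormedAddCommGroup W] [NormedSpace ℂ W] : W →L[ℝ] W :=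
  (Complex.I • ContinuousLinearMap.id ℂ W).restrictScalars ℝ

/-- The `ℂ`-antilinear part `v ↦ (A v + i A (i v)) / 2` of a real linear map `A`. -/
def antilinearPart (A : W →L[ℝ] G) : W →L[ℝ] G :=
  (1 / 2 : ℂ) • (A + Complex.I • A.comp (mulI W))

/-- The `ℂ`-linear part `v ↦ (A v - i A (i v)) / 2` of a real linear map `A`. -/
def linearPart (A : W →L[ℝ] G) : W →L[ℝ] G :=
  (1 / 2 : ℂ) • (A - Complex.I • A.comp (mulI W))

/-- `∂̄ a = ∑ⱼ dz̄ⱼ ∧ ∂a/∂z̄ⱼ` for a vector valued form `a` on an open subset of `W ≅ ℂⁿ`; the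
derivatives are those of the coefficients. -/
def dbarLocal {k : ℕ} (a : W → W [⋀^Fin k]→L[ℝ] G) (y : W) :
    W [⋀^Fin (k + 1)]→L[ℝ] G :=
  .alternatizeUncurryFin (antilinearPart (fderiv ℝ a y))

/-- `∂ a = ∑ⱼ dzⱼ ∧ ∂a/∂zⱼ` for a vector valued form `a` on an open subset of `W ≅ ℂⁿ`. -/
def delLocal {k : ℕ} (a : W → W [⋀^Fin k]→L[ℝ] G) (y : W) :
    W [⋀^Fin (k + 1)]→L[ℝ] G :=
  .alternatizeUncurryFin (linearPart (fderiv ℝ a y))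

variable (W) in
/-- The linear coordinates `ℂⁿ ≃ W` given by a complex basis `(eⱼ)` of `W`. -/
def coord [FiniteDimensional ℂ W] : (Fin (Module.finrank ℂ W) → ℂ) ≃ₗ[ℂ] W :=
  (Module.finBasis ℂ W).equivFun.symm

variable (W) in
/-- The real frame `(e₁, i e₁, …, eₙ, i eₙ) = (∂/∂x₁, ∂/∂y₁, …, ∂/∂xₙ, ∂/∂yₙ)` of `W`, which is
positively oriented. -/
def stdFrame [FiniteDimensional ℂ W] : Fin (2 * Module.finrank ℂ W) → W :=
  fun k => (if k.1 % 2 = 0 then (1 : ℂ) else Complex.I) •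
    Module.finBasis ℂ W ⟨k.1 / 2, by omega⟩

end Local

/-! ## Forms on a complex manifold -/

section Manifold

variable {W : Type*} [NormedAddCommGroup W] [NormedSpace ℂ W] [FiniteDimensional ℂ W]
  {X : Type*} [TopologicalSpace X] [ChartedSpace W X]

/-- The holomorphic tangent space of `X` at `x`, with its complex structure. -/
abbrev Tan (W : Type*) [NormedAddCommGroup W] [NormedSpace ℂ W]
    {X : Type*} [TopologicalSpace X] [ChartedSpace W X] (x : X) : Type _ :=
  TangentSpace 𝓘(ℂ, W) x

/-- The differential at `y` of the inverse of the preferred chart at `x₀`, as a real linear map. -/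
def dChartSymm (x₀ : X) (y : W) :
    W →ₗ[ℝ] Tan W ((chartAt W x₀).symm y) :=
  LinearMap.restrictScalars ℝ (M := W) (M₂ := Tan W ((chartAt W x₀).symm y)) (S := ℂ)
    (mfderiv 𝓘(ℂ, W) 𝓘(ℂ, W) (chartAt W x₀).symm y).toLinearMap

/-- The differential at `x` of the preferred chart at `x`, as a real linear map. -/
def dChart (x : X) : Tan W x →ₗ[ℝ] W :=
  LinearMap.restrictScalars ℝ (M := Tan W x) (M₂ := W) (S := ℂ)
    (mfderiv 𝓘(ℂ, W) 𝓘(ℂ, W) (chartAt W x) x).toLinearMap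

/-- The expression of a `G`-valued form in the preferred chart at `x₀`, i.e. its pullback by the
inverse of the chart; only its values on the target of the chart matter. -/
def chartPull {G : Type*} [NormedAddCommGroup G] [NormedSpace ℂ G] (x₀ : X) {k : ℕ}
    (a : ∀ x : X, Tan W x [⋀^Fin k]→ₗ[ℝ] G) (y : W) : W [⋀^Fin k]→L[ℝ] G :=
  toCont ((a ((chartAt W x₀).symm y)).compLinearMap (dChartSymm x₀ y))

/-- A smooth positive `(1,1)`-form `α`: a smooth real `2`-form that is invariant under the complex
structure `J` (that is, of type `(1,1)`) and satisfies `α (v, J v) > 0` for `v ≠ 0`. -/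
structure IsPositiveForm (α : ∀ x : X, Tan W x [⋀^Fin 2]→ₗ[ℝ] ℝ) : Prop where
  smooth : ∀ x₀ : X, ContDiffOn ℝ ∞
    (chartPull x₀ fun x => Complex.ofRealLI.toLinearMap.compAlternatingMap (α x))
    (chartAt W x₀).target
  invariant : ∀ (x : X) (v w : Tan W x),
    α x ![Complex.I • v, Complex.I • w] = α x ![v, w]
  pos : ∀ (x : X) (v : Tan W x), v ≠ 0 → 0 < α x ![v, Complex.I • v]

/-- A complex valued form is `d`-closed: in every chart its exterior derivative vanishes. -/
def IsDClosed (a : ∀ x : X, GForm (Tan W x) ℂ) : Prop :=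
  ∀ (x : X) (k : ℕ),
    extDeriv (chartPull x fun x' => a x' k) (chartAt W x x) = 0

/-- The form `α₁ ∧ ⋯ ∧ αᵣ`; it is `1` if `r = 0`. -/
def wedgeProd {r : ℕ} (α : Fin r → ∀ x : X, Tan W x [⋀^Fin 2]→ₗ[ℝ] ℝ) (x : X) :
    GForm (Tan W x) ℂ :=
  (List.ofFn fun j => ofTwoForm (α j x)).foldr (wedge (smulBilin ℂ)) (oneForm (Tan W x))

section Integral

theorem isManifold_real [hX : IsManifold 𝓘(ℂ, W) ω X] :
    IsManifold 𝓘(ℝ, W) ∞ X := by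
  refine isManifold_of_contDiffOn _ _ _ fun e e' he he' => ?_
  have h := (contDiffGroupoid ω 𝓘(ℂ, W)).compatible he he'
  rw [contDiffGroupoid, mem_groupoid_of_pregroupoid] at h
  have h1 : ContDiffOn ℂ ω _ _ := h.1
  exact (h1.restrict_scalars ℝ).of_le le_top

variable (W X) in
/-- A smooth partition of unity on `X` subordinate to the cover by the preferred charts. -/
def chartPartition [IsManifold 𝓘(ℂ, W) ω X] [T2Space X] [SigmaCompactSpace X] :
    SmoothPartitionOfUnity X 𝓘(ℝ, W) X Set.univ :=
  haveI : IsManifold 𝓘(ℝ, W) ∞ X := isManifold_real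
  (SmoothPartitionOfUnity.exists_isSubordinate_chartAt_source 𝓘(ℝ, W) X).choose

/-- The integral over `X`, with its complex orientation, of a compactly supported complex valued
form of degree `2n`: cut the form into pieces by a partition of unity and integrate each piece
`g dx₁ ∧ dy₁ ∧ ⋯ ∧ dxₙ ∧ dyₙ` in its chart. -/
def integralForm [IsManifold 𝓘(ℂ, W) ω X] [T2Space X] [SigmaCompactSpace X]
    (η : ∀ x : X, Tan W x [⋀^Fin (2 * Module.finrank ℂ W)]→ₗ[ℝ] ℂ) : ℂ :=
  ∑ᶠ i : X, ∫ z in {z | coord W z ∈ (chartAt W i).target},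
    (chartPartition W X i ((chartAt W i).symm (coord W z)) : ℂ) *
      chartPull i η (coord W z) (stdFrame W)

end Integral

/-! ## Forms with values in a holomorphic vector bundle -/

variable {F : Type*} [NormedAddCommGroup F] [NormedSpace ℂ F] {E : X → Type*}
  [∀ x, AddCommGroup (E x)] [∀ x, Module ℂ (E x)]

variable (W E) in
/-- (Not necessarily smooth) `E`-valued inhomogeneous forms on `X`. -/
abbrev EForm : Type _ := ∀ x : X, GForm (Tan W x) (E x)

/-- The component of degree `k` of a form. -/
def comp (k : ℕ) (u : EForm W E) : EForm W E := fun x => Pi.single k (u x k)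

/-- The Weil operator: `(J u) (v₁, …, vₖ) = u (J v₁, …, J vₖ)`; it is multiplication by
`i ^ (p - q)` on forms of type `(p, q)`. -/
def weil (u : EForm W E) : EForm W E := fun x k =>
  (u x k).compLinearMap
    (LinearMap.restrictScalars ℝ (Complex.I • (LinearMap.id : Tan W x →ₗ[ℂ] Tan W x)))

/-- Exterior multiplication by a complex valued form. -/
def wedgeE (E : X → Type*) [∀ x, AddCommGroup (E x)] [∀ x, Module ℂ (E x)]
    (a : ∀ x : X, GForm (Tan W x) ℂ) : EForm W E →ₗ[ℂ] EForm W E where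
  toFun u := fun x => wedge (smulBilin (E x)) (a x) (u x)
  map_add' u v := funext fun x => wedge_add_right _ _ _ _
  map_smul' c u := funext fun x => wedge_smul_right _ _ _

variable [∀ x, TopologicalSpace (E x)] [TopologicalSpace (Bundle.TotalSpace F E)]
  [FiberBundle F E] [VectorBundle ℂ F E]

variable (F) in
/-- The expression of the degree `k` component of an `E`-valued form in the preferred chart and
the preferred holomorphic trivialization at `x₀`. -/
def localForm (x₀ : X) (k : ℕ) (u : EForm W E) (y : W) : W [⋀^Fin k]→L[ℝ] F :=
  chartPull x₀ (fun x => (((trivializationAt F E x₀).linearMapAt ℂ x).restrictScalars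
    ℝ).compAlternatingMap (u x k)) y

variable (W F E) in
/-- The part of the target of the preferred chart at `x₀` over which the preferred
trivialization at `x₀` is defined. -/
def localDomain (x₀ : X) : Set W :=
  (chartAt W x₀).target ∩
    (chartAt W x₀).symm ⁻¹' (trivializationAt F E x₀).baseSet

theorem localForm_add (x₀ : X) (k : ℕ) (u v : EForm W E) :
    localForm F x₀ k (u + v) = localForm F x₀ k u + localForm F x₀ k v := by
  funext y
  ext w
  exact map_add ((trivializationAt F E x₀).linearMapAt ℂ _) _ _

theorem localForm_smul (x₀ : X) (k : ℕ) (c : ℂ) (u : EForm W E) :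
    localForm F x₀ k (c • u) = c • localForm F x₀ k u := by
  funext y
  ext w
  exact map_smul ((trivializationAt F E x₀).linearMapAt ℂ _) _ _

variable (W F E) in
/-- `V`: the space of smooth `E`-valued forms with compact support on `X`. -/
def V : Submodule ℂ (EForm W E) where
  carrier := {u | (∀ (x₀ : X) (k : ℕ), ContDiffOn ℝ ∞ (localForm F x₀ k u) (localDomain W F E x₀)) ∧
    ∃ K : Set X, IsCompact K ∧ ∀ x ∉ K, u x = 0}
  zero_mem' := by
    refine ⟨fun x₀ k => ?_, ∅, isCompact_empty, fun x _ => rfl⟩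
    have h : localForm F x₀ k (0 : EForm W E) = 0 := by
      simpa using localForm_smul (F := F) x₀ k 0 (0 : EForm W E)
    rw [h]
    exact contDiffOn_const
  add_mem' := by
    rintro u v ⟨hu, K, hK, hKu⟩ ⟨hv, K', hK', hKv⟩
    refine ⟨fun x₀ k => ?_, K ∪ K', hK.union hK', fun x hx => ?_⟩
    · rw [localForm_add]
      exact (hu x₀ k).add (hv x₀ k)
    · rw [Pi.add_apply, hKu x fun h => hx (Or.inl h), hKv x fun h => hx (Or.inr h), add_zero]
  smul_mem' := by
    rintro c u ⟨hu, K, hK, hKu⟩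
    refine ⟨fun x₀ k => ?_, K, hK, fun x hx => ?_⟩
    · rw [localForm_smul]
      exact (hu x₀ k).const_smul c
    · rw [Pi.smul_apply, hKu x hx, smul_zero]

variable (W E) in
/-- Forms that are homogeneous of degree `k`. -/
def homogeneous (k : ℕ) : Submodule ℂ (EForm W E) where
  carrier := {u | ∀ (x : X) (j : ℕ), j ≠ k → u x j = 0}
  zero_mem' := fun _ _ _ => rfl
  add_mem' := fun hu hv x j hj => by
    rw [Pi.add_apply, Pi.add_apply, hu x j hj, hv x j hj, add_zero]
  smul_mem' := fun c u hu x j hj => by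
    rw [Pi.smul_apply, Pi.smul_apply, hu x j hj, smul_zero]

variable (W F E) in
/-- `Vᵏ`: the space of smooth `E`-valued `k`-forms with compact support on `X`. -/
def Vdeg (k : ℕ) : Submodule ℂ (EForm W E) := V W F E ⊓ homogeneous W E k

variable (F E) in
/-- A smooth Hermitian metric on `E`, linear in the first and antilinear in the second variable. -/
structure HermitianMetric where
  /-- The Hermitian form on each fibre. -/
  toFun : ∀ x : X, E x →ₗ[ℂ] E x →ₗ⋆[ℂ] ℂ
  conj_symm : ∀ (x : X) (s t : E x), conj (toFun x s t) = toFun x t s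
  pos : ∀ (x : X) (s : E x), s ≠ 0 → 0 < (toFun x s s).re
  smooth : ∀ (x₀ : X) (s t : F), ContDiffOn ℝ ∞
    (fun y => toFun ((chartAt W x₀).symm y)
      ((trivializationAt F E x₀).symm _ s) ((trivializationAt F E x₀).symm _ t))
    (localDomain W F E x₀)

/-- A Hermitian metric on the fibre at `x`, as a real bilinear map. -/
def HermitianMetric.bilin (h : HermitianMetric (W := W) F E) (x : X) : E x →ₗ[ℝ] E x →ₗ[ℝ] ℂ :=
  LinearMap.mk₂ ℝ (fun s t => h.toFun x s t) (fun _ _ _ => by simp)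
    (fun r s t => by
      rw [← Complex.coe_smul, map_smul, LinearMap.smul_apply, Complex.coe_smul])
    (fun _ _ _ => by simp)
    (fun r s t => by
      rw [← Complex.coe_smul, LinearMap.map_smulₛₗ, Complex.conj_ofReal, Complex.coe_smul])

/-- The sesquilinear pairing `{u, v}_h = ∑ h(e_α, e_β) u^α ∧ conj v^β` of `E`-valued forms. -/
def HermitianMetric.pair (h : HermitianMetric (W := W) F E) (u v : EForm W E) (x : X) :
    GForm (Tan W x) ℂ :=
  wedge (h.bilin x) (u x) (v x)

/-- The Gram matrix of the metric at `x` in the frame of `E` given by the preferred trivialization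
at `x₀` and a basis `(bⱼ)` of `F`, as the linear map `s ↦ (h (s, bⱼ))ⱼ`. -/
def HermitianMetric.gram [FiniteDimensional ℂ F] (h : HermitianMetric (W := W) F E) (x₀ x : X) :
    F →ₗ[ℂ] (Fin (Module.finrank ℂ F) → ℂ) :=
  LinearMap.pi fun j =>
    { toFun := fun s => h.toFun x ((trivializationAt F E x₀).symmₗ ℂ x s)
        ((trivializationAt F E x₀).symmₗ ℂ x (Module.finBasis ℂ F j))
      map_add' := fun s t => by simp
      map_smul' := fun c s => by simp }

variable (F) in
/-- The `E x`-valued alternating form on the tangent space at `x` whose expression in the preferred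
chart and the preferred trivialization at `x` is `a`. -/
def fromLocal (x : X) {k : ℕ} (a : W [⋀^Fin k]→L[ℝ] F) : Tan W x [⋀^Fin k]→ₗ[ℝ] E x :=
  (((trivializationAt F E x).symmₗ ℂ x).restrictScalars ℝ).compAlternatingMap
    (a.toAlternatingMap.compLinearMap (dChart x))

variable (F) in
/-- The operator `∂̄` on `E`-valued forms: in a holomorphic chart and a holomorphic trivialization
it acts on the coefficients. -/
def dbarE (u : EForm W E) : EForm W E
  | _, 0 => 0
  | x, k + 1 => fromLocal F x (dbarLocal (localForm F x k u) (chartAt W x x))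

/-- The `(1,0)`-part `∂^E` of the Chern connection of `(E, h)`: in a holomorphic chart and a
holomorphic trivialization it is `H⁻¹ ∘ ∂ ∘ H`, where `H` is the Gram matrix of `h`. -/
def delE [FiniteDimensional ℂ F] (h : HermitianMetric (W := W) F E) (u : EForm W E) : EForm W E
  | _, 0 => 0
  | x, k + 1 => fromLocal F x
      (((h.gram x x).toContinuousLinearMap.inverse.restrictScalars
        ℝ).compContinuousAlternatingMap
        (delLocal (fun y => ((h.gram x
          ((chartAt W x).symm y)).toContinuousLinearMap.restrictScalars
            ℝ).compContinuousAlternatingMap (localForm F x k u y)) (chartAt W x x)))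

/-! ## The space `V_T` and its operators -/

variable (W F E) in
/-- `V_T = {T ∧ u : u ∈ V}`. -/
def VT (T : ∀ x : X, GForm (Tan W x) ℂ) : Submodule ℂ (EForm W E) :=
  (V W F E).map (wedgeE E T)

variable (W F E) in
/-- `V_T^k = {T ∧ u : u ∈ Vᵏ}`. -/
def VTdeg (T : ∀ x : X, GForm (Tan W x) ℂ) (k : ℕ) : Submodule ℂ (EForm W E) :=
  (Vdeg W F E k).map (wedgeE E T)

/-- The commutator `[P, Q] = P Q - Q P` of two operators. -/
def commutator {U : Type*} [AddCommGroup U] [Module ℂ U] (P Q : Module.End ℂ U) :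
    Module.End ℂ U :=
  P * Q - Q * P

variable {T : ∀ x : X, GForm (Tan W x) ℂ}

/-- The operator `P` on `E`-valued forms restricts to the linear operator `Q` on `V_T`. -/
def RestrictsTo (P : EForm W E → EForm W E) (Q : Module.End ℂ (VT W F E T)) : Prop :=
  ∀ u : VT W F E T, (Q u : EForm W E) = P u

open Classical in
variable (F T) in
/-- The linear operator on `V_T` to which `P` restricts (`0` if there is none). -/
def onVT (P : EForm W E → EForm W E) : Module.End ℂ (VT W F E T) :=
  if h : ∃ Q, RestrictsTo P Q then h.choose else 0

variable (F E T) in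
/-- The operator `L : u ↦ Ω ∧ u` on `V_T`. -/
def lefschetz (Ω : ∀ x : X, Tan W x [⋀^Fin 2]→ₗ[ℝ] ℝ) : Module.End ℂ (VT W F E T) :=
  onVT F T (wedgeE E fun x => ofTwoForm (Ω x))

/-- `Lᵣ = Lʳ / r!`. -/
def powDiv {U : Type*} [AddCommGroup U] [Module ℂ U] (L : Module.End ℂ U) (r : ℕ) :
    Module.End ℂ U :=
  (1 / (r.factorial : ℂ)) • L ^ r

/-- `u` is a primitive element of `V_T^k`: `k ≤ m` and `L ^ (m - k + 1) u = 0`. -/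
def IsPrimitive (m : ℕ) (Ω : ∀ x : X, Tan W x [⋀^Fin 2]→ₗ[ℝ] ℝ) (k : ℕ)
    (u : VT W F E T) : Prop :=
  (u : EForm W E) ∈ VTdeg W F E T k ∧ k ≤ m ∧ (lefschetz F E T Ω ^ (m - k + 1)) u = 0

/-- `s` is the Lefschetz star operator on `V_T`:
`s (Lᵣ u) = (-1) ^ (k + ⋯ + 1) L_{m-r-k} u` for `u ∈ V_T^k` primitive. -/
def IsLefschetzStar (m : ℕ) (Ω : ∀ x : X, Tan W x [⋀^Fin 2]→ₗ[ℝ] ℝ)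
    (s : VT W F E T ≃ₗ[ℂ] VT W F E T) : Prop :=
  ∀ (k r : ℕ) (u : VT W F E T), IsPrimitive m Ω k u → r + k ≤ m →
    s (powDiv (lefschetz F E T Ω) r u) =
      (-1 : ℂ) ^ (∑ i ∈ Finset.range (k + 1), i) • powDiv (lefschetz F E T Ω) (m - r - k) u

open Classical in
variable (F E T) in
/-- The Lefschetz star operator `*ₛ` on `V_T` (the identity if there is none). -/
def lefschetzStar (m : ℕ) (Ω : ∀ x : X, Tan W x [⋀^Fin 2]→ₗ[ℝ] ℝ) :
    VT W F E T ≃ₗ[ℂ] VT W F E T :=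
  if h : ∃ s, IsLefschetzStar m Ω s then h.choose else LinearEquiv.refl ℂ _

variable (F E T) in
/-- `Λ = *ₛ⁻¹ L *ₛ`. -/
def Lam (m : ℕ) (Ω : ∀ x : X, Tan W x [⋀^Fin 2]→ₗ[ℝ] ℝ) : Module.End ℂ (VT W F E T) :=
  (lefschetzStar F E T m Ω).symm.toLinearMap ∘ₗ lefschetz F E T Ω ∘ₗ
    (lefschetzStar F E T m Ω).toLinearMap

variable (F E T) in
/-- The Hodge star operator `* = *ₛ ∘ J` on `V_T`. -/
def hodgeStar (m : ℕ) (Ω : ∀ x : X, Tan W x [⋀^Fin 2]→ₗ[ℝ] ℝ) : Module.End ℂ (VT W F E T) :=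
  (lefschetzStar F E T m Ω).toLinearMap ∘ₗ onVT F T weil

variable (F T) in
/-- `f_T⁻¹ w`: an element `u ∈ Vᵏ` with `T ∧ u = w`; it is unique if `k ≤ m`. -/
def fTinv (k : ℕ) (w : EForm W E) : EForm W E :=
  Function.invFunOn (wedgeE E T) (Vdeg W F E k : Set (EForm W E)) w

/-- The inner product of `V_T`, for which the `V_T^k` are mutually orthogonal and
`(u, v) = ∫ {f_T⁻¹ u, *v}_h` on `V_T^k`, `k ≤ m`, `(u, v) = ∫ {u, f_T⁻¹ (*v)}_h` on `V_T^k`,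
`k ≥ m`.  Elements of `V_T^k` are forms of degree `k + 2 (Module.finrank ℂ W - m)`. -/
def innerT [IsManifold 𝓘(ℂ, W) ω X] [T2Space X] [SigmaCompactSpace X] (m : ℕ)
    (h : HermitianMetric (W := W) F E) (Ω : ∀ x : X, Tan W x [⋀^Fin 2]→ₗ[ℝ] ℝ)
    (u v : VT W F E T) : ℂ :=
  ∑ k ∈ Finset.range (2 * m + 1),
    if k ≤ m then
      integralForm fun x =>
        h.pair (fTinv F T k (comp (k + 2 * (Module.finrank ℂ W - m)) (u : EForm W E)))
          (comp (2 * m - k + 2 * (Module.finrank ℂ W - m)) (hodgeStar F E T m Ω v : EForm W E)) x (2 * Module.finrank ℂ W)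
    else
      integralForm fun x =>
        h.pair (comp (k + 2 * (Module.finrank ℂ W - m)) (u : EForm W E))
          (fTinv F T (2 * m - k)
            (comp (2 * m - k + 2 * (Module.finrank ℂ W - m)) (hodgeStar F E T m Ω v : EForm W E))) x (2 * Module.finrank ℂ W)

/-- `Q` is the adjoint of the operator `P` on `V_T`. -/
def IsAdjoint [IsManifold 𝓘(ℂ, W) ω X] [T2Space X] [SigmaCompactSpace X] (m : ℕ)
    (h : HermitianMetric (W := W) F E) (Ω : ∀ x : X, Tan W x [⋀^Fin 2]→ₗ[ℝ] ℝ)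
    (P Q : Module.End ℂ (VT W F E T)) : Prop :=
  ∀ u v : VT W F E T, innerT m h Ω (P u) v = innerT m h Ω u (Q v)

open Classical in
/-- The adjoint of the operator `P` on `V_T` (`0` if there is none). -/
def adj [IsManifold 𝓘(ℂ, W) ω X] [T2Space X] [SigmaCompactSpace X] (m : ℕ)
    (h : HermitianMetric (W := W) F E) (Ω : ∀ x : X, Tan W x [⋀^Fin 2]→ₗ[ℝ] ℝ)
    (P : Module.End ℂ (VT W F E T)) : Module.End ℂ (VT W F E T) :=
  if hQ : ∃ Q, IsAdjoint m h Ω P Q then hQ.choose else 0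

/-- The Laplacian `P P* + P* P` of an operator `P` on `V_T`. -/
def laplacian [IsManifold 𝓘(ℂ, W) ω X] [T2Space X] [SigmaCompactSpace X] (m : ℕ)
    (h : HermitianMetric (W := W) F E) (Ω : ∀ x : X, Tan W x [⋀^Fin 2]→ₗ[ℝ] ℝ)
    (P : Module.End ℂ (VT W F E T)) : Module.End ℂ (VT W F E T) :=
  P * adj m h Ω P + adj m h Ω P * P

variable (F E T) in
/-- `∂̄` on `V_T`. -/
def dbarT : Module.End ℂ (VT W F E T) := onVT F T (dbarE F)

variable (T) in
/-- `∂^E` on `V_T`. -/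
def delT [FiniteDimensional ℂ F] (h : HermitianMetric (W := W) F E) :
    Module.End ℂ (VT W F E T) := onVT F T (delE h)

variable (T) in
/-- The Chern connection `D = ∂̄ + ∂^E` on `V_T`. -/
def DT [FiniteDimensional ℂ F] (h : HermitianMetric (W := W) F E) : Module.End ℂ (VT W F E T) :=
  dbarT F E T + delT T h

variable (T) in
/-- `D^c = i ∂̄ - i ∂^E` on `V_T`. -/
def DcT [FiniteDimensional ℂ F] (h : HermitianMetric (W := W) F E) : Module.End ℂ (VT W F E T) :=
  Complex.I • dbarT F E T - Complex.I • delT T h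

variable (T) in
/-- The Chern curvature `Θ(E, h) = D²`, acting on `V_T`. -/
def curvT [FiniteDimensional ℂ F] (h : HermitianMetric (W := W) F E) :
    Module.End ℂ (VT W F E T) :=
  DT T h ^ 2

end Manifold

end THodge

end

noncomputable section

namespace THodge

section Wedge

variable {M N N' N₁ N₂ N₃ N₄ N₅ N₆ : Type*} [AddCommGroup M] [Module ℝ M]
  [AddCommGroup N] [Module ℝ N] [AddCommGroup N'] [Module ℝ N']
  [AddCommGroup N₁] [Module ℝ N₁] [AddCommGroup N₂] [Module ℝ N₂] [AddCommGroup N₃] [Module ℝ N₃]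
  [AddCommGroup N₄] [Module ℝ N₄] [AddCommGroup N₅] [Module ℝ N₅] [AddCommGroup N₆] [Module ℝ N₆]

theorem alternating_sum_apply {ι κ : Type*} (s : Finset κ) (f : κ → M [⋀^ι]→ₗ[ℝ] N) (w : ι → M) :
    (∑ i ∈ s, f i) w = ∑ i ∈ s, f i w :=
  map_sum ({ toFun := fun g => g w, map_zero' := rfl, map_add' := fun _ _ => rfl } :
    (M [⋀^ι]→ₗ[ℝ] N) →+ N) f s

/-- The interior product of an inhomogeneous form with a vector. -/
def iota (v : M) : GForm M N →ₗ[ℝ] GForm M N where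
  toFun u := fun k => (u (k + 1)).curryLeft v
  map_add' u u' := by funext k; simp
  map_smul' c u := by funext k; simp

theorem iota_apply (v : M) (u : GForm M N) (k : ℕ) (w : Fin k → M) :
    iota v u k w = u (k + 1) (Fin.cons v w) := rfl

/-- The interior product of a fixed form, as a linear function of the vector. -/
def iotaLin (u : GForm M N) : M →ₗ[ℝ] GForm M N where
  toFun v := iota v u
  map_add' v v' := by funext k; ext w; simp [iota]
  map_smul' c v := by funext k; ext w; simp [iota]

@[simp] theorem iotaLin_apply (u : GForm M N) (v : M) : iotaLin u v = iota v u := rfl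

theorem GForm.succ_ext {u u' : GForm M N} {k : ℕ} (h : ∀ v, iota v u k = iota v u' k) :
    u (k + 1) = u' (k + 1) := by
  ext w
  have := DFunLike.congr_fun (h (w 0)) (Fin.tail w)
  simpa [iota_apply] using this

/-- Multiplication of the component of degree `k` by `c k`. -/
def scaleDeg (c : ℕ → ℝ) : GForm M N →ₗ[ℝ] GForm M N where
  toFun u := fun k => c k • u k
  map_add' u u' := by funext k; simp
  map_smul' r u := by funext k; exact smul_comm (c k) r (u k)

@[simp] theorem scaleDeg_apply (c : ℕ → ℝ) (u : GForm M N) (k : ℕ) :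
    scaleDeg c u k = c k • u k := rfl

/-- The grading operator `(-1) ^ k`. -/
def sgn : GForm M N →ₗ[ℝ] GForm M N := scaleDeg fun k => (-1) ^ k

@[simp] theorem sgn_apply (u : GForm M N) (k : ℕ) : sgn u k = (-1 : ℝ) ^ k • u k := rfl

@[simp] theorem sgn_sgn (u : GForm M N) : sgn (sgn u) = u := by
  funext k
  simp [smul_smul, ← mul_pow]

theorem iota_sgn (v : M) (u : GForm M N) : iota v (sgn u) = -sgn (iota v u) := by
  funext k
  ext w
  simp [iota_apply, pow_succ]

theorem iota_anticomm (v w : M) (u : GForm M N) : iota v (iota w u) = -iota w (iota v u) := by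
  funext k
  ext x
  simp only [iota_apply, Pi.neg_apply, AlternatingMap.neg_apply]
  have := (u (k + 1 + 1)).map_swap (Fin.cons w (Fin.cons v x)) (i := 0) (j := 1) (by simp)
  rw [eq_neg_iff_add_eq_zero, ← eq_neg_iff_add_eq_zero.1 this, add_comm]
  congr 2
  funext i
  refine Fin.cases ?_ (fun i => ?_) i
  · simp
  · refine Fin.cases ?_ (fun i => ?_) i
    · simp
    · have h1 : i.succ.succ ≠ (0 : Fin (k + 1 + 1)) := Fin.succ_ne_zero _
      have h2 : i.succ.succ ≠ (1 : Fin (k + 1 + 1)) := by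
        rw [← Fin.succ_zero_eq_one]
        exact fun h => Fin.succ_ne_zero _ (Fin.succ_injective _ h)
      simp [Equiv.swap_apply_of_ne_of_ne h1 h2]

/-- Composition of the values of a form with a linear map. -/
def mapV (g : N →ₗ[ℝ] N') : GForm M N →ₗ[ℝ] GForm M N' where
  toFun u := fun k => g.compAlternatingMap (u k)
  map_add' u u' := by funext k; ext; simp
  map_smul' r u := by funext k; ext; simp

@[simp] theorem mapV_apply (g : N →ₗ[ℝ] N') (u : GForm M N) (k : ℕ) (w : Fin k → M) :
    mapV g u k w = g (u k w) := rfl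

theorem iota_mapV (g : N →ₗ[ℝ] N') (v : M) (u : GForm M N) :
    iota v (mapV g u) = mapV g (iota v u) := rfl

theorem sgn_mapV (g : N →ₗ[ℝ] N') (u : GForm M N) : sgn (mapV g u) = mapV g (sgn u) := by
  funext k; ext w; simp

/-- The antisymmetrization of a linear family of forms, `∑ θⱼ ∧ A eⱼ` in a basis. -/
def altG (A : M →ₗ[ℝ] GForm M N) : GForm M N
  | 0 => 0
  | k + 1 => AlternatingMap.alternatizeUncurryFin (LinearMap.proj k ∘ₗ A)

@[simp] theorem altG_zero_apply (A : M →ₗ[ℝ] GForm M N) : altG A 0 = 0 := rfl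

theorem altG_succ_apply (A : M →ₗ[ℝ] GForm M N) (k : ℕ) (w : Fin (k + 1) → M) :
    altG A (k + 1) w = ∑ i : Fin (k + 1), (-1 : ℝ) ^ (i : ℕ) • A (w i) k (i.removeNth w) := by
  simp only [altG, AlternatingMap.alternatizeUncurryFin_apply]
  refine Finset.sum_congr rfl fun i _ => ?_
  rcases Nat.even_or_odd (i : ℕ) with h | h <;> simp [h.neg_one_pow]

theorem altG_add (A B : M →ₗ[ℝ] GForm M N) : altG (A + B) = altG A + altG B := by
  funext k
  cases k with
  | zero => simp
  | succ k => ext w; simp [altG_succ_apply, Finset.sum_add_distrib]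

theorem altG_smul (c : ℝ) (A : M →ₗ[ℝ] GForm M N) : altG (c • A) = c • altG A := by
  funext k
  cases k with
  | zero => simp
  | succ k => ext w; simp [altG_succ_apply, Finset.smul_sum, smul_comm c]

theorem altG_neg (A : M →ₗ[ℝ] GForm M N) : altG (-A) = -altG A := by
  rw [← neg_one_smul ℝ A, altG_smul, neg_one_smul]

theorem altG_congr_deg {A B : M →ₗ[ℝ] GForm M N} {k : ℕ} (h : ∀ j < k, ∀ v, A v j = B v j) :
    altG A k = altG B k := by
  cases k with
  | zero => rfl
  | succ k =>
    ext w
    simp only [altG_succ_apply]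
    exact Finset.sum_congr rfl fun i _ => by rw [h k (Nat.lt_succ_self k)]

theorem altG_iotaLin (u : GForm M N) : altG (iotaLin u) = scaleDeg (fun k => (k : ℝ)) u := by
  funext k
  cases k with
  | zero => simp
  | succ k =>
    have := (u (k + 1)).alternatizeUncurryFin_curryLeft
    ext w
    have h := DFunLike.congr_fun this w
    rw [AlternatingMap.alternatizeUncurryFin_apply] at h
    rw [altG_succ_apply, scaleDeg_apply, AlternatingMap.smul_apply]
    push_cast
    rw [show ((k : ℝ) + 1) • (u (k + 1)) w = (k + 1) • (u (k + 1)) w by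
      rw [← Nat.cast_smul_eq_nsmul ℝ]; push_cast; rfl]
    rw [AlternatingMap.smul_apply] at h
    rw [← h]
    refine Finset.sum_congr rfl fun i _ => ?_
    rcases Nat.even_or_odd (i : ℕ) with h | h <;> simp [h.neg_one_pow, iota]

theorem iota_altG (v : M) (A : M →ₗ[ℝ] GForm M N) :
    iota v (altG A) = A v - altG (iota v ∘ₗ A) := by
  funext k
  ext w
  rw [iota_apply, altG_succ_apply, Fin.sum_univ_succ]
  cases k with
  | zero => simp [Fin.removeNth, Fin.tail]
  | succ k =>
    rw [Pi.sub_apply, AlternatingMap.sub_apply, altG_succ_apply, sub_eq_add_neg,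
      ← Finset.sum_neg_distrib]
    refine congrArg₂ (· + ·) ?_ ?_
    · simp [Fin.removeNth]
    · refine Finset.sum_congr rfl fun i _ => ?_
      rw [LinearMap.comp_apply, iota_apply, ← neg_smul, Fin.val_succ, pow_succ, mul_neg_one,
        Fin.cons_succ]
      congr 2
      funext j
      refine Fin.cases ?_ (fun j => ?_) j <;> simp [Fin.removeNth]

theorem altG_sgn (A : M →ₗ[ℝ] GForm M N) : altG (sgn ∘ₗ A) = -sgn (altG A) := by
  funext k
  cases k with
  | zero => simp
  | succ k =>
    ext w
    rw [Pi.neg_apply, AlternatingMap.neg_apply, sgn_apply, AlternatingMap.smul_apply,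
      altG_succ_apply, altG_succ_apply, Finset.smul_sum, ← Finset.sum_neg_distrib]
    refine Finset.sum_congr rfl fun i _ => ?_
    rw [LinearMap.comp_apply, sgn_apply, AlternatingMap.smul_apply, smul_comm, pow_succ,
      mul_neg_one, neg_smul, neg_neg]

/-! ### The exterior product -/

/-- The exterior product of homogeneous forms, with prescribed degree. -/
def wedgeAt (B : N₁ →ₗ[ℝ] N₂ →ₗ[ℝ] N₃) {p q k : ℕ} (h : p + q = k) (a : M [⋀^Fin p]→ₗ[ℝ] N₁)
    (b : M [⋀^Fin q]→ₗ[ℝ] N₂) : M [⋀^Fin k]→ₗ[ℝ] N₃ :=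
  (wedgeHom B a b).domDomCongr (finCongr h)

theorem factorial_smul_wedgeAt (B : N₁ →ₗ[ℝ] N₂ →ₗ[ℝ] N₃) {p q k : ℕ} (h : p + q = k)
    (a : M [⋀^Fin p]→ₗ[ℝ] N₁) (b : M [⋀^Fin q]→ₗ[ℝ] N₂) (v : Fin k → M) :
    ((p.factorial * q.factorial : ℕ) : ℝ) • wedgeAt B h a b v =
      ∑ σ : Equiv.Perm (Fin k), ((Equiv.Perm.sign σ : ℤ) : ℝ) •
        B (a fun i => v (σ (Fin.cast h (Fin.castAdd q i))))
          (b fun j => v (σ (Fin.cast h (Fin.natAdd p j)))) := by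
  subst h
  have h1 := DFunLike.congr_fun (MultilinearMap.domCoprod_alternization_eq a b)
    (v ∘ finSumFinEquiv)
  have h2 := congrArg (TensorProduct.lift B) h1
  rw [MultilinearMap.alternatization_apply, AlternatingMap.smul_apply, map_nsmul, map_sum] at h2
  simp only [Fintype.card_fin] at h2
  rw [Nat.cast_smul_eq_nsmul]
  refine h2.symm.trans ?_
  rw [← Equiv.sum_comp (finSumFinEquiv.permCongr)]
  refine Finset.sum_congr rfl fun σ _ => ?_
  rw [Equiv.Perm.sign_permCongr]
  rcases Int.units_eq_one_or (Equiv.Perm.sign σ) with hs | hs <;>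
    simp [hs, MultilinearMap.domCoprod_apply, Equiv.permCongr_apply, Function.comp_def]

theorem sum_perm_succ {k : ℕ} (F : (Fin (k + 1) → M) → N) (v : Fin (k + 1) → M) :
    ∑ σ : Equiv.Perm (Fin (k + 1)), ((Equiv.Perm.sign σ : ℤ) : ℝ) • F (v ∘ σ) =
      ∑ i : Fin (k + 1), (-1 : ℝ) ^ (i : ℕ) • ∑ τ : Equiv.Perm (Fin k),
        ((Equiv.Perm.sign τ : ℤ) : ℝ) • F (Fin.cons (v i) (i.removeNth v ∘ τ)) := by
  let φ : Fin (k + 1) × Equiv.Perm (Fin k) → Equiv.Perm (Fin (k + 1)) := fun x =>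
    x.1.cycleRange.symm * Equiv.Perm.decomposeFin.symm (0, x.2)
  have hφ0 : ∀ x, φ x 0 = x.1 := fun x => by simp [φ]
  have hφs : ∀ x j, φ x (Fin.succ j) = x.1.succAbove (x.2 j) := fun x j => by simp [φ]
  have hinj : Function.Injective φ := by
    intro x y hxy
    have h0 : x.1 = y.1 := by rw [← hφ0 x, hxy, hφ0 y]
    refine Prod.ext h0 (Equiv.ext fun j => ?_)
    have := hφs x j
    rw [hxy, hφs, h0] at this
    exact (Fin.succAbove_right_injective this).symm
  have hbij : Function.Bijective φ := by
    rw [Fintype.bijective_iff_injective_and_card]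
    refine ⟨hinj, ?_⟩
    simp [Fintype.card_perm, Nat.factorial_succ]
  rw [← hbij.sum_comp, Fintype.sum_prod_type]
  refine Finset.sum_congr rfl fun i _ => ?_
  rw [Finset.smul_sum]
  refine Finset.sum_congr rfl fun τ _ => ?_
  rw [smul_smul]
  congr 1
  · simp only [φ, Equiv.Perm.sign_mul, Equiv.Perm.sign_symm, Fin.sign_cycleRange,
      Equiv.Perm.decomposeFin.symm_sign]
    simp
  · congr 1
    funext j
    refine Fin.cases ?_ (fun j => ?_) j
    · simp [hφ0]
    · simp [hφs, Fin.removeNth]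

theorem succ_smul_wedgeAt (B : N₁ →ₗ[ℝ] N₂ →ₗ[ℝ] N₃) {p q k : ℕ} (h : p + 1 + q = k + 1)
    (h' : p + q = k) (a : M [⋀^Fin (p + 1)]→ₗ[ℝ] N₁) (b : M [⋀^Fin q]→ₗ[ℝ] N₂)
    (v : Fin (k + 1) → M) :
    ((p : ℝ) + 1) • wedgeAt B h a b v = ∑ i : Fin (k + 1), (-1 : ℝ) ^ (i : ℕ) •
      wedgeAt B h' (a.curryLeft (v i)) b (i.removeNth v) := by
  have hne : ((p.factorial * q.factorial : ℕ) : ℝ) ≠ 0 := by positivity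
  apply smul_right_injective _ hne
  simp only
  rw [smul_smul, Finset.smul_sum]
  have e1 : ((p.factorial * q.factorial : ℕ) : ℝ) * ((p : ℝ) + 1)
      = (((p + 1).factorial * q.factorial : ℕ) : ℝ) := by
    rw [Nat.factorial_succ]; push_cast; ring
  rw [e1, factorial_smul_wedgeAt]
  refine (sum_perm_succ (fun w => B (a fun i => w (Fin.cast h (Fin.castAdd q i)))
          (b fun j => w (Fin.cast h (Fin.natAdd (p + 1) j)))) v).trans ?_
  refine Finset.sum_congr rfl fun i _ => ?_
  rw [smul_comm, factorial_smul_wedgeAt]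
  congr 1
  refine Finset.sum_congr rfl fun τ _ => ?_
  congr 1
  subst h'
  have ea : (fun j : Fin (p + 1) => (Fin.cons (v i) (i.removeNth v ∘ τ) : Fin (p + q + 1) → M)
        (Fin.cast h (Fin.castAdd q j)))
      = Matrix.vecCons (v i) (fun j => i.removeNth v (τ (Fin.cast rfl (Fin.castAdd q j)))) := by
    funext j
    refine Fin.cases ?_ (fun j => ?_) j
    · rfl
    · rfl
  have eb : (fun j : Fin q => (Fin.cons (v i) (i.removeNth v ∘ τ) : Fin (p + q + 1) → M)
        (Fin.cast h (Fin.natAdd (p + 1) j)))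
      = (fun j => i.removeNth v (τ (Fin.cast rfl (Fin.natAdd p j)))) := by
    funext j
    have : Fin.cast h (Fin.natAdd (p + 1) j) = Fin.succ (Fin.natAdd p j) := by
      ext; simp; omega
    rw [this]
    rfl
  rw [ea, eb]
  rfl

theorem wedgeAt_zero_left (B : N₁ →ₗ[ℝ] N₂ →ₗ[ℝ] N₃) {k : ℕ} (h : 0 + k = k)
    (a : M [⋀^Fin 0]→ₗ[ℝ] N₁) (b : M [⋀^Fin k]→ₗ[ℝ] N₂) :
    wedgeAt B h a b = (B (a ![])).compAlternatingMap b := by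
  ext v
  have hne : ((Nat.factorial 0 * k.factorial : ℕ) : ℝ) ≠ 0 := by positivity
  apply smul_right_injective _ hne
  simp only
  rw [factorial_smul_wedgeAt]
  have : ∀ σ : Equiv.Perm (Fin k), ((Equiv.Perm.sign σ : ℤ) : ℝ) •
        B (a fun i => v (σ (Fin.cast h (Fin.castAdd k i))))
          (b fun j => v (σ (Fin.cast h (Fin.natAdd 0 j)))) = B (a ![]) (b v) := by
    intro σ
    have e1 : (fun i : Fin 0 => v (σ (Fin.cast h (Fin.castAdd k i)))) = ![] :=
      Subsingleton.elim _ _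
    have e2 : (fun j => v (σ (Fin.cast h (Fin.natAdd 0 j)))) = v ∘ σ := by
      funext j; simp
    rw [e1, e2, AlternatingMap.map_perm]
    rcases Int.units_eq_one_or (Equiv.Perm.sign σ) with hs | hs <;> simp [hs]
  rw [Finset.sum_congr rfl fun σ _ => this σ]
  simp [Fintype.card_perm, ← Nat.cast_smul_eq_nsmul ℝ]

theorem wedge_apply (B : N₁ →ₗ[ℝ] N₂ →ₗ[ℝ] N₃) (a : GForm M N₁) (b : GForm M N₂) (k : ℕ) :
    wedge B a b k = ∑ pq ∈ Finset.HasAntidiagonal.antidiagonal k,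
      if h : pq.1 + pq.2 = k then wedgeAt B h (a pq.1) (b pq.2) else 0 := by
  rw [← Finset.sum_attach]
  refine Finset.sum_congr rfl fun pq _ => ?_
  rw [dif_pos (Finset.HasAntidiagonal.mem_antidiagonal.1 pq.2)]
  rfl

theorem wedgeAt_add_left (B : N₁ →ₗ[ℝ] N₂ →ₗ[ℝ] N₃) {p q k : ℕ} (h : p + q = k)
    (a a' : M [⋀^Fin p]→ₗ[ℝ] N₁) (b : M [⋀^Fin q]→ₗ[ℝ] N₂) :
    wedgeAt B h (a + a') b = wedgeAt B h a b + wedgeAt B h a' b := by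
  have h1 : (a + a').domCoprod b = a.domCoprod b + a'.domCoprod b := by
    simp only [← AlternatingMap.domCoprod'_apply, TensorProduct.add_tmul, map_add]
  ext v
  simp [wedgeAt, wedgeHom, h1]

theorem wedgeAt_smul_left (B : N₁ →ₗ[ℝ] N₂ →ₗ[ℝ] N₃) {p q k : ℕ} (h : p + q = k) (c : ℝ)
    (a : M [⋀^Fin p]→ₗ[ℝ] N₁) (b : M [⋀^Fin q]→ₗ[ℝ] N₂) :
    wedgeAt B h (c • a) b = c • wedgeAt B h a b := by
  have h1 : (c • a).domCoprod b = c • a.domCoprod b := by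
    simp only [← AlternatingMap.domCoprod'_apply, ← TensorProduct.smul_tmul', map_smul]
  ext v
  simp [wedgeAt, wedgeHom, h1]

theorem wedgeAt_smul_right (B : N₁ →ₗ[ℝ] N₂ →ₗ[ℝ] N₃) {p q k : ℕ} (h : p + q = k) (c : ℝ)
    (a : M [⋀^Fin p]→ₗ[ℝ] N₁) (b : M [⋀^Fin q]→ₗ[ℝ] N₂) :
    wedgeAt B h a (c • b) = c • wedgeAt B h a b := by
  have h1 : a.domCoprod (c • b) = c • a.domCoprod b := by
    simp only [← AlternatingMap.domCoprod'_apply, TensorProduct.tmul_smul, map_smul]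
  ext v
  simp [wedgeAt, wedgeHom, h1]

/-- The exterior product as a bilinear map. -/
def wedgeL (B : N₁ →ₗ[ℝ] N₂ →ₗ[ℝ] N₃) : GForm M N₁ →ₗ[ℝ] GForm M N₂ →ₗ[ℝ] GForm M N₃ :=
  LinearMap.mk₂ ℝ (wedge B)
    (fun a a' b => by
      funext k
      rw [Pi.add_apply, wedge_apply, wedge_apply, wedge_apply, ← Finset.sum_add_distrib]
      refine Finset.sum_congr rfl fun pq _ => ?_
      split_ifs <;> simp [wedgeAt_add_left])
    (fun c a b => by
      funext k
      rw [Pi.smul_apply, wedge_apply, wedge_apply, Finset.smul_sum]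
      refine Finset.sum_congr rfl fun pq _ => ?_
      split_ifs <;> simp [wedgeAt_smul_left])
    (wedge_add_right B)
    (fun c a b => by
      funext k
      rw [Pi.smul_apply, wedge_apply, wedge_apply, Finset.smul_sum]
      refine Finset.sum_congr rfl fun pq _ => ?_
      split_ifs <;> simp [wedgeAt_smul_right])

theorem wedgeL_apply (B : N₁ →ₗ[ℝ] N₂ →ₗ[ℝ] N₃) (a : GForm M N₁) (b : GForm M N₂) :
    wedgeL B a b = wedge B a b := rfl

theorem wedge_congr_deg (B : N₁ →ₗ[ℝ] N₂ →ₗ[ℝ] N₃) {a a' : GForm M N₁} {b b' : GForm M N₂} {k : ℕ}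
    (ha : ∀ j ≤ k, a j = a' j) (hb : ∀ j ≤ k, b j = b' j) : wedge B a b k = wedge B a' b' k := by
  rw [wedge_apply, wedge_apply]
  refine Finset.sum_congr rfl fun pq hpq => ?_
  have := Finset.HasAntidiagonal.mem_antidiagonal.1 hpq
  rw [ha _ (by omega), hb _ (by omega)]

theorem scaleDeg_wedge_eq_altG (B : N₁ →ₗ[ℝ] N₂ →ₗ[ℝ] N₃) (a : GForm M N₁) (b : GForm M N₂) :
    wedge B (scaleDeg (fun k => (k : ℝ)) a) b = altG ((wedgeL B).flip b ∘ₗ iotaLin a) := by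
  funext k
  cases k with
  | zero =>
    rw [wedge_apply]
    ext v
    simp [wedgeAt, wedgeHom, ← AlternatingMap.domCoprod'_apply]
  | succ k =>
    rw [wedge_apply, Finset.Nat.sum_antidiagonal_succ]
    ext v
    rw [altG_succ_apply]
    have h0 : (0 : ℕ) + (k + 1) = k + 1 := by omega
    simp only [dif_pos h0, scaleDeg_apply, Nat.cast_zero, zero_smul]
    have hz : wedgeAt B h0 (0 : M [⋀^Fin 0]→ₗ[ℝ] N₁) (b (k + 1)) = 0 := by
      simpa using wedgeAt_smul_left B h0 0 (0 : M [⋀^Fin 0]→ₗ[ℝ] N₁) (b (k + 1))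
    rw [hz, zero_add, alternating_sum_apply]
    simp only [LinearMap.comp_apply, iotaLin_apply, LinearMap.flip_apply, wedgeL_apply,
      wedge_apply, alternating_sum_apply, Finset.smul_sum]
    rw [Finset.sum_comm]
    refine Finset.sum_congr rfl fun pq hpq => ?_
    have h1 := Finset.HasAntidiagonal.mem_antidiagonal.1 hpq
    have h2 : pq.1 + 1 + pq.2 = k + 1 := by omega
    simp only [dif_pos h1, dif_pos h2]
    rw [wedgeAt_smul_left, AlternatingMap.smul_apply]
    push_cast
    rw [succ_smul_wedgeAt B h2 h1]
    rfl

theorem wedge_single_zero (B : N₁ →ₗ[ℝ] N₂ →ₗ[ℝ] N₃) (a : M [⋀^Fin 0]→ₗ[ℝ] N₁) (b : GForm M N₂) :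
    wedge B (Pi.single 0 a) b = mapV (B (a ![])) b := by
  funext k
  rw [wedge_apply, Finset.sum_eq_single (0, k)]
  · rw [dif_pos (Nat.zero_add k)]
    simp only [Pi.single_eq_same]
    rw [wedgeAt_zero_left B (Nat.zero_add k)]
    rfl
  · intro pq hpq hne
    have h1 := Finset.HasAntidiagonal.mem_antidiagonal.1 hpq
    have h2 : pq.1 ≠ 0 := fun h => hne (Prod.ext h (by simp only; omega))
    rw [dif_pos h1, Pi.single_eq_of_ne h2]
    simpa using wedgeAt_smul_left B h1 0 0 (b pq.2)
  · simp

/-- The interior product is an antiderivation of the exterior product. -/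
theorem iota_wedge (B : N₁ →ₗ[ℝ] N₂ →ₗ[ℝ] N₃) (v : M) (a : GForm M N₁) (b : GForm M N₂) :
    iota v (wedge B a b) = wedge B (iota v a) b + wedge B (sgn a) (iota v b) := by
  funext k
  induction k using Nat.strong_induction_on generalizing a b v with
  | _ k ih =>
  obtain ⟨c, a', ha⟩ : ∃ (c : M [⋀^Fin 0]→ₗ[ℝ] N₁) (a' : GForm M N₁),
      a = Pi.single 0 c + scaleDeg (fun k => (k : ℝ)) a' := by
    refine ⟨a 0, scaleDeg (fun k => (k : ℝ)⁻¹) a, ?_⟩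
    funext j
    rcases eq_or_ne j 0 with rfl | hj
    · simp
    · have : (j : ℝ) ≠ 0 := by exact_mod_cast hj
      simp [hj, smul_smul, this]
  have hc : iota v (wedge B (Pi.single 0 c) b)
      = wedge B (iota v (Pi.single 0 c)) b + wedge B (sgn (Pi.single 0 c)) (iota v b) := by
    have h1 : iota v (Pi.single 0 c : GForm M N₁) = 0 := by
      funext j; simp [iota]
    have h2 : sgn (Pi.single 0 c : GForm M N₁) = Pi.single 0 c := by
      funext j
      rcases eq_or_ne j 0 with rfl | hj <;> simp [*]
    rw [h1, h2, wedge_single_zero, wedge_single_zero, ← wedgeL_apply, map_zero]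
    simp [iota_mapV]
  have hE : iota v (wedge B (scaleDeg (fun k => (k : ℝ)) a') b) k
      = (wedge B (iota v (scaleDeg (fun k => (k : ℝ)) a')) b
        + wedge B (sgn (scaleDeg (fun k => (k : ℝ)) a')) (iota v b)) k := by
    rw [scaleDeg_wedge_eq_altG, iota_altG, Pi.sub_apply]
    have h1 : altG (iota v ∘ₗ (wedgeL B).flip b ∘ₗ iotaLin a') k
        = altG (-((wedgeL B).flip b ∘ₗ iotaLin (iota v a'))
          - ((wedgeL B).flip (iota v b) ∘ₗ iotaLin (sgn a'))) k := by
      refine altG_congr_deg fun j hj w => ?_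
      simp only [LinearMap.comp_apply, LinearMap.flip_apply, LinearMap.sub_apply,
        LinearMap.neg_apply, iotaLin_apply, wedgeL_apply]
      rw [ih j hj, iota_anticomm v w, iota_sgn]
      simp only [← wedgeL_apply, map_neg, LinearMap.neg_apply, Pi.add_apply, Pi.sub_apply,
        Pi.neg_apply, sub_eq_add_neg, neg_neg]
    rw [h1, sub_eq_add_neg (-_), altG_add, altG_neg, altG_neg, ← scaleDeg_wedge_eq_altG,
      ← scaleDeg_wedge_eq_altG]
    have h2 : iota v (scaleDeg (fun k => (k : ℝ)) a')
        = scaleDeg (fun k => (k : ℝ)) (iota v a') + iota v a' := by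
      funext j; ext w; simp [iota_apply, add_smul]
    have h3 : sgn (scaleDeg (fun k => (k : ℝ)) a') = scaleDeg (fun k => (k : ℝ)) (sgn a') := by
      funext j; exact smul_comm _ (j : ℝ) (a' j)
    rw [h2, h3]
    simp only [← wedgeL_apply, map_add, LinearMap.add_apply, Pi.add_apply, Pi.neg_apply,
      LinearMap.comp_apply, LinearMap.flip_apply, iotaLin_apply]
    abel
  rw [ha]
  simp only [← wedgeL_apply, map_add, LinearMap.add_apply, Pi.add_apply] at hE hc ⊢
  rw [hE, hc]
  simp only [Pi.add_apply]
  abel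

theorem wedge_apply_zero (B : N₁ →ₗ[ℝ] N₂ →ₗ[ℝ] N₃) (a : GForm M N₁) (b : GForm M N₂)
    (w : Fin 0 → M) : wedge B a b 0 w = B (a 0 ![]) (b 0 ![]) := by
  have : wedge B a b 0 = wedge B (Pi.single 0 (a 0)) b 0 :=
    wedge_congr_deg B (fun j hj => by obtain rfl : j = 0 := by omega
                                      simp) fun _ _ => rfl
  rw [this, wedge_single_zero, mapV_apply, Subsingleton.elim w ![]]

end Wedge

section WedgeIdentities

variable {M M' M'' N N' N'' N₁ N₂ N₃ N₄ N₅ : Type*} [AddCommGroup M] [Module ℝ M]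
  [AddCommGroup M'] [Module ℝ M'] [AddCommGroup M''] [Module ℝ M'']
  [AddCommGroup N] [Module ℝ N] [AddCommGroup N'] [Module ℝ N'] [AddCommGroup N''] [Module ℝ N'']
  [AddCommGroup N₁] [Module ℝ N₁] [AddCommGroup N₂] [Module ℝ N₂] [AddCommGroup N₃] [Module ℝ N₃]
  [AddCommGroup N₄] [Module ℝ N₄] [AddCommGroup N₅] [Module ℝ N₅]

/-- To compare two forms depending on parameters, it suffices to compare their values in degree
zero and their interior products, assuming equality in lower degrees. -/
theorem GForm.ext_of_iota {ι : Type*} (f g : ι → GForm M N)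
    (h0 : ∀ i, f i 0 ![] = g i 0 ![])
    (hs : ∀ k, (∀ i, f i k = g i k) → ∀ i v, iota v (f i) k = iota v (g i) k) (i : ι) :
    f i = g i := by
  funext k
  induction k generalizing i with
  | zero =>
    ext w
    rw [Subsingleton.elim w ![], h0]
  | succ k ih => exact GForm.succ_ext (hs k (fun i => ih i) i)

theorem iota_wedgeL (B : N₁ →ₗ[ℝ] N₂ →ₗ[ℝ] N₃) (v : M) (a : GForm M N₁) (b : GForm M N₂) :
    iota v (wedgeL B a b) = wedgeL B (iota v a) b + wedgeL B (sgn a) (iota v b) :=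
  iota_wedge B v a b

theorem sgn_wedge (B : N₁ →ₗ[ℝ] N₂ →ₗ[ℝ] N₃) (a : GForm M N₁) (b : GForm M N₂) :
    sgn (wedge B a b) = wedge B (sgn a) (sgn b) := by
  refine GForm.ext_of_iota (fun x : GForm M N₁ × GForm M N₂ => sgn (wedge B x.1 x.2))
    (fun x => wedge B (sgn x.1) (sgn x.2)) (fun x => ?_) (fun k ih x v => ?_) (a, b)
  · simp [wedge_apply_zero]
  · have h1 := ih (iota v x.1, x.2)
    have h2 := ih (sgn x.1, iota v x.2)
    simp only at h1 h2 ⊢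
    simp only [iota_sgn, iota_wedgeL, map_add, ← wedgeL_apply, map_neg, LinearMap.neg_apply,
      Pi.add_apply, Pi.neg_apply] at h1 h2 ⊢
    rw [h1, h2]
    abel

theorem sgn_wedgeL (B : N₁ →ₗ[ℝ] N₂ →ₗ[ℝ] N₃) (a : GForm M N₁) (b : GForm M N₂) :
    sgn (wedgeL B a b) = wedgeL B (sgn a) (sgn b) := sgn_wedge B a b

theorem wedge_assoc {B₁ : N₁ →ₗ[ℝ] N₂ →ₗ[ℝ] N} {B₂ : N₃ →ₗ[ℝ] N₄ →ₗ[ℝ] N₂}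
    {B₃ : N₅ →ₗ[ℝ] N₄ →ₗ[ℝ] N} {B₄ : N₁ →ₗ[ℝ] N₃ →ₗ[ℝ] N₅}
    (hB : ∀ x y z, B₁ x (B₂ y z) = B₃ (B₄ x y) z)
    (a : GForm M N₁) (b : GForm M N₃) (c : GForm M N₄) :
    wedge B₁ a (wedge B₂ b c) = wedge B₃ (wedge B₄ a b) c := by
  refine GForm.ext_of_iota
    (fun x : GForm M N₁ × GForm M N₃ × GForm M N₄ => wedge B₁ x.1 (wedge B₂ x.2.1 x.2.2))
    (fun x => wedge B₃ (wedge B₄ x.1 x.2.1) x.2.2) (fun x => ?_) (fun k ih x v => ?_) (a, b, c)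
  · simp [wedge_apply_zero, hB]
  · have h1 := ih (iota v x.1, x.2)
    have h2 := ih (sgn x.1, iota v x.2.1, x.2.2)
    have h3 := ih (sgn x.1, sgn x.2.1, iota v x.2.2)
    simp only at h1 h2 h3 ⊢
    simp only [iota_wedgeL, sgn_wedgeL, ← wedgeL_apply, map_add, LinearMap.add_apply,
      Pi.add_apply] at h1 h2 h3 ⊢
    rw [h1, h2, h3, add_assoc]

theorem wedge_comm_aux (B : N₁ →ₗ[ℝ] N₂ →ₗ[ℝ] N₃) (a : GForm M N₁) (b : GForm M N₂) :
    (sgn b = b → wedge B a b = wedge B.flip b a) ∧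
    (sgn b = -b → wedge B a b = wedge B.flip b (sgn a)) := by
  suffices h : ∀ k (a : GForm M N₁) (b : GForm M N₂),
      (sgn b = b → wedge B a b k = wedge B.flip b a k) ∧
      (sgn b = -b → wedge B a b k = wedge B.flip b (sgn a) k) from
    ⟨fun hb => funext fun k => (h k a b).1 hb, fun hb => funext fun k => (h k a b).2 hb⟩
  intro k
  induction k with
  | zero =>
    intro a b
    refine ⟨fun _ => ?_, fun _ => ?_⟩ <;> ext w <;> simp [wedge_apply_zero]
  | succ k ih =>
    intro a b
    refine ⟨fun hb => GForm.succ_ext fun v => ?_, fun hb => GForm.succ_ext fun v => ?_⟩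
    · have hb' : sgn (iota v b) = -iota v b := by
        rw [← neg_eq_iff_eq_neg, ← iota_sgn, hb]
      have h1 := (ih (iota v a) b).1 hb
      have h2 := (ih (sgn a) (iota v b)).2 hb'
      rw [sgn_sgn] at h2
      rw [iota_wedge, iota_wedge, Pi.add_apply, Pi.add_apply, h1, h2, hb, add_comm]
    · have hb' : sgn (iota v b) = iota v b := by
        have := iota_sgn v b
        rw [hb, map_neg, neg_inj] at this
        exact this.symm
      have h1 := (ih (iota v a) b).2 hb
      have h2 := (ih (sgn a) (iota v b)).1 hb'
      rw [iota_wedge, iota_wedge, Pi.add_apply, Pi.add_apply, h1, h2, hb, iota_sgn, add_comm]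
      simp [← wedgeL_apply]

theorem wedge_comm_of_even (B : N₁ →ₗ[ℝ] N₂ →ₗ[ℝ] N₃) (a : GForm M N₁) {b : GForm M N₂}
    (hb : sgn b = b) : wedge B a b = wedge B.flip b a :=
  (wedge_comm_aux B a b).1 hb

theorem wedge_comm_of_odd (B : N₁ →ₗ[ℝ] N₂ →ₗ[ℝ] N₃) (a : GForm M N₁) {b : GForm M N₂}
    (hb : sgn b = -b) : wedge B a b = wedge B.flip b (sgn a) :=
  (wedge_comm_aux B a b).2 hb

theorem mapV_wedge {B : N₁ →ₗ[ℝ] N₂ →ₗ[ℝ] N₃} {B' : N →ₗ[ℝ] N' →ₗ[ℝ] N''} {g : N₃ →ₗ[ℝ] N''}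
    {f : N₁ →ₗ[ℝ] N} {f' : N₂ →ₗ[ℝ] N'} (hg : ∀ x y, g (B x y) = B' (f x) (f' y))
    (a : GForm M N₁) (b : GForm M N₂) :
    mapV g (wedge B a b) = wedge B' (mapV f a) (mapV f' b) := by
  refine GForm.ext_of_iota (fun x : GForm M N₁ × GForm M N₂ => mapV g (wedge B x.1 x.2))
    (fun x => wedge B' (mapV f x.1) (mapV f' x.2)) (fun x => ?_) (fun k ih x v => ?_) (a, b)
  · simp [wedge_apply_zero, hg]
  · have h1 := ih (iota v x.1, x.2)
    have h2 := ih (sgn x.1, iota v x.2)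
    simp only at h1 h2 ⊢
    simp only [iota_mapV, iota_wedge, map_add, Pi.add_apply, sgn_mapV] at h1 h2 ⊢
    rw [h1, h2]

/-- Pullback of an inhomogeneous form by a linear map. -/
def pull (f : M' →ₗ[ℝ] M) : GForm M N →ₗ[ℝ] GForm M' N where
  toFun u := fun k => (u k).compLinearMap f
  map_add' u u' := by funext k; ext; simp
  map_smul' r u := by funext k; ext; simp

@[simp] theorem pull_apply (f : M' →ₗ[ℝ] M) (u : GForm M N) (k : ℕ) (w : Fin k → M') :
    pull f u k w = u k fun i => f (w i) := rfl

theorem iota_pull (f : M' →ₗ[ℝ] M) (v : M') (u : GForm M N) :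
    iota v (pull f u) = pull f (iota (f v) u) := by
  funext k
  ext w
  simp only [iota_apply, pull_apply]
  congr 1
  funext i
  refine Fin.cases ?_ (fun i => ?_) i <;> simp

theorem sgn_pull (f : M' →ₗ[ℝ] M) (u : GForm M N) : sgn (pull f u) = pull f (sgn u) := by
  funext k; ext w; simp

theorem pull_mapV (f : M' →ₗ[ℝ] M) (g : N →ₗ[ℝ] N') (u : GForm M N) :
    pull f (mapV g u) = mapV g (pull f u) := rfl

theorem pull_pull (f : M' →ₗ[ℝ] M) (g : M'' →ₗ[ℝ] M') (u : GForm M N) :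
    pull g (pull f u) = pull (f ∘ₗ g) u := rfl

theorem pull_id (u : GForm M N) : pull LinearMap.id u = u := rfl

theorem pull_wedge (f : M' →ₗ[ℝ] M) (B : N₁ →ₗ[ℝ] N₂ →ₗ[ℝ] N₃) (a : GForm M N₁)
    (b : GForm M N₂) : pull f (wedge B a b) = wedge B (pull f a) (pull f b) := by
  refine GForm.ext_of_iota (fun x : GForm M N₁ × GForm M N₂ => pull f (wedge B x.1 x.2))
    (fun x => wedge B (pull f x.1) (pull f x.2)) (fun x => ?_) (fun k ih x v => ?_) (a, b)
  · rw [wedge_apply_zero, pull_apply, Subsingleton.elim (fun i => f (![] i)) ![],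
      wedge_apply_zero]
    simp only [pull_apply]
    rw [Subsingleton.elim (fun i => f (![] i)) ![]]
  · have h1 := ih (iota (f v) x.1, x.2)
    have h2 := ih (sgn x.1, iota (f v) x.2)
    simp only at h1 h2 ⊢
    simp only [iota_pull, iota_wedge, map_add, Pi.add_apply, sgn_pull] at h1 h2 ⊢
    rw [h1, h2]

theorem pull_altG (f : M' →ₗ[ℝ] M) (A : M →ₗ[ℝ] GForm M N) :
    pull f (altG A) = altG (pull f ∘ₗ A ∘ₗ f) := by
  funext k
  cases k with
  | zero => ext w; simp
  | succ k =>
    ext w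
    simp only [altG_succ_apply, pull_apply, LinearMap.comp_apply]
    rfl

theorem mapV_altG (g : N →ₗ[ℝ] N') (A : M →ₗ[ℝ] GForm M N) :
    mapV g (altG A) = altG (mapV g ∘ₗ A) := by
  funext k
  cases k with
  | zero => ext w; simp
  | succ k => ext w; simp [altG_succ_apply]

theorem altG_wedge_right (B : N₁ →ₗ[ℝ] N₂ →ₗ[ℝ] N₃) (A : M →ₗ[ℝ] GForm M N₁) (b : GForm M N₂) :
    altG ((wedgeL B).flip b ∘ₗ A) = wedge B (altG A) b := by
  refine GForm.ext_of_iota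
    (fun x : (M →ₗ[ℝ] GForm M N₁) × GForm M N₂ => altG ((wedgeL B).flip x.2 ∘ₗ x.1))
    (fun x => wedge B (altG x.1) x.2) (fun x => ?_) (fun k ih x v => ?_) (A, b)
  · simp [wedge_apply_zero]
  · have h1 := ih (iota v ∘ₗ x.1, x.2)
    have h2 := ih (sgn ∘ₗ x.1, iota v x.2)
    have e : iota v ∘ₗ (wedgeL B).flip x.2 ∘ₗ x.1 = (wedgeL B).flip x.2 ∘ₗ iota v ∘ₗ x.1
        + (wedgeL B).flip (iota v x.2) ∘ₗ sgn ∘ₗ x.1 := by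
      refine LinearMap.ext fun w => ?_
      simp [wedgeL_apply, iota_wedge]
    simp only at h1 h2 ⊢
    rw [iota_altG, e, altG_add, Pi.sub_apply, Pi.add_apply, h1, h2, iota_wedge, iota_altG,
      altG_sgn]
    simp only [← wedgeL_apply, LinearMap.comp_apply, LinearMap.flip_apply, map_sub, map_neg,
      LinearMap.sub_apply, LinearMap.neg_apply, Pi.sub_apply, Pi.add_apply, Pi.neg_apply]
    abel

theorem altG_wedge_left (B : N₁ →ₗ[ℝ] N₂ →ₗ[ℝ] N₃) (a : GForm M N₁) (A : M →ₗ[ℝ] GForm M N₂) :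
    altG (wedgeL B a ∘ₗ A) = wedge B (sgn a) (altG A) := by
  refine GForm.ext_of_iota
    (fun x : GForm M N₁ × (M →ₗ[ℝ] GForm M N₂) => altG (wedgeL B x.1 ∘ₗ x.2))
    (fun x => wedge B (sgn x.1) (altG x.2)) (fun x => ?_) (fun k ih x v => ?_) (a, A)
  · simp [wedge_apply_zero]
  · have h1 := ih (iota v x.1, x.2)
    have h2 := ih (sgn x.1, iota v ∘ₗ x.2)
    have e : iota v ∘ₗ wedgeL B x.1 ∘ₗ x.2 = wedgeL B (iota v x.1) ∘ₗ x.2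
        + wedgeL B (sgn x.1) ∘ₗ iota v ∘ₗ x.2 := by
      refine LinearMap.ext fun w => ?_
      simp [wedgeL_apply, iota_wedge]
    simp only at h1 h2 ⊢
    rw [iota_altG, e, altG_add, Pi.sub_apply, Pi.add_apply, h1, h2, iota_wedge, iota_altG,
      iota_sgn, sgn_sgn]
    simp only [← wedgeL_apply, LinearMap.comp_apply, map_sub, map_neg,
      LinearMap.neg_apply, Pi.sub_apply, Pi.add_apply, Pi.neg_apply]
    abel

/-! ### Homogeneous forms -/

/-- The form `u` is homogeneous of degree `k`. -/
def IsDeg (k : ℕ) (u : GForm M N) : Prop := ∀ j, j ≠ k → u j = 0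

theorem IsDeg.single (k : ℕ) (a : M [⋀^Fin k]→ₗ[ℝ] N) : IsDeg k (Pi.single k a : GForm M N) :=
  fun _ hj => Pi.single_eq_of_ne hj _

theorem IsDeg.eq_single {k : ℕ} {u : GForm M N} (hu : IsDeg k u) : u = Pi.single k (u k) := by
  funext j
  rcases eq_or_ne j k with rfl | h
  · simp
  · rw [hu j h, Pi.single_eq_of_ne h]

theorem IsDeg.ext {k : ℕ} {u u' : GForm M N} (hu : IsDeg k u) (hu' : IsDeg k u')
    (h : u k = u' k) : u = u' := by
  rw [hu.eq_single, hu'.eq_single, h]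

theorem IsDeg.zero (k : ℕ) : IsDeg k (0 : GForm M N) := fun _ _ => rfl

theorem IsDeg.add {k : ℕ} {u u' : GForm M N} (hu : IsDeg k u) (hu' : IsDeg k u') :
    IsDeg k (u + u') := fun j hj => by rw [Pi.add_apply, hu j hj, hu' j hj, add_zero]

theorem IsDeg.smul {k : ℕ} {u : GForm M N} (c : ℝ) (hu : IsDeg k u) :
    IsDeg k (c • u) := fun j hj => by rw [Pi.smul_apply, hu j hj, smul_zero]

theorem IsDeg.sgn_eq {k : ℕ} {u : GForm M N} (hu : IsDeg k u) : sgn u = (-1 : ℝ) ^ k • u := by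
  funext j
  rcases eq_or_ne j k with rfl | h
  · simp
  · simp [hu j h]

theorem IsDeg.pull {k : ℕ} {u : GForm M N} (hu : IsDeg k u) (f : M' →ₗ[ℝ] M) :
    IsDeg k (pull f u) := fun j hj => by
  ext w; simp [hu j hj]

theorem IsDeg.mapV {k : ℕ} {u : GForm M N} (hu : IsDeg k u) (g : N →ₗ[ℝ] N') :
    IsDeg k (mapV g u) := fun j hj => by
  ext w; simp [hu j hj]

theorem IsDeg.iota {k : ℕ} {u : GForm M N} (hu : IsDeg (k + 1) u) (v : M) :
    IsDeg k (iota v u) := fun j hj => by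
  ext w; simp [iota_apply, hu (j + 1) (by omega)]

theorem IsDeg.iota_eq_zero {u : GForm M N} (hu : IsDeg 0 u) (v : M) : THodge.iota v u = 0 := by
  funext j
  ext w; simp [iota_apply, hu (j + 1) (by omega)]

theorem IsDeg.wedge {p q : ℕ} {a : GForm M N₁} {b : GForm M N₂} (ha : IsDeg p a) (hb : IsDeg q b)
    (B : N₁ →ₗ[ℝ] N₂ →ₗ[ℝ] N₃) : IsDeg (p + q) (wedge B a b) := by
  intro k hk
  rw [wedge_apply]
  refine Finset.sum_eq_zero fun x hx => ?_
  have hx' := Finset.HasAntidiagonal.mem_antidiagonal.1 hx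
  rw [dif_pos hx']
  by_cases h1 : x.1 = p
  · have h2 : x.2 ≠ q := by omega
    rw [hb _ h2]
    simpa using wedgeAt_smul_right B hx' 0 (a x.1) 0
  · rw [ha _ h1]
    simpa using wedgeAt_smul_left B hx' 0 0 (b x.2)

/-! ### One-forms and the Euler operator -/

end WedgeIdentities

section OneForms

variable {M M' N N' N₁ N₂ N₃ : Type*} [AddCommGroup M] [Module ℝ M]
  [AddCommGroup M'] [Module ℝ M']
  [AddCommGroup N] [Module ℝ N] [AddCommGroup N'] [Module ℝ N']
  [AddCommGroup N₁] [Module ℝ N₁] [AddCommGroup N₂] [Module ℝ N₂] [AddCommGroup N₃] [Module ℝ N₃]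

/-- A constant as a form of degree zero. -/
def const (c : N) : GForm M N := Pi.single 0 (AlternatingMap.constOfIsEmpty ℝ M (Fin 0) c)

/-- A linear functional as a form of degree one. -/
def one (θ : M →ₗ[ℝ] N) : GForm M N := Pi.single 1 (AlternatingMap.ofSubsingleton ℝ M N 0 θ)

theorem isDeg_const (c : N) : IsDeg 0 (const c : GForm M N) := IsDeg.single 0 _

theorem isDeg_one (θ : M →ₗ[ℝ] N) : IsDeg 1 (one θ) := IsDeg.single 1 _

theorem iota_single (v : M) (k : ℕ) (a : M [⋀^Fin (k + 1)]→ₗ[ℝ] N) :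
    iota v (Pi.single (k + 1) a) = Pi.single k (a.curryLeft v) := by
  refine IsDeg.ext ((IsDeg.single _ a).iota v) (IsDeg.single k _) ?_
  ext w
  simp [iota]

theorem iota_one (v : M) (θ : M →ₗ[ℝ] N) : iota v (one θ) = const (θ v) := by
  refine IsDeg.ext ((isDeg_one θ).iota v) (isDeg_const _) ?_
  ext w
  simp [iota, one, const]

theorem pull_const (f : M' →ₗ[ℝ] M) (c : N) : pull f (const c) = const c := by
  refine IsDeg.ext ((isDeg_const c).pull f) (isDeg_const c) ?_
  ext w
  simp [const]

theorem pull_one (f : M' →ₗ[ℝ] M) (θ : M →ₗ[ℝ] N) : pull f (one θ) = one (θ ∘ₗ f) := by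
  refine IsDeg.ext ((isDeg_one θ).pull f) (isDeg_one _) ?_
  ext w
  simp [one]

theorem pull_single (f : M' →ₗ[ℝ] M) (k : ℕ) (a : M [⋀^Fin k]→ₗ[ℝ] N) :
    pull f (Pi.single k a) = Pi.single k (a.compLinearMap f) := by
  refine IsDeg.ext ((IsDeg.single k a).pull f) (IsDeg.single k _) ?_
  ext w
  simp

theorem wedge_const_left (B : N₁ →ₗ[ℝ] N₂ →ₗ[ℝ] N₃) (c : N₁) (b : GForm M N₂) :
    wedge B (const c) b = mapV (B c) b := by
  rw [const, wedge_single_zero]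
  simp

theorem sgn_const (c : N) : sgn (const c : GForm M N) = const c := by
  simpa using (isDeg_const (M := M) c).sgn_eq

theorem sgn_one (θ : M →ₗ[ℝ] N) : sgn (one θ) = -one θ := by
  rw [(isDeg_one θ).sgn_eq, pow_one, neg_one_smul]

theorem wedge_const_right (B : N₁ →ₗ[ℝ] N₂ →ₗ[ℝ] N₃) (a : GForm M N₁) (c : N₂) :
    wedge B a (const c) = mapV (B.flip c) a := by
  rw [wedge_comm_of_even B a (sgn_const c), wedge_const_left]

theorem wedge_one_left (B : N₁ →ₗ[ℝ] N₂ →ₗ[ℝ] N₃) (θ : M →ₗ[ℝ] N₁) (b : GForm M N₂) :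
    wedge B (one θ) b
      = altG ((wedgeL B).flip b ∘ₗ (iotaLin (one θ))) := by
  rw [← scaleDeg_wedge_eq_altG]
  congr 1
  refine IsDeg.ext (isDeg_one θ) (fun j hj => ?_) (by simp)
  rw [scaleDeg_apply, isDeg_one θ j hj, smul_zero]

theorem lsmul_wedge_one (θ : M →ₗ[ℝ] ℝ) (x : GForm M N) :
    wedge (LinearMap.lsmul ℝ N) (one θ) x = altG (θ.smulRight x) := by
  rw [wedge_one_left]
  congr 1
  refine LinearMap.ext fun v => ?_
  simp only [LinearMap.comp_apply, LinearMap.flip_apply, iotaLin_apply, iota_one, wedgeL_apply,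
    wedge_const_left, LinearMap.smulRight_apply]
  rfl

theorem altG_sum {κ : Type*} (s : Finset κ) (A : κ → M →ₗ[ℝ] GForm M N) :
    altG (∑ i ∈ s, A i) = ∑ i ∈ s, altG (A i) := by
  classical
  induction s using Finset.induction_on with
  | empty => simpa using altG_smul 0 (0 : M →ₗ[ℝ] GForm M N)
  | insert i s hi ih => rw [Finset.sum_insert hi, Finset.sum_insert hi, altG_add, ih]

theorem altG_eq_sum {κ : Type*} [Fintype κ] (b : Module.Basis κ ℝ M) (A : M →ₗ[ℝ] GForm M N) :
    altG A = ∑ j, wedge (LinearMap.lsmul ℝ N) (one (b.coord j)) (A (b j)) := by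
  have h : A = ∑ j, (b.coord j).smulRight (A (b j)) := by
    refine b.ext fun i => ?_
    classical
    rw [LinearMap.sum_apply, Finset.sum_eq_single i]
    · simp
    · intro j _ hj
      simp [Finsupp.single_eq_of_ne hj]
    · simp
  conv_lhs => rw [h, altG_sum]
  exact Finset.sum_congr rfl fun j _ => (lsmul_wedge_one _ _).symm

theorem sum_iota_wedge_one {κ : Type*} [Fintype κ] (b : Module.Basis κ ℝ M) {p : ℕ}
    {x : GForm M N} (hx : IsDeg p x) :
    ∑ j, iota (b j) (wedge (LinearMap.lsmul ℝ N) (one (b.coord j)) x)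
      = ((Fintype.card κ : ℝ) - p) • x := by
  have h1 : ∀ j, iota (b j) (wedge (LinearMap.lsmul ℝ N) (one (b.coord j)) x)
      = x - wedge (LinearMap.lsmul ℝ N) (one (b.coord j)) (iotaLin x (b j)) := by
    intro j
    rw [iota_wedge, iota_one, wedge_const_left, sgn_one]
    have e : mapV ((LinearMap.lsmul ℝ N) ((b.coord j) (b j))) x = x := by
      funext k; ext w; simp
    rw [e, sub_eq_add_neg, ← wedgeL_apply, map_neg]
    rfl
  rw [Finset.sum_congr rfl fun j _ => h1 j, Finset.sum_sub_distrib, ← altG_eq_sum, altG_iotaLin,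
    sub_smul]
  congr 1
  · simp [← Nat.cast_smul_eq_nsmul ℝ]
  · funext j
    rcases eq_or_ne j p with rfl | h
    · simp
    · simp [hx j h]

/-- Poincaré duality. -/
theorem eq_zero_of_wedge_eq_zero {d : ℕ} (b : Module.Basis (Fin d) ℝ M) {p q : ℕ} (h : p + q = d)
    {x : GForm M N} (hx : IsDeg p x)
    (h0 : ∀ y : GForm M ℝ, IsDeg q y →
      wedge (LinearMap.lsmul ℝ N) y x d b = 0) : x = 0 := by
  induction q generalizing p x with
  | zero =>
    have := h0 (const 1) (isDeg_const 1)
    rw [wedge_const_left] at this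
    obtain rfl : p = d := h
    refine hx.ext (IsDeg.zero p) (Module.Basis.ext_alternating b fun v hv => ?_)
    have hb : Function.Bijective v := Finite.injective_iff_bijective.1 hv
    have h2 := (x p).map_perm b (Equiv.ofBijective v hb)
    have h3 : (x p) b = 0 := by simpa using this
    rw [h3, smul_zero] at h2
    simpa [Function.comp_def] using h2
  | succ q ih =>
    have h1 : ∀ θ : M →ₗ[ℝ] ℝ, wedge (LinearMap.lsmul ℝ N) (one θ) x = 0 := by
      intro θ
      refine ih (p := 1 + p) (by omega) ((isDeg_one θ).wedge hx _) fun y hy => ?_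
      rw [wedge_assoc (B₃ := (LinearMap.lsmul ℝ N)) (B₄ := LinearMap.mul ℝ ℝ)
        fun r s z => smul_smul r s z]
      exact h0 _ (hy.wedge (isDeg_one θ) _)
    have h2 := sum_iota_wedge_one b hx
    simp only [h1, map_zero, Finset.sum_const_zero, Fintype.card_fin] at h2
    refine (smul_eq_zero.1 h2.symm).resolve_left ?_
    have : (d : ℝ) = p + (q + 1 : ℕ) := by rw [← h]; push_cast; ring
    rw [this]
    push_cast
    intro h3
    have : (0 : ℝ) ≤ q := Nat.cast_nonneg q
    linarith

end OneForms

section RealForms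

variable {M M' : Type*} [AddCommGroup M] [Module ℝ M] [AddCommGroup M'] [Module ℝ M']

theorem mapV_id {N : Type*} [AddCommGroup N] [Module ℝ N] {g : N →ₗ[ℝ] N} (hg : ∀ x, g x = x)
    (u : GForm M N) : mapV g u = u := by
  funext k; ext w; simp [hg]

/-- Real valued forms are a ring under the exterior product. -/
instance : Ring (GForm M ℝ) :=
  { (inferInstance : AddCommGroup (GForm M ℝ)) with
    mul := wedge (LinearMap.mul ℝ ℝ)
    one := const 1
    mul_assoc := fun a b c => (wedge_assoc (fun x y z => (mul_assoc x y z).symm) a b c).symm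
    one_mul := fun a => (wedge_const_left (LinearMap.mul ℝ ℝ) 1 a).trans
      (mapV_id (fun x => one_mul x) a)
    mul_one := fun a => (wedge_const_right (LinearMap.mul ℝ ℝ) a 1).trans
      (mapV_id (fun x => mul_one x) a)
    left_distrib := fun a b c => (wedgeL (LinearMap.mul ℝ ℝ) a).map_add b c
    right_distrib := fun a b c => ((wedgeL (LinearMap.mul ℝ ℝ)).flip c).map_add a b
    zero_mul := fun a => ((wedgeL (LinearMap.mul ℝ ℝ)).flip a).map_zero
    mul_zero := fun a => (wedgeL (LinearMap.mul ℝ ℝ) a).map_zero }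

instance : Algebra ℝ (GForm M ℝ) :=
  Algebra.ofModule (fun r a b => ((wedgeL (LinearMap.mul ℝ ℝ)).flip b).map_smul r a)
    (fun r a b => (wedgeL (LinearMap.mul ℝ ℝ) a).map_smul r b)

theorem mul_def (a b : GForm M ℝ) : a * b = wedge (LinearMap.mul ℝ ℝ) a b := rfl

theorem one_def : (1 : GForm M ℝ) = const 1 := rfl

theorem isDeg_mul {p q : ℕ} {a b : GForm M ℝ} (ha : IsDeg p a) (hb : IsDeg q b) :
    IsDeg (p + q) (a * b) := ha.wedge hb _

theorem iota_mul (v : M) (a b : GForm M ℝ) : iota v (a * b) = iota v a * b + sgn a * iota v b :=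
  iota_wedge _ v a b

theorem mul_comm_of_even (a : GForm M ℝ) {b : GForm M ℝ} (hb : sgn b = b) : a * b = b * a := by
  rw [mul_def, wedge_comm_of_even _ a hb]
  congr 1
  ext x y
  simp

theorem mul_comm_of_odd (a : GForm M ℝ) {b : GForm M ℝ} (hb : sgn b = -b) :
    a * b = b * sgn a := by
  rw [mul_def, wedge_comm_of_odd _ a hb]
  congr 1
  ext x y
  simp

/-- Pullback as a ring homomorphism. -/
def pullHom (f : M' →ₗ[ℝ] M) : GForm M ℝ →+* GForm M' ℝ where
  toFun := pull f
  map_one' := pull_const f 1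
  map_mul' := pull_wedge f _
  map_zero' := map_zero _
  map_add' := map_add _

@[simp] theorem pullHom_apply (f : M' →ₗ[ℝ] M) (u : GForm M ℝ) : pullHom f u = pull f u := rfl

theorem pull_mul (f : M' →ₗ[ℝ] M) (a b : GForm M ℝ) : pull f (a * b) = pull f a * pull f b :=
  pull_wedge f _ a b

/-- A real two-form as an inhomogeneous form. -/
def two (a : M [⋀^Fin 2]→ₗ[ℝ] ℝ) : GForm M ℝ := Pi.single 2 a

theorem isDeg_two (a : M [⋀^Fin 2]→ₗ[ℝ] ℝ) : IsDeg 2 (two a) := IsDeg.single 2 a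

theorem sgn_two (a : M [⋀^Fin 2]→ₗ[ℝ] ℝ) : sgn (two a) = two a := by
  rw [(isDeg_two a).sgn_eq]; simp

theorem pull_two (f : M' →ₗ[ℝ] M) (a : M [⋀^Fin 2]→ₗ[ℝ] ℝ) :
    pull f (two a) = two (a.compLinearMap f) := pull_single f 2 a

/-- The linear functional `a (v, ·)`. -/
def slice (a : M [⋀^Fin 2]→ₗ[ℝ] ℝ) (v : M) : M →ₗ[ℝ] ℝ :=
  (AlternatingMap.ofSubsingleton ℝ M ℝ (0 : Fin 1)).symm (a.curryLeft v)

theorem slice_apply (a : M [⋀^Fin 2]→ₗ[ℝ] ℝ) (v w : M) : slice a v w = a ![v, w] := by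
  have : (fun _ : Fin 1 => w) = ![w] := by funext i; fin_cases i; rfl
  simp [slice, AlternatingMap.ofSubsingleton, this]

theorem iota_two (v : M) (a : M [⋀^Fin 2]→ₗ[ℝ] ℝ) : iota v (two a) = one (slice a v) := by
  rw [two, iota_single, one, slice, Equiv.apply_symm_apply]

theorem one_mul_eq_altG (θ : M →ₗ[ℝ] ℝ) (x : GForm M ℝ) : one θ * x = altG (θ.smulRight x) :=
  lsmul_wedge_one θ x

theorem one_mul_apply_eq_zero (θ : M →ₗ[ℝ] ℝ) (x : GForm M ℝ) {k : ℕ} (w : Fin k → M)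
    (h : ∀ i, θ (w i) = 0) : (one θ * x) k w = 0 := by
  rw [one_mul_eq_altG]
  cases k with
  | zero => simp
  | succ k => simp [altG_succ_apply, h]

theorem one_mul_self (θ : M →ₗ[ℝ] ℝ) : one θ * one θ = 0 := by
  have h := mul_comm_of_odd (one θ) (sgn_one θ)
  rw [sgn_one, mul_neg] at h
  have h2 : (2 : ℝ) • (one θ * one θ) = 0 := by
    rw [two_smul]
    nth_rewrite 1 [h]
    exact neg_add_cancel _
  exact (smul_eq_zero.1 h2).resolve_left two_ne_zero

end RealForms

section Frames

variable {W N : Type*} [AddCommGroup W] [Module ℂ W] [AddCommGroup N] [Module ℝ N]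

/-- The real frame `(e₁, i e₁, …, eₙ, i eₙ)`. -/
def cframe {n : ℕ} (e : Fin n → W) : Fin (2 * n) → W :=
  fun k => (if k.1 % 2 = 0 then (1 : ℂ) else Complex.I) • e ⟨k.1 / 2, by omega⟩

/-- The value of a form on the real frame of a complex frame. -/
def topv {n : ℕ} (e : Fin n → W) (η : GForm W N) : N := η (2 * n) (cframe e)

/-- The operator `ι_{iv} ι_v`. -/
def iotaPair (v : W) (η : GForm W N) : GForm W N := iota (Complex.I • v) (iota v η)

theorem topv_add {n : ℕ} (e : Fin n → W) (η η' : GForm W N) :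
    topv e (η + η') = topv e η + topv e η' := rfl

theorem topv_smul {n : ℕ} (e : Fin n → W) (c : ℝ) (η : GForm W N) :
    topv e (c • η) = c • topv e η := rfl

theorem topv_zero {n : ℕ} (e : Fin n → W) : topv e (0 : GForm W N) = 0 := rfl

theorem cframe_succ {n : ℕ} (e : Fin (n + 1) → W) :
    cframe e = (Fin.cons (e 0) (Fin.cons (Complex.I • e 0) (cframe (Fin.tail e))) :
      Fin (2 * n + 1 + 1) → W) := by
  funext k
  revert k
  intro (k : Fin (2 * n + 1 + 1))
  refine Fin.cases ?_ (fun k => ?_) k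
  · simp [cframe]
  · refine Fin.cases ?_ (fun k => ?_) k
    · simp only [cframe, Fin.cons_succ, Fin.cons_zero, Fin.val_succ, Fin.val_zero]
      norm_num
    · simp only [cframe, Fin.cons_succ, Fin.val_succ, Fin.tail]
      have h1 : (k.1 + 1 + 1) % 2 = k.1 % 2 := by omega
      have h2 : (⟨(k.1 + 1 + 1) / 2, by omega⟩ : Fin (n + 1)) = Fin.succ ⟨k.1 / 2, by omega⟩ := by
        ext; simp; omega
      simp only [h1, h2]

theorem topv_succ {n : ℕ} (e : Fin (n + 1) → W) (η : GForm W N) :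
    topv e η = topv (Fin.tail e) (iotaPair (e 0) η) := by
  rw [topv, cframe_succ]
  rfl

theorem cframe_mem {n : ℕ} (e : Fin n → W) (k : Fin (2 * n)) :
    ∃ j, cframe e k = e j ∨ cframe e k = Complex.I • e j := by
  refine ⟨⟨k.1 / 2, by omega⟩, ?_⟩
  unfold cframe
  split_ifs <;> simp

theorem topv_one_mul_eq_zero {n : ℕ} (e : Fin n → W) (θ : W →ₗ[ℝ] ℝ) (x : GForm W ℝ)
    (h : ∀ i, θ (e i) = 0) (h' : ∀ i, θ (Complex.I • e i) = 0) : topv e (one θ * x) = 0 := by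
  refine one_mul_apply_eq_zero θ x _ fun k => ?_
  obtain ⟨j, hj | hj⟩ := cframe_mem e k <;> rw [hj]
  exacts [h j, h' j]

/-- The complex frame `e` is orthogonal for the two-form `a`. -/
def IsDiagFrame (a : W [⋀^Fin 2]→ₗ[ℝ] ℝ) {n : ℕ} (e : Fin n → W) : Prop :=
  ∀ i j, i ≠ j → a ![e i, e j] = 0 ∧ a ![e i, Complex.I • e j] = 0 ∧
    a ![Complex.I • e i, e j] = 0 ∧ a ![Complex.I • e i, Complex.I • e j] = 0

theorem IsDiagFrame.tail {a : W [⋀^Fin 2]→ₗ[ℝ] ℝ} {n : ℕ} {e : Fin (n + 1) → W}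
    (h : IsDiagFrame a e) : IsDiagFrame a (Fin.tail e) :=
  fun _ _ hij => h _ _ fun h' => hij (Fin.succ_injective _ h')

theorem topv_two_mul_succ {n : ℕ} {a : W [⋀^Fin 2]→ₗ[ℝ] ℝ} {e : Fin (n + 1) → W}
    (h : IsDiagFrame a e) (η : GForm W ℝ) :
    topv e (two a * η) = a ![e 0, Complex.I • e 0] * topv (Fin.tail e) η
      + topv (Fin.tail e) (two a * iotaPair (e 0) η) := by
  rw [topv_succ, iotaPair, iota_mul, map_add, iota_mul, iota_mul, sgn_two, iota_two, iota_two,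
    sgn_one, iota_one, topv_add, topv_add, topv_add, slice_apply, neg_mul]
  have e1 : topv (Fin.tail e) (-(one (slice a (e 0)) * iota (Complex.I • e 0) η)) = 0 := by
    rw [← neg_one_smul ℝ, topv_smul, topv_one_mul_eq_zero, smul_zero] <;> intro i <;>
      rw [slice_apply]
    exacts [(h _ _ (Fin.succ_ne_zero i).symm).1, (h _ _ (Fin.succ_ne_zero i).symm).2.1]
  have e2 : topv (Fin.tail e) (one (slice a (Complex.I • e 0)) * iota (e 0) η) = 0 := by
    rw [topv_one_mul_eq_zero] <;> intro i <;> rw [slice_apply]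
    exacts [(h _ _ (Fin.succ_ne_zero i).symm).2.2.1, (h _ _ (Fin.succ_ne_zero i).symm).2.2.2]
  have e3 : topv (Fin.tail e) (const (a ![e 0, Complex.I • e 0]) * η)
      = a ![e 0, Complex.I • e 0] * topv (Fin.tail e) η := by
    rw [mul_def, wedge_const_left]; rfl
  rw [e1, e2, e3, add_zero, zero_add, sgn_two, ← iotaPair]

theorem topv_two_mul {a : W [⋀^Fin 2]→ₗ[ℝ] ℝ} : ∀ {n : ℕ} {e : Fin (n + 1) → W}
    (_ : IsDiagFrame a e) (η : GForm W ℝ),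
    topv e (two a * η) = ∑ j, a ![e j, Complex.I • e j] * topv (fun i => e (j.succAbove i)) η
  | 0, e, h, η => by
    have h1 : topv (Fin.tail e) (two a * iotaPair (e 0) η) = 0 := by
      change (two a * iotaPair (e 0) η) 0 _ = 0
      rw [mul_def, wedge_apply_zero]
      simp [two]
    have h0 : (fun i => e ((0 : Fin 1).succAbove i)) = Fin.tail e := Subsingleton.elim _ _
    rw [topv_two_mul_succ h, h1, add_zero, Fin.sum_univ_one, h0]
  | n + 1, e, h, η => by
    have h0 : (fun i => e ((0 : Fin (n + 2)).succAbove i)) = Fin.tail e := by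
      funext i; simp [Fin.tail]
    rw [topv_two_mul_succ h, Fin.sum_univ_succ, topv_two_mul h.tail, h0]
    congr 1
    refine Finset.sum_congr rfl fun j _ => ?_
    rw [topv_succ (fun i => e (j.succ.succAbove i))]
    have h4 : (Fin.tail fun i => e (j.succ.succAbove i)) = fun i => Fin.tail e (j.succAbove i) := by
      funext i; simp [Fin.tail]
    rw [h4, Fin.succ_succAbove_zero, Fin.tail]

end Frames

universe u

section Positive

variable {W W' : Type*} [AddCommGroup W] [Module ℂ W] [AddCommGroup W'] [Module ℂ W']

/-- A positive `(1,1)`-form on a complex vector space. -/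
structure IsPos (a : W [⋀^Fin 2]→ₗ[ℝ] ℝ) : Prop where
  invariant : ∀ v w, a ![Complex.I • v, Complex.I • w] = a ![v, w]
  pos : ∀ v, v ≠ 0 → 0 < a ![v, Complex.I • v]

theorem two_form_swap (a : W [⋀^Fin 2]→ₗ[ℝ] ℝ) (v w : W) : a ![v, w] = -a ![w, v] := by
  have h : a ![w, v] = -a ![v, w] := by
    rw [← a.map_swap ![v, w] (i := 0) (j := 1) (by simp)]
    congr 1
    funext i
    fin_cases i <;> simp
  rw [h, neg_neg]

theorem two_form_self (a : W [⋀^Fin 2]→ₗ[ℝ] ℝ) (v : W) : a ![v, v] = 0 :=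
  a.map_eq_zero_of_eq ![v, v] (i := 0) (j := 1) rfl (by simp)

theorem two_form_add_right (a : W [⋀^Fin 2]→ₗ[ℝ] ℝ) (v w w' : W) :
    a ![v, w + w'] = a ![v, w] + a ![v, w'] := by
  simp only [← slice_apply, map_add]

theorem two_form_add_left (a : W [⋀^Fin 2]→ₗ[ℝ] ℝ) (v v' w : W) :
    a ![v + v', w] = a ![v, w] + a ![v', w] := by
  rw [two_form_swap, two_form_add_right, two_form_swap a v, two_form_swap a v', neg_add]

theorem two_form_smul_right (a : W [⋀^Fin 2]→ₗ[ℝ] ℝ) (c : ℝ) (v w : W) :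
    a ![v, c • w] = c * a ![v, w] := by
  simp only [← slice_apply, map_smul, smul_eq_mul]

theorem two_form_smul_left (a : W [⋀^Fin 2]→ₗ[ℝ] ℝ) (c : ℝ) (v w : W) :
    a ![c • v, w] = c * a ![v, w] := by
  rw [two_form_swap, two_form_smul_right, two_form_swap a v, mul_neg]

theorem IsPos.apply_I_left {a : W [⋀^Fin 2]→ₗ[ℝ] ℝ} (ha : IsPos a) (v w : W) :
    a ![Complex.I • v, w] = -a ![v, Complex.I • w] := by
  rw [← ha.invariant v, smul_smul, Complex.I_mul_I, neg_one_smul, ← neg_one_smul ℝ w,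
    two_form_smul_right]
  ring

/-- The Hermitian inner product of a positive `(1,1)`-form. -/
@[reducible] def IsPos.core {a : W [⋀^Fin 2]→ₗ[ℝ] ℝ} (ha : IsPos a) : InnerProductSpace.Core ℂ W where
  inner v w := ⟨a ![v, Complex.I • w], a ![v, w]⟩
  conj_inner_symm v w := by
    apply Complex.ext
    · simp only [Complex.conj_re]
      rw [two_form_swap, ha.apply_I_left, neg_neg]
    · simp only [Complex.conj_im]
      rw [two_form_swap, neg_neg]
  re_inner_nonneg v := by
    rcases eq_or_ne v 0 with rfl | h
    · rw [smul_zero]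
      exact (two_form_self a 0).ge
    · exact (ha.pos v h).le
  add_left x y z := by
    apply Complex.ext <;> simp [two_form_add_left]
  smul_left x y r := by
    have h : r • x = r.re • x + r.im • (Complex.I • x) := by
      rw [← Complex.coe_smul, ← Complex.coe_smul, smul_smul, ← add_smul]
      congr 1
      exact (Complex.re_add_im r).symm
    apply Complex.ext
    · change a ![r • x, Complex.I • y] = _
      rw [h, two_form_add_left, two_form_smul_left, two_form_smul_left, ha.invariant]
      simp
    · change a ![r • x, y] = _
      rw [h, two_form_add_left, two_form_smul_left, two_form_smul_left, ha.apply_I_left]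
      simp
  definite v hv := by
    by_contra h
    exact (ha.pos v h).ne' (congrArg Complex.re hv)

theorem IsPos.exists_basis {a : W [⋀^Fin 2]→ₗ[ℝ] ℝ} (ha : IsPos a) {n : ℕ}
    [FiniteDimensional ℂ W] (hn : Module.finrank ℂ W = n + 1) (H : Submodule ℂ W) (hH : H ≠ ⊤) :
    ∃ e : Module.Basis (Fin (n + 1)) ℂ W, IsDiagFrame a e ∧ (∀ i, a ![e i, Complex.I • e i] = 1) ∧
      ∀ v ∈ H, e.coord 0 v = 0 := by
  letI : NormedAddCommGroup W := ha.core.toNormedAddCommGroup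
  letI : InnerProductSpace ℂ W := InnerProductSpace.ofCore ha.core.toCore
  have hinner : ∀ v w : W, inner ℂ v w = (⟨a ![v, Complex.I • w], a ![v, w]⟩ : ℂ) :=
    fun _ _ => rfl
  have h1 : Hᗮ ≠ ⊥ := fun h => hH (H.orthogonal_eq_bot_iff.1 h)
  obtain ⟨v, hv, hv0⟩ := (Submodule.ne_bot_iff _).1 h1
  set w : W := ((‖v‖⁻¹ : ℝ) : ℂ) • v with hw
  have hw1 : ‖w‖ = 1 := by
    rw [hw, norm_smul]
    simp [hv0]
  have hwH : w ∈ Hᗮ := Hᗮ.smul_mem _ hv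
  obtain ⟨b, hb⟩ := Orthonormal.exists_orthonormalBasis_extension_of_card_eq (𝕜 := ℂ)
    (ι := Fin (n + 1)) (by simpa using hn) (v := fun _ => w) (s := {0}) (by
      constructor
      · intro i; exact hw1
      · intro i j hij
        exact absurd (Subtype.ext (i.2.trans j.2.symm)) hij)
  have hb0 : b 0 = w := hb 0 rfl
  have horth : ∀ i j, i ≠ j → a ![b i, Complex.I • b j] = 0 ∧ a ![b i, b j] = 0 := by
    intro i j hij
    have : inner ℂ (b i) (b j) = 0 := b.orthonormal.2 hij
    rw [hinner] at this
    exact ⟨congrArg Complex.re this, congrArg Complex.im this⟩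
  refine ⟨b.toBasis, fun i j hij => ?_, fun i => ?_, fun x hx => ?_⟩
  · simp only [OrthonormalBasis.coe_toBasis]
    obtain ⟨h2, h3⟩ := horth i j hij
    refine ⟨h3, h2, ?_, ?_⟩
    · rw [ha.apply_I_left, h2, neg_zero]
    · rw [ha.invariant, h3]
  · simp only [OrthonormalBasis.coe_toBasis]
    have := inner_self_eq_norm_sq_to_K (𝕜 := ℂ) (b i)
    rw [hinner, b.orthonormal.1 i] at this
    simpa using congrArg Complex.re this
  · rw [Module.Basis.coord_apply, OrthonormalBasis.coe_toBasis_repr_apply,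
      OrthonormalBasis.repr_apply_apply, hb0]
    exact Submodule.inner_left_of_mem_orthogonal hx hwH

theorem IsPos.comp {a : W [⋀^Fin 2]→ₗ[ℝ] ℝ} (ha : IsPos a) (f : W' →ₗ[ℂ] W)
    (hf : Function.Injective f) : IsPos (a.compLinearMap (f.restrictScalars ℝ)) := by
  have h : ∀ v w : W', a.compLinearMap (f.restrictScalars ℝ) ![v, w] = a ![f v, f w] := by
    intro v w
    rw [AlternatingMap.compLinearMap_apply]
    congr 1
    funext i
    fin_cases i <;> rfl
  refine ⟨fun v w => ?_, fun v hv => ?_⟩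
  · rw [h, h, map_smul, map_smul, ha.invariant]
  · rw [h, map_smul]
    exact ha.pos _ ((map_ne_zero_iff f hf).2 hv)

theorem IsPos.combo {a b : W [⋀^Fin 2]→ₗ[ℝ] ℝ} (ha : IsPos a) (hb : IsPos b) {t : ℝ}
    (h0 : 0 ≤ t) (h1 : t ≤ 1) : IsPos ((1 - t) • a + t • b) := by
  refine ⟨fun v w => ?_, fun v hv => ?_⟩
  · simp [ha.invariant, hb.invariant]
  · have h2 := ha.pos v hv
    have h3 := hb.pos v hv
    simp only [AlternatingMap.add_apply, AlternatingMap.smul_apply, smul_eq_mul]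
    rcases eq_or_lt_of_le h0 with rfl | h
    · simpa using h2
    · have := mul_pos h h3
      have := mul_nonneg (sub_nonneg.2 h1) h2.le
      linarith

variable (W) in
/-- The complex structure as a real linear map. -/
def jmap : W →ₗ[ℝ] W := LinearMap.restrictScalars ℝ (Complex.I • (LinearMap.id : W →ₗ[ℂ] W))

@[simp] theorem jmap_apply (v : W) : jmap W v = Complex.I • v := rfl

/-- The Weil operator on forms on a complex vector space. -/
def jf {N : Type*} [AddCommGroup N] [Module ℝ N] : GForm W N →ₗ[ℝ] GForm W N := pull (jmap W)

theorem jf_mul (u v : GForm W ℝ) : jf (u * v) = jf u * jf v := pull_mul _ u v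

theorem IsDeg.jf {N : Type*} [AddCommGroup N] [Module ℝ N] {k : ℕ} {u : GForm W N}
    (hu : IsDeg k u) : IsDeg k (jf u) := hu.pull _

theorem jf_pull {N : Type*} [AddCommGroup N] [Module ℝ N] (f : W' →ₗ[ℂ] W) (u : GForm W N) :
    jf (pull (f.restrictScalars ℝ) u) = pull (f.restrictScalars ℝ) (jf u) := by
  funext k
  ext w
  simp [jf]

theorem topv_pull {N : Type*} [AddCommGroup N] [Module ℝ N] (f : W' →ₗ[ℂ] W) {n : ℕ}
    (e : Fin n → W') (η : GForm W N) :
    topv e (pull (f.restrictScalars ℝ) η) = topv (fun i => f (e i)) η := by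
  simp only [topv, pull_apply]
  congr 1
  funext i
  simp only [cframe]
  split_ifs <;> simp

/-- The sign `(-1) ^ (1 + ⋯ + k)`. -/
def eps (k : ℕ) : ℝ := (-1) ^ (∑ i ∈ Finset.range (k + 1), i)

@[simp] theorem eps_zero : eps 0 = 1 := by simp [eps]

theorem eps_succ (k : ℕ) : eps (k + 1) = eps k * (-1) ^ (k + 1) := by
  rw [eps, Finset.sum_range_succ, pow_add, eps]

theorem eps_mul_self (k : ℕ) : eps k * eps k = 1 := by
  rw [eps, ← mul_pow]; simp

/-- The product of a list of two-forms. -/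
def prodTwo (l : List (W [⋀^Fin 2]→ₗ[ℝ] ℝ)) : GForm W ℝ := (l.map two).prod

@[simp] theorem prodTwo_nil : prodTwo ([] : List (W [⋀^Fin 2]→ₗ[ℝ] ℝ)) = 1 := rfl

@[simp] theorem prodTwo_cons (a : W [⋀^Fin 2]→ₗ[ℝ] ℝ) (l : List (W [⋀^Fin 2]→ₗ[ℝ] ℝ)) :
    prodTwo (a :: l) = two a * prodTwo l := by simp [prodTwo]

theorem prodTwo_replicate (a : W [⋀^Fin 2]→ₗ[ℝ] ℝ) (r : ℕ) :
    prodTwo (List.replicate r a) = two a ^ r := by simp [prodTwo]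

theorem isDeg_prodTwo (l : List (W [⋀^Fin 2]→ₗ[ℝ] ℝ)) : IsDeg (2 * l.length) (prodTwo l) := by
  induction l with
  | nil => exact isDeg_const 1
  | cons a l ih =>
    rw [prodTwo_cons]
    have := isDeg_mul (isDeg_two a) ih
    rwa [List.length_cons, show 2 * (l.length + 1) = 2 + 2 * l.length by ring]

theorem sgn_prodTwo (l : List (W [⋀^Fin 2]→ₗ[ℝ] ℝ)) : sgn (prodTwo l) = prodTwo l := by
  rw [(isDeg_prodTwo l).sgn_eq]; simp

theorem pull_prodTwo (f : W' →ₗ[ℝ] W) (l : List (W [⋀^Fin 2]→ₗ[ℝ] ℝ)) :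
    pull f (prodTwo l) = prodTwo (l.map fun a => a.compLinearMap f) := by
  induction l with
  | nil => exact pull_const f 1
  | cons a l ih => rw [prodTwo_cons, pull_mul, ih, pull_two, List.map_cons, prodTwo_cons]

/-- The mixed Hodge–Riemann bilinear relations in dimension `n`. -/
def HodgeRiemann (n : ℕ) : Prop :=
  ∀ (W : Type u) [AddCommGroup W] [Module ℂ W] (e : Module.Basis (Fin n) ℂ W)
    (a : W [⋀^Fin 2]→ₗ[ℝ] ℝ) (l : List (W [⋀^Fin 2]→ₗ[ℝ] ℝ)) (k : ℕ) (x : GForm W ℝ),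
    IsPos a → (∀ b ∈ l, IsPos b) → l.length + k = n → IsDeg k x →
    two a * (prodTwo l * x) = 0 → x ≠ 0 → 0 < eps k * topv e (prodTwo l * (x * jf x))

/-- The mixed hard Lefschetz theorem in dimension `n` (injectivity). -/
def HardLefschetz (n : ℕ) : Prop :=
  ∀ (W : Type u) [AddCommGroup W] [Module ℂ W] (_ : Module.Basis (Fin n) ℂ W)
    (l : List (W [⋀^Fin 2]→ₗ[ℝ] ℝ)) (k : ℕ) (x : GForm W ℝ),
    (∀ b ∈ l, IsPos b) → l.length + k = n → IsDeg k x → prodTwo l * x = 0 → x = 0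

/-- The Hodge–Riemann relations on the span of part of a basis. -/
theorem HodgeRiemann.pos_span {n : ℕ} (h : HodgeRiemann.{u} n) {W : Type u} [AddCommGroup W]
    [Module ℂ W] {e : Fin n → W} (he : LinearIndependent ℂ e)
    {a : W [⋀^Fin 2]→ₗ[ℝ] ℝ} {l : List (W [⋀^Fin 2]→ₗ[ℝ] ℝ)} {k : ℕ} {x : GForm W ℝ}
    (ha : IsPos a) (hl : ∀ b ∈ l, IsPos b) (hk : l.length + k = n) (hx : IsDeg k x)
    (h0 : two a * (prodTwo l * x) = 0)
    (hne : pull ((Submodule.span ℂ (Set.range e)).subtype.restrictScalars ℝ) x ≠ 0) :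
    0 < eps k * topv e (prodTwo l * (x * jf x)) := by
  set f := (Submodule.span ℂ (Set.range e)).subtype with hf
  have hinj : Function.Injective f := Subtype.val_injective
  have h1 := h _ (Module.Basis.span he) (a.compLinearMap (f.restrictScalars ℝ))
    (l.map fun a => a.compLinearMap (f.restrictScalars ℝ)) k (pull (f.restrictScalars ℝ) x)
    (ha.comp f hinj) (by
      intro b hb
      obtain ⟨c, hc, rfl⟩ := List.mem_map.1 hb
      exact (hl c hc).comp f hinj) (by simpa using hk) (hx.pull _) (by
      rw [← pull_two, ← pull_prodTwo, ← pull_mul, ← pull_mul, h0, map_zero]) hne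
  rw [jf_pull, ← pull_prodTwo, ← pull_mul, ← pull_mul, topv_pull] at h1
  convert h1 using 4
  exact (congrArg f (Module.Basis.span_apply he _)).symm ▸ rfl

theorem HodgeRiemann.nonneg_span {n : ℕ} (h : HodgeRiemann.{u} n) {W : Type u} [AddCommGroup W]
    [Module ℂ W] {e : Fin n → W} (he : LinearIndependent ℂ e)
    {a : W [⋀^Fin 2]→ₗ[ℝ] ℝ} {l : List (W [⋀^Fin 2]→ₗ[ℝ] ℝ)} {k : ℕ} {x : GForm W ℝ}
    (ha : IsPos a) (hl : ∀ b ∈ l, IsPos b) (hk : l.length + k = n) (hx : IsDeg k x)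
    (h0 : two a * (prodTwo l * x) = 0) :
    0 ≤ eps k * topv e (prodTwo l * (x * jf x)) := by
  by_cases hne : pull ((Submodule.span ℂ (Set.range e)).subtype.restrictScalars ℝ) x = 0
  · have h1 : topv (fun i => (Submodule.span ℂ (Set.range e)).subtype
        (Module.Basis.span he i)) (prodTwo l * (x * jf x)) = 0 := by
      rw [← topv_pull, pull_mul, pull_mul, hne, zero_mul, mul_zero, topv_zero]
    have h2 : (fun i => (Submodule.span ℂ (Set.range e)).subtype (Module.Basis.span he i)) = e := by
      funext i
      exact congrArg Subtype.val (Module.Basis.span_apply he i)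
    rw [h2] at h1
    rw [h1, mul_zero]
  · exact (h.pos_span he ha hl hk hx h0 hne).le

theorem hardLefschetz_succ {n : ℕ} (h : HodgeRiemann.{u} n) : HardLefschetz.{u} (n + 1) := by
  intro W _ _ e l k x hl hk hx h0
  rcases l with _ | ⟨a, l⟩
  · simpa using h0
  · have ha : IsPos a := hl a (by simp)
    have hl' : ∀ b ∈ l, IsPos b := fun b hb => hl b (by simp [hb])
    have hk' : l.length + k = n := by simp only [List.length_cons] at hk; omega
    rw [prodTwo_cons, mul_assoc] at h0
    refine hx.ext (IsDeg.zero k) ?_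
    ext v
    haveI : FiniteDimensional ℂ W := Module.Finite.of_basis e
    have hn : Module.finrank ℂ W = n + 1 := by simp [Module.finrank_eq_card_basis e]
    have hH : Submodule.span ℂ (Set.range v) ≠ ⊤ := by
      intro htop
      have h1 := finrank_range_le_card (R := ℂ) v
      rw [Set.finrank, htop, finrank_top, hn, Fintype.card_fin] at h1
      omega
    obtain ⟨b, hb, hb1, hbH⟩ := ha.exists_basis hn _ hH
    have hlin : ∀ j : Fin (n + 1), LinearIndependent ℂ fun i => b (j.succAbove i) := fun j =>
      b.linearIndependent.comp _ Fin.succAbove_right_injective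
    have hsum : ∑ j : Fin (n + 1), eps k * topv (fun i => b (j.succAbove i))
        (prodTwo l * (x * jf x)) = 0 := by
      have h2 := topv_two_mul hb (prodTwo l * (x * jf x))
      rw [← mul_assoc (prodTwo l), ← mul_assoc (two a), h0, zero_mul, topv_zero] at h2
      rw [← Finset.mul_sum, ← mul_assoc (prodTwo l)]
      simp only [hb1, one_mul] at h2
      rw [← h2, mul_zero]
    have hz := (Finset.sum_eq_zero_iff_of_nonneg fun j _ =>
      h.nonneg_span (hlin j) ha hl' hk' hx h0).1 hsum 0 (Finset.mem_univ _)
    by_contra hv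
    refine (h.pos_span (hlin 0) ha hl' hk' hx h0 fun h3 => hv ?_).ne' hz
    have hmem : ∀ i, v i ∈ Submodule.span ℂ (Set.range fun i => b ((0 : Fin (n + 1)).succAbove i)) := by
      intro i
      have h4 := hbH (v i) (Submodule.subset_span ⟨i, rfl⟩)
      rw [Module.Basis.coord_apply] at h4
      rw [← b.sum_repr (v i), Fin.sum_univ_succ, h4, zero_smul, zero_add]
      exact Submodule.sum_mem _ fun j _ => Submodule.smul_mem _ _
        (Submodule.subset_span ⟨j, by simp⟩)
    exact DFunLike.congr_fun (congrFun h3 k) (fun i => ⟨v i, hmem i⟩)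

end Positive

section Path

open Matrix in
/-- A continuous family of symmetric forms `Q t`, `0 ≤ t ≤ 1`, which are nondegenerate on `U` and on
a fixed subspace, remains positive definite on the orthogonal complement of that subspace. -/
theorem pos_of_path {U Y : Type*} [NormedAddCommGroup U] [NormedSpace ℝ U] [FiniteDimensional ℝ U]
    [AddCommGroup Y] [Module ℝ Y] [FiniteDimensional ℝ Y] (ℓ : Y →ₗ[ℝ] U)
    (Q : ℝ → U →ₗ[ℝ] U →ₗ[ℝ] ℝ) (hc : ∀ u v, Continuous fun t => Q t u v)
    (hs : ∀ t u v, Q t u v = Q t v u)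
    (hU : ∀ t ∈ Set.Icc (0 : ℝ) 1, ∀ u, (∀ v, Q t u v = 0) → u = 0)
    (hY : ∀ t ∈ Set.Icc (0 : ℝ) 1, ∀ y, (∀ y', Q t (ℓ y) (ℓ y') = 0) → y = 0)
    (h0 : ∀ u, (∀ y, Q 0 u (ℓ y) = 0) → u ≠ 0 → 0 < Q 0 u u) (u : U)
    (hu : ∀ y, Q 1 u (ℓ y) = 0) (hne : u ≠ 0) : 0 < Q 1 u u := by
  classical
  let c := Module.finBasis ℝ U
  have hjc : Continuous fun x : ℝ × U × U => Q x.1 x.2.1 x.2.2 := by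
    have h1 : ∀ (t : ℝ) (u v : U), Q t u v = ∑ i, ∑ j, c.coord i u * c.coord j v * Q t (c i) (c j) := by
      intro t u v
      have e1 : Q t u v = ∑ i, c.repr u i * Q t (c i) v := by
        conv_lhs => rw [← c.sum_repr u]
        simp only [map_sum, LinearMap.sum_apply, map_smul, LinearMap.smul_apply, smul_eq_mul]
      have e2 : ∀ i, Q t (c i) v = ∑ j, c.repr v j * Q t (c i) (c j) := by
        intro i
        conv_lhs => rw [← c.sum_repr v]
        simp only [map_sum, map_smul, smul_eq_mul]
      rw [e1]
      refine Finset.sum_congr rfl fun i _ => ?_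
      rw [e2, Finset.mul_sum]
      exact Finset.sum_congr rfl fun j _ => by
        simp only [Module.Basis.coord_apply]
        ring
    refine Continuous.congr ?_ fun x : ℝ × U × U => (h1 x.1 x.2.1 x.2.2).symm
    have h2 : ∀ i, Continuous (c.coord i) := fun i => (c.coord i).continuous_of_finiteDimensional
    refine continuous_finsetSum _ fun i _ => continuous_finsetSum _ fun j _ => ?_
    exact (((h2 i).comp continuous_snd.fst).mul ((h2 j).comp continuous_snd.snd)).mul
      ((hc _ _).comp continuous_fst)
  let b := Module.finBasis ℝ Y
  let G : ℝ → Matrix (Fin (Module.finrank ℝ Y)) (Fin (Module.finrank ℝ Y)) ℝ :=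
    fun t => Matrix.of fun i j => Q t (ℓ (b i)) (ℓ (b j))
  let q : ℝ → U → Fin (Module.finrank ℝ Y) → ℝ := fun t w j => Q t (ℓ (b j)) w
  let p : ℝ → U → U := fun t w => (G t).det • w - ∑ i, ((G t).adjugate *ᵥ q t w) i • ℓ (b i)
  have hGc : Continuous G := continuous_matrix fun i j => hc _ _
  have hdet : ∀ t ∈ Set.Icc (0 : ℝ) 1, (G t).det ≠ 0 := by
    intro t ht hd
    obtain ⟨v, hv, hv0⟩ := Matrix.exists_mulVec_eq_zero_iff.2 hd
    refine hv ?_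
    have hy : ∑ j, v j • b j = 0 := by
      refine hY t ht _ fun y' => ?_
      rw [hs]
      have h1 : ∀ i, Q t (ℓ (b i)) (ℓ (∑ j, v j • b j)) = 0 := by
        intro i
        have := congrFun hv0 i
        simp only [Matrix.mulVec, dotProduct, G, Matrix.of_apply, Pi.zero_apply] at this
        rw [← this]
        simp only [map_sum, map_smul, smul_eq_mul]
        exact Finset.sum_congr rfl fun j _ => mul_comm _ _
      generalize ℓ (∑ j, v j • b j) = z at h1
      have h2 : (Q t).flip z ∘ₗ ℓ = 0 := b.ext fun i => h1 i
      exact LinearMap.congr_fun h2 y'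
    funext j
    have := congrArg (fun y => b.repr y j) hy
    simpa [Finsupp.single_apply] using this
  have hp : ∀ t w y, Q t (p t w) (ℓ y) = 0 := by
    intro t w y
    rw [hs]
    have h1 : ∀ k, Q t (ℓ (b k)) (p t w) = 0 := by
      intro k
      have h2 := congrFun (congrArg (· *ᵥ q t w) (Matrix.mul_adjugate (G t))) k
      simp only [← Matrix.mulVec_mulVec, Matrix.smul_mulVec, Matrix.one_mulVec, Pi.smul_apply,
        smul_eq_mul] at h2
      simp only [p, map_sub, map_smul, smul_eq_mul, map_sum]
      rw [← show (G t).det * q t w k = (G t).det * Q t (ℓ (b k)) w from rfl, ← h2, sub_eq_zero,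
        Matrix.mulVec, dotProduct]
      exact Finset.sum_congr rfl fun i _ => mul_comm _ _
    have h2 : (Q t).flip (p t w) ∘ₗ ℓ = 0 := b.ext fun i => h1 i
    exact LinearMap.congr_fun h2 y
  have hp' : ∀ t w, (∀ y, Q t w (ℓ y) = 0) → p t w = (G t).det • w := by
    intro t w hw
    have : q t w = 0 := by
      funext j
      exact (hs _ _ _).trans (hw _)
    simp [p, this]
  have hpc : ∀ w, Continuous fun t => p t w := by
    intro w
    refine (hGc.matrix_det.smul continuous_const).sub (continuous_finsetSum _ fun i _ => ?_)
    refine Continuous.smul ?_ continuous_const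
    have : Continuous fun t => (G t).adjugate *ᵥ q t w :=
      hGc.matrix_adjugate.matrix_mulVec (continuous_pi fun j => hc _ _)
    exact (continuous_apply i).comp this
  let S : Set (ℝ × U) := {x | x.1 ∈ Set.Icc (0 : ℝ) 1 ∧ ‖x.2‖ = 1 ∧ (∀ y, Q x.1 x.2 (ℓ y) = 0) ∧
    Q x.1 x.2 x.2 ≤ 0}
  have hScompact : IsCompact S := by
    refine IsCompact.of_isClosed_subset (isCompact_Icc.prod (isCompact_sphere (0 : U) 1)) ?_
      (s := Set.Icc (0 : ℝ) 1 ×ˢ Metric.sphere (0 : U) 1) ?_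
    · have hP : IsClosed {x : ℝ × U | ∀ y, Q x.1 x.2 (ℓ y) = 0} := by
        rw [show {x : ℝ × U | ∀ y, Q x.1 x.2 (ℓ y) = 0}
          = ⋂ y, {x : ℝ × U | Q x.1 x.2 (ℓ y) = 0} by ext; simp]
        refine isClosed_iInter fun y => isClosed_eq ?_ continuous_const
        exact hjc.comp (continuous_fst.prodMk (continuous_snd.prodMk continuous_const))
      have hQ : IsClosed {x : ℝ × U | Q x.1 x.2 x.2 ≤ 0} := by
        refine isClosed_le ?_ continuous_const
        exact hjc.comp (continuous_fst.prodMk (continuous_snd.prodMk continuous_snd))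
      have hN : IsClosed {x : ℝ × U | ‖x.2‖ = 1} := isClosed_eq continuous_snd.norm continuous_const
      exact (isClosed_Icc.preimage continuous_fst).inter (hN.inter (hP.inter hQ))
    · rintro x ⟨h1, h2, -⟩
      exact ⟨h1, by simpa using h2⟩
  have hSmem : ∀ t ∈ Set.Icc (0 : ℝ) 1, ∀ w, w ≠ 0 → (∀ y, Q t w (ℓ y) = 0) → Q t w w ≤ 0 →
      (t, ‖w‖⁻¹ • w) ∈ S := by
    intro t ht w hw h1 h2
    refine ⟨ht, ?_, fun y => ?_, ?_⟩
    · rw [norm_smul, norm_inv, norm_norm, inv_mul_cancel₀ (norm_ne_zero_iff.2 hw)]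
    · simp [h1]
    · simp only [map_smul, LinearMap.smul_apply, smul_eq_mul]
      exact mul_nonpos_of_nonneg_of_nonpos (by positivity)
        (mul_nonpos_of_nonneg_of_nonpos (by positivity) h2)
  by_contra hcon
  rw [not_lt] at hcon
  obtain ⟨⟨t, w⟩, hmem, hmin⟩ := hScompact.exists_isMinOn
    ⟨_, hSmem 1 ⟨zero_le_one, le_rfl⟩ u hne hu hcon⟩ continuous_fst.continuousOn
  obtain ⟨ht, hw1, hwP, hwQ⟩ := hmem
  simp only at ht hw1 hwP hwQ
  have hw0 : w ≠ 0 := fun h => by rw [h, norm_zero] at hw1; exact zero_ne_one hw1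
  obtain ⟨v, hvP, hvQ⟩ : ∃ v, (∀ y, Q t v (ℓ y) = 0) ∧ Q t v v < 0 := by
    rcases hwQ.lt_or_eq with h | h
    · exact ⟨w, hwP, h⟩
    · obtain ⟨z, hz⟩ : ∃ z, Q t w z ≠ 0 := by
        by_contra hcon
        push Not at hcon
        exact hw0 (hU t ht w hcon)
      have hz' : Q t w (p t z) ≠ 0 := by
        simp only [p, map_sub, map_smul, map_sum, hwP, smul_zero, Finset.sum_const_zero, sub_zero]
        exact mul_ne_zero (hdet t ht) hz
      set r := Q t w (p t z) with hr
      set A := Q t (p t z) (p t z) with hA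
      refine ⟨w + (-r / (1 + |A|)) • p t z, fun y => ?_, ?_⟩
      · simp [hwP, hp]
      · have h1 : 0 < 1 + |A| := by positivity
        have h2 : Q t (w + (-r / (1 + |A|)) • p t z) (w + (-r / (1 + |A|)) • p t z)
            = (r ^ 2 / (1 + |A|) ^ 2) * (A - 2 * (1 + |A|)) := by
          simp only [map_add, map_smul, LinearMap.add_apply, LinearMap.smul_apply, smul_eq_mul]
          rw [h, hs t (p t z) w, ← hr, ← hA]
          field_simp
          ring
        rw [h2]
        refine mul_neg_of_pos_of_neg (by positivity) ?_
        have := le_abs_self A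
        have := abs_nonneg A
        linarith
  have hf : Continuous fun s => Q s (p s v) (p s v) :=
    hjc.comp (continuous_id.prodMk ((hpc v).prodMk (hpc v)))
  have hft : Q t (p t v) (p t v) < 0 := by
    rw [hp' t v hvP]
    simp only [map_smul, LinearMap.smul_apply, smul_eq_mul]
    rw [← mul_assoc]
    exact mul_neg_of_pos_of_neg (mul_self_pos.2 (hdet t ht)) hvQ
  rcases ht.1.eq_or_lt with h | h
  · subst h
    have hv0 : v ≠ 0 := fun h => by simp [h] at hvQ
    exact absurd (h0 v hvP hv0) hvQ.not_gt
  · have h1 : ∀ᶠ s in nhdsWithin t (Set.Iio t), Q s (p s v) (p s v) < 0 :=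
      (hf.tendsto t).mono_left nhdsWithin_le_nhds |>.eventually (gt_mem_nhds hft)
    have h2 : ∀ᶠ s in nhdsWithin t (Set.Iio t), s ∈ Set.Ioo 0 t :=
      Ioo_mem_nhdsLT h
    obtain ⟨s, hs1, hs2⟩ := (h1.and h2).exists
    have h3 : p s v ≠ 0 := fun h => by simp [h] at hs1
    have h4 := hmin (hSmem s ⟨hs2.1.le, hs2.2.le.trans ht.2⟩ _ h3 (hp s v) hs1.le)
    exact absurd h4 (not_le.2 hs2.2)

end Path

section TopForms

variable {W : Type*} [AddCommGroup W] [Module ℂ W]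

/-- The real basis `(e₁, i e₁, …, eₙ, i eₙ)`. -/
def frameBasis {n : ℕ} (e : Module.Basis (Fin n) ℂ W) : Module.Basis (Fin (2 * n)) ℝ W :=
  (Complex.basisOneI.smulTower e).reindex
    (((Equiv.prodComm _ _).trans finProdFinEquiv).trans (finCongr (mul_comm n 2)))

@[simp] theorem coe_frameBasis {n : ℕ} (e : Module.Basis (Fin n) ℂ W) :
    ⇑(frameBasis e) = cframe e := by
  funext k
  rw [frameBasis, Module.Basis.reindex_apply, Module.Basis.smulTower_apply]
  simp only [cframe, Equiv.symm_trans_apply, Equiv.prodComm_symm, Equiv.prodComm_apply,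
    finProdFinEquiv_symm_apply, Prod.fst_swap, Prod.snd_swap, finCongr_symm, finCongr_apply,
    Complex.coe_basisOneI]
  congr 1
  have h2 : k.1 % 2 = 0 ∨ k.1 % 2 = 1 := Nat.mod_two_eq_zero_or_one k.1
  have h3 : ((Fin.cast (mul_comm 2 n) k).modNat : Fin 2) = ⟨k.1 % 2, by omega⟩ := rfl
  rw [h3]
  rcases h2 with h | h <;> simp [h]

theorem finite_real [FiniteDimensional ℂ W] : Module.Finite ℝ W :=
  Module.Finite.trans ℂ W

instance finite_alternatingMap {M N : Type*} [AddCommGroup M] [Module ℝ M] [AddCommGroup N]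
    [Module ℝ N] [Module.Finite ℝ M] [Module.Finite ℝ N] (k : ℕ) :
    Module.Finite ℝ (M [⋀^Fin k]→ₗ[ℝ] N) :=
  Module.Finite.equiv (exteriorPower.alternatingMapLinearEquiv (R := ℝ) (M := M) (N := N)).symm

theorem finrank_alternatingMap (M N : Type*) [AddCommGroup M] [Module ℝ M] [AddCommGroup N]
    [Module ℝ N] [Module.Finite ℝ M] [Module.Finite ℝ N] (k : ℕ) :
    Module.finrank ℝ (M [⋀^Fin k]→ₗ[ℝ] N)
      = (Module.finrank ℝ M).choose k * Module.finrank ℝ N := by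
  rw [(exteriorPower.alternatingMapLinearEquiv (R := ℝ) (M := M) (N := N)).finrank_eq,
    Module.finrank_linearMap, exteriorPower.finrank_eq]

theorem alternatingMap_eq_zero_of_lt {M N : Type*} [AddCommGroup M] [Module ℝ M] [AddCommGroup N]
    [Module ℝ N] [Module.Finite ℝ M] {k : ℕ} (h : Module.finrank ℝ M < k)
    (a : M [⋀^Fin k]→ₗ[ℝ] N) : a = 0 := by
  ext v
  refine a.map_linearDependent v fun hv => ?_
  have := hv.fintype_card_le_finrank
  rw [Fintype.card_fin] at this
  omega

theorem alternatingMap_eq_det_smul {M N κ : Type*} [AddCommGroup M] [Module ℝ M] [AddCommGroup N]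
    [Module ℝ N] [Fintype κ] [DecidableEq κ] (f : Module.Basis κ ℝ M) (η : M [⋀^κ]→ₗ[ℝ] N)
    (w : κ → M) : η w = f.det w • η f := by
  have : η = (LinearMap.toSpanSingleton ℝ N (η f)).compAlternatingMap f.det := by
    refine Module.Basis.ext_alternating f fun v hv => ?_
    let σ : Equiv.Perm κ := Equiv.ofBijective v (Finite.injective_iff_bijective.1 hv)
    change η (f ∘ σ) = (LinearMap.toSpanSingleton ℝ N (η f)).compAlternatingMap f.det (f ∘ σ)
    rw [AlternatingMap.map_perm, AlternatingMap.map_perm]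
    simp [Module.Basis.det_self]
  conv_lhs => rw [this]
  simp

theorem det_restrictScalars_complex [FiniteDimensional ℂ W] (g : W →ₗ[ℂ] W) :
    LinearMap.det (g.restrictScalars ℝ) = Complex.normSq (LinearMap.det g) := by
  rw [LinearMap.det_restrictScalars, Algebra.norm_complex_apply]

theorem topv_comp {N : Type*} [AddCommGroup N] [Module ℝ N] {n : ℕ} (e : Module.Basis (Fin n) ℂ W)
    (g : W →ₗ[ℂ] W) (η : GForm W N) :
    topv (fun i => g (e i)) η = Complex.normSq (LinearMap.det g) • topv e η := by
  haveI : FiniteDimensional ℂ W := Module.Finite.of_basis e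
  have h : cframe (fun i => g (e i)) = (g.restrictScalars ℝ) ∘ frameBasis e := by
    funext i
    simp only [coe_frameBasis, cframe, Function.comp_apply, LinearMap.restrictScalars_apply]
    split_ifs <;> simp
  rw [topv, h, alternatingMap_eq_det_smul (frameBasis e), Module.Basis.det_comp,
    Module.Basis.det_self, mul_one, det_restrictScalars_complex, coe_frameBasis]
  rfl

theorem exists_topv_eq {N : Type*} [AddCommGroup N] [Module ℝ N] {n : ℕ}
    (e e' : Module.Basis (Fin n) ℂ W) :
    ∃ c : ℝ, 0 < c ∧ ∀ η : GForm W N, topv e' η = c • topv e η := by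
  haveI : FiniteDimensional ℂ W := Module.Finite.of_basis e
  let g : W ≃ₗ[ℂ] W := e.equiv e' (Equiv.refl _)
  refine ⟨Complex.normSq (LinearMap.det g.toLinearMap),
    Complex.normSq_pos.2 g.isUnit_det'.ne_zero, fun η => ?_⟩
  rw [← topv_comp]
  congr 1
  funext i
  simp [g]

theorem topv_jf {N : Type*} [AddCommGroup N] [Module ℝ N] {n : ℕ} (e : Fin n → W) (η : GForm W N) :
    topv e (jf η) = topv e η := by
  induction n generalizing η with
  | zero => exact congrArg (η 0) (Subsingleton.elim _ _)
  | succ n ih =>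
    rw [topv_succ, topv_succ, ← ih (Fin.tail e) (iotaPair (e 0) η)]
    congr 1
    simp only [iotaPair, jf, iota_pull, jmap_apply]
    rw [smul_smul, Complex.I_mul_I, neg_one_smul, iota_anticomm (Complex.I • e 0) (e 0)]
    congr 1
    rw [← iotaLin_apply (iota (Complex.I • e 0) η) (-e 0), map_neg]
    rfl

theorem mul_comm_deg {M : Type*} [AddCommGroup M] [Module ℝ M] {p q : ℕ} {a b : GForm M ℝ}
    (ha : IsDeg p a) (hb : IsDeg q b) : a * b = (-1 : ℝ) ^ (p * q) • (b * a) := by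
  rcases Nat.even_or_odd q with h | h
  · rw [mul_comm_of_even a (by rw [hb.sgn_eq, h.neg_one_pow, one_smul]),
      (h.mul_left p).neg_one_pow, one_smul]
  · rw [mul_comm_of_odd a (by rw [hb.sgn_eq, h.neg_one_pow, neg_one_smul]), ha.sgn_eq,
      mul_smul_comm]
    congr 1
    rw [mul_comm, pow_mul, h.neg_one_pow]

theorem jf_jf {N : Type*} [AddCommGroup N] [Module ℝ N] (u : GForm W N) : jf (jf u) = sgn u := by
  funext k
  ext w
  have h : (fun i => Complex.I • Complex.I • w i) = fun i => (-1 : ℝ) • w i := by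
    funext i
    rw [smul_smul, Complex.I_mul_I, neg_one_smul, neg_one_smul]
  simp only [jf, pull_apply, jmap_apply, sgn_apply, AlternatingMap.smul_apply]
  rw [h, ← AlternatingMap.coe_multilinearMap, MultilinearMap.map_smul_univ]
  simp

/-- Poincaré duality for real forms. -/
theorem eq_zero_of_topv_mul {n : ℕ} (e : Module.Basis (Fin n) ℂ W) {p q : ℕ} (h : p + q = 2 * n)
    {x : GForm W ℝ} (hx : IsDeg p x) (h0 : ∀ y, IsDeg q y → topv e (x * y) = 0) : x = 0 := by
  refine eq_zero_of_wedge_eq_zero (frameBasis e) h hx fun y hy => ?_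
  have h1 := h0 y hy
  rw [mul_comm_deg hx hy, topv_smul, smul_eq_mul] at h1
  rw [coe_frameBasis]
  exact (mul_eq_zero.1 h1).resolve_left (pow_ne_zero _ (by norm_num))

theorem IsPos.jf_two {a : W [⋀^Fin 2]→ₗ[ℝ] ℝ} (ha : IsPos a) : jf (two a) = two a := by
  rw [jf, pull_two]
  congr 1
  ext v
  have h : v = ![v 0, v 1] := by funext i; fin_cases i <;> rfl
  rw [AlternatingMap.compLinearMap_apply]
  conv_rhs => rw [h, ← ha.invariant]
  congr 1
  funext i
  fin_cases i <;> rfl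

theorem jf_prodTwo {l : List (W [⋀^Fin 2]→ₗ[ℝ] ℝ)} (hl : ∀ a ∈ l, IsPos a) :
    jf (prodTwo l) = prodTwo l := by
  induction l with
  | nil => exact pull_const _ 1
  | cons a l ih =>
    rw [prodTwo_cons, jf_mul, (hl a (by simp)).jf_two, ih fun b hb => hl b (by simp [hb])]

end TopForms


section Split

variable {W S : Type*} [AddCommGroup W] [Module ℂ W] [AddCommGroup S] [Module ℂ S]

theorem iota_smul_eq_zero {N : Type*} [AddCommGroup N] [Module ℝ N] {e : W} {u : GForm W N}
    (h : iota e u = 0) (h' : iota (Complex.I • e) u = 0) (z : ℂ) : iota (z • e) u = 0 := by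
  have : z • e = z.re • e + z.im • (Complex.I • e) := by
    conv_lhs => rw [← Complex.re_add_im z]
    rw [add_smul, mul_smul, Complex.coe_smul, Complex.coe_smul]
  rw [this, ← iotaLin_apply, map_add, map_smul, map_smul, iotaLin_apply, iotaLin_apply, h, h']
  simp

theorem pull_eq_self_of_iota {N : Type*} [AddCommGroup N] [Module ℝ N] {g : W →ₗ[ℝ] W}
    {c : W →ₗ[ℂ] ℂ} {e : W} (hg : ∀ w, g w = w - c w • e) {u : GForm W N} (h : iota e u = 0)
    (h' : iota (Complex.I • e) u = 0) : pull g u = u := by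
  have key : ∀ (k : ℕ) (u : GForm W N), iota e u = 0 → iota (Complex.I • e) u = 0 →
      pull g u k = u k := by
    intro k
    induction k with
    | zero =>
      intro u _ _
      ext v
      exact congrArg (u 0) (Subsingleton.elim _ _)
    | succ k ih =>
      intro u h h'
      ext v
      have h1 : iota (g (v 0)) u = iota (v 0) u := by
        rw [hg, ← iotaLin_apply, map_sub, iotaLin_apply, iotaLin_apply, iota_smul_eq_zero h h',
          sub_zero]
      have h2 : ∀ z : GForm W N, z (k + 1) v = iota (v 0) z k (Fin.tail v) := by
        intro z
        rw [iota_apply, Fin.cons_self_tail]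
      rw [h2, h2, iota_pull, h1, ih]
      · rw [iota_anticomm, h, map_zero, neg_zero]
      · rw [iota_anticomm, h', map_zero, neg_zero]
  exact funext fun k => key k u h h'

/-- The real part of a complex linear functional. -/
def reC (c : W →ₗ[ℂ] ℂ) : W →ₗ[ℝ] ℝ := Complex.reLm ∘ₗ c.restrictScalars ℝ

/-- The imaginary part of a complex linear functional. -/
def imC (c : W →ₗ[ℂ] ℂ) : W →ₗ[ℝ] ℝ := Complex.imLm ∘ₗ c.restrictScalars ℝ

@[simp] theorem reC_apply (c : W →ₗ[ℂ] ℂ) (w : W) : reC c w = (c w).re := rfl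
@[simp] theorem imC_apply (c : W →ₗ[ℂ] ℂ) (w : W) : imC c w = (c w).im := rfl

/-- The form `u₀ + θ u₁ + θ' u₂ + θ θ' u₃` with `θ + i θ' = c` and `uᵢ` pulled back by `p`. -/
def nf (p : W →ₗ[ℂ] S) (c : W →ₗ[ℂ] ℂ) (u₀ u₁ u₂ u₃ : GForm S ℝ) : GForm W ℝ :=
  pull (p.restrictScalars ℝ) u₀ + one (reC c) * pull (p.restrictScalars ℝ) u₁ +
    one (imC c) * pull (p.restrictScalars ℝ) u₂ +
    one (reC c) * (one (imC c) * pull (p.restrictScalars ℝ) u₃)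

variable {p : W →ₗ[ℂ] S} {f : S →ₗ[ℂ] W} {c : W →ₗ[ℂ] ℂ} {e : W}

theorem mul_one_form {M : Type*} [AddCommGroup M] [Module ℝ M] (u : GForm M ℝ) (θ : M →ₗ[ℝ] ℝ) :
    u * one θ = one θ * sgn u := mul_comm_of_odd u (sgn_one θ)

theorem nf_mul (u₀ u₁ u₂ u₃ v₀ v₁ v₂ v₃ : GForm S ℝ) :
    nf p c u₀ u₁ u₂ u₃ * nf p c v₀ v₁ v₂ v₃ =
      nf p c (u₀ * v₀) (u₁ * v₀ + sgn u₀ * v₁) (u₂ * v₀ + sgn u₀ * v₂)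
        (u₀ * v₃ + u₃ * v₀ + sgn u₁ * v₂ - sgn u₂ * v₁) := by
  have hs : ∀ u : GForm S ℝ, sgn (pull (p.restrictScalars ℝ) u)
      = pull (p.restrictScalars ℝ) (sgn u) := fun u => sgn_pull _ u
  simp only [nf, map_add, map_sub, pull_mul]
  have h1 : ∀ (θ : W →ₗ[ℝ] ℝ) (u : GForm S ℝ) (z : GForm W ℝ),
      pull (p.restrictScalars ℝ) u * (one θ * z)
        = one θ * (pull (p.restrictScalars ℝ) (sgn u) * z) := by
    intro θ u z
    rw [← mul_assoc, mul_one_form, hs, mul_assoc]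
  have h2 : ∀ (θ : W →ₗ[ℝ] ℝ) (z : GForm W ℝ), one θ * (one θ * z) = 0 := by
    intro θ z
    rw [← mul_assoc, one_mul_self, zero_mul]
  have h3 : ∀ z : GForm W ℝ, one (imC c) * (one (reC c) * z) = -(one (reC c) * (one (imC c) * z)) := by
    intro z
    rw [← mul_assoc, mul_one_form, sgn_one, mul_neg, neg_mul, mul_assoc]
  simp only [mul_add, add_mul, mul_assoc, h1, h2, h3, mul_zero, mul_neg, mul_sub, sgn_sgn, neg_zero]
  abel

theorem jf_nf (u₀ u₁ u₂ u₃ : GForm S ℝ) :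
    jf (nf p c u₀ u₁ u₂ u₃) = nf p c (jf u₀) (jf u₂) (-jf u₁) (jf u₃) := by
  have h1 : jf (one (reC c)) = -one (imC c) := by
    rw [jf, pull_one]
    have : reC c ∘ₗ jmap W = -imC c := by ext w; simp
    rw [this]
    exact (congrArg (Pi.single 1) (by ext v; simp [AlternatingMap.ofSubsingleton])).trans (Pi.single_neg 1 _)
  have h2 : jf (one (imC c)) = one (reC c) := by
    rw [jf, pull_one]
    congr 1
    ext w
    simp
  have h3 : one (imC c) * (-one (imC c)) = 0 := by rw [mul_neg, one_mul_self, neg_zero]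
  simp only [nf, map_add, jf_mul, h1, h2, jf_pull, map_neg]
  have h4 : ∀ z : GForm W ℝ, one (imC c) * (one (reC c) * z) = -(one (reC c) * (one (imC c) * z)) := by
    intro z
    rw [← mul_assoc, mul_one_form, sgn_one, mul_neg, neg_mul, mul_assoc]
  simp only [neg_mul, mul_neg, h4, neg_neg]
  abel

theorem iota_nf (hpe : p e = 0) (hce : c e = 1) (u₀ u₁ u₂ u₃ : GForm S ℝ) :
    iota e (nf p c u₀ u₁ u₂ u₃) = pull (p.restrictScalars ℝ) u₁ +
      one (imC c) * pull (p.restrictScalars ℝ) u₃ := by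
  have h0 : ∀ u : GForm S ℝ, iota e (pull (p.restrictScalars ℝ) u) = 0 := by
    intro u
    rw [iota_pull, LinearMap.restrictScalars_apply, hpe, ← iotaLin_apply, map_zero, map_zero]
  simp only [nf, map_add, iota_mul, iota_one, h0, sgn_one, reC_apply, imC_apply, hce,
    Complex.one_re, Complex.one_im, mul_zero, add_zero, ← one_def, zero_add]
  have h1 : (const 0 : GForm W ℝ) = 0 := Pi.single_eq_zero_iff.2 (by ext; simp)
  have h2 : (const 1 : GForm W ℝ) = 1 := rfl
  simp [h1, h2]

theorem iota_I_pull (hpe : p e = 0) (u : GForm S ℝ) :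
    iota (Complex.I • e) (pull (p.restrictScalars ℝ) u) = 0 := by
  rw [iota_pull, LinearMap.restrictScalars_apply, map_smul, hpe, smul_zero, ← iotaLin_apply,
    map_zero, map_zero]

theorem iota_I_one_mul (hpe : p e = 0) (hce : c e = 1) (u : GForm S ℝ) :
    iota (Complex.I • e) (one (imC c) * pull (p.restrictScalars ℝ) u)
      = pull (p.restrictScalars ℝ) u := by
  rw [iota_mul, iota_I_pull hpe, iota_one, imC_apply, map_smul, hce, mul_zero, add_zero,
    smul_eq_mul, mul_one, Complex.I_im]
  exact one_mul _

theorem iotaPair_nf (hpe : p e = 0) (hce : c e = 1) (u₀ u₁ u₂ u₃ : GForm S ℝ) :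
    iotaPair e (nf p c u₀ u₁ u₂ u₃) = pull (p.restrictScalars ℝ) u₃ := by
  rw [iotaPair, iota_nf hpe hce, map_add, iota_I_pull hpe, iota_I_one_mul hpe hce, zero_add]

theorem nf_eq_zero (hpf : ∀ s, p (f s) = s) (hpe : p e = 0) (hce : c e = 1)
    {u₀ u₁ u₂ u₃ : GForm S ℝ} (h : nf p c u₀ u₁ u₂ u₃ = 0) :
    u₀ = 0 ∧ u₁ = 0 ∧ u₂ = 0 ∧ u₃ = 0 := by
  have hinj : ∀ u : GForm S ℝ, pull (p.restrictScalars ℝ) u = 0 → u = 0 := by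
    intro u hu
    have h1 := congrArg (pull (f.restrictScalars ℝ)) hu
    rw [pull_pull, map_zero] at h1
    have h2 : p.restrictScalars ℝ ∘ₗ f.restrictScalars ℝ = LinearMap.id := by
      ext s
      exact hpf s
    rwa [h2, pull_id] at h1
  have h3 : u₃ = 0 := hinj _ (by rw [← iotaPair_nf hpe hce u₀ u₁ u₂ u₃, h]; simp [iotaPair])
  subst h3
  have h1 : u₁ = 0 := hinj _ (by
    have := iota_nf hpe hce u₀ u₁ u₂ 0
    rw [h] at this
    simpa using this.symm)
  subst h1
  have h4 : pull (p.restrictScalars ℝ) u₀ + one (imC c) * pull (p.restrictScalars ℝ) u₂ = 0 := by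
    simpa [nf] using h
  have h2 : u₂ = 0 := hinj _ (by
    have := congrArg (iota (Complex.I • e)) h4
    rwa [map_add, iota_I_pull hpe, iota_I_one_mul hpe hce, zero_add, map_zero] at this)
  subst h2
  exact ⟨hinj _ (by simpa using h4), rfl, rfl, rfl⟩

theorem exists_eq_nf (hfp : ∀ w, f (p w) = w - c w • e) (hce : c e = 1) {k : ℕ} {x : GForm W ℝ}
    (hx : IsDeg k x) : ∃ u₀ u₁ u₂ u₃ : GForm S ℝ, x = nf p c u₀ u₁ u₂ u₃ ∧ IsDeg k u₀ ∧
      (∀ j, k = j + 1 → IsDeg j u₁ ∧ IsDeg j u₂) ∧ (k = 0 → u₁ = 0 ∧ u₂ = 0) ∧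
      (∀ j, k = j + 2 → IsDeg j u₃) ∧ (k < 2 → u₃ = 0) := by
  have hP : ∀ w : GForm W ℝ, iota e w = 0 → iota (Complex.I • e) w = 0 →
      pull (p.restrictScalars ℝ) (pull (f.restrictScalars ℝ) w) = w := by
    intro w h h'
    rw [pull_pull]
    exact pull_eq_self_of_iota (c := c) (e := e) hfp h h'
  have c1 : (const 1 : GForm W ℝ) = 1 := rfl
  have c0 : (const 0 : GForm W ℝ) = 0 := Pi.single_eq_zero_iff.2 (by ext; simp)
  have hsq : ∀ (v : W) (z : GForm W ℝ), iota v (iota v z) = 0 := by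
    intro v z
    have h := iota_anticomm v v z
    have h2 : (2 : ℝ) • iota v (iota v z) = 0 := by
      rw [two_smul]
      nth_rewrite 1 [h]
      rw [neg_add_cancel]
    exact (smul_eq_zero.1 h2).resolve_left two_ne_zero
  set i := Complex.I • e with hi
  have e1 : reC c e = 1 := by simp [hce]
  have e2 : imC c e = 0 := by simp [hce]
  have e3 : reC c i = 0 := by simp [hi, hce]
  have e4 : imC c i = 1 := by simp [hi, hce]
  let w3 := iota i (iota e x)
  let w1 := iota e x - one (imC c) * w3
  let x' := x - one (reC c) * iota e x
  let w2 := iota i x'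
  let w0 := x' - one (imC c) * w2
  have h3e : iota e w3 = 0 := by
    change iota e (iota i (iota e x)) = 0
    rw [iota_anticomm, hsq, map_zero, neg_zero]
  have h3i : iota i w3 = 0 := hsq _ _
  have h1e : iota e w1 = 0 := by
    simp only [w1, map_sub, iota_mul, hsq, h3e, iota_one, e2, c0]
    simp
  have h1i : iota i w1 = 0 := by
    simp only [w1, map_sub, iota_mul, h3i, iota_one, e4, c1]
    simp [w3]
  have hxe : iota e x' = 0 := by
    simp only [x', map_sub, iota_mul, hsq, iota_one, e1, c1]
    simp
  have h2i : iota i w2 = 0 := hsq _ _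
  have h2e : iota e w2 = 0 := by
    change iota e (iota i x') = 0
    rw [iota_anticomm, hxe, map_zero, neg_zero]
  have h0e : iota e w0 = 0 := by
    simp only [w0, map_sub, iota_mul, hxe, h2e, iota_one, e2, c0]
    simp
  have h0i : iota i w0 = 0 := by
    simp only [w0, map_sub, iota_mul, h2i, iota_one, e4, c1]
    simp [w2]
  have d1 : ∀ j, k = j + 1 → IsDeg j (iota e x) := by
    rintro j rfl
    exact hx.iota e
  have d1' : k = 0 → iota e x = 0 := by
    rintro rfl
    exact hx.iota_eq_zero e
  have d3 : ∀ j, k = j + 2 → IsDeg j w3 := fun j hj => (d1 (j + 1) hj).iota i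
  have d3' : k < 2 → w3 = 0 := by
    intro hk
    rcases Nat.eq_zero_or_pos k with h | h
    · simp [w3, d1' h]
    · exact (d1 0 (by omega)).iota_eq_zero i
  have dsub : ∀ {j : ℕ} {a b : GForm W ℝ}, IsDeg j a → IsDeg j b → IsDeg j (a - b) := by
    intro j a b ha hb l hl
    rw [Pi.sub_apply, ha l hl, hb l hl, sub_zero]
  have dw1 : ∀ j, k = j + 1 → IsDeg j w1 := by
    intro j hj
    refine dsub (d1 j hj) ?_
    rcases j with _ | j
    · rw [d3' (by omega), mul_zero]
      exact IsDeg.zero _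
    · have := isDeg_mul (isDeg_one (imC c)) (d3 j hj)
      rwa [add_comm] at this
  have dx' : IsDeg k x' := by
    refine dsub hx ?_
    rcases k with _ | k
    · rw [d1' rfl, mul_zero]
      exact IsDeg.zero _
    · have := isDeg_mul (isDeg_one (reC c)) (d1 k rfl)
      rwa [add_comm] at this
  have dw2 : ∀ j, k = j + 1 → IsDeg j w2 := by
    rintro j rfl
    exact dx'.iota i
  have dw2' : k = 0 → w2 = 0 := by
    rintro rfl
    exact dx'.iota_eq_zero i
  have dw0 : IsDeg k w0 := by
    refine dsub dx' ?_
    rcases k with _ | k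
    · rw [dw2' rfl, mul_zero]
      exact IsDeg.zero _
    · have := isDeg_mul (isDeg_one (imC c)) (dw2 k rfl)
      rwa [add_comm] at this
  refine ⟨pull (f.restrictScalars ℝ) w0, pull (f.restrictScalars ℝ) w1,
    pull (f.restrictScalars ℝ) w2, pull (f.restrictScalars ℝ) w3, ?_, dw0.pull _,
    fun j hj => ⟨(dw1 j hj).pull _, (dw2 j hj).pull _⟩, fun hk => ⟨?_, ?_⟩,
    fun j hj => (d3 j hj).pull _, fun hk => ?_⟩
  · rw [nf, hP _ h0e h0i, hP _ h1e h1i, hP _ h2e h2i, hP _ h3e h3i]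
    have : one (reC c) * w1 = one (reC c) * iota e x - one (reC c) * (one (imC c) * w3) := by
      simp only [w1, mul_sub]
    rw [this]
    simp only [w0, x']
    abel
  · simp only [w1, d1' hk, d3' (by omega)]
    simp
  · rw [dw2' hk, map_zero]
  · rw [d3' hk, map_zero]

end Split


section Classical

variable {W S : Type*} [AddCommGroup W] [Module ℂ W] [AddCommGroup S] [Module ℂ S]
  {p : W →ₗ[ℂ] S} {f : S →ₗ[ℂ] W} {c : W →ₗ[ℂ] ℂ} {e : W}

theorem two_eq_nf {a : W [⋀^Fin 2]→ₗ[ℝ] ℝ} (ha : IsPos a) (hfp : ∀ w, f (p w) = w - c w • e)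
    (hcf : ∀ s, c (f s) = 0) (hce : c e = 1) (hs : slice a e = imC c) :
    two a = nf p c (two (a.compLinearMap (f.restrictScalars ℝ))) 0 0 1 := by
  have c1 : (const 1 : GForm W ℝ) = 1 := rfl
  have c0 : (const 0 : GForm W ℝ) = 0 := Pi.single_eq_zero_iff.2 (by ext; simp)
  have hs' : slice a (Complex.I • e) = -reC c := by
    ext w
    rw [slice_apply, ha.apply_I_left, ← slice_apply, hs]
    simp
  have hneg : one (-reC c) = -one (reC c) :=
    (congrArg (Pi.single 1) (by ext v; simp [AlternatingMap.ofSubsingleton])).trans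
      (Pi.single_neg 1 _)
  have h1 : iota e (two a - one (reC c) * one (imC c)) = 0 := by
    rw [map_sub, iota_two, hs, iota_mul, iota_one, iota_one, reC_apply, imC_apply, hce,
      Complex.one_re, Complex.one_im, c1, c0]
    simp
  have h2 : iota (Complex.I • e) (two a - one (reC c) * one (imC c)) = 0 := by
    rw [map_sub, iota_two, hs', iota_mul, iota_one, iota_one, reC_apply, imC_apply, map_smul, hce,
      smul_eq_mul, mul_one, Complex.I_re, Complex.I_im, c1, c0, hneg, sgn_one]
    simp
  have h3 : pull (p.restrictScalars ℝ) (pull (f.restrictScalars ℝ)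
      (two a - one (reC c) * one (imC c))) = two a - one (reC c) * one (imC c) := by
    rw [pull_pull]
    exact pull_eq_self_of_iota (c := c) (e := e) hfp h1 h2
  have h4 : pull (f.restrictScalars ℝ) (one (reC c)) = 0 := by
    rw [pull_one, show reC c ∘ₗ f.restrictScalars ℝ = 0 by ext s; simp [hcf]]
    exact Pi.single_eq_zero_iff.2 (by ext v; simp [AlternatingMap.ofSubsingleton])
  rw [map_sub, pull_mul, h4, zero_mul, sub_zero, pull_two] at h3
  rw [nf, h3, map_zero, mul_zero, mul_zero]
  have h5 : pull (p.restrictScalars ℝ) (1 : GForm S ℝ) = 1 := pull_const _ 1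
  rw [h5, mul_one]
  abel

theorem nf_pow_mul {t : GForm S ℝ} (ht : sgn t = t) (s : ℕ) (v₀ v₁ v₂ v₃ : GForm S ℝ) :
    nf p c t 0 0 1 ^ s * nf p c v₀ v₁ v₂ v₃ = nf p c (t ^ s * v₀) (t ^ s * v₁) (t ^ s * v₂)
      (t ^ s * v₃ + (s : ℝ) • (t ^ (s - 1) * v₀)) := by
  induction s with
  | zero => simp
  | succ s ih =>
    rw [pow_succ', mul_assoc, ih, nf_mul, ht, map_zero]
    simp only [zero_mul, zero_add, sub_zero, add_zero, one_mul, ← mul_assoc, ← pow_succ', mul_add,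
      mul_smul_comm]
    congr 1
    rcases s with _ | s
    · simp
    · rw [Nat.add_sub_cancel, Nat.add_sub_cancel, add_assoc]
      congr 1
      push_cast
      module

theorem topv_nf {n : ℕ} (b : Fin (n + 1) → W) (hpe : p (b 0) = 0) (hce : c (b 0) = 1)
    (u₀ u₁ u₂ u₃ : GForm S ℝ) :
    topv b (nf p c u₀ u₁ u₂ u₃) = topv (fun i => p (b i.succ)) u₃ := by
  rw [topv_succ, iotaPair_nf hpe hce, topv_pull]
  rfl

theorem lefschetz_quadratic {t : GForm S ℝ} (ht : ∀ z, z * t = t * z) (hjt : jf t = t) (s : ℕ)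
    {p q : GForm S ℝ} (hp : t ^ s * p = 0) :
    t ^ s * ((p + t * q) * jf (-((s : ℝ) + 1) • q) + (-((s : ℝ) + 1) • q) * jf (p + t * q))
      + (s : ℝ) • (t ^ (s - 1) * ((p + t * q) * jf (p + t * q)))
      = (s : ℝ) • (t ^ (s - 1) * (p * jf p)) - ((s : ℝ) + 2) • (t ^ (s + 1) * (q * jf q)) := by
  have hts : ∀ (r : ℕ) z, z * t ^ r = t ^ r * z := fun r z => ((show Commute z t from ht z).pow_right r).eq
  have h1 : ∀ z w, z * (t * w) = t * (z * w) := fun z w => by rw [← mul_assoc, ht, mul_assoc]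
  have hjp : t ^ s * jf p = 0 := by
    have h := congrArg jf hp
    rw [jf_mul, map_zero] at h
    have hj : jf (t ^ s) = t ^ s := by
      have := map_pow (pullHom (jmap S)) t s
      rw [pullHom_apply, pullHom_apply] at this
      exact this.trans (congrArg (· ^ s) hjt)
    rwa [hj] at h
  have h2 : t ^ s * (p * jf q) = 0 := by rw [← mul_assoc, hp, zero_mul]
  have h3 : t ^ s * (q * jf p) = 0 := by rw [← mul_assoc, ← hts, mul_assoc, hjp, mul_zero]
  have h4 : t ^ s * (t * (q * jf q)) = t ^ (s + 1) * (q * jf q) := by rw [← mul_assoc, ← pow_succ]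
  rcases s with _ | s
  · simp only [pow_zero, one_mul] at hp h4
    simp only [hp, pow_zero, one_mul, map_add, map_smul, jf_mul, hjt, map_zero, CharP.cast_eq_zero,
      zero_smul, zero_add, mul_smul_comm, smul_mul_assoc, h1, zero_mul, mul_assoc, pow_one]
    module
  · have h5 : ∀ z, t ^ s * (t * z) = t ^ (s + 1) * z := fun z => by rw [← mul_assoc, ← pow_succ]
    simp only [map_add, map_smul, jf_mul, hjt, mul_add, add_mul, mul_smul_comm, smul_mul_assoc,
      h1 p, h1 q, mul_assoc, h2, h3, h4, Nat.add_sub_cancel, h5, smul_zero, add_zero, zero_add, smul_add]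
    push_cast
    module

/-- The classical Hodge–Riemann relations, with a single form. -/
theorem hodgeRiemann_pow {n : ℕ} (h : HodgeRiemann.{u} n) {W : Type u} [AddCommGroup W]
    [Module ℂ W] (e : Module.Basis (Fin (n + 1)) ℂ W) {a : W [⋀^Fin 2]→ₗ[ℝ] ℝ} (ha : IsPos a)
    {s k : ℕ} (hsk : s + k = n + 1) {x : GForm W ℝ} (hx : IsDeg k x)
    (h0 : two a ^ (s + 1) * x = 0) (hne : x ≠ 0) :
    0 < eps k * topv e (two a ^ s * (x * jf x)) := by
  haveI : FiniteDimensional ℂ W := Module.Finite.of_basis e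
  have hn : Module.finrank ℂ W = n + 1 := by simp [Module.finrank_eq_card_basis e]
  haveI : Nontrivial W := Module.nontrivial_of_finrank_pos (R := ℂ) (by omega)
  obtain ⟨b, hb, hb1, -⟩ := ha.exists_basis hn ⊥ bot_ne_top
  obtain ⟨r, hr, he⟩ := exists_topv_eq (N := ℝ) b e
  rw [he, smul_eq_mul, mul_left_comm]
  refine mul_pos hr ?_
  have hli : LinearIndependent ℂ fun i : Fin n => b i.succ :=
    b.linearIndependent.comp _ (Fin.succ_injective n)
  let S := Submodule.span ℂ (Set.range fun i : Fin n => b i.succ)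
  let bS : Module.Basis (Fin n) ℂ S := Module.Basis.span hli
  let f : S →ₗ[ℂ] W := S.subtype
  have hf : ∀ i, f (bS i) = b i.succ := fun i =>
    congrArg Subtype.val (Module.Basis.span_apply hli i)
  let p : W →ₗ[ℂ] S := b.constr ℂ (Fin.cons 0 bS : Fin (n + 1) → S)
  have hp0 : p (b 0) = 0 := by simp [p]
  have hps : ∀ i : Fin n, p (b i.succ) = bS i := fun i => by simp [p]
  let c := b.coord 0
  have hc0 : c (b 0) = 1 := by simp [c]
  have hcs : ∀ i : Fin n, c (b i.succ) = 0 := fun i => by simp [c]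
  have hfp : ∀ w, f (p w) = w - c w • b 0 := by
    have : f ∘ₗ p = LinearMap.id - c.smulRight (b 0) := b.ext fun i => by
      refine Fin.cases ?_ (fun i => ?_) i
      · simp [hp0, hc0]
      · simp [hps, hcs, hf]
    exact LinearMap.congr_fun this
  have hpf : ∀ s, p (f s) = s := by
    have : p ∘ₗ f = LinearMap.id := bS.ext fun i => by simp [hf, hps]
    exact LinearMap.congr_fun this
  have hcf : ∀ s, c (f s) = 0 := by
    have : c ∘ₗ f = 0 := bS.ext fun i => by simp [hf, hcs]
    exact LinearMap.congr_fun this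
  have hslice : slice a (b 0) = imC c := by
    refine (frameBasis b).ext fun j => ?_
    rw [coe_frameBasis, cframe, slice_apply, imC_apply, map_smul, smul_eq_mul]
    generalize (⟨j.1 / 2, _⟩ : Fin (n + 1)) = i
    refine Fin.cases ?_ (fun i => ?_) i
    · rw [hc0]
      split_ifs
      · simp [two_form_self]
      · simp [hb1]
    · rw [hcs]
      have h1 := hb 0 i.succ (Fin.succ_ne_zero i).symm
      split_ifs
      · simp [h1]
      · simp [h1]
  set a' := a.compLinearMap (f.restrictScalars ℝ)
  have ha' : IsPos a' := ha.comp f Subtype.val_injective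
  have htwo : two a = nf p c (two a') 0 0 1 := two_eq_nf ha hfp hcf hc0 hslice
  set t := two a' with htdef
  have ht : ∀ z, z * t = t * z := fun z => mul_comm_of_even z (sgn_two a')
  have hjt : jf t = t := ha'.jf_two
  have hHR : ∀ (r j : ℕ) (y : GForm S ℝ), r + j = n → IsDeg j y → t ^ (r + 1) * y = 0 →
      0 ≤ eps j * topv bS (t ^ r * (y * jf y)) ∧
        (eps j * topv bS (t ^ r * (y * jf y)) = 0 → y = 0) := by
    intro r j y hrj hy h1
    by_cases hy0 : y = 0
    · subst hy0
      simp [topv_zero]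
    · have h2 := h S bS a' (List.replicate r a') j y ha'
        (fun b hb => (List.eq_of_mem_replicate hb) ▸ ha') (by simpa using hrj) hy
        (by rw [prodTwo_replicate, ← mul_assoc, ← pow_succ']; exact h1) hy0
      rw [prodTwo_replicate] at h2
      exact ⟨h2.le, fun h3 => absurd h3 h2.ne'⟩
  obtain ⟨u₀, u₁, u₂, u₃, rfl, d0, d12, z12, d3, z3⟩ := exists_eq_nf (p := p) (f := f) hfp hc0 hx
  rw [htwo, nf_pow_mul (sgn_two a')] at h0
  obtain ⟨k0, k1, k2, k3⟩ := nf_eq_zero hpf hp0 hc0 h0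
  rw [Nat.add_sub_cancel] at k3
  have hT : ∀ u : GForm S ℝ, (∀ j, k = j + 1 → IsDeg j u) → (k = 0 → u = 0) →
      t ^ (s + 1) * u = 0 → 0 ≤ -(eps k * topv bS (t ^ s * (sgn u * jf u))) ∧
        (-(eps k * topv bS (t ^ s * (sgn u * jf u))) = 0 → u = 0) := by
    intro u hu hu0 hk
    rcases k with _ | k
    · rw [hu0 rfl]
      simp [topv_zero]
    · have h1 := hHR s k u (by omega) (hu k rfl) hk
      have h2 : -(eps (k + 1) * topv bS (t ^ s * (sgn u * jf u)))
          = eps k * topv bS (t ^ s * (u * jf u)) := by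
        have h3 : ((-1 : ℝ) ^ k) * (-1) ^ k = 1 := by rw [← mul_pow]; simp
        rw [(hu k rfl).sgn_eq, smul_mul_assoc, mul_smul_comm, topv_smul, smul_eq_mul, eps_succ,
          pow_succ]
        linear_combination (eps k * topv bS (t ^ s * (u * jf u))) * h3
      rwa [h2]
  obtain ⟨n1, m1⟩ := hT u₁ (fun j hj => (d12 j hj).1) (fun h => (z12 h).1) k1
  obtain ⟨n2, m2⟩ := hT u₂ (fun j hj => (d12 j hj).2) (fun h => (z12 h).2) k2
  have hs1 : (s : ℝ) + 1 ≠ 0 := by positivity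
  obtain ⟨q, rfl⟩ : ∃ q, u₃ = -((s : ℝ) + 1) • q :=
    ⟨(-((s : ℝ) + 1))⁻¹ • u₃, by rw [smul_smul, mul_inv_cancel₀ (neg_ne_zero.2 hs1), one_smul]⟩
  obtain ⟨v, rfl⟩ : ∃ v, u₀ = v + t * q := ⟨u₀ - t * q, by abel⟩
  have hq3 : ∀ {j}, IsDeg j (-((s : ℝ) + 1) • q) → IsDeg j q := fun {j} hj => by
    have := hj.smul (-((s : ℝ) + 1))⁻¹
    rwa [smul_smul, inv_mul_cancel₀ (neg_ne_zero.2 hs1), one_smul] at this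
  have hq0 : k < 2 → q = 0 := fun hk => (smul_eq_zero.1 (z3 hk)).resolve_left (neg_ne_zero.2 hs1)
  have hv : t ^ s * v = 0 := by
    have h1 : ((s : ℝ) + 1) • (t ^ s * v) = 0 := by
      rw [← k3, mul_add, ← mul_assoc (t ^ s), ← pow_succ, mul_smul_comm]
      push_cast
      module
    exact (smul_eq_zero.1 h1).resolve_left hs1
  have hq : t ^ (s + 2) * q = 0 := by
    rw [mul_add, pow_succ', mul_assoc, hv, mul_zero, zero_add, ← pow_succ', ← mul_assoc,
      ← pow_succ] at k0
    exact k0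
  have dv : IsDeg k v := by
    have h1 : IsDeg k (t * q) := by
      rcases Nat.lt_or_ge k 2 with hk | hk
      · rw [hq0 hk, mul_zero]
        exact IsDeg.zero k
      · obtain ⟨j, rfl⟩ := Nat.exists_eq_add_of_le' hk
        have := isDeg_mul (isDeg_two a') (hq3 (d3 j rfl))
        rwa [add_comm] at this
    have := d0.add (h1.smul (-1))
    rwa [neg_one_smul, add_neg_cancel_right] at this
  have hV : 0 ≤ s * (eps k * topv bS (t ^ (s - 1) * (v * jf v))) ∧
      (s * (eps k * topv bS (t ^ (s - 1) * (v * jf v))) = 0 → v = 0) := by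
    rcases s with _ | s
    · have : v = 0 := by simpa using hv
      simp [this]
    · obtain ⟨h1, h2⟩ := hHR s k v (by omega) dv hv
      refine ⟨mul_nonneg (Nat.cast_nonneg _) h1, fun h3 => h2 ?_⟩
      exact (mul_eq_zero.1 h3).resolve_left (by positivity)
  have hQ : 0 ≤ -((s + 2) * (eps k * topv bS (t ^ (s + 1) * (q * jf q)))) ∧
      (-((s + 2) * (eps k * topv bS (t ^ (s + 1) * (q * jf q)))) = 0 → q = 0) := by
    rcases Nat.lt_or_ge k 2 with hk | hk
    · simp [hq0 hk, topv_zero]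
    · obtain ⟨j, rfl⟩ := Nat.exists_eq_add_of_le' hk
      obtain ⟨h1, h2⟩ := hHR (s + 1) j q (by omega) (hq3 (d3 j rfl)) hq
      have h4 : eps (j + 2) = -eps j := by
        have h3 : ((-1 : ℝ) ^ j) * (-1) ^ j = 1 := by rw [← mul_pow]; simp
        rw [eps_succ, eps_succ, pow_succ, pow_succ]
        linear_combination -eps j * h3
      rw [h4]
      have h5 : -(((s : ℝ) + 2) * (-eps j * topv bS (t ^ (s + 1) * (q * jf q))))
        = (s + 2) * (eps j * topv bS (t ^ (s + 1) * (q * jf q))) := by ring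
      rw [h5]
      refine ⟨by positivity, fun h6 => h2 ?_⟩
      exact (mul_eq_zero.1 h6).resolve_left (by positivity)
  have hmain : eps k * topv b (two a ^ s * (nf p c (v + t * q) u₁ u₂ (-((s : ℝ) + 1) • q) *
      jf (nf p c (v + t * q) u₁ u₂ (-((s : ℝ) + 1) • q))))
      = s * (eps k * topv bS (t ^ (s - 1) * (v * jf v)))
        + -((s + 2) * (eps k * topv bS (t ^ (s + 1) * (q * jf q))))
        + -(eps k * topv bS (t ^ s * (sgn u₁ * jf u₁)))
        + -(eps k * topv bS (t ^ s * (sgn u₂ * jf u₂))) := by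
    have h1 : (fun i : Fin n => p (b i.succ)) = bS := funext hps
    rw [htwo, jf_nf, nf_mul, nf_pow_mul (sgn_two a'), topv_nf _ hp0 hc0, h1]
    have h2 : t ^ s * ((v + t * q) * jf (-((s : ℝ) + 1) • q) + -((s : ℝ) + 1) • q * jf (v + t * q) +
        sgn u₁ * -jf u₁ - sgn u₂ * jf u₂) + (s : ℝ) • (t ^ (s - 1) * ((v + t * q) * jf (v + t * q)))
      = (s : ℝ) • (t ^ (s - 1) * (v * jf v)) + (-((s : ℝ) + 2)) • (t ^ (s + 1) * (q * jf q))
        + (-1 : ℝ) • (t ^ s * (sgn u₁ * jf u₁)) + (-1 : ℝ) • (t ^ s * (sgn u₂ * jf u₂)) := by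
      have h3 := lefschetz_quadratic ht hjt s (q := q) hv
      rw [mul_sub, mul_add _ _ (sgn u₁ * -jf u₁), mul_neg, mul_neg]
      linear_combination (norm := module) h3
    rw [h2]
    simp only [topv_add, topv_smul, smul_eq_mul]
    ring
  rw [hmain]
  rcases (add_nonneg (add_nonneg (add_nonneg hV.1 hQ.1) n1) n2).eq_or_lt with h | h
  · exfalso
    refine hne ?_
    have e1 := hV.2 (by linarith [hV.1, hQ.1])
    have e2 := hQ.2 (by linarith [hV.1, hQ.1])
    have e3 := m1 (by linarith [hV.1, hQ.1])
    have e4 := m2 (by linarith [hV.1, hQ.1])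
    rw [e1, e2, e3, e4]
    simp [nf]
  · exact h

end Classical


section Mixed

/-- `pos_of_path` without a norm. -/
theorem pos_of_path_module {U Y : Type*} [AddCommGroup U] [Module ℝ U] [Module.Finite ℝ U]
    [AddCommGroup Y] [Module ℝ Y] [Module.Finite ℝ Y] (ℓ : Y →ₗ[ℝ] U)
    (Q : ℝ → U →ₗ[ℝ] U →ₗ[ℝ] ℝ) (hc : ∀ u v, Continuous fun t => Q t u v)
    (hs : ∀ t u v, Q t u v = Q t v u)
    (hU : ∀ t ∈ Set.Icc (0 : ℝ) 1, ∀ u, (∀ v, Q t u v = 0) → u = 0)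
    (hY : ∀ t ∈ Set.Icc (0 : ℝ) 1, ∀ y, (∀ y', Q t (ℓ y) (ℓ y') = 0) → y = 0)
    (h0 : ∀ u, (∀ y, Q 0 u (ℓ y) = 0) → u ≠ 0 → 0 < Q 0 u u) (u : U)
    (hu : ∀ y, Q 1 u (ℓ y) = 0) (hne : u ≠ 0) : 0 < Q 1 u u := by
  let φ := (Module.finBasis ℝ U).equivFun
  letI : NormedAddCommGroup U := NormedAddCommGroup.induced U (Fin (Module.finrank ℝ U) → ℝ)
    φ.toLinearMap φ.injective
  letI : NormedSpace ℝ U := NormedSpace.induced ℝ U (Fin (Module.finrank ℝ U) → ℝ) φ.toLinearMap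
  exact pos_of_path ℓ Q hc hs hU hY h0 u hu hne

variable {W : Type u} [AddCommGroup W] [Module ℂ W]

theorem continuous_topv_prodTwo {n : ℕ} (e : Fin n → W) (a : W [⋀^Fin 2]→ₗ[ℝ] ℝ)
    (l : List (W [⋀^Fin 2]→ₗ[ℝ] ℝ)) (z : GForm W ℝ) :
    Continuous fun t : ℝ => topv e (prodTwo (l.map fun b => (1 - t) • a + t • b) * z) := by
  induction l generalizing z with
  | nil => exact (continuous_const : Continuous fun _ : ℝ => topv e (prodTwo [] * z))
  | cons b l ih =>
    have h : ∀ t : ℝ, topv e (prodTwo ((b :: l).map fun b => (1 - t) • a + t • b) * z)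
        = (1 - t) * topv e (prodTwo (l.map fun b => (1 - t) • a + t • b) * (two a * z))
          + t * topv e (prodTwo (l.map fun b => (1 - t) • a + t • b) * (two b * z)) := by
      intro t
      have h1 : two ((1 - t) • a + t • b) = (1 - t) • two a + t • two b := by
        simp only [two, Pi.single_add, Pi.single_smul]
      rw [List.map_cons, prodTwo_cons, ← mul_comm_of_even _ (sgn_two _), mul_assoc, h1, add_mul,
        smul_mul_assoc, smul_mul_assoc, mul_add, mul_smul_comm, mul_smul_comm, topv_add, topv_smul,
        topv_smul, smul_eq_mul, smul_eq_mul]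
    simp only [h]
    exact ((continuous_const.sub continuous_id).mul (ih _)).add (continuous_id.mul (ih _))

/-- The Hodge–Riemann form of a product of two-forms. -/
def hrForm {n : ℕ} (e : Fin n → W) (A : GForm W ℝ) (k : ℕ) :
    (W [⋀^Fin k]→ₗ[ℝ] ℝ) →ₗ[ℝ] (W [⋀^Fin k]→ₗ[ℝ] ℝ) →ₗ[ℝ] ℝ :=
  LinearMap.mk₂ ℝ (fun u v => eps k *
      topv e (A * ((Pi.single k u : GForm W ℝ) * jf (Pi.single k v : GForm W ℝ))))
    (fun u u' v => by rw [Pi.single_add, add_mul, mul_add, topv_add, mul_add])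
    (fun r u v => by
      rw [Pi.single_smul, smul_mul_assoc, mul_smul_comm, topv_smul, smul_eq_mul, smul_eq_mul,
        mul_left_comm])
    (fun u v v' => by rw [Pi.single_add, map_add, mul_add, mul_add, topv_add, mul_add])
    (fun r u v => by
      rw [Pi.single_smul, map_smul, mul_smul_comm, mul_smul_comm, topv_smul, smul_eq_mul,
        smul_eq_mul, mul_left_comm])

theorem hrForm_apply {n : ℕ} (e : Fin n → W) (A : GForm W ℝ) (k : ℕ)
    (u v : W [⋀^Fin k]→ₗ[ℝ] ℝ) : hrForm e A k u v = eps k *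
      topv e (A * ((Pi.single k u : GForm W ℝ) * jf (Pi.single k v : GForm W ℝ))) := rfl

theorem topv_mul_jf_symm {n : ℕ} (e : Fin n → W) {A : GForm W ℝ} (hA : jf A = A) {k : ℕ}
    {u v : GForm W ℝ} (hu : IsDeg k u) (hv : IsDeg k v) :
    topv e (A * (u * jf v)) = topv e (A * (v * jf u)) := by
  rw [← topv_jf e (A * (u * jf v)), jf_mul, jf_mul, jf_jf, hA, hv.sgn_eq, mul_smul_comm,
    mul_comm_deg hu.jf hv, smul_smul]
  have : (-1 : ℝ) ^ k * (-1) ^ (k * k) = 1 := by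
    rw [← pow_add, show k + k * k = k * (k + 1) by ring, (Nat.even_mul_succ_self k).neg_one_pow]
  rw [this, one_smul]

theorem HardLefschetz.eq_zero {n : ℕ} (h : HardLefschetz.{u} n) (e : Module.Basis (Fin n) ℂ W)
    {l : List (W [⋀^Fin 2]→ₗ[ℝ] ℝ)} {k : ℕ} {x : GForm W ℝ}
    (hl : ∀ b ∈ l, IsPos b) (hk : l.length + k = n) (hx : IsDeg k x)
    (h0 : ∀ y, IsDeg k y → topv e (prodTwo l * (x * jf y)) = 0) : x = 0 := by
  refine h W e l k x hl hk hx ?_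
  refine eq_zero_of_topv_mul e (p := 2 * l.length + k) (q := k) (by omega)
    (isDeg_mul (isDeg_prodTwo l) hx) fun y hy => ?_
  have h1 : y = jf (((-1 : ℝ) ^ k) • jf y) := by
    rw [map_smul, jf_jf, hy.sgn_eq, smul_smul, ← mul_pow]
    simp
  rw [h1, mul_assoc]
  exact h0 _ (hy.jf.smul _)

theorem IsDeg.eq_zero_of_lt {N : Type*} [AddCommGroup N] [Module ℝ N] {n : ℕ}
    (e : Module.Basis (Fin n) ℂ W) {p : ℕ} (h : 2 * n < p) {x : GForm W N} (hx : IsDeg p x) :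
    x = 0 := by
  haveI : Module.Finite ℝ W := Module.Finite.of_basis (frameBasis e)
  refine hx.ext (IsDeg.zero p) (alternatingMap_eq_zero_of_lt ?_ _)
  rwa [Module.finrank_eq_card_basis (frameBasis e), Fintype.card_fin]

theorem hodgeRiemann_succ {n : ℕ} (h : HodgeRiemann.{u} n) : HodgeRiemann.{u} (n + 1) := by
  intro W _ _ e a l k x ha hl hk hx h0 hne
  have HL := hardLefschetz_succ h
  haveI : Module.Finite ℝ W := Module.Finite.of_basis (frameBasis e)
  let lt : ℝ → List (W [⋀^Fin 2]→ₗ[ℝ] ℝ) := fun t => l.map fun b => (1 - t) • a + t • b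
  have hlt : ∀ t ∈ Set.Icc (0 : ℝ) 1, ∀ b ∈ lt t, IsPos b := by
    intro t ht b hb
    obtain ⟨c, hc, rfl⟩ := List.mem_map.1 hb
    exact ha.combo (hl c hc) ht.1 ht.2
  have hlen : ∀ t, (lt t).length = l.length := fun t => List.length_map _
  have hj : ∀ t, jf (prodTwo (lt t)) = prodTwo (lt t) := by
    intro t
    rw [jf, pull_prodTwo]
    congr 1
    rw [List.map_map]
    refine List.map_congr_left fun b hb => ?_
    have h1 : ∀ b : W [⋀^Fin 2]→ₗ[ℝ] ℝ, IsPos b → b.compLinearMap (jmap W) = b := by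
      intro b hb
      have := congrFun hb.jf_two 2
      rw [jf, pull_two] at this
      simpa [two] using this
    have h2 := h1 a ha
    have h3 := h1 b (hl b hb)
    ext v
    have h4 := DFunLike.congr_fun h2 v
    have h5 := DFunLike.congr_fun h3 v
    simp only [AlternatingMap.compLinearMap_apply] at h4 h5
    simp only [Function.comp_apply, AlternatingMap.compLinearMap_apply, AlternatingMap.add_apply,
      AlternatingMap.smul_apply, h4, h5]
  have hcentral : ∀ t (z : GForm W ℝ), z * prodTwo (lt t) = prodTwo (lt t) * z := fun t z =>
    mul_comm_of_even z (sgn_prodTwo _)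
  have hca : ∀ z : GForm W ℝ, z * two a = two a * z := fun z => mul_comm_of_even z (sgn_two _)
  let Y : Submodule ℝ (GForm W ℝ) :=
    { carrier := {y | ∀ i, i + 2 ≠ k → y i = 0}
      zero_mem' := fun _ _ => rfl
      add_mem' := fun hy hz i hi => by rw [Pi.add_apply, hy i hi, hz i hi, add_zero]
      smul_mem' := fun c y hy i hi => by rw [Pi.smul_apply, hy i hi, smul_zero] }
  have hYdeg : ∀ (y : Y) j, k = j + 2 → IsDeg j (y : GForm W ℝ) := fun y j hj i hi =>
    y.2 i (by omega)
  have hY0 : k < 2 → ∀ y : Y, (y : GForm W ℝ) = 0 := fun hk y => funext fun i => y.2 i (by omega)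
  have hYmem : ∀ j, k = j + 2 → ∀ y : GForm W ℝ, IsDeg j y → y ∈ Y := fun j hj y hy i hi =>
    hy i (by omega)
  haveI : Module.Finite ℝ Y := by
    refine Module.Finite.of_injective
      ((LinearMap.proj (k - 2) : GForm W ℝ →ₗ[ℝ] W [⋀^Fin (k - 2)]→ₗ[ℝ] ℝ) ∘ₗ Y.subtype) ?_
    intro y z hyz
    refine Subtype.ext (funext fun i => ?_)
    by_cases hi : i + 2 = k
    · obtain rfl : i = k - 2 := by omega
      exact hyz
    · rw [y.2 i hi, z.2 i hi]
  let ℓ : Y →ₗ[ℝ] W [⋀^Fin k]→ₗ[ℝ] ℝ :=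
    (LinearMap.proj k : GForm W ℝ →ₗ[ℝ] _) ∘ₗ (LinearMap.mulLeft ℝ (two a)) ∘ₗ Y.subtype
  have hℓ : ∀ y : Y, (Pi.single k (ℓ y) : GForm W ℝ) = two a * y := by
    intro y
    suffices h : IsDeg k (two a * (y : GForm W ℝ)) from h.eq_single.symm
    rcases Nat.lt_or_ge k 2 with hk | hk
    · rw [hY0 hk, mul_zero]
      exact IsDeg.zero k
    · obtain ⟨j, hj⟩ := Nat.exists_eq_add_of_le' hk
      have := isDeg_mul (isDeg_two a) (hYdeg y j hj)
      rwa [add_comm, ← hj] at this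
  have heps : eps k ≠ 0 := fun h => by simpa [h] using eps_mul_self k
  have hS : ∀ u : W [⋀^Fin k]→ₗ[ℝ] ℝ, IsDeg k (Pi.single k u : GForm W ℝ) := fun u =>
    IsDeg.single k u
  have hS0 : ∀ u : W [⋀^Fin k]→ₗ[ℝ] ℝ, (Pi.single k u : GForm W ℝ) = 0 → u = 0 := fun u hu => by
    have := congrFun hu k
    rwa [Pi.single_eq_same] at this
  have hcm : ∀ z w : GForm W ℝ, z * (two a * w) = two a * (z * w) := fun z w => by
    rw [← mul_assoc, hca, mul_assoc]
  have key := pos_of_path_module ℓ (fun t => hrForm e (prodTwo (lt t)) k) ?_ ?_ ?_ ?_ ?_ (x k) ?_ ?_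
  · simp only [hrForm_apply] at key
    rw [← hx.eq_single] at key
    have h1 : lt 1 = l := by simp [lt]
    rwa [h1] at key
  · intro u v
    exact (continuous_topv_prodTwo e a l _).const_smul (eps k)
  · intro t u v
    simp only [hrForm_apply]
    rw [topv_mul_jf_symm e (hj t) (hS u) (hS v)]
  · intro t ht u hu
    refine hS0 u (HL.eq_zero e (hlt t ht) (by rw [hlen, hk]) (hS u) fun y hy => ?_)
    have h1 := hu (y k)
    simp only [hrForm_apply] at h1
    rw [← hy.eq_single] at h1
    exact (mul_eq_zero.1 h1).resolve_left heps
  · intro t ht y hy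
    rcases Nat.lt_or_ge k 2 with hk2 | hk2
    · exact Subtype.ext (hY0 hk2 y)
    · obtain ⟨j, hj⟩ := Nat.exists_eq_add_of_le' hk2
      refine Subtype.ext (HL.eq_zero e (l := a :: a :: lt t) (k := j) ?_ ?_ (hYdeg y j hj)
        fun z hz => ?_)
      · simp only [List.mem_cons]
        rintro b (rfl | rfl | hb)
        exacts [ha, ha, hlt t ht b hb]
      · simp only [List.length_cons, hlen]
        omega
      · have h1 := hy ⟨z, hYmem j hj z hz⟩
        simp only [hrForm_apply, hℓ] at h1
        have h2 := (mul_eq_zero.1 h1).resolve_left heps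
        rw [jf_mul, ha.jf_two, mul_assoc (two a), hcm, hcm, hcm] at h2
        rw [prodTwo_cons, prodTwo_cons, mul_assoc, mul_assoc]
        exact h2
  · intro u hu hu0
    simp only [hrForm_apply] at hu ⊢
    have h1 : prodTwo (lt 0) = two a ^ l.length := by
      have : lt 0 = List.replicate l.length a := by
        simp [lt]
      rw [this, prodTwo_replicate]
    rw [h1] at hu ⊢
    refine hodgeRiemann_pow h e ha hk (hS u) ?_ fun h => hu0 (hS0 u h)
    have hd : IsDeg (2 * (l.length + 1) + k) (two a ^ (l.length + 1) * (Pi.single k u : GForm W ℝ)) := by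
      have h3 := isDeg_prodTwo (List.replicate (l.length + 1) a)
      rw [prodTwo_replicate, List.length_replicate] at h3
      exact isDeg_mul h3 (hS u)
    rcases Nat.lt_or_ge k 2 with hk2 | hk2
    · exact hd.eq_zero_of_lt e (by omega)
    · obtain ⟨j, hj⟩ := Nat.exists_eq_add_of_le' hk2
      refine eq_zero_of_topv_mul e (q := j) (by omega) hd fun y hy => ?_
      have h3 : y = jf (((-1 : ℝ) ^ j) • jf y) := by
        rw [map_smul, jf_jf, hy.sgn_eq, smul_smul, ← mul_pow]
        simp
      have h2 := hu ⟨((-1 : ℝ) ^ j) • jf y, hYmem j hj _ (hy.jf.smul _)⟩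
      rw [hℓ, jf_mul, ha.jf_two] at h2
      have h4 := (mul_eq_zero.1 h2).resolve_left heps
      rw [← h3] at h4
      rw [hcm, ← mul_assoc, ← pow_succ, ← mul_assoc] at h4
      exact h4
  · intro y
    simp only [hrForm_apply]
    have h1 : lt 1 = l := by simp [lt]
    rw [← hx.eq_single, h1, hℓ, jf_mul, ha.jf_two]
    have : prodTwo l * (x * (two a * jf (y : GForm W ℝ))) = 0 := by
      rw [hcm, hcm, ← mul_assoc (prodTwo l), ← mul_assoc (two a), h0, zero_mul]
    rw [this, topv_zero, mul_zero]
  · intro h1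
    apply hne
    rw [hx.eq_single, h1, Pi.single_zero]

theorem hodgeRiemann_zero : HodgeRiemann.{u} 0 := by
  intro W _ _ e a l k x ha hl hk hx h0 hne
  obtain ⟨h1, rfl⟩ : l.length = 0 ∧ k = 0 := by omega
  obtain rfl := List.length_eq_zero_iff.1 h1
  have h2 : x = const (x 0 ![]) := by
    refine hx.ext (isDeg_const _) ?_
    ext v
    simp only [const, Pi.single_eq_same, AlternatingMap.constOfIsEmpty_apply]
    exact congrArg (x 0) (Subsingleton.elim _ _)
  have h3 : jf x = x := by
    rw [h2]
    exact pull_const _ _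
  have h4 : x 0 ![] ≠ 0 := fun h => hne (by rw [h2, h]; exact Pi.single_eq_zero_iff.2 (by ext; simp))
  rw [eps_zero, one_mul, prodTwo_nil, one_mul, h3, mul_def, topv]
  have h5 : wedge (LinearMap.mul ℝ ℝ) x x = const (x 0 ![] * x 0 ![]) := by
    rw [h2, wedge_const_left]
    refine IsDeg.ext ((isDeg_const _).mapV _) (isDeg_const _) ?_
    ext v
    simp [const]
  rw [h5]
  exact mul_self_pos.2 h4

theorem hodgeRiemann (n : ℕ) : HodgeRiemann.{u} n :=
  Nat.rec hodgeRiemann_zero (fun _ => hodgeRiemann_succ) n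

/-- The mixed hard Lefschetz theorem for constant real forms. -/
theorem hardLefschetz (n : ℕ) : HardLefschetz.{u} n := by
  rcases n with _ | n
  · intro W _ _ e l k x hl hk hx h0
    obtain ⟨h1, rfl⟩ : l.length = 0 ∧ k = 0 := by omega
    obtain rfl := List.length_eq_zero_iff.1 h1
    simpa using h0
  · exact hardLefschetz_succ (hodgeRiemann n)

end Mixed

section Abstract

variable {U : Type*} [AddCommGroup U] [Module ℂ U]

/-- A graded space of degrees `0, …, 2m` with an operator `L` of degree `2` that satisfies the hard
Lefschetz theorem. -/
structure LefschetzModule (m : ℕ) (deg : ℕ → Submodule ℂ U) (pr : ℕ → Module.End ℂ U)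
    (L : Module.End ℂ U) : Prop where
  proj_mem : ∀ d u, pr d u ∈ deg d
  proj_self : ∀ d, ∀ u ∈ deg d, pr d u = u
  proj_of_ne : ∀ d d', d ≠ d' → ∀ u ∈ deg d', pr d u = 0
  sum_proj : ∀ u, ∑ d ∈ Finset.range (2 * m + 1), pr d u = u
  map_mem : ∀ d, ∀ u ∈ deg d, L u ∈ deg (d + 2)
  inj : ∀ d ≤ m, ∀ u ∈ deg d, (L ^ (m - d)) u = 0 → u = 0
  surj : ∀ d ≤ m, ∀ w ∈ deg (2 * m - d), ∃ u ∈ deg d, (L ^ (m - d)) u = w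

/-- Primitive elements of degree `k`. -/
def prim (m : ℕ) (deg : ℕ → Submodule ℂ U) (L : Module.End ℂ U) (k : ℕ) : Submodule ℂ U :=
  deg k ⊓ LinearMap.ker (L ^ (m - k + 1))

/-- The defining property of the Lefschetz star operator. -/
def IsStar (m : ℕ) (deg : ℕ → Submodule ℂ U) (L s : Module.End ℂ U) : Prop :=
  ∀ k r, r + k ≤ m → ∀ u ∈ prim m deg L k,
    s (powDiv L r u) = (-1 : ℂ) ^ (∑ i ∈ Finset.range (k + 1), i) • powDiv L (m - r - k) u

namespace LefschetzModule

variable {m : ℕ} {deg : ℕ → Submodule ℂ U} {pr : ℕ → Module.End ℂ U} {L s : Module.End ℂ U}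

theorem pow_eq (r : ℕ) (u : U) : (L ^ r) u = (r.factorial : ℂ) • powDiv L r u := by
  rw [powDiv, LinearMap.smul_apply, smul_smul, mul_one_div_cancel (Nat.cast_ne_zero.2 r.factorial_ne_zero), one_smul]

theorem powDiv_apply (r : ℕ) (u : U) : powDiv L r u = (1 / (r.factorial : ℂ)) • (L ^ r) u := rfl

theorem powDiv_succ (r : ℕ) (u : U) : L (powDiv L r u) = ((r : ℂ) + 1) • powDiv L (r + 1) u := by
  rw [powDiv_apply, powDiv_apply, map_smul, smul_smul, pow_succ', Module.End.mul_apply]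
  congr 1
  rw [Nat.factorial_succ]
  push_cast
  have : (r.factorial : ℂ) ≠ 0 := Nat.cast_ne_zero.2 r.factorial_ne_zero
  have : (r : ℂ) + 1 ≠ 0 := Nat.cast_add_one_ne_zero r
  field_simp

theorem powDiv_L (r : ℕ) (u : U) : powDiv L r (L u) = ((r : ℂ) + 1) • powDiv L (r + 1) u := by
  rw [← powDiv_succ, powDiv_apply, powDiv_apply, map_smul, ← Module.End.mul_apply,
    ← Module.End.mul_apply, ← pow_succ, ← pow_succ']

theorem pow_mem (h : LefschetzModule m deg pr L) (r d : ℕ) {u : U} (hu : u ∈ deg d) : (L ^ r) u ∈ deg (d + 2 * r) := by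
  induction r with
  | zero => exact hu
  | succ r ih =>
    rw [pow_succ', Module.End.mul_apply]
    exact h.map_mem _ _ ih

theorem eq_zero_of_lt (h : LefschetzModule m deg pr L) {d : ℕ} (hd : 2 * m < d) {u : U} (hu : u ∈ deg d) : u = 0 := by
  rw [← h.sum_proj u]
  refine Finset.sum_eq_zero fun i hi => h.proj_of_ne i d ?_ u hu
  have := Finset.mem_range.1 hi
  omega

theorem pow_prim_eq_zero (h : LefschetzModule m deg pr L) {k r : ℕ} (hk : k ≤ m) (hr : m < r + k) {u : U} (hu : u ∈ prim m deg L k) :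
    (L ^ r) u = 0 := by
  obtain ⟨j, rfl⟩ : ∃ j, r = j + (m - k + 1) := ⟨r - (m - k + 1), by omega⟩
  rw [pow_add, Module.End.mul_apply, LinearMap.mem_ker.1 hu.2, map_zero]

theorem exists_prim_add (h : LefschetzModule m deg pr L) {d : ℕ} (hd : d ≤ m) {u : U} (hu : u ∈ deg d) :
    ∃ p ∈ prim m deg L d, ∃ v, u = p + L v ∧ (∀ j, d = j + 2 → v ∈ deg j) ∧ (d < 2 → v = 0) := by
  rcases Nat.lt_or_ge d 2 with h2 | h2
  · refine ⟨u, ⟨hu, h.eq_zero_of_lt (d := d + 2 * (m - d + 1)) (by omega) (h.pow_mem _ _ hu)⟩, 0,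
      by simp, fun j hj => by omega, fun _ => rfl⟩
  · obtain ⟨j, rfl⟩ := Nat.exists_eq_add_of_le' h2
    obtain ⟨v, hv, hv'⟩ := h.surj j (by omega) ((L ^ (m - (j + 2) + 1)) u) (by
      have := h.pow_mem (m - (j + 2) + 1) _ hu
      rwa [show j + 2 + 2 * (m - (j + 2) + 1) = 2 * m - j by omega] at this)
    refine ⟨u - L v, ⟨Submodule.sub_mem _ hu (h.map_mem _ _ hv), ?_⟩, v, by abel,
      fun i hi => (show j = i by omega) ▸ hv, fun hlt => by omega⟩
    rw [SetLike.mem_coe, LinearMap.mem_ker, map_sub, sub_eq_zero, ← hv', ← Module.End.mul_apply, ← pow_succ]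
    congr 2
    omega

theorem induction_prim (h : LefschetzModule m deg pr L) {C : U → Prop} (hadd : ∀ u v, C u → C v → C (u + v)) (h0 : C 0)
    (hp : ∀ k r, r + k ≤ m → ∀ p ∈ prim m deg L k, C ((L ^ r) p)) (u : U) : C u := by
  have key : ∀ d ≤ m, ∀ r, ∀ u ∈ deg d, C ((L ^ r) u) := by
    intro d
    induction d using Nat.strong_induction_on with
    | h d ih =>
      intro hd r u hu
      obtain ⟨p, hp', v, rfl, hv, hv0⟩ := h.exists_prim_add hd hu
      rw [map_add]
      refine hadd _ _ ?_ ?_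
      · rcases le_or_gt (r + d) m with hr | hr
        · exact hp d r hr p hp'
        · rw [h.pow_prim_eq_zero hd hr hp']
          exact h0
      · rcases Nat.lt_or_ge d 2 with h2 | h2
        · rw [hv0 h2, map_zero, map_zero]
          exact h0
        · obtain ⟨j, rfl⟩ := Nat.exists_eq_add_of_le' h2
          rw [← Module.End.mul_apply, ← pow_succ]
          exact ih j (by omega) (by omega) _ v (hv j rfl)
  rw [← h.sum_proj u]
  refine Finset.sum_induction _ C hadd h0 fun d hd => ?_
  have hd := Finset.mem_range.1 hd
  rcases le_or_gt d m with hdm | hdm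
  · exact key d hdm 0 _ (h.proj_mem d u)
  · obtain ⟨v, hv, hv'⟩ := h.surj (2 * m - d) (by omega) (pr d u) (by
      rw [show 2 * m - (2 * m - d) = d by omega]
      exact h.proj_mem d u)
    rw [← hv']
    exact key _ (by omega) _ v hv

theorem ext_prim (h : LefschetzModule m deg pr L) {A B : Module.End ℂ U}
    (hp : ∀ k r, r + k ≤ m → ∀ p ∈ prim m deg L k, A ((L ^ r) p) = B ((L ^ r) p)) : A = B :=
  LinearMap.ext fun u => h.induction_prim (C := fun u => A u = B u)
    (fun u v hu hv => by rw [map_add, map_add, hu, hv]) (by rw [map_zero, map_zero]) hp u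

theorem star_unique (h : LefschetzModule m deg pr L) {s' : Module.End ℂ U} (hs : IsStar m deg L s) (hs' : IsStar m deg L s') :
    s = s' := by
  refine h.ext_prim fun k r hr p hp => ?_
  rw [pow_eq, map_smul, map_smul, hs k r hr p hp, hs' k r hr p hp]

theorem star_star (h : LefschetzModule m deg pr L) (hs : IsStar m deg L s) (u : U) : s (s u) = u := by
  have : s ∘ₗ s = LinearMap.id := by
    refine h.ext_prim fun k r hr p hp => ?_
    rw [pow_eq, LinearMap.comp_apply, map_smul, map_smul, hs k r hr p hp, map_smul,
      hs k _ (by omega) p hp, smul_smul, smul_smul, mul_assoc, ← mul_pow, show m - (m - r - k) - k = r by omega]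
    simp
  exact LinearMap.congr_fun this u

/-- The index set of the Lefschetz decomposition. -/
theorem exists_star (h : LefschetzModule m deg pr L) : ∃ s, IsStar m deg L s := by
  classical
  let ι := {x : Fin (m + 1) × Fin (m + 1) // x.2.1 + x.1.1 ≤ m}
  let Φ : ((i : ι) → prim m deg L i.1.1) →ₗ[ℂ] U :=
    ∑ i : ι, (L ^ i.1.2.1) ∘ₗ (prim m deg L i.1.1).subtype ∘ₗ LinearMap.proj i
  have hΦ : ∀ p, Φ p = ∑ i : ι, (L ^ i.1.2.1) (p i : U) := fun p => by
    simp [Φ, LinearMap.sum_apply]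
  have hsingle : ∀ (i : ι) (p : prim m deg L i.1.1),
      Φ (Pi.single i p) = (L ^ i.1.2.1) (p : U) := by
    intro i p
    rw [hΦ, Finset.sum_eq_single i]
    · rw [Pi.single_eq_same]
    · intro j _ hj
      rw [Pi.single_eq_of_ne hj]
      exact map_zero _
    · simp
  have hinj : Function.Injective Φ := by
    rw [← LinearMap.ker_eq_bot, LinearMap.ker_eq_bot']
    intro p hp
    have key : ∀ k, ∀ i : ι, i.1.1.1 = k → p i = 0 := by
      intro k
      induction k using Nat.strong_induction_on with
      | h k ih =>
        rintro ⟨⟨k', r⟩, hi⟩ rfl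
        set i : ι := ⟨⟨k', r⟩, hi⟩ with hidef
        have hi' : r.1 + k'.1 ≤ m := hi
        have h1 : ∑ j : ι, (L ^ (m - k'.1 - r.1)) (pr (k'.1 + 2 * r.1) ((L ^ j.1.2.1) (p j : U))) = 0 := by
          rw [← map_sum, ← map_sum, ← hΦ, hp, map_zero, map_zero]
        rw [Finset.sum_eq_single i] at h1
        · rw [h.proj_self _ _ (h.pow_mem r.1 k'.1 (p i).2.1), ← Module.End.mul_apply, ← pow_add,
            show m - k'.1 - r.1 + r.1 = m - k'.1 by omega] at h1
          exact Subtype.ext (h.inj k'.1 (by omega) _ (p i).2.1 h1)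
        · intro j _ hj
          by_cases hdeg : j.1.1.1 + 2 * j.1.2.1 = k'.1 + 2 * r.1
          · rcases lt_trichotomy j.1.1.1 k'.1 with hlt | heq | hgt
            · rw [ih _ hlt j rfl]
              simp
            · exact absurd (Subtype.ext (Prod.ext (Fin.ext heq) (Fin.ext (by
                simp only [hidef]; omega)))) hj
            · rw [← hdeg, h.proj_self _ _ (h.pow_mem j.1.2.1 j.1.1.1 (p j).2.1),
                ← Module.End.mul_apply, ← pow_add]
              exact h.pow_prim_eq_zero (by omega) (by omega) (p j).2
          · rw [h.proj_of_ne _ _ (fun h => hdeg h.symm) _ (h.pow_mem j.1.2.1 j.1.1.1 (p j).2.1),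
              map_zero]
        · simp
    exact funext fun i => key _ i rfl
  have hsurj : Function.Surjective Φ := by
    intro u
    refine h.induction_prim (C := fun u => ∃ a, Φ a = u) ?_ ⟨0, map_zero _⟩ ?_ u
    · rintro _ _ ⟨a, rfl⟩ ⟨b, rfl⟩
      exact ⟨a + b, map_add _ _ _⟩
    · intro k r hr p hp
      exact ⟨_, hsingle ⟨⟨⟨k, by omega⟩, ⟨r, by omega⟩⟩, hr⟩ ⟨p, hp⟩⟩
  let Φe := LinearEquiv.ofBijective Φ ⟨hinj, hsurj⟩
  let Ψ : ((i : ι) → prim m deg L i.1.1) →ₗ[ℂ] U :=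
    ∑ i : ι, ((-1 : ℂ) ^ (∑ l ∈ Finset.range (i.1.1.1 + 1), l) * i.1.2.1.factorial) •
      (powDiv L (m - i.1.2.1 - i.1.1.1) ∘ₗ (prim m deg L i.1.1).subtype ∘ₗ LinearMap.proj i)
  have hΨ : ∀ (i : ι) (p : prim m deg L i.1.1), Ψ (Pi.single i p) =
      ((-1 : ℂ) ^ (∑ l ∈ Finset.range (i.1.1.1 + 1), l) * i.1.2.1.factorial) •
        powDiv L (m - i.1.2.1 - i.1.1.1) (p : U) := by
    intro i p
    simp only [Ψ, LinearMap.sum_apply, LinearMap.smul_apply, LinearMap.comp_apply,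
      LinearMap.proj_apply, Submodule.subtype_apply]
    rw [Finset.sum_eq_single i]
    · rw [Pi.single_eq_same]
    · intro j _ hj
      rw [Pi.single_eq_of_ne hj, ZeroMemClass.coe_zero, map_zero, smul_zero]
    · simp
  refine ⟨Ψ ∘ₗ Φe.symm.toLinearMap, fun k r hr p hp => ?_⟩
  have h1 := hsingle ⟨⟨⟨k, by omega⟩, ⟨r, by omega⟩⟩, hr⟩ ⟨p, hp⟩
  have h2 := hΨ ⟨⟨⟨k, by omega⟩, ⟨r, by omega⟩⟩, hr⟩ ⟨p, hp⟩
  have h3 : Φe.symm ((L ^ r) p) = Pi.single ⟨⟨⟨k, by omega⟩, ⟨r, by omega⟩⟩, hr⟩ ⟨p, hp⟩ := by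
    rw [LinearEquiv.symm_apply_eq]
    exact h1.symm
  rw [powDiv_apply, map_smul, LinearMap.comp_apply, LinearEquiv.coe_coe, h3, h2, smul_smul]
  congr 1
  have : (r.factorial : ℂ) ≠ 0 := Nat.cast_ne_zero.2 r.factorial_ne_zero
  field_simp

theorem star_mem (h : LefschetzModule m deg pr L) (hs : IsStar m deg L s) {d : ℕ} (hd : d ≤ 2 * m) {u : U} (hu : u ∈ deg d) :
    s u ∈ deg (2 * m - d) := by
  have key : ∀ u : U, s (pr d u) = pr (2 * m - d) (s u) := by
    refine LinearMap.congr_fun (f := s ∘ₗ pr d) (g := pr (2 * m - d) ∘ₗ s) ?_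
    refine h.ext_prim fun k r hr p hp => ?_
    rw [LinearMap.comp_apply, LinearMap.comp_apply]
    by_cases hdk : k + 2 * r = d
    · rw [h.proj_self d _ (hdk ▸ h.pow_mem r k hp.1), pow_eq, map_smul, map_smul, hs k r hr p hp,
        map_smul, powDiv_apply, map_smul, h.proj_self]
      have := h.pow_mem (m - r - k) k hp.1
      rwa [show k + 2 * (m - r - k) = 2 * m - d by omega] at this
    · rw [h.proj_of_ne d (k + 2 * r) (fun h => hdk h.symm) _ (h.pow_mem r k hp.1), map_zero, pow_eq,
        map_smul, map_smul, hs k r hr p hp, map_smul, powDiv_apply, map_smul,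
        h.proj_of_ne _ (k + 2 * (m - r - k)) (by omega) _ (h.pow_mem _ k hp.1)]
      simp
  rw [← h.proj_self d u hu, key]
  exact h.proj_mem _ _

theorem star_comm (h : LefschetzModule m deg pr L) (hs : IsStar m deg L s) {J : Module.End ℂ U} (hJ : ∀ d, ∀ u ∈ deg d, J u ∈ deg d)
    (hJL : ∀ u, J (L u) = L (J u)) (u : U) : s (J u) = J (s u) := by
  have hpow : ∀ r u, J ((L ^ r) u) = (L ^ r) (J u) := by
    intro r
    induction r with
    | zero => intro u; rfl
    | succ r ih => intro u; rw [pow_succ', Module.End.mul_apply, hJL, ih, Module.End.mul_apply]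
  have hdiv : ∀ r u, J (powDiv L r u) = powDiv L r (J u) := by
    intro r u
    rw [powDiv_apply, map_smul, hpow, powDiv_apply]
  refine LinearMap.congr_fun (f := s ∘ₗ J) (g := J ∘ₗ s) (h.ext_prim fun k r hr p hp => ?_) u
  have hJp : J p ∈ prim m deg L k := ⟨hJ k p hp.1, by
    rw [SetLike.mem_coe, LinearMap.mem_ker, ← hpow, LinearMap.mem_ker.1 hp.2, map_zero]⟩
  rw [LinearMap.comp_apply, LinearMap.comp_apply, pow_eq, map_smul, map_smul, map_smul, map_smul,
    hs k r hr p hp, map_smul, hdiv, hs k r hr _ hJp, hdiv]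

/-- `L_{r-1}`, with the convention `L_{-1} = 0`. -/
def powDivPred (L : Module.End ℂ U) : ℕ → Module.End ℂ U
  | 0 => 0
  | r + 1 => powDiv L r

theorem powDiv_eq_zero (h : LefschetzModule m deg pr L) {k r : ℕ} (hk : k ≤ m) (hr : m < r + k) {u : U} (hu : u ∈ prim m deg L k) :
    powDiv L r u = 0 := by
  rw [powDiv_apply, h.pow_prim_eq_zero hk hr hu, smul_zero]

theorem lam_powDiv (h : LefschetzModule m deg pr L) (hs : IsStar m deg L s) {k r : ℕ} (hk : k ≤ m) (hr : r + k ≤ m + 1) {p : U}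
    (hp : p ∈ prim m deg L k) :
    s (L (s (powDiv L r p))) = ((m : ℂ) + 1 - r - k) • powDivPred L r p := by
  rcases hr.eq_or_lt with hr' | hr'
  · rw [h.powDiv_eq_zero (by omega) (by omega) hp, map_zero, map_zero, map_zero]
    have : (m : ℂ) + 1 - r - k = 0 := by
      rw [sub_sub, ← Nat.cast_add, hr']
      push_cast
      ring
    rw [this, zero_smul]
  · obtain ⟨q, hq⟩ : ∃ q, m = q + r + k := ⟨m - r - k, by omega⟩
    have hcast : (m : ℂ) + 1 - r - k = q + 1 := by rw [hq]; push_cast; ring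
    rw [hs k r (by omega) p hp, map_smul, map_smul, show m - r - k = q by omega, powDiv_succ,
      map_smul, hcast]
    rcases r with _ | r
    · rw [h.powDiv_eq_zero (by omega) (by omega) hp, map_zero, smul_zero, smul_zero]
      simp [powDivPred]
    · rw [hs k (q + 1) (by omega) p hp, smul_comm ((q : ℂ) + 1), smul_smul, ← mul_pow,
        show m - (q + 1) - k = r by omega]
      simp [powDivPred]

theorem exists_decomp (h : LefschetzModule m deg pr L) {D : Module.End ℂ U} (hD : ∀ d, ∀ u ∈ deg d, D u ∈ deg (d + 1))
    (hDL : ∀ u, D (L u) = L (D u)) {k : ℕ} (hk : k ≤ m) {p : U} (hp : p ∈ prim m deg L k) :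
    ∃ a b, D p = a + L b ∧ (k + 1 ≤ m → a ∈ prim m deg L (k + 1)) ∧ (m < k + 1 → a = 0) ∧
      (∀ j, k = j + 1 → b ∈ prim m deg L j) ∧ (k = 0 → b = 0) := by
  have hpow : ∀ r u, D ((L ^ r) u) = (L ^ r) (D u) := by
    intro r
    induction r with
    | zero => intro u; rfl
    | succ r ih => intro u; rw [pow_succ', Module.End.mul_apply, hDL, ih, Module.End.mul_apply]
  have hDp : (L ^ (m - k + 1)) (D p) = 0 := by
    rw [← hpow, LinearMap.mem_ker.1 hp.2, map_zero]
  rcases Nat.lt_or_ge m (k + 1) with hlt | hge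
  · obtain rfl : k = m := by omega
    rcases k with _ | j
    · exact ⟨0, 0, by rw [h.eq_zero_of_lt (by omega) (hD _ _ hp.1)]; simp, fun h => by omega,
        fun _ => rfl, fun j hj => by omega, fun _ => rfl⟩
    · obtain ⟨v, hv, hv'⟩ := h.surj j (by omega) (D p) (by
        have := hD _ _ hp.1
        rwa [show j + 1 + 1 = 2 * (j + 1) - j by omega] at this)
      rw [show j + 1 - j = 1 by omega, pow_one] at hv'
      refine ⟨0, v, by rw [hv', zero_add], fun h => by omega, fun _ => rfl, fun i hi => ?_,
        fun h => by omega⟩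
      obtain rfl : j = i := by omega
      refine ⟨hv, ?_⟩
      rw [← hv', ← Module.End.mul_apply, ← pow_succ] at hDp
      rw [SetLike.mem_coe, LinearMap.mem_ker, ← hDp]
      congr 2
      omega
  · obtain ⟨a, ha, v, hav, hv, hv0⟩ := h.exists_prim_add hge (hD _ _ hp.1)
    refine ⟨a, v, hav, fun _ => ha, fun h => by omega, fun j hj => ?_, fun h => hv0 (by omega)⟩
    subst hj
    refine ⟨hv j rfl, ?_⟩
    rw [hav, map_add, h.pow_prim_eq_zero (by omega) (by omega) ha, zero_add, ← Module.End.mul_apply,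
      ← pow_succ] at hDp
    rw [SetLike.mem_coe, LinearMap.mem_ker, ← hDp]
    congr 2
    omega

theorem sign_mul_succ (k : ℕ) : (-1 : ℂ) ^ (∑ i ∈ Finset.range (k + 1), i) *
    (-1) ^ (∑ i ∈ Finset.range (k + 1 + 1), i) = (-1) ^ (k + 1) := by
  rw [Finset.sum_range_succ _ (k + 1), pow_add, ← mul_assoc, ← mul_pow]
  simp

/-- The abstract Kähler identity: if `D` has degree `1` and commutes with `L`, then
`s D s = (-1)ᵈ [Λ, D]` on elements of degree `d`. -/
theorem star_conj (h : LefschetzModule m deg pr L) (hs : IsStar m deg L s) {D : Module.End ℂ U}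
    (hD : ∀ d, ∀ u ∈ deg d, D u ∈ deg (d + 1)) (hDL : ∀ u, D (L u) = L (D u)) {d : ℕ} {u : U}
    (hu : u ∈ deg d) :
    s (D (s u)) = (-1 : ℂ) ^ d • (s (L (s (D u))) - D (s (L (s u)))) := by
  have hpow : ∀ r u, D (powDiv L r u) = powDiv L r (D u) := by
    have : ∀ r u, D ((L ^ r) u) = (L ^ r) (D u) := by
      intro r
      induction r with
      | zero => intro u; rfl
      | succ r ih => intro u; rw [pow_succ', Module.End.mul_apply, hDL, ih, Module.End.mul_apply]
    intro r u
    rw [powDiv_apply, map_smul, this, powDiv_apply]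
  have hpred : ∀ r u, D (powDivPred L r u) = powDivPred L r (D u) := by
    intro r u
    cases r with
    | zero => simp [powDivPred]
    | succ r => exact hpow r u
  have hpredL : ∀ r u, powDivPred L r (L u) = (r : ℂ) • powDiv L r u := by
    intro r u
    cases r with
    | zero => simp [powDivPred]
    | succ r =>
      rw [powDivPred, powDiv_L]
      push_cast
      rfl
  have key : ∀ k r, r + k ≤ m → ∀ p ∈ prim m deg L k, s (D (s (powDiv L r p))) =
      (-1 : ℂ) ^ k • (s (L (s (D (powDiv L r p)))) - D (s (L (s (powDiv L r p))))) := by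
    intro k r hr p hp
    obtain ⟨a, b, hab, ha, ha0, hb, hb0⟩ := h.exists_decomp hD hDL (by omega) hp
    obtain ⟨q, hq⟩ : ∃ q, m = q + r + k := ⟨m - r - k, by omega⟩
    have hcast : (m : ℂ) = q + r + k := by rw [hq]; push_cast; ring
    have hLa : s (powDiv L q a) = (-1 : ℂ) ^ (∑ i ∈ Finset.range (k + 1 + 1), i) •
        powDivPred L r a := by
      rcases Nat.lt_or_ge m (k + 1) with hlt | hge
      · rw [ha0 hlt]
        simp
      · rcases r with _ | r
        · rw [h.powDiv_eq_zero (by omega) (by omega) (ha hge), map_zero]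
          simp [powDivPred]
        · rw [hs (k + 1) q (by omega) a (ha hge), show m - q - (k + 1) = r by omega, powDivPred]
    have hΛa : s (L (s (powDiv L r a))) = (q : ℂ) • powDivPred L r a := by
      rcases Nat.lt_or_ge m (k + 1) with hlt | hge
      · rw [ha0 hlt]
        simp
      · rw [h.lam_powDiv hs (by omega) (by omega) (ha hge), hcast]
        congr 1
        push_cast
        ring
    have hLb : (-1 : ℂ) ^ (∑ i ∈ Finset.range (k + 1), i) • s (powDiv L (q + 1) b) =
        (-1 : ℂ) ^ k • powDiv L r b := by
      rcases k with _ | j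
      · rw [hb0 rfl]
        simp
      · rw [hs j (q + 1) (by omega) b (hb j rfl), smul_smul, mul_comm, sign_mul_succ,
          show m - (q + 1) - j = r by omega]
    have hΛb : s (L (s (powDiv L (r + 1) b))) = ((q : ℂ) + 1) • powDiv L r b := by
      rcases k with _ | j
      · rw [hb0 rfl]
        simp
      · rw [h.lam_powDiv hs (by omega) (by omega) (hb j rfl), hcast, powDivPred]
        congr 1
        push_cast
        ring
    rw [h.lam_powDiv hs (by omega) (by omega) hp, hs k r hr p hp, show m - r - k = q by omega,
      map_smul, map_smul, hpow, hab, map_add, map_add, powDiv_L, map_smul, smul_add, smul_comm _ ((q : ℂ) + 1), hLb, hLa, smul_smul, sign_mul_succ,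
      hpow, hab, map_add, powDiv_L, map_add, map_add, map_add, hΛa, map_smul, map_smul, map_smul, hΛb,
      map_smul, hpred, hab, map_add, hpredL, hcast, pow_succ]
    module
  have hgen : ∀ u, s (D (s (pr d u))) =
      (-1 : ℂ) ^ d • (s (L (s (D (pr d u)))) - D (s (L (s (pr d u))))) := by
    refine h.induction_prim (fun u v hu hv => ?_) ?_ fun k r hr p hp => ?_
    · simp only [map_add, hu, hv, ← smul_add]
      congr 1
      abel
    · simp
    · by_cases hdk : k + 2 * r = d
      · rw [h.proj_self d _ (hdk ▸ h.pow_mem r k hp.1), pow_eq]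
        simp only [map_smul]
        rw [key k r hr p hp, ← smul_sub, smul_comm, ← hdk, pow_add, pow_mul]
        simp
      · rw [h.proj_of_ne d (k + 2 * r) (fun h => hdk h.symm) _ (h.pow_mem r k hp.1)]
        simp
  have := hgen u
  rwa [h.proj_self d u hu] at this

end LefschetzModule

end Abstract


section FibreLefschetz

variable {W : Type u} [AddCommGroup W] [Module ℂ W]

/-- The inclusion of the real numbers in the complex numbers. -/
def ofRealₗ : ℝ →ₗ[ℝ] ℂ := Complex.ofRealLI.toLinearMap

/-- The exterior product of a list of real two-forms, as a complex form. -/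
def bigT (l : List (W [⋀^Fin 2]→ₗ[ℝ] ℝ)) : GForm W ℂ :=
  (l.map ofTwoForm).foldr (wedge (smulBilin ℂ)) (oneForm W)

theorem ofTwoForm_eq (a : W [⋀^Fin 2]→ₗ[ℝ] ℝ) : ofTwoForm a = mapV ofRealₗ (two a) := by
  refine (IsDeg.single 2 _).ext ((isDeg_two a).mapV _) ?_
  ext v
  simp [ofTwoForm, two, ofRealₗ]

theorem oneForm_eq : oneForm W = mapV ofRealₗ (1 : GForm W ℝ) := by
  refine (IsDeg.single 0 _).ext ((isDeg_const (1 : ℝ)).mapV _) ?_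
  ext v
  simp [oneForm, one_def, const, ofRealₗ]

theorem bigT_eq (l : List (W [⋀^Fin 2]→ₗ[ℝ] ℝ)) : bigT l = mapV ofRealₗ (prodTwo l) := by
  induction l with
  | nil => exact oneForm_eq
  | cons a l ih =>
    rw [prodTwo_cons, mul_def, mapV_wedge (B' := smulBilin ℂ) (f := ofRealₗ) (f' := ofRealₗ), ← ih,
      ← ofTwoForm_eq]
    · rfl
    · intro x y
      simp [ofRealₗ, smulBilin]

theorem isDeg_bigT (l : List (W [⋀^Fin 2]→ₗ[ℝ] ℝ)) : IsDeg (2 * l.length) (bigT l) := by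
  rw [bigT_eq]
  exact (isDeg_prodTwo l).mapV _

variable {N : Type*} [AddCommGroup N] [Module ℂ N]

theorem smulBilin_apply (c : ℂ) (s : N) : smulBilin N c s = c • s := rfl

theorem wedge_bigT (l : List (W [⋀^Fin 2]→ₗ[ℝ] ℝ)) (u : GForm W N) :
    wedge (smulBilin N) (bigT l) u = wedge (LinearMap.lsmul ℝ N) (prodTwo l) u := by
  have h := mapV_wedge (B := LinearMap.lsmul ℝ N) (B' := smulBilin N) (g := LinearMap.id)
    (f := ofRealₗ) (f' := LinearMap.id) (fun x y => by simp [ofRealₗ, smulBilin]) (prodTwo l) u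
  rw [bigT_eq]
  exact h.symm

theorem mapV_wedge_bigT (l : List (W [⋀^Fin 2]→ₗ[ℝ] ℝ)) (u : GForm W N) (φ : N →ₗ[ℝ] ℝ) :
    mapV φ (wedge (smulBilin N) (bigT l) u) = prodTwo l * mapV φ u := by
  rw [wedge_bigT, mul_def]
  have h := mapV_wedge (B := LinearMap.lsmul ℝ N) (B' := LinearMap.mul ℝ ℝ) (g := φ)
    (f := LinearMap.id) (f' := φ) (fun x y => by simp) (prodTwo l) u
  exact h

theorem eq_zero_of_mapV {u : GForm W N} (h : ∀ φ : N →ₗ[ℝ] ℝ, mapV φ u = 0) : u = 0 := by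
  funext k
  ext v
  refine (Module.forall_dual_apply_eq_zero_iff ℝ (u k v)).1 fun φ => ?_
  exact DFunLike.congr_fun (congrFun (h φ) k) v

/-- The mixed hard Lefschetz theorem for vector valued forms: injectivity. -/
theorem eq_zero_of_wedge_bigT [FiniteDimensional ℂ W] {n : ℕ} (hn : Module.finrank ℂ W = n)
    {l : List (W [⋀^Fin 2]→ₗ[ℝ] ℝ)} (hl : ∀ b ∈ l, IsPos b) {k : ℕ} (hk : l.length + k = n)
    {u : GForm W N} (hu : IsDeg k u) (h : wedge (smulBilin N) (bigT l) u = 0) : u = 0 :=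
  eq_zero_of_mapV fun φ => hardLefschetz n W (Module.finBasisOfFinrankEq ℂ W hn) l k _ hl hk
    (hu.mapV φ) (by rw [← mapV_wedge_bigT, h, map_zero])

/-- Exterior multiplication by a form of degree `q`, from degree `k` to degree `q + k`. -/
def wedgeDeg (N : Type*) [AddCommGroup N] [Module ℂ N] (q k : ℕ) (t : W [⋀^Fin q]→ₗ[ℝ] ℂ) :
    (W [⋀^Fin k]→ₗ[ℝ] N) →ₗ[ℝ] W [⋀^Fin (q + k)]→ₗ[ℝ] N :=
  (LinearMap.proj (q + k) : GForm W N →ₗ[ℝ] W [⋀^Fin (q + k)]→ₗ[ℝ] N) ∘ₗ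
    wedgeL (smulBilin N) (Pi.single q t) ∘ₗ LinearMap.single ℝ (fun k => W [⋀^Fin k]→ₗ[ℝ] N) k

theorem wedgeDeg_apply (q k : ℕ) (t : W [⋀^Fin q]→ₗ[ℝ] ℂ) (u : W [⋀^Fin k]→ₗ[ℝ] N) :
    wedgeDeg N q k t u
      = wedge (smulBilin N) (Pi.single q t : GForm W ℂ) (Pi.single k u : GForm W N) (q + k) := rfl

theorem single_wedgeDeg {q k : ℕ} {t : GForm W ℂ} {u : GForm W N} (ht : IsDeg q t)
    (hu : IsDeg k u) : wedge (smulBilin N) t u = Pi.single (q + k) (wedgeDeg N q k (t q) (u k)) := by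
  rw [wedgeDeg_apply, ← ht.eq_single, ← hu.eq_single]
  exact (ht.wedge hu _).eq_single

/-- The mixed hard Lefschetz theorem for vector valued forms: bijectivity. -/
theorem bijective_wedgeDeg_bigT [FiniteDimensional ℂ W] [FiniteDimensional ℂ N] {n : ℕ}
    (hn : Module.finrank ℂ W = n) {l : List (W [⋀^Fin 2]→ₗ[ℝ] ℝ)} (hl : ∀ b ∈ l, IsPos b) {k : ℕ}
    (hk : l.length + k = n) :
    Function.Bijective (wedgeDeg N (2 * l.length) k (bigT l (2 * l.length))) := by
  haveI : Module.Finite ℝ W := finite_real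
  haveI : Module.Finite ℝ N := finite_real
  have hinj : Function.Injective (wedgeDeg N (2 * l.length) k (bigT l (2 * l.length))) := by
    rw [← LinearMap.ker_eq_bot, LinearMap.ker_eq_bot']
    intro u hu
    have h1 : (Pi.single k u : GForm W N) = 0 := by
      refine eq_zero_of_wedge_bigT hn hl hk (IsDeg.single k u) ?_
      rw [single_wedgeDeg (isDeg_bigT l) (IsDeg.single k u), Pi.single_eq_same, hu, Pi.single_zero]
    have := congrFun h1 k
    rwa [Pi.single_eq_same] at this
  refine ⟨hinj, (LinearMap.injective_iff_surjective_of_finrank_eq_finrank ?_).1 hinj⟩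
  rw [finrank_alternatingMap, finrank_alternatingMap]
  congr 1
  have : Module.finrank ℝ W = 2 * n := by rw [← hn, finrank_real_of_complex]
  rw [this, ← Nat.choose_symm_of_eq_add]
  omega

theorem exists_wedge_bigT_eq [FiniteDimensional ℂ W] [FiniteDimensional ℂ N] {n : ℕ}
    (hn : Module.finrank ℂ W = n) {l : List (W [⋀^Fin 2]→ₗ[ℝ] ℝ)} (hl : ∀ b ∈ l, IsPos b) {k : ℕ}
    (hk : l.length + k = n) {w : GForm W N} (hw : IsDeg (2 * l.length + k) w) :
    ∃ u, IsDeg k u ∧ wedge (smulBilin N) (bigT l) u = w := by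
  obtain ⟨u, hu⟩ := (bijective_wedgeDeg_bigT (N := N) hn hl hk).2 (w (2 * l.length + k))
  refine ⟨Pi.single k u, IsDeg.single k u, ?_⟩
  rw [single_wedgeDeg (isDeg_bigT l) (IsDeg.single k u), Pi.single_eq_same, hu]
  exact hw.eq_single.symm

theorem pull_bigT {W' : Type*} [AddCommGroup W'] [Module ℂ W'] (f : W' →ₗ[ℝ] W)
    (l : List (W [⋀^Fin 2]→ₗ[ℝ] ℝ)) :
    pull f (bigT l) = bigT (l.map fun a => a.compLinearMap f) := by
  rw [bigT_eq, pull_mapV, pull_prodTwo, bigT_eq]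

theorem jf_bigT {l : List (W [⋀^Fin 2]→ₗ[ℝ] ℝ)} (hl : ∀ b ∈ l, IsPos b) :
    jf (bigT l) = bigT l := by
  rw [bigT_eq, jf, pull_mapV]
  exact congrArg _ (jf_prodTwo hl)

theorem sgn_bigT (l : List (W [⋀^Fin 2]→ₗ[ℝ] ℝ)) : sgn (bigT l) = bigT l := by
  rw [(isDeg_bigT l).sgn_eq]; simp

theorem wedge_smul_assoc (a b : GForm W ℂ) (u : GForm W N) :
    wedge (smulBilin N) a (wedge (smulBilin N) b u)
      = wedge (smulBilin N) (wedge (smulBilin ℂ) a b) u :=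
  wedge_assoc (fun x y z => by simp [smulBilin, mul_smul]) a b u

theorem bigT_cons (a : W [⋀^Fin 2]→ₗ[ℝ] ℝ) (l : List (W [⋀^Fin 2]→ₗ[ℝ] ℝ)) :
    bigT (a :: l) = wedge (smulBilin ℂ) (ofTwoForm a) (bigT l) := rfl

theorem wedge_bigT_cons (a : W [⋀^Fin 2]→ₗ[ℝ] ℝ) (l : List (W [⋀^Fin 2]→ₗ[ℝ] ℝ))
    (u : GForm W N) : wedge (smulBilin N) (bigT (a :: l)) u
      = wedge (smulBilin N) (ofTwoForm a) (wedge (smulBilin N) (bigT l) u) :=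
  (wedge_smul_assoc _ _ _).symm

theorem wedge_smul_comm {a : GForm W ℂ} (b : GForm W ℂ) (ha : sgn a = a) (u : GForm W N) :
    wedge (smulBilin N) a (wedge (smulBilin N) b u)
      = wedge (smulBilin N) b (wedge (smulBilin N) a u) := by
  rw [wedge_smul_assoc, wedge_smul_assoc, wedge_comm_of_even _ b ha]
  congr 2
  exact LinearMap.ext fun x => LinearMap.ext fun y => mul_comm x y

end FibreLefschetz

section Calculus

variable {W : Type*} [NormedAddCommGroup W] [NormedSpace ℂ W] [FiniteDimensional ℂ W]
  {G G₁ G₂ G₃ : Type*} [NormedAddCommGroup G] [NormedSpace ℂ G] [FiniteDimensional ℂ G]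
  [NormedAddCommGroup G₁] [NormedSpace ℂ G₁] [FiniteDimensional ℂ G₁]
  [NormedAddCommGroup G₂] [NormedSpace ℂ G₂] [FiniteDimensional ℂ G₂]
  [NormedAddCommGroup G₃] [NormedSpace ℂ G₃] [FiniteDimensional ℂ G₃]

/-- `toCont` as a linear equivalence. -/
def toContₗ (W G : Type*) [NormedAddCommGroup W] [NormedSpace ℂ W] [FiniteDimensional ℂ W]
    [NormedAddCommGroup G] [NormedSpace ℂ G] (k : ℕ) :
    (W [⋀^Fin k]→ₗ[ℝ] G) ≃ₗ[ℝ] W [⋀^Fin k]→L[ℝ] G where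
  toFun := toCont
  invFun a := a.toAlternatingMap
  map_add' _ _ := rfl
  map_smul' _ _ := rfl
  left_inv _ := rfl
  right_inv _ := rfl

@[simp] theorem toCont_apply {k : ℕ} (a : W [⋀^Fin k]→ₗ[ℝ] G) (w : Fin k → W) :
    toCont a w = a w := rfl

instance finite_continuousAlternatingMap (k : ℕ) : Module.Finite ℝ (W [⋀^Fin k]→L[ℝ] G) :=
  haveI : Module.Finite ℝ W := finite_real
  haveI : Module.Finite ℝ G := finite_real
  Module.Finite.equiv (toContₗ W G k)

theorem contDiffAt_toCont {k : ℕ} {E : Type*} [NormedAddCommGroup E] [NormedSpace ℝ E]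
    {N : WithTop ℕ∞} {a : E → W [⋀^Fin k]→ₗ[ℝ] G} {y : E}
    (h : ∀ w, ContDiffAt ℝ N (fun z => a z w) y) : ContDiffAt ℝ N (fun z => toCont (a z)) y := by
  let b := Module.finBasis ℝ W
  let ev : (W [⋀^Fin k]→L[ℝ] G) →ₗ[ℝ] (Fin k → Fin (Module.finrank ℝ W)) → G :=
    { toFun := fun a r => a fun i => b (r i)
      map_add' := fun _ _ => rfl
      map_smul' := fun _ _ => rfl }
  have hinj : LinearMap.ker ev = ⊥ := by
    rw [LinearMap.ker_eq_bot']
    intro a ha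
    refine ContinuousAlternatingMap.toAlternatingMap_injective (Module.Basis.ext_alternating b fun r _ => ?_)
    exact congrFun ha r
  obtain ⟨g, hg⟩ := ev.exists_leftInverse_of_injective hinj
  have h1 : (fun z => toCont (a z)) = fun z => g fun r => a z fun i => b (r i) := by
    funext z
    exact (LinearMap.congr_fun hg (toCont (a z))).symm
  rw [h1]
  exact g.toContinuousLinearMap.contDiff.contDiffAt.comp y (contDiffAt_pi.2 fun r => h _)

/-- Smoothness of a family of forms at a point. -/
def SmoothAt (a : W → GForm W G) (y : W) : Prop :=
  ∀ k, ContDiffAt ℝ ∞ (fun z => toCont (a z k)) y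

theorem SmoothAt.eval {a : W → GForm W G} {y : W} (h : SmoothAt a y) (k : ℕ) (w : Fin k → W) :
    ContDiffAt ℝ ∞ (fun z => a z k w) y := by
  let ev : (W [⋀^Fin k]→L[ℝ] G) →ₗ[ℝ] G :=
    { toFun := fun a => a w
      map_add' := fun _ _ => rfl
      map_smul' := fun _ _ => rfl }
  exact ev.toContinuousLinearMap.contDiff.contDiffAt.comp y (h k)

theorem smoothAt_of_eval {a : W → GForm W G} {y : W}
    (h : ∀ k (w : Fin k → W), ContDiffAt ℝ ∞ (fun z => a z k w) y) : SmoothAt a y :=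
  fun k => contDiffAt_toCont (h k)

theorem SmoothAt.congr {a b : W → GForm W G} {y : W} (h : SmoothAt a y) (hab : b =ᶠ[nhds y] a) :
    SmoothAt b y := fun k =>
  (h k).congr_of_eventuallyEq (hab.fun_comp fun u => toCont (u k))

/-- The directional derivatives of a family of forms. -/
def dirDeriv (a : W → GForm W G) (y : W) : W →ₗ[ℝ] GForm W G where
  toFun v := fun k => (fderiv ℝ (fun z => toCont (a z k)) y v).toAlternatingMap
  map_add' v v' := by
    funext k
    rw [map_add]
    rfl
  map_smul' r v := by
    funext k
    rw [map_smul]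
    rfl

theorem dirDeriv_def (a : W → GForm W G) (y v : W) (k : ℕ) :
    dirDeriv a y v k = (fderiv ℝ (fun z => toCont (a z k)) y v).toAlternatingMap := rfl

theorem toCont_dirDeriv (a : W → GForm W G) (y v : W) (k : ℕ) :
    toCont (dirDeriv a y v k) = fderiv ℝ (fun z => toCont (a z k)) y v := rfl

theorem dirDeriv_apply {a : W → GForm W G} {y : W} (h : SmoothAt a y) (v : W) (k : ℕ)
    (w : Fin k → W) : dirDeriv a y v k w = fderiv ℝ (fun z => a z k w) y v :=
  (fderiv_continuousAlternatingMap_apply_const_apply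
    ((h k).differentiableAt (by simp)) w v).symm

theorem dirDeriv_congr {a b : W → GForm W G} {y : W} (hab : a =ᶠ[nhds y] b) :
    dirDeriv a y = dirDeriv b y := by
  ext1 v
  funext k
  have h : (fun z => toCont (a z k)) =ᶠ[nhds y] fun z => toCont (b z k) := hab.mono fun z hz => by
    simp only [hz]
  rw [dirDeriv_def, dirDeriv_def, h.fderiv_eq]

theorem SmoothAt.mapV {a : W → GForm W G₁} {y : W} (h : SmoothAt a y) (g : G₁ →ₗ[ℝ] G₂) :
    SmoothAt (fun z => mapV g (a z)) y :=
  smoothAt_of_eval fun k w => g.toContinuousLinearMap.contDiff.contDiffAt.comp y (h.eval k w)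

theorem dirDeriv_mapV {a : W → GForm W G₁} {y : W} (h : SmoothAt a y) (g : G₁ →ₗ[ℝ] G₂) :
    dirDeriv (fun z => mapV g (a z)) y = mapV g ∘ₗ dirDeriv a y := by
  ext v k w
  rw [dirDeriv_apply (h.mapV g), LinearMap.comp_apply, mapV_apply, dirDeriv_apply h]
  have h1 := g.toContinuousLinearMap.hasFDerivAt.comp y
    ((h.eval k w).differentiableAt (by simp)).hasFDerivAt
  exact DFunLike.congr_fun h1.fderiv v

theorem SmoothAt.pullConst {a : W → GForm W G} {y : W} (h : SmoothAt a y) (f : W →ₗ[ℝ] W) :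
    SmoothAt (fun z => pull f (a z)) y :=
  smoothAt_of_eval fun k w => h.eval k fun i => f (w i)

theorem dirDeriv_pullConst {a : W → GForm W G} {y : W} (h : SmoothAt a y) (f : W →ₗ[ℝ] W) :
    dirDeriv (fun z => pull f (a z)) y = pull f ∘ₗ dirDeriv a y := by
  ext v k w
  rw [dirDeriv_apply (h.pullConst f), LinearMap.comp_apply, pull_apply, dirDeriv_apply h]
  rfl

theorem SmoothAt.add {a b : W → GForm W G} {y : W} (h : SmoothAt a y) (h' : SmoothAt b y) :
    SmoothAt (fun z => a z + b z) y :=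
  smoothAt_of_eval fun k w => (h.eval k w).add (h'.eval k w)

theorem dirDeriv_add {a b : W → GForm W G} {y : W} (h : SmoothAt a y) (h' : SmoothAt b y) :
    dirDeriv (fun z => a z + b z) y = dirDeriv a y + dirDeriv b y := by
  ext v k w
  rw [dirDeriv_apply (h.add h'), LinearMap.add_apply, Pi.add_apply, AlternatingMap.add_apply,
    dirDeriv_apply h, dirDeriv_apply h']
  exact DFunLike.congr_fun (fderiv_add ((h.eval k w).differentiableAt (by simp))
    ((h'.eval k w).differentiableAt (by simp))) v

theorem SmoothAt.sgn {a : W → GForm W G} {y : W} (h : SmoothAt a y) :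
    SmoothAt (fun z => sgn (a z)) y :=
  smoothAt_of_eval fun k w => (h.eval k w).const_smul ((-1 : ℝ) ^ k)

/-- The components of degree at most `k`. -/
def truncG (k : ℕ) (u : GForm W G) : (j : Fin (k + 1)) → W [⋀^Fin j]→L[ℝ] G :=
  fun j => toCont (u j)

/-- The form with given components of degree at most `k`. -/
def extendG (W G : Type*) [NormedAddCommGroup W] [NormedSpace ℂ W]
    [NormedAddCommGroup G] [NormedSpace ℂ G] (k : ℕ) :
    ((j : Fin (k + 1)) → W [⋀^Fin j]→L[ℝ] G) →ₗ[ℝ] GForm W G where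
  toFun x := fun j => if h : j < k + 1 then (x ⟨j, h⟩).toAlternatingMap else 0
  map_add' x y := by
    funext j
    by_cases h : j < k + 1
    · simp only [Pi.add_apply, dif_pos h]
      rfl
    · simp only [Pi.add_apply, dif_neg h, add_zero]
  map_smul' r x := by
    funext j
    by_cases h : j < k + 1
    · simp only [Pi.smul_apply, dif_pos h]
      rfl
    · simp only [Pi.smul_apply, dif_neg h, smul_zero]

theorem extendG_truncG (k : ℕ) (u : GForm W G) {j : ℕ} (hj : j ≤ k) :
    extendG W G k (truncG k u) j = u j := by
  have : j < k + 1 := by omega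
  simp only [extendG, LinearMap.coe_mk, AddHom.coe_mk, this, dif_pos]
  rfl

/-- The degree `k` part of the exterior product as a continuous bilinear map. -/
def wedgeTrunc (W : Type*) [NormedAddCommGroup W] [NormedSpace ℂ W] [FiniteDimensional ℂ W]
    (B : G₁ →ₗ[ℝ] G₂ →ₗ[ℝ] G₃) (k : ℕ) :
    ((j : Fin (k + 1)) → W [⋀^Fin j]→L[ℝ] G₁) →L[ℝ]
      ((j : Fin (k + 1)) → W [⋀^Fin j]→L[ℝ] G₂) →L[ℝ] W [⋀^Fin k]→L[ℝ] G₃ :=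
  (LinearMap.toContinuousLinearMap.toLinearMap ∘ₗ
    (((wedgeL B).compl₁₂ (extendG W G₁ k) (extendG W G₂ k)).compr₂
      ((toContₗ W G₃ k).toLinearMap ∘ₗ
        (LinearMap.proj k : GForm W G₃ →ₗ[ℝ] W [⋀^Fin k]→ₗ[ℝ] G₃)))).toContinuousLinearMap

theorem wedgeTrunc_apply (B : G₁ →ₗ[ℝ] G₂ →ₗ[ℝ] G₃) (k : ℕ) (a : GForm W G₁) (b : GForm W G₂) :
    wedgeTrunc W B k (truncG k a) (truncG k b) = toCont (wedge B a b k) :=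
  congrArg toCont (wedge_congr_deg B (fun _ hj => extendG_truncG k a hj)
    fun _ hj => extendG_truncG k b hj)

theorem SmoothAt.truncG {a : W → GForm W G} {y : W} (h : SmoothAt a y) (k : ℕ) :
    ContDiffAt ℝ ∞ (fun z => truncG k (a z)) y :=
  contDiffAt_pi.2 fun j => h j

theorem fderiv_truncG {a : W → GForm W G} {y : W} (h : SmoothAt a y) (k : ℕ) (v : W) :
    fderiv ℝ (fun z => truncG k (a z)) y v = truncG k (dirDeriv a y v) := by
  have h1 := hasFDerivAt_pi.2 fun j : Fin (k + 1) =>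
    ((h j).differentiableAt (by simp)).hasFDerivAt
  exact DFunLike.congr_fun h1.fderiv v

theorem contDiffAt_bilinear {H H₁ H₂ H₃ : Type*} [NormedAddCommGroup H] [NormedSpace ℝ H]
    [NormedAddCommGroup H₁] [NormedSpace ℝ H₁] [NormedAddCommGroup H₂] [NormedSpace ℝ H₂]
    [NormedAddCommGroup H₃] [NormedSpace ℝ H₃] (B : H₁ →L[ℝ] H₂ →L[ℝ] H₃) {f : H → H₁} {g : H → H₂}
    {y : H} (hf : ContDiffAt ℝ ∞ f y) (hg : ContDiffAt ℝ ∞ g y) :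
    ContDiffAt ℝ ∞ (fun z => B (f z) (g z)) y :=
  (B.contDiff.contDiffAt.comp y hf).clm_apply hg

theorem SmoothAt.wedge {a : W → GForm W G₁} {b : W → GForm W G₂} {y : W} (ha : SmoothAt a y)
    (hb : SmoothAt b y) (B : G₁ →ₗ[ℝ] G₂ →ₗ[ℝ] G₃) :
    SmoothAt (fun z => wedge B (a z) (b z)) y := by
  intro k
  simp only [← wedgeTrunc_apply]
  exact contDiffAt_bilinear (wedgeTrunc W B k) (ha.truncG k) (hb.truncG k)

theorem dirDeriv_wedge {a : W → GForm W G₁} {b : W → GForm W G₂} {y : W} (ha : SmoothAt a y)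
    (hb : SmoothAt b y) (B : G₁ →ₗ[ℝ] G₂ →ₗ[ℝ] G₃) :
    dirDeriv (fun z => wedge B (a z) (b z)) y =
      (wedgeL B).flip (b y) ∘ₗ dirDeriv a y + wedgeL B (a y) ∘ₗ dirDeriv b y := by
  ext1 v
  funext k
  refine (toContₗ W G₃ k).injective ?_
  change toCont _ = toCont _
  rw [toCont_dirDeriv]
  simp only [← wedgeTrunc_apply]
  have h1 := (wedgeTrunc W B k).hasFDerivAt_of_bilinear
    ((ha.truncG k).differentiableAt (by simp)).hasFDerivAt
    ((hb.truncG k).differentiableAt (by simp)).hasFDerivAt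
  rw [h1.fderiv]
  simp only [ContinuousLinearMap.add_apply, ContinuousLinearMap.precompR_apply,
    ContinuousLinearMap.precompL_apply, ContinuousLinearMap.compL_apply,
    ContinuousLinearMap.comp_apply]
  rw [fderiv_truncG ha, fderiv_truncG hb, wedgeTrunc_apply, wedgeTrunc_apply, add_comm]
  rfl

end Calculus

theorem neg_one_pow_zsmul {N : Type*} [AddCommGroup N] [Module ℝ N] (i : ℕ) (x : N) :
    (-1 : ℤ) ^ i • x = (-1 : ℝ) ^ i • x := by
  rcases neg_one_pow_eq_or ℤ i with h | h <;> rcases Nat.even_or_odd i with h' | h' <;>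
    simp [h'.neg_one_pow]

theorem two_le_infty : (2 : WithTop ℕ∞) ≤ ∞ := by
  exact WithTop.coe_le_coe.2 (le_top : (2 : ℕ∞) ≤ ⊤)

section AltAlt

variable {M N : Type*} [AddCommGroup M] [Module ℝ M] [AddCommGroup N] [Module ℝ N]

/-- `altG` as a linear map. -/
def altGₗ : (M →ₗ[ℝ] GForm M N) →ₗ[ℝ] GForm M N where
  toFun := altG
  map_add' := altG_add
  map_smul' := altG_smul

theorem altG_altG (B : M →ₗ[ℝ] M →ₗ[ℝ] GForm M N) (hB : ∀ v w, B v w = B w v) :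
    altG (altGₗ ∘ₗ B) = 0 := by
  funext k
  induction k generalizing B with
  | zero => rfl
  | succ k ih =>
    ext w
    have h1 : iota (w 0) (altG (altGₗ ∘ₗ B)) = altG (altGₗ ∘ₗ B.compr₂ (iota (w 0))) := by
      have h2 : iota (w 0) ∘ₗ altGₗ ∘ₗ B = B (w 0) - altGₗ ∘ₗ B.compr₂ (iota (w 0)) := by
        ext1 v
        refine (iota_altG (w 0) (B v)).trans ?_
        rw [hB]
        rfl
      rw [iota_altG, h2, sub_eq_add_neg (B (w 0)), altG_add, altG_neg]
      change altG (B (w 0)) - _ = _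
      abel
    have h3 : altG (altGₗ ∘ₗ B) (k + 1) w = iota (w 0) (altG (altGₗ ∘ₗ B)) k (Fin.tail w) := by
      rw [iota_apply]
      congr 1
      exact (Fin.cons_self_tail w).symm
    rw [h3, h1, ih _ fun v u => by simp only [LinearMap.compr₂_apply, hB]]
    rfl

end AltAlt

section Complex

variable {M N : Type*} [AddCommGroup M] [Module ℂ M] [AddCommGroup N] [Module ℂ N]

theorem csmul_eq_mapV {M : Type*} [AddCommGroup M] [Module ℝ M] (c : ℂ) (u : GForm M N) :
    c • u = mapV (smulBilin N c) u := rfl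

theorem altG_csmul {M : Type*} [AddCommGroup M] [Module ℝ M] (c : ℂ) (A : M →ₗ[ℝ] GForm M N) :
    altG (c • A) = c • altG A :=
  (mapV_altG (smulBilin N c) A).symm

theorem pull_csmul {M M' : Type*} [AddCommGroup M] [Module ℝ M] [AddCommGroup M'] [Module ℝ M']
    (f : M' →ₗ[ℝ] M) (c : ℂ) (u : GForm M N) : pull f (c • u) = c • pull f u := rfl

theorem half_csmul {M : Type*} [AddCommGroup M] [Module ℝ M] (u : GForm M N) :
    (1 / 2 : ℂ) • u = (1 / 2 : ℝ) • u := by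
  have half : (1 / 2 : ℂ) = ((1 / 2 : ℝ) : ℂ) := by push_cast; ring
  funext k
  ext w
  simp only [Pi.smul_apply, AlternatingMap.smul_apply]
  rw [half, Complex.coe_smul]

/-- The part `v ↦ (A v + c A (i v)) / 2` of a real linear map; it is `ℂ`-antilinear if `c = i` and
`ℂ`-linear if `c = -i`. -/
def partL (c : ℂ) (A : M →ₗ[ℝ] N) : M →ₗ[ℝ] N := (1 / 2 : ℂ) • (A + c • A ∘ₗ jmap M)

theorem partL_apply (c : ℂ) (A : M →ₗ[ℝ] N) (v : M) :
    partL c A v = (1 / 2 : ℂ) • (A v + c • A (Complex.I • v)) := rfl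

theorem partL_add (c : ℂ) (A B : M →ₗ[ℝ] N) : partL c (A + B) = partL c A + partL c B := by
  ext v
  simp only [partL_apply, LinearMap.add_apply, smul_add]
  abel

/-- The inverse of the Weil operator. -/
def jinv : GForm M N →ₗ[ℝ] GForm M N := jf ∘ₗ jf ∘ₗ jf

theorem jf_jinv (u : GForm M N) : jf (jinv u) = u := by
  simp only [jinv, LinearMap.comp_apply]
  rw [jf_jf, jf_jf, sgn_sgn]

theorem altG_comp_jmap (A : M →ₗ[ℝ] GForm M N) : altG (A ∘ₗ jmap M) = jf (altG (jinv ∘ₗ A)) := by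
  rw [jf, pull_altG]
  congr 1
  ext v : 1
  exact (jf_jinv _).symm

theorem altG_partL (c : ℂ) (A : M →ₗ[ℝ] GForm M N) :
    altG (partL c A) = (1 / 2 : ℂ) • (altG A + c • altG (A ∘ₗ jmap M)) := by
  rw [partL, altG_csmul, altG_add, altG_csmul]

theorem jf_altG_partL {c : ℂ} (hc : c * c = -1) (A : M →ₗ[ℝ] GForm M N) :
    jf (altG (partL c A)) = -c • altG (partL c (jf ∘ₗ A)) := by
  rw [jf, pull_altG, ← altG_csmul]
  congr 1
  ext1 v
  simp only [LinearMap.comp_apply, LinearMap.smul_apply, partL_apply, jmap_apply, smul_smul,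
    Complex.I_mul_I, neg_one_smul, map_neg]
  rw [pull_csmul, map_add, pull_csmul, map_neg]
  have h : ((-c * (1 / 2)) : ℂ) • (pull (jmap M) (A v) + c • pull (jmap M) (A (Complex.I • v)))
      = (1 / 2 : ℂ) • (pull (jmap M) (A (Complex.I • v)) + c • -pull (jmap M) (A v)) := by
    have h2 : -c * (1 / 2) * c = 1 / 2 := by linear_combination (-1 / 2) * hc
    rw [smul_add, smul_add, smul_smul, h2, smul_smul, smul_neg, ← neg_smul, add_comm]
    congr 2
    ring
  exact h.symm

end Complex

section Dolbeault

variable {W : Type*} [NormedAddCommGroup W] [NormedSpace ℂ W] [FiniteDimensional ℂ W]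
  {G G₁ G₂ G₃ : Type*} [NormedAddCommGroup G] [NormedSpace ℂ G] [FiniteDimensional ℂ G]
  [NormedAddCommGroup G₁] [NormedSpace ℂ G₁] [FiniteDimensional ℂ G₁]
  [NormedAddCommGroup G₂] [NormedSpace ℂ G₂] [FiniteDimensional ℂ G₂]
  [NormedAddCommGroup G₃] [NormedSpace ℂ G₃] [FiniteDimensional ℂ G₃]

/-- The operator `∂̄` (for `c = i`) or `∂` (for `c = -i`) on families of forms on `W`. -/
def dol (c : ℂ) (a : W → GForm W G) (y : W) : GForm W G := altG (partL c (dirDeriv a y))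

theorem toCont_dol_I (a : W → GForm W G) (y : W) (k : ℕ) :
    toCont (dol Complex.I a y (k + 1)) = dbarLocal (fun z => toCont (a z k)) y := by
  ext w
  rw [toCont_apply, dol, altG_succ_apply, dbarLocal,
    ContinuousAlternatingMap.alternatizeUncurryFin_apply]
  refine Finset.sum_congr rfl fun i _ => ?_
  rw [neg_one_pow_zsmul]
  rfl

theorem toCont_dol_neg_I (a : W → GForm W G) (y : W) (k : ℕ) :
    toCont (dol (-Complex.I) a y (k + 1)) = delLocal (fun z => toCont (a z k)) y := by
  ext w
  rw [toCont_apply, dol, altG_succ_apply, delLocal,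
    ContinuousAlternatingMap.alternatizeUncurryFin_apply]
  refine Finset.sum_congr rfl fun i _ => ?_
  rw [neg_one_pow_zsmul, linearPart, sub_eq_add_neg, ← neg_smul]
  rfl

theorem dol_congr (c : ℂ) {a b : W → GForm W G} {y : W} (h : a =ᶠ[nhds y] b) :
    dol c a y = dol c b y := by
  rw [dol, dol, dirDeriv_congr h]

theorem dol_zero_apply (c : ℂ) (a : W → GForm W G) (y : W) : dol c a y 0 = 0 := rfl

theorem dol_add (c : ℂ) {a b : W → GForm W G} {y : W} (h : SmoothAt a y) (h' : SmoothAt b y) :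
    dol c (fun z => a z + b z) y = dol c a y + dol c b y := by
  rw [dol, dirDeriv_add h h', partL_add, altG_add]
  rfl

theorem dol_mapV (c : ℂ) {a : W → GForm W G₁} {y : W} (h : SmoothAt a y) {g : G₁ →ₗ[ℝ] G₂}
    {c' : ℂ} (hg : ∀ x, g (c' • x) = c • g x) :
    dol c (fun z => mapV g (a z)) y = mapV g (altG (partL c' (dirDeriv a y))) := by
  have hg2 : ∀ x, g ((1 / 2 : ℂ) • x) = (1 / 2 : ℂ) • g x := by
    intro x
    have : (1 / 2 : ℂ) = ((1 / 2 : ℝ) : ℂ) := by push_cast; ring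
    rw [this, Complex.coe_smul, Complex.coe_smul, map_smul]
  rw [dol, dirDeriv_mapV h, mapV_altG]
  congr 1
  ext v k w
  simp only [partL_apply, LinearMap.comp_apply, Pi.smul_apply, Pi.add_apply,
    AlternatingMap.smul_apply, AlternatingMap.add_apply, mapV_apply, hg2, map_add, hg]

theorem dol_wedge {c c' : ℂ} {a : W → GForm W G₁} {b : W → GForm W G₂} {y : W}
    (ha : SmoothAt a y) (hb : SmoothAt b y) {B : G₁ →ₗ[ℝ] G₂ →ₗ[ℝ] G₃}
    (hB₁ : ∀ x z, B (c • x) z = c • B x z) (hB₂ : ∀ x z, B x (c' • z) = c • B x z) :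
    dol c (fun z => wedge B (a z) (b z)) y =
      wedge B (dol c a y) (b y) + wedge B (sgn (a y)) (dol c' b y) := by
  have key₁ : ∀ (u : GForm W G₁) (v : GForm W G₂), wedge B (c • u) v = c • wedge B u v := by
    intro u v
    exact (mapV_wedge (g := smulBilin G₃ c) (f := smulBilin G₁ c) (f' := LinearMap.id)
      (fun x z => (hB₁ x z).symm) u v).symm
  have key₂ : ∀ (u : GForm W G₁) (v : GForm W G₂), wedge B u (c' • v) = c • wedge B u v := by
    intro u v
    exact (mapV_wedge (g := smulBilin G₃ c) (f := LinearMap.id) (f' := smulBilin G₂ c')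
      (fun x z => (hB₂ x z).symm) u v).symm
  rw [dol, dirDeriv_wedge ha hb, partL_add, altG_add, dol, dol, ← altG_wedge_right,
    ← altG_wedge_left]
  congr 2
  · ext1 v
    simp only [partL_apply, LinearMap.comp_apply, LinearMap.flip_apply]
    rw [half_csmul, half_csmul, map_smul (wedgeL B), LinearMap.smul_apply, map_add, LinearMap.add_apply, wedgeL_apply,
      wedgeL_apply, wedgeL_apply, key₁]
  · ext1 v
    simp only [partL_apply, LinearMap.comp_apply]
    rw [half_csmul, half_csmul, map_smul (wedgeL B (a y)), map_add, wedgeL_apply, wedgeL_apply, wedgeL_apply, key₂]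

theorem dol_eq (c : ℂ) (a : W → GForm W G) (y : W) :
    dol c a y = (1 / 2 : ℂ) • (altG (dirDeriv a y) + c • altG (dirDeriv a y ∘ₗ jmap W)) :=
  altG_partL c _

theorem jf_dol {c : ℂ} (hc : c * c = -1) {a : W → GForm W G} {y : W} (h : SmoothAt a y) :
    jf (dol c a y) = -c • dol c (fun z => jf (a z)) y := by
  have h1 : dirDeriv (fun z => jf (a z)) y = jf ∘ₗ dirDeriv a y := dirDeriv_pullConst h _
  rw [dol, dol, jf_altG_partL hc, h1]

theorem toCont_altG_dirDeriv (a : W → GForm W G) (y : W) (k : ℕ) :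
    toCont (altG (dirDeriv a y) (k + 1)) = extDeriv (fun z => toCont (a z k)) y := by
  ext w
  rw [toCont_apply, altG_succ_apply, extDeriv,
    ContinuousAlternatingMap.alternatizeUncurryFin_apply]
  refine Finset.sum_congr rfl fun i _ => ?_
  rw [neg_one_pow_zsmul]
  rfl

/-- A closed form that is invariant under the Weil operator is `∂`- and `∂̄`-closed. -/
theorem dol_eq_zero_of_closed {a : W → GForm W G} {y : W} (h : SmoothAt a y)
    (hd : ∀ k, extDeriv (fun z => toCont (a z k)) y = 0) (hj : (fun z => jf (a z)) =ᶠ[nhds y] a) :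
    dol Complex.I a y = 0 ∧ dol (-Complex.I) a y = 0 := by
  have hd0 : altG (dirDeriv a y) = 0 := by
    funext k
    cases k with
    | zero => rfl
    | succ k => exact (toContₗ W G (k + 1)).injective ((toCont_altG_dirDeriv a y k).trans (hd k))
  have hI : Complex.I * Complex.I = -1 := Complex.I_mul_I
  have hI' : -Complex.I * -Complex.I = -1 := by rw [neg_mul_neg, hI]
  have h1 := jf_dol hI h
  have h2 := jf_dol hI' h
  rw [dol_congr _ hj] at h1 h2
  have hsum : dol Complex.I a y + dol (-Complex.I) a y = 0 := by
    rw [dol_eq, dol_eq, hd0, zero_add, zero_add, neg_smul, smul_neg, add_neg_cancel]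
  have h3 : dol (-Complex.I) a y = -dol Complex.I a y := by
    rw [eq_neg_iff_add_eq_zero, add_comm, hsum]
  rw [h3, map_neg, h1, neg_neg, smul_neg, neg_smul, neg_neg] at h2
  have h4 : ((2 : ℂ) * Complex.I) • dol Complex.I a y = 0 := by
    rw [mul_smul, two_smul]
    nth_rewrite 1 [h2]
    rw [neg_add_cancel]
  have h5 := (smul_eq_zero.1 h4).resolve_left (by simp)
  exact ⟨h5, by rw [h3, h5, neg_zero]⟩

theorem altG_dirDeriv_pull {a : W → GForm W G} {φ : W → W} {y : W} (ha : SmoothAt a (φ y))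
    (hφ : ContDiffAt ℝ ∞ φ y) {a' : W → GForm W G}
    (h : ∀ᶠ z in nhds y, a' z = pull (fderiv ℝ φ z).toLinearMap (a (φ z))) :
    altG (dirDeriv a' y) = pull (fderiv ℝ φ y).toLinearMap (altG (dirDeriv a (φ y))) := by
  rw [dirDeriv_congr h]
  funext k
  cases k with
  | zero => rfl
  | succ k =>
    refine (toContₗ W G (k + 1)).injective ?_
    refine (toCont_altG_dirDeriv _ y k).trans ?_
    have h1 := extDeriv_pullback (f := φ) (r := ∞)
      (show DifferentiableAt ℝ (fun z => toCont (a z k)) (φ y) from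
        (ha k).differentiableAt (by simp)) hφ (by simpa using two_le_infty)
    refine h1.trans ?_
    rw [← toCont_altG_dirDeriv]
    rfl

theorem dol_pull {a : W → GForm W G} {φ : W → W} {y : W} (ha : SmoothAt a (φ y))
    (hφ : ContDiffAt ℝ ∞ φ y)
    (hI : ∀ᶠ z in nhds y, ∀ v, fderiv ℝ φ z (Complex.I • v) = Complex.I • fderiv ℝ φ z v)
    {a' : W → GForm W G} (ha' : SmoothAt a' y)
    (h : ∀ᶠ z in nhds y, a' z = pull (fderiv ℝ φ z).toLinearMap (a (φ z))) (c : ℂ) :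
    dol c a' y = pull (fderiv ℝ φ y).toLinearMap (dol c a (φ y)) := by
  have hjp : ∀ᶠ z in nhds y, ∀ u : GForm W G, jf (pull (fderiv ℝ φ z).toLinearMap u)
      = pull (fderiv ℝ φ z).toLinearMap (jf u) := by
    filter_upwards [hI] with z hz u
    rw [jf, pull_pull, pull_pull]
    exact congrArg (fun f => pull f u) (LinearMap.ext fun v => hz v)
  have hjinv : ∀ {b : W → GForm W G} {x : W}, SmoothAt b x →
      SmoothAt (fun z => jinv (b z)) x ∧ dirDeriv (fun z => jinv (b z)) x = jinv ∘ₗ dirDeriv b x := by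
    intro b x hb
    have h1 := hb.pullConst (jmap W)
    have h2 := h1.pullConst (jmap W)
    refine ⟨h2.pullConst (jmap W), ?_⟩
    refine (dirDeriv_pullConst h2 (jmap W)).trans ?_
    rw [dirDeriv_pullConst h1 (jmap W), dirDeriv_pullConst hb (jmap W)]
    rfl
  have hJ : altG (dirDeriv a' y ∘ₗ jmap W)
      = pull (fderiv ℝ φ y).toLinearMap (altG (dirDeriv a (φ y) ∘ₗ jmap W)) := by
    rw [altG_comp_jmap, altG_comp_jmap, ← (hjinv ha').2, ← (hjinv ha).2,
      ← hjp.self_of_nhds]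
    congr 1
    refine altG_dirDeriv_pull (hjinv ha).1 hφ ?_
    filter_upwards [h, hjp] with z hz hjz
    rw [hz]
    simp only [jinv, LinearMap.comp_apply, hjz]
  rw [dol_eq, dol_eq, altG_dirDeriv_pull ha hφ h, hJ, pull_csmul, map_add, pull_csmul]

/-- `partL` as a continuous linear map. -/
def partCLM {H : Type*} [NormedAddCommGroup H] [NormedSpace ℂ H] [NormedSpace ℝ H]
    [SMulCommClass ℝ ℂ H] [FiniteDimensional ℝ H] (c : ℂ) :
    (W →L[ℝ] H) →L[ℝ] W →L[ℝ] H :=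
  haveI : Module.Finite ℝ W := finite_real
  LinearMap.toContinuousLinearMap
    { toFun := fun A => (1 / 2 : ℂ) • (A + c • A.comp (mulI W))
      map_add' := fun A B => by
        ext v : 1
        simp only [ContinuousLinearMap.add_apply, ContinuousLinearMap.smul_apply,
          ContinuousLinearMap.comp_apply, smul_add]
        abel
      map_smul' := fun r A => by
        ext v : 1
        simp only [ContinuousLinearMap.add_apply, ContinuousLinearMap.smul_apply,
          ContinuousLinearMap.comp_apply, RingHom.id_apply, smul_add, smul_comm r] }

set_option synthInstance.maxHeartbeats 200000 in
theorem toCont_dol (c : ℂ) (a : W → GForm W G) (y : W) (k : ℕ) :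
    toCont (dol c a y (k + 1)) = ContinuousAlternatingMap.alternatizeUncurryFinCLM ℝ W G
      (partCLM c (fderiv ℝ (fun z => toCont (a z k)) y)) := by
  ext w
  rw [toCont_apply, dol, altG_succ_apply, ContinuousAlternatingMap.alternatizeUncurryFinCLM_apply,
    ContinuousAlternatingMap.alternatizeUncurryFin_apply]
  refine Finset.sum_congr rfl fun i _ => ?_
  rw [neg_one_pow_zsmul]
  rfl

set_option synthInstance.maxHeartbeats 200000 in
theorem SmoothAt.dol {a : W → GForm W G} {y : W} (h : SmoothAt a y) (c : ℂ) :
    SmoothAt (dol c a) y := by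
  intro k
  cases k with
  | zero => exact (contDiffAt_const : ContDiffAt ℝ ∞ (fun _ : W => (0 : W [⋀^Fin 0]→L[ℝ] G)) y)
  | succ k =>
    simp only [toCont_dol]
    have h2 : ContDiffAt ℝ ∞ (fderiv ℝ fun z => toCont (a z k)) y :=
      (h k).fderiv_right (by simp)
    exact ((ContinuousAlternatingMap.alternatizeUncurryFinCLM ℝ W G).comp
      (partCLM c)).contDiff.contDiffAt.comp y h2

/-- A continuous bilinear map as a bilinear map. -/
def bilinOfCLM {H : Type*} [NormedAddCommGroup H] [NormedSpace ℝ H] (D : W →L[ℝ] W →L[ℝ] H) :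
    W →ₗ[ℝ] W →ₗ[ℝ] H :=
  ContinuousLinearMap.coeLM ℝ ∘ₗ D.toLinearMap

/-- The second derivatives of the degree `k` component of a family of forms. -/
def fderiv₂ (a : W → GForm W G) (y : W) (k : ℕ) : W →ₗ[ℝ] W →ₗ[ℝ] W [⋀^Fin k]→L[ℝ] G :=
  bilinOfCLM (fderiv ℝ (fderiv ℝ fun z => toCont (a z k)) y)

/-- The second derivatives of a family of forms. -/
def dirDeriv₂ (a : W → GForm W G) (y : W) : W →ₗ[ℝ] W →ₗ[ℝ] GForm W G :=
  LinearMap.mk₂ ℝ (fun v u => fun k => (toContₗ W G k).symm (fderiv₂ a y k v u))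
    (fun v v' u => by
      funext k
      rw [LinearMap.map_add₂, map_add]
      rfl)
    (fun r v u => by
      funext k
      rw [LinearMap.map_smul₂, map_smul]
      rfl)
    (fun v u u' => by
      funext k
      rw [map_add, map_add]
      rfl)
    (fun r v u => by
      funext k
      rw [map_smul, map_smul]
      rfl)

set_option synthInstance.maxHeartbeats 200000 in
theorem dirDeriv₂_symm {a : W → GForm W G} {y : W} (h : SmoothAt a y) (v w : W) :
    dirDeriv₂ a y v w = dirDeriv₂ a y w v := by
  funext k
  exact congrArg ContinuousAlternatingMap.toAlternatingMap
    ((h k).isSymmSndFDerivAt (by simpa using two_le_infty) v w)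

set_option synthInstance.maxHeartbeats 200000 in
theorem dirDeriv_dol (c : ℂ) {a : W → GForm W G} {y : W} (h : SmoothAt a y) (v : W) :
    dirDeriv (dol c a) y v = altG (partL c (dirDeriv₂ a y v)) := by
  funext k
  cases k with
  | zero =>
    have h1 : (fun z => toCont (dol c a z 0)) = fun _ => 0 := rfl
    rw [dirDeriv_def, h1, fderiv_fun_const]
    rfl
  | succ k =>
    have h2 : DifferentiableAt ℝ (fderiv ℝ fun z => toCont (a z k)) y :=
      ((h k).fderiv_right (m := 1) (one_add_one_eq_two.trans_le two_le_infty)).differentiableAt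
        (by simp)
    have h3 : fderiv ℝ (fun z => toCont (dol c a z (k + 1))) y =
        (ContinuousAlternatingMap.alternatizeUncurryFinCLM ℝ W G).comp
          ((partCLM c).comp (fderiv ℝ (fderiv ℝ fun z => toCont (a z k)) y)) := by
      simp only [toCont_dol]
      exact (((ContinuousAlternatingMap.alternatizeUncurryFinCLM ℝ W G).comp
        (partCLM c)).hasFDerivAt (x := fderiv ℝ (fun z => toCont (a z k)) y)).comp y
          h2.hasFDerivAt |>.fderiv
    ext w
    rw [altG_succ_apply, dirDeriv_def, h3]
    refine (ContinuousAlternatingMap.alternatizeUncurryFin_apply _ _).trans ?_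
    refine Finset.sum_congr rfl fun i _ => ?_
    rw [neg_one_pow_zsmul]
    rfl

theorem dol_dol {c : ℂ} {a : W → GForm W G} {y : W} (h : SmoothAt a y) :
    dol c (dol c a) y = 0 := by
  let P : (W →ₗ[ℝ] GForm W G) →ₗ[ℝ] W →ₗ[ℝ] GForm W G :=
    { toFun := partL c
      map_add' := partL_add c
      map_smul' := fun r A => by
        ext1 v
        simp only [partL_apply, LinearMap.smul_apply, RingHom.id_apply]
        rw [smul_comm c r, ← smul_add, smul_comm _ r] }
  let Q : W →ₗ[ℝ] W →ₗ[ℝ] GForm W G := partL c (P ∘ₗ dirDeriv₂ a y)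
  have hQ : ∀ v w, Q v w = Q w v := by
    intro v w
    have hs := dirDeriv₂_symm h
    have e : ∀ v w, Q v w = (1 / 2 : ℂ) • ((1 / 2 : ℂ) • (dirDeriv₂ a y v w
        + c • dirDeriv₂ a y v (Complex.I • w)) + c • (1 / 2 : ℂ) • (dirDeriv₂ a y (Complex.I • v) w
        + c • dirDeriv₂ a y (Complex.I • v) (Complex.I • w))) := fun _ _ => rfl
    rw [e, e, hs w v, hs w (Complex.I • v), hs (Complex.I • w) v,
      hs (Complex.I • w) (Complex.I • v)]
    module
  have h1 : partL c (dirDeriv (dol c a) y) = altGₗ ∘ₗ Q := by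
    ext1 v
    rw [partL_apply, dirDeriv_dol c h, dirDeriv_dol c h, ← altG_csmul, ← altG_add, ← altG_csmul]
    rfl
  rw [dol, h1, altG_altG Q hQ]

end Dolbeault

section Pullback

variable {W : Type*} [NormedAddCommGroup W] [NormedSpace ℂ W] [FiniteDimensional ℂ W]
  {G G₁ G₂ : Type*} [NormedAddCommGroup G] [NormedSpace ℂ G] [FiniteDimensional ℂ G]
  [NormedAddCommGroup G₁] [NormedSpace ℂ G₁] [FiniteDimensional ℂ G₁]
  [NormedAddCommGroup G₂] [NormedSpace ℂ G₂] [FiniteDimensional ℂ G₂]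

theorem SmoothAt.pull {a : W → GForm W G} {φ : W → W} {D : W → W →ₗ[ℝ] W} {y : W}
    (ha : SmoothAt a (φ y)) (hφ : ContDiffAt ℝ ∞ φ y) (hD : ∀ v, ContDiffAt ℝ ∞ (fun z => D z v) y) :
    SmoothAt (fun z => pull (D z) (a (φ z))) y := by
  refine smoothAt_of_eval fun k w => ?_
  let b := Module.finBasis ℝ W
  have h : (fun z => THodge.pull (D z) (a (φ z)) k w) = fun z =>
      ∑ r : Fin k → Fin (Module.finrank ℝ W),
        (∏ i, b.equivFun (D z (w i)) (r i)) • a (φ z) k fun i => b (r i) := by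
    funext z
    have hv : (fun i => D z (w i)) = fun i => ∑ j, b.equivFun (D z (w i)) j • b j := by
      funext i
      exact (b.sum_equivFun _).symm
    rw [pull_apply, hv, ← AlternatingMap.coe_multilinearMap, MultilinearMap.map_sum]
    exact Finset.sum_congr rfl fun r _ => MultilinearMap.map_smul_univ _ _ _
  rw [h]
  refine ContDiffAt.sum fun r _ => ?_
  have hp : ContDiffAt ℝ ∞ (fun z => ∏ i, b.equivFun (D z (w i)) (r i)) y :=
    contDiffAt_prod fun i _ => ((LinearMap.proj (r i) : _ →ₗ[ℝ] ℝ) ∘ₗ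
      b.equivFun.toLinearMap).toContinuousLinearMap.contDiff.contDiffAt.comp y (hD _)
  exact hp.smul ((ha.eval k _).comp y hφ)

section RealSpaces

variable {E H₁ H₂ : Type*} [NormedAddCommGroup E] [NormedSpace ℝ E]
  [NormedAddCommGroup H₁] [NormedSpace ℝ H₁] [FiniteDimensional ℝ H₁]
  [NormedAddCommGroup H₂] [NormedSpace ℝ H₂] [FiniteDimensional ℝ H₂]

theorem contDiffAt_toContinuousLinearMap {N : WithTop ℕ∞} {g : E → H₁ →ₗ[ℝ] H₂} {y : E}
    (hg : ∀ s, ContDiffAt ℝ N (fun z => g z s) y) :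
    ContDiffAt ℝ N (fun z => (g z).toContinuousLinearMap) y := by
  let b := Module.finBasis ℝ H₁
  let ev : (H₁ →L[ℝ] H₂) →ₗ[ℝ] (Fin (Module.finrank ℝ H₁)) → H₂ :=
    { toFun := fun a r => a (b r)
      map_add' := fun _ _ => rfl
      map_smul' := fun _ _ => rfl }
  have hinj : LinearMap.ker ev = ⊥ := by
    rw [LinearMap.ker_eq_bot']
    intro a ha
    refine ContinuousLinearMap.coe_injective (b.ext fun r => ?_)
    exact congrFun ha r
  obtain ⟨l, hl⟩ := ev.exists_leftInverse_of_injective hinj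
  have h1 : (fun z => (g z).toContinuousLinearMap) = fun z => l fun r => g z (b r) := by
    funext z
    exact (LinearMap.congr_fun hl (g z).toContinuousLinearMap).symm
  rw [h1]
  exact l.toContinuousLinearMap.contDiff.contDiffAt.comp y (contDiffAt_pi.2 fun r => hg _)

theorem contDiffAt_apply_apply {N : WithTop ℕ∞} {g : E → H₁ →ₗ[ℝ] H₂} {f : E → H₁} {y : E}
    (hg : ∀ s, ContDiffAt ℝ N (fun z => g z s) y) (hf : ContDiffAt ℝ N f y) :
    ContDiffAt ℝ N (fun z => g z (f z)) y :=
  (contDiffAt_toContinuousLinearMap hg).clm_apply hf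

/-- The solution of a smooth family of uniquely solvable linear equations is smooth. -/
theorem contDiffAt_of_apply {N : WithTop ℕ∞} {g : E → H₁ →ₗ[ℝ] H₂} {f : E → H₁} {y : E}
    (hg : ∀ s, ContDiffAt ℝ N (fun z => g z s) y)
    (hbij : ∀ᶠ z in nhds y, Function.Bijective (g z))
    (hf : ContDiffAt ℝ N (fun z => g z (f z)) y) : ContDiffAt ℝ N f y := by
  have hinv : ∀ᶠ z in nhds y, ∃ e : H₁ ≃L[ℝ] H₂,
      (e : H₁ →L[ℝ] H₂) = (g z).toContinuousLinearMap := by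
    filter_upwards [hbij] with z hz
    exact ⟨(LinearEquiv.ofBijective (g z) hz).toContinuousLinearEquiv, by ext; rfl⟩
  obtain ⟨e, he⟩ := hinv.self_of_nhds
  have h1 : ContDiffAt ℝ N (fun z => (g z).toContinuousLinearMap.inverse) y := by
    have h2 := contDiffAt_map_inverse (n := N) e
    rw [he] at h2
    exact h2.comp y (contDiffAt_toContinuousLinearMap hg)
  refine (h1.clm_apply hf).congr_of_eventuallyEq ?_
  filter_upwards [hinv] with z ⟨e, he⟩
  rw [← he, ContinuousLinearMap.inverse_equiv]
  have h3 : g z (f z) = e (f z) := (DFunLike.congr_fun he (f z)).symm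
  rw [h3]
  exact (e.symm_apply_apply _).symm

end RealSpaces

theorem fderiv_apply_apply {g : W → G₁ →ₗ[ℝ] G₂} {f : W → G₁} {y : W}
    (hg : ∀ s, ContDiffAt ℝ ∞ (fun z => g z s) y) (hf : ContDiffAt ℝ ∞ f y) (v : W) :
    fderiv ℝ (fun z => g z (f z)) y v =
      fderiv ℝ (fun z => g z (f y)) y v + g y (fderiv ℝ f y v) := by
  haveI : FiniteDimensional ℝ G₁ := finite_real
  haveI : FiniteDimensional ℝ G₂ := finite_real
  have hG := ((contDiffAt_toContinuousLinearMap hg).differentiableAt (by simp)).hasFDerivAt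
  have hF := (hf.differentiableAt (by simp)).hasFDerivAt
  have h1 := hG.clm_apply hF
  have h2 := hG.clm_apply (hasFDerivAt_const (f y) y)
  have e1 := DFunLike.congr_fun h1.fderiv v
  have e2 := DFunLike.congr_fun h2.fderiv v
  refine e1.trans ?_
  rw [show fderiv ℝ (fun z => g z (f y)) y v = _ from e2]
  simp [add_comm]

theorem SmoothAt.mapV_var {a : W → GForm W G₁} {g : W → G₁ →ₗ[ℂ] G₂} {y : W}
    (hg : ∀ s, ContDiffAt ℝ ∞ (fun z => g z s) y) (ha : SmoothAt a y) :
    SmoothAt (fun z => THodge.mapV ((g z).restrictScalars ℝ) (a z)) y :=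
  haveI : FiniteDimensional ℝ G₁ := finite_real
  haveI : FiniteDimensional ℝ G₂ := finite_real
  smoothAt_of_eval fun k w =>
    contDiffAt_apply_apply (g := fun z => (g z).restrictScalars ℝ) hg (ha.eval k w)

theorem SmoothAt.of_mapV_var {a : W → GForm W G₁} {g : W → G₁ →ₗ[ℂ] G₂} {y : W}
    (hg : ∀ s, ContDiffAt ℝ ∞ (fun z => g z s) y)
    (hbij : ∀ᶠ z in nhds y, Function.Bijective (g z))
    (ha : SmoothAt (fun z => THodge.mapV ((g z).restrictScalars ℝ) (a z)) y) : SmoothAt a y :=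
  haveI : FiniteDimensional ℝ G₁ := finite_real
  haveI : FiniteDimensional ℝ G₂ := finite_real
  smoothAt_of_eval fun k w =>
    contDiffAt_of_apply (g := fun z => (g z).restrictScalars ℝ) hg hbij (ha.eval k w)

/-- Multiplication by a (anti)holomorphic matrix function commutes with `∂̄` (respectively `∂`). -/
theorem dol_mapV_var {c : ℂ} (hc : c * c = -1) {a : W → GForm W G₁} {g : W → G₁ →ₗ[ℂ] G₂} {y : W}
    (hg : ∀ s, ContDiffAt ℝ ∞ (fun z => g z s) y)
    (hg' : ∀ s v, fderiv ℝ (fun z => g z s) y (Complex.I • v) = c • fderiv ℝ (fun z => g z s) y v)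
    (ha : SmoothAt a y) :
    dol c (fun z => mapV ((g z).restrictScalars ℝ) (a z)) y =
      mapV ((g y).restrictScalars ℝ) (dol c a y) := by
  rw [dol, dol, mapV_altG]
  congr 1
  ext v k w
  have h : ∀ v, dirDeriv (fun z => mapV ((g z).restrictScalars ℝ) (a z)) y v k w =
      fderiv ℝ (fun z => g z (a y k w)) y v + g y (dirDeriv a y v k w) := by
    intro v
    rw [dirDeriv_apply (SmoothAt.mapV_var hg ha), dirDeriv_apply ha]
    exact fderiv_apply_apply (g := fun z => (g z).restrictScalars ℝ) hg (ha.eval k w) v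
  simp only [partL_apply, LinearMap.comp_apply, Pi.smul_apply, Pi.add_apply,
    AlternatingMap.smul_apply, AlternatingMap.add_apply, mapV_apply, h, hg',
    LinearMap.restrictScalars_apply, map_smul, map_add]
  generalize fderiv ℝ (fun z => g z (a y k w)) y v = e
  have : c • c • e = -e := by rw [smul_smul, hc, neg_one_smul]
  rw [smul_add c, this]
  congr 1
  abel

end Pullback

section Charts

variable {W : Type*} [NormedAddCommGroup W] [NormedSpace ℂ W]
  {X : Type*} [TopologicalSpace X] [ChartedSpace W X]
  {G : Type*} [AddCommGroup G] [Module ℝ G]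

/-- The differential of the inverse of the preferred chart at `x₀`, with values in the preferred
chart at the image point. -/
def dC (x₀ : X) (y : W) : W →L[ℂ] W :=
  fderiv ℂ (chartAt W ((chartAt W x₀).symm y) ∘ (chartAt W x₀).symm) y

/-- The coordinate change between two preferred charts. -/
def chartTrans (x₀ x₁ : X) : W → W := chartAt W x₁ ∘ (chartAt W x₀).symm

/-- The set where the coordinate change is defined. -/
def overlap (W : Type*) [NormedAddCommGroup W] [NormedSpace ℂ W]
  {X : Type*} [TopologicalSpace X] [ChartedSpace W X] (x₀ x₁ : X) : Set W :=
  (chartAt W x₀).target ∩ (chartAt W x₀).symm ⁻¹' (chartAt W x₁).source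

theorem isOpen_overlap (x₀ x₁ : X) : IsOpen (overlap W x₀ x₁) :=
  (chartAt W x₀).symm.isOpen_inter_preimage (chartAt W x₁).open_source

theorem symm_chartTrans {x₀ x₁ : X} {z : W} (hz : z ∈ overlap W x₀ x₁) :
    (chartAt W x₁).symm (chartTrans x₀ x₁ z) = (chartAt W x₀).symm z :=
  (chartAt W x₁).left_inv hz.2

theorem chartTrans_mem {x₀ x₁ : X} {z : W} (hz : z ∈ overlap W x₀ x₁) :
    chartTrans x₀ x₁ z ∈ overlap W x₁ x₀ := by
  refine ⟨(chartAt W x₁).map_source hz.2, ?_⟩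
  rw [Set.mem_preimage, symm_chartTrans hz]
  exact (chartAt W x₀).map_target hz.1

theorem chartTrans_chartTrans {x₀ x₁ : X} {z : W} (hz : z ∈ overlap W x₀ x₁) :
    chartTrans x₁ x₀ (chartTrans x₀ x₁ z) = z := by
  rw [chartTrans, Function.comp_apply, symm_chartTrans hz, (chartAt W x₀).right_inv hz.1]

variable [IsManifold 𝓘(ℂ, W) ω X]

theorem contDiffAt_chartTrans {x₀ x₁ : X} {z : W} (hz : z ∈ overlap W x₀ x₁) :
    ContDiffAt ℂ ω (chartTrans x₀ x₁) z := by
  have h := (contDiffGroupoid ω 𝓘(ℂ, W)).compatible (chart_mem_atlas W x₀) (chart_mem_atlas W x₁)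
  rw [contDiffGroupoid, mem_groupoid_of_pregroupoid] at h
  have h1 : ContDiffOn ℂ ω (chartTrans x₀ x₁) _ := h.1
  refine h1.contDiffAt ?_
  have h2 : ((chartAt W x₀).symm.trans (chartAt W x₁)).source ∈ nhds z := by
    refine ((chartAt W x₀).symm.trans (chartAt W x₁)).open_source.mem_nhds ?_
    rw [OpenPartialHomeomorph.trans_source]
    exact hz
  simpa using h2

theorem fderiv_real_eq {f : W → W} {z : W} (h : ContDiffAt ℂ ω f z) :
    fderiv ℝ f z = (fderiv ℂ f z).restrictScalars ℝ :=
  ((h.differentiableAt (by simp)).hasFDerivAt.restrictScalars ℝ).fderiv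

theorem dChartSymm_apply (x₀ : X) {y : W} (hy : y ∈ (chartAt W x₀).target) (v : W) :
    (dChartSymm x₀ y v : W) = dC x₀ y v := by
  haveI : IsManifold 𝓘(ℂ, W) 1 X := IsManifold.of_le (n := ω) le_top
  have h := mdifferentiableAt_atlas_symm (I := 𝓘(ℂ, W)) (chart_mem_atlas W x₀) hy
  have h2 : fderivWithin ℂ (writtenInExtChartAt 𝓘(ℂ, W) 𝓘(ℂ, W) y (chartAt W x₀).symm)
      (Set.range 𝓘(ℂ, W)) (extChartAt 𝓘(ℂ, W) y y) = dC x₀ y := by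
    simp only [mfld_simps, fderivWithin_univ]
    rfl
  exact DFunLike.congr_fun (h.mfderiv.trans h2) v

theorem dChart_apply (x : X) (v : Tan W x) : (dChart x v : W) = v := by
  haveI : IsManifold 𝓘(ℂ, W) 1 X := IsManifold.of_le (n := ω) le_top
  have h := mdifferentiableAt_atlas (I := 𝓘(ℂ, W)) (chart_mem_atlas W x) (mem_chart_source W x)
  have h2 : writtenInExtChartAt 𝓘(ℂ, W) 𝓘(ℂ, W) x (chartAt W x) =ᶠ[nhds (chartAt W x x)] id := by
    filter_upwards [(chartAt W x).open_target.mem_nhds (mem_chart_target W x)] with z hz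
    simp [writtenInExtChartAt, (chartAt W x).right_inv hz, chartAt_self_eq]
  have h3 : fderivWithin ℂ (writtenInExtChartAt 𝓘(ℂ, W) 𝓘(ℂ, W) x (chartAt W x))
      (Set.range 𝓘(ℂ, W)) (extChartAt 𝓘(ℂ, W) x x) = ContinuousLinearMap.id ℂ W := by
    simp only [modelWithCornersSelf_coe, Set.range_id, fderivWithin_univ]
    rw [← fderiv_id (x := chartAt W x x), ← h2.fderiv_eq]
    simp only [mfld_simps]
  exact DFunLike.congr_fun (h.mfderiv.trans h3) v

theorem dC_chart_self (x : X) : dC x (chartAt W x x) = ContinuousLinearMap.id ℂ W := by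
  have h2 : chartAt W ((chartAt W x).symm (chartAt W x x)) ∘ (chartAt W x).symm
      =ᶠ[nhds (chartAt W x x)] id := by
    rw [(chartAt W x).left_inv (mem_chart_source W x)]
    filter_upwards [(chartAt W x).open_target.mem_nhds (mem_chart_target W x)] with z hz
    simp [(chartAt W x).right_inv hz]
  rw [dC, h2.fderiv_eq, fderiv_id]

theorem dC_comp {x₀ x₁ : X} {z : W} (hz : z ∈ overlap W x₀ x₁) :
    dC x₀ z = (dC x₁ (chartTrans x₀ x₁ z)).comp (fderiv ℂ (chartTrans x₀ x₁) z) := by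
  have hs := symm_chartTrans hz
  rw [dC, dC, hs]
  generalize hp : (chartAt W x₀).symm z = p
  rw [hp] at hs
  have h1 : chartAt W p ∘ (chartAt W x₀).symm =ᶠ[nhds z]
      (chartAt W p ∘ (chartAt W x₁).symm) ∘ chartTrans x₀ x₁ := by
    filter_upwards [(isOpen_overlap x₀ x₁).mem_nhds hz] with z' hz'
    simp only [Function.comp_apply]
    rw [symm_chartTrans hz']
  have h2 : ContDiffAt ℂ ω (chartTrans x₁ p) (chartTrans x₀ x₁ z) := by
    refine contDiffAt_chartTrans ⟨(chartTrans_mem hz).1, ?_⟩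
    rw [Set.mem_preimage, hs]
    exact mem_chart_source W p
  rw [h1.fderiv_eq]
  exact fderiv_comp z (h2.differentiableAt (by simp))
    ((contDiffAt_chartTrans hz).differentiableAt (by simp))

theorem isUnit_dC {x₀ : X} {y : W} (hy : y ∈ (chartAt W x₀).target) :
    Function.Bijective (dC x₀ y) := by
  have hz : y ∈ overlap W x₀ ((chartAt W x₀).symm y) := ⟨hy, mem_chart_source W _⟩
  have h := contDiffAt_chartTrans hz
  have h' := contDiffAt_chartTrans (chartTrans_mem hz)
  have h1 : (fderiv ℂ (chartTrans ((chartAt W x₀).symm y) x₀)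
      (chartTrans x₀ ((chartAt W x₀).symm y) y)).comp (dC x₀ y)
      = ContinuousLinearMap.id ℂ W := by
    rw [dC, ← chartTrans, ← fderiv_comp y (h'.differentiableAt (by simp))
      (h.differentiableAt (by simp))]
    have : chartTrans ((chartAt W x₀).symm y) x₀ ∘ chartTrans x₀ ((chartAt W x₀).symm y)
        =ᶠ[nhds y] id := by
      filter_upwards [(isOpen_overlap _ _).mem_nhds hz] with z' hz'
      exact chartTrans_chartTrans hz'
    rw [this.fderiv_eq, fderiv_id]
  have h2 : (dC x₀ y).comp (fderiv ℂ (chartTrans ((chartAt W x₀).symm y) x₀)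
      (chartTrans x₀ ((chartAt W x₀).symm y) y))
      = ContinuousLinearMap.id ℂ W := by
    have e := chartTrans_chartTrans hz
    have h3 : dC x₀ y = fderiv ℂ (chartTrans x₀ ((chartAt W x₀).symm y))
      (chartTrans ((chartAt W x₀).symm y) x₀ (chartTrans x₀ ((chartAt W x₀).symm y) y)) := by
      rw [e]; rfl
    rw [h3, ← fderiv_comp _ (by rw [e]; exact h.differentiableAt (by simp))
      (h'.differentiableAt (by simp))]
    have : chartTrans x₀ ((chartAt W x₀).symm y) ∘ chartTrans ((chartAt W x₀).symm y) x₀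
        =ᶠ[nhds (chartTrans x₀ ((chartAt W x₀).symm y) y)] id := by
      filter_upwards [(isOpen_overlap _ _).mem_nhds (chartTrans_mem hz)] with z' hz'
      exact chartTrans_chartTrans hz'
    rw [this.fderiv_eq, fderiv_id]
  exact Function.bijective_iff_has_inverse.2 ⟨_, fun v => DFunLike.congr_fun h1 v,
    fun v => DFunLike.congr_fun h2 v⟩

/-- The expression of a family of forms on `W`, indexed by `X`, in the preferred chart at `x₀`. -/
def loc (x₀ : X) (a : X → GForm W G) (y : W) : GForm W G :=
  pull ((dC x₀ y).restrictScalars ℝ).toLinearMap (a ((chartAt W x₀).symm y))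

theorem loc_self (x : X) (a : X → GForm W G) : loc x a (chartAt W x x) = a x := by
  rw [loc, dC_chart_self, (chartAt W x).left_inv (mem_chart_source W x)]
  rfl

theorem loc_eq_pull {x₀ x₁ : X} {z : W} (hz : z ∈ overlap W x₀ x₁) (a : X → GForm W G) :
    loc x₀ a z = pull (fderiv ℝ (chartTrans x₀ x₁) z).toLinearMap (loc x₁ a (chartTrans x₀ x₁ z)) := by
  rw [loc, loc, dC_comp hz, symm_chartTrans hz, pull_pull, fderiv_real_eq (contDiffAt_chartTrans hz)]
  rfl

end Charts

section BundleForms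

variable {W : Type*} [NormedAddCommGroup W] [NormedSpace ℂ W]
  {X : Type*} [TopologicalSpace X] [ChartedSpace W X]
  {F : Type*} [NormedAddCommGroup F] [NormedSpace ℂ F]
  {E : X → Type*} [∀ x, AddCommGroup (E x)] [∀ x, Module ℂ (E x)]
  [∀ x, TopologicalSpace (E x)] [TopologicalSpace (Bundle.TotalSpace F E)]
  [FiberBundle F E] [VectorBundle ℂ F E]

variable (F) in
/-- An `E`-valued form in the frame given by the preferred trivialization at `x₀`. -/
def flat (x₀ : X) (u : EForm W E) (p : X) : GForm W F :=
  mapV (M := Tan W p) (((trivializationAt F E x₀).linearMapAt ℂ p).restrictScalars ℝ) (u p)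

variable (F) in
/-- An `E`-valued form in the preferred chart and the preferred trivialization at `x₀`. -/
def lf (x₀ : X) (u : EForm W E) : W → GForm W F := loc x₀ (flat F x₀ u)

/-- The matrix of the change from the frame at `x₁` to the frame at `x₀`. -/
def frameChange (F : Type*) [NormedAddCommGroup F] [NormedSpace ℂ F]
    (E : X → Type*) [∀ x, AddCommGroup (E x)] [∀ x, Module ℂ (E x)]
    [∀ x, TopologicalSpace (E x)] [TopologicalSpace (Bundle.TotalSpace F E)]
    [FiberBundle F E] [VectorBundle ℂ F E] (x₀ x₁ p : X) : F →L[ℂ] F :=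
  ((trivializationAt F E x₁).coordChangeL ℂ (trivializationAt F E x₀) p : F →L[ℂ] F)

theorem frameChange_apply {x₀ x₁ p : X} (h₀ : p ∈ (trivializationAt F E x₀).baseSet)
    (h₁ : p ∈ (trivializationAt F E x₁).baseSet) (s : F) :
    frameChange F E x₀ x₁ p s = (trivializationAt F E x₀).linearMapAt ℂ p
      ((trivializationAt F E x₁).symmₗ ℂ p s) := by
  have h : ⇑((trivializationAt F E x₀).linearMapAt ℂ p) = _ :=
    Bundle.Trivialization.coe_linearMapAt_of_mem _ h₀
  rw [h, Bundle.Trivialization.coe_symmₗ _ h₁]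
  exact Bundle.Trivialization.coordChangeL_apply (R := ℂ) (trivializationAt F E x₁)
    (trivializationAt F E x₀) ⟨h₁, h₀⟩ s

theorem frameChange_linearMapAt {x₀ x₁ p : X} (h₀ : p ∈ (trivializationAt F E x₀).baseSet)
    (h₁ : p ∈ (trivializationAt F E x₁).baseSet) (s : E p) :
    frameChange F E x₀ x₁ p ((trivializationAt F E x₁).linearMapAt ℂ p s) =
      (trivializationAt F E x₀).linearMapAt ℂ p s := by
  rw [frameChange_apply h₀ h₁, Bundle.Trivialization.symmₗ_linearMapAt _ h₁]

theorem symmₗ_frameChange {x₀ x₁ p : X} (h₀ : p ∈ (trivializationAt F E x₀).baseSet)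
    (h₁ : p ∈ (trivializationAt F E x₁).baseSet) (s : F) :
    (trivializationAt F E x₀).symmₗ ℂ p (frameChange F E x₀ x₁ p s) =
      (trivializationAt F E x₁).symmₗ ℂ p s := by
  rw [frameChange_apply h₀ h₁, Bundle.Trivialization.symmₗ_linearMapAt _ h₀]

theorem flat_injective {x p : X} (h : p ∈ (trivializationAt F E x).baseSet) {u v : EForm W E}
    (huv : flat F x u p = flat F x v p) : u p = v p := by
  funext k
  ext w
  have h1 := DFunLike.congr_fun (congrFun huv k) w
  have h2 := congrArg ((trivializationAt F E x).symmₗ ℂ p) h1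
  exact ((Bundle.Trivialization.symmₗ_linearMapAt _ h _).symm.trans h2).trans
    (Bundle.Trivialization.symmₗ_linearMapAt _ h _)

theorem ext_flat {u v : EForm W E} (h : ∀ x, flat F x u x = flat F x v x) : u = v :=
  funext fun x => flat_injective (FiberBundle.mem_baseSet_trivializationAt F E x) (h x)

/-- The points in the chart at `x₀` that lie in the charts and trivializations at `x₀` and `x₁`. -/
def overlapE (W : Type*) [NormedAddCommGroup W] [NormedSpace ℂ W]
    {X : Type*} [TopologicalSpace X] [ChartedSpace W X]
    (F : Type*) [NormedAddCommGroup F] [NormedSpace ℂ F]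
    (E : X → Type*) [∀ x, AddCommGroup (E x)] [∀ x, Module ℂ (E x)]
    [∀ x, TopologicalSpace (E x)] [TopologicalSpace (Bundle.TotalSpace F E)]
    [FiberBundle F E] (x₀ x₁ : X) : Set W :=
  overlap W x₀ x₁ ∩ ((chartAt W x₀).target ∩ (chartAt W x₀).symm ⁻¹'
    ((trivializationAt F E x₀).baseSet ∩ (trivializationAt F E x₁).baseSet))

theorem isOpen_overlapE (x₀ x₁ : X) : IsOpen (overlapE W F E x₀ x₁) :=
  (isOpen_overlap x₀ x₁).inter ((chartAt W x₀).symm.isOpen_inter_preimage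
    ((trivializationAt F E x₀).open_baseSet.inter (trivializationAt F E x₁).open_baseSet))

theorem isOpen_localDomain (x₀ : X) : IsOpen (localDomain W F E x₀) :=
  (chartAt W x₀).symm.isOpen_inter_preimage (trivializationAt F E x₀).open_baseSet

theorem mem_overlapE_symm {x₀ : X} {y : W} (hy : y ∈ localDomain W F E x₀) :
    y ∈ overlapE W F E x₀ ((chartAt W x₀).symm y) :=
  ⟨⟨hy.1, mem_chart_source W _⟩, hy.1, hy.2, FiberBundle.mem_baseSet_trivializationAt F E _⟩

theorem chart_mem_localDomain (x : X) : chartAt W x x ∈ localDomain W F E x := by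
  refine ⟨mem_chart_target W x, ?_⟩
  rw [Set.mem_preimage, (chartAt W x).left_inv (mem_chart_source W x)]
  exact FiberBundle.mem_baseSet_trivializationAt F E x

theorem localDomain_mem_nhds (x : X) : localDomain W F E x ∈ nhds (chartAt W x x) :=
  (isOpen_localDomain x).mem_nhds (chart_mem_localDomain x)

theorem flat_eq {x₀ x₁ p : X} (h₀ : p ∈ (trivializationAt F E x₀).baseSet)
    (h₁ : p ∈ (trivializationAt F E x₁).baseSet) (u : EForm W E) :
    flat F x₀ u p = mapV ((frameChange F E x₀ x₁ p).toLinearMap.restrictScalars ℝ)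
      (flat F x₁ u p) := by
  funext k
  ext w
  exact (frameChange_linearMapAt h₀ h₁ _).symm

variable [IsManifold 𝓘(ℂ, W) ω X]

theorem lf_self (x : X) (u : EForm W E) : lf F x u (chartAt W x x) = flat F x u x := loc_self x _

theorem lf_eq {x₀ x₁ : X} {z : W} (hz : z ∈ overlapE W F E x₀ x₁) (u : EForm W E) :
    lf F x₀ u z = mapV ((frameChange F E x₀ x₁ ((chartAt W x₀).symm z)).toLinearMap.restrictScalars ℝ)
      (pull (fderiv ℝ (chartTrans x₀ x₁) z).toLinearMap (lf F x₁ u (chartTrans x₀ x₁ z))) := by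
  rw [lf, lf, ← loc_eq_pull hz.1, loc, flat_eq hz.2.2.1 hz.2.2.2]
  rfl

section Holomorphic

variable [FiniteDimensional ℂ F] [ContMDiffVectorBundle ω F E 𝓘(ℂ, W)]

theorem contDiffAt_frameChange {x₀ x₁ : X} {z : W} (hz : z ∈ overlapE W F E x₀ x₁) :
    ContDiffAt ℂ ω (fun z => frameChange F E x₀ x₁ ((chartAt W x₀).symm z)) z := by
  rw [← contMDiffAt_iff_contDiffAt]
  have h1 : ContMDiffAt 𝓘(ℂ, W) 𝓘(ℂ, F →L[ℂ] F) ω (frameChange F E x₀ x₁)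
      ((chartAt W x₀).symm z) :=
    contMDiffAt_coordChangeL hz.2.2.2 hz.2.2.1
  have h2 : ContMDiffAt 𝓘(ℂ, W) 𝓘(ℂ, W) ω (chartAt W x₀).symm z :=
    contMDiffOn_chart_symm.contMDiffAt ((chartAt W x₀).open_target.mem_nhds hz.1.1)
  exact h1.comp z h2

theorem contDiffAt_real_of_complex {V' : Type*} [NormedAddCommGroup V'] [NormedSpace ℂ V']
    {f : W → V'} {z : W} (h : ContDiffAt ℂ ω f z) : ContDiffAt ℝ ∞ f z :=
  (h.restrict_scalars ℝ).of_le le_top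

theorem fderiv_real_I_smul {V' : Type*} [NormedAddCommGroup V'] [NormedSpace ℂ V']
    {f : W → V'} {z : W} (h : ContDiffAt ℂ ω f z) (v : W) :
    fderiv ℝ f z (Complex.I • v) = Complex.I • fderiv ℝ f z v := by
  rw [((h.differentiableAt (by simp)).hasFDerivAt.restrictScalars ℝ).fderiv]
  exact map_smul (fderiv ℂ f z) _ _

theorem contDiffAt_frameChange_apply {x₀ x₁ : X} {z : W} (hz : z ∈ overlapE W F E x₀ x₁) (s : F) :
    ContDiffAt ℂ ω (fun z => frameChange F E x₀ x₁ ((chartAt W x₀).symm z) s) z :=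
  (contDiffAt_frameChange hz).clm_apply contDiffAt_const

variable [FiniteDimensional ℂ W]

theorem smoothAt_pull_chartTrans {G : Type*} [NormedAddCommGroup G] [NormedSpace ℂ G]
    [FiniteDimensional ℂ G] {x₀ x₁ : X} {z : W} (hz : z ∈ overlap W x₀ x₁)
    {a : W → GForm W G} (ha : SmoothAt a (chartTrans x₀ x₁ z)) :
    SmoothAt (fun z => pull (fderiv ℝ (chartTrans x₀ x₁) z).toLinearMap (a (chartTrans x₀ x₁ z))) z := by
  have h := contDiffAt_real_of_complex (contDiffAt_chartTrans hz)
  exact ha.pull h fun v => (h.fderiv_right (by simp)).clm_apply contDiffAt_const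

theorem dol_pull_chartTrans {G : Type*} [NormedAddCommGroup G] [NormedSpace ℂ G]
    [FiniteDimensional ℂ G] {x₀ x₁ : X} {z : W} (hz : z ∈ overlap W x₀ x₁)
    {a : W → GForm W G} (ha : SmoothAt a (chartTrans x₀ x₁ z)) (c : ℂ) :
    dol c (fun z => pull (fderiv ℝ (chartTrans x₀ x₁) z).toLinearMap (a (chartTrans x₀ x₁ z))) z =
      pull (fderiv ℝ (chartTrans x₀ x₁) z).toLinearMap (dol c a (chartTrans x₀ x₁ z)) := by
  refine dol_pull ha (contDiffAt_real_of_complex (contDiffAt_chartTrans hz)) ?_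
    (smoothAt_pull_chartTrans hz ha) (Filter.Eventually.of_forall fun _ => rfl) c
  filter_upwards [(isOpen_overlap x₀ x₁).mem_nhds hz] with z' hz' v
  exact fderiv_real_I_smul (contDiffAt_chartTrans hz') v

/-- Smoothness of an `E`-valued form. -/
def IsSmooth (F : Type*) [NormedAddCommGroup F] [NormedSpace ℂ F]
    {E : X → Type*} [∀ x, AddCommGroup (E x)] [∀ x, Module ℂ (E x)]
    [∀ x, TopologicalSpace (E x)] [TopologicalSpace (Bundle.TotalSpace F E)]
    [FiberBundle F E] [VectorBundle ℂ F E] (u : EForm W E) : Prop :=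
  ∀ x : X, SmoothAt (lf F x u) (chartAt W x x)

theorem IsSmooth.smoothAt {u : EForm W E} (hu : IsSmooth F u) {x₀ : X} {y : W}
    (hy : y ∈ localDomain W F E x₀) : SmoothAt (lf F x₀ u) y := by
  have hz := mem_overlapE_symm hy
  have h1 : SmoothAt (lf F ((chartAt W x₀).symm y) u)
    (chartTrans x₀ ((chartAt W x₀).symm y) y) := hu _
  refine SmoothAt.congr (SmoothAt.mapV_var
    (fun s => contDiffAt_real_of_complex (contDiffAt_frameChange_apply hz s))
    (smoothAt_pull_chartTrans hz.1 h1)) ?_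
  filter_upwards [(isOpen_overlapE x₀ _).mem_nhds hz] with z hz'
  exact lf_eq hz' u

theorem localForm_eq (x₀ : X) (k : ℕ) (u : EForm W E) {y : W} (hy : y ∈ (chartAt W x₀).target) :
    localForm F x₀ k u y = toCont (lf F x₀ u y k) := by
  ext w
  have h : (fun i => dChartSymm x₀ y (w i)) = fun i => dC x₀ y (w i) :=
    funext fun i => dChartSymm_apply x₀ hy (w i)
  exact congrArg (fun w' => (trivializationAt F E x₀).linearMapAt ℂ ((chartAt W x₀).symm y)
    (u ((chartAt W x₀).symm y) k w')) h

theorem localForm_eventuallyEq (x : X) (k : ℕ) (u : EForm W E) :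
    localForm F x k u =ᶠ[nhds (chartAt W x x)] fun z => toCont (lf F x u z k) := by
  filter_upwards [(chartAt W x).open_target.mem_nhds (mem_chart_target W x)] with z hz
  exact localForm_eq x k u hz

theorem mem_V_iff {u : EForm W E} :
    u ∈ V W F E ↔ IsSmooth F u ∧ ∃ K : Set X, IsCompact K ∧ ∀ x ∉ K, u x = 0 := by
  refine and_congr_left fun _ => ⟨fun h x k => ?_, fun h x k y hy => ?_⟩
  · exact ((h x k).contDiffAt (localDomain_mem_nhds x)).congr_of_eventuallyEq
      (localForm_eventuallyEq x k u).symm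
  · refine ContDiffAt.contDiffWithinAt ?_
    refine ((h.smoothAt hy) k).congr_of_eventuallyEq ?_
    filter_upwards [(isOpen_localDomain x).mem_nhds hy] with z hz
    exact localForm_eq x k u hz.1

/-- The transformation rule of `∂̄`. -/
theorem dol_I_lf {u : EForm W E} (hu : IsSmooth F u) {x₀ x₁ : X} {z : W}
    (hz : z ∈ overlapE W F E x₀ x₁) (hz₁ : chartTrans x₀ x₁ z ∈ localDomain W F E x₁) :
    dol Complex.I (lf F x₀ u) z =
      mapV ((frameChange F E x₀ x₁ ((chartAt W x₀).symm z)).toLinearMap.restrictScalars ℝ)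
      (pull (fderiv ℝ (chartTrans x₀ x₁) z).toLinearMap
        (dol Complex.I (lf F x₁ u) (chartTrans x₀ x₁ z))) := by
  have h1 := hu.smoothAt hz₁
  have h2 : lf F x₀ u =ᶠ[nhds z] fun z =>
      mapV ((frameChange F E x₀ x₁ ((chartAt W x₀).symm z)).toLinearMap.restrictScalars ℝ)
        (pull (fderiv ℝ (chartTrans x₀ x₁) z).toLinearMap (lf F x₁ u (chartTrans x₀ x₁ z))) := by
    filter_upwards [(isOpen_overlapE x₀ x₁).mem_nhds hz] with z' hz'
    exact lf_eq hz' u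
  rw [dol_congr _ h2, ← dol_pull_chartTrans hz.1 h1]
  refine dol_mapV_var Complex.I_mul_I
    (fun s => contDiffAt_real_of_complex (contDiffAt_frameChange_apply hz s)) (fun s v => ?_)
    (smoothAt_pull_chartTrans hz.1 h1)
  exact fderiv_real_I_smul (contDiffAt_frameChange_apply hz s) v

theorem flat_fromLocal (x : X) {u : EForm W E} {k : ℕ} {a : W [⋀^Fin k]→L[ℝ] F}
    (h : u x k = fromLocal F x a) : flat F x u x k = a.toAlternatingMap := by
  ext w
  have h1 : (fun i => dChart x (w i)) = w := funext fun i => dChart_apply x (w i)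
  have h2 : flat F x u x k w = (trivializationAt F E x).linearMapAt ℂ x
    ((trivializationAt F E x).symmₗ ℂ x (a fun i => dChart x (w i))) :=
    congrArg (fun b : Tan W x [⋀^Fin k]→ₗ[ℝ] E x =>
      (trivializationAt F E x).linearMapAt ℂ x (b w)) h
  rw [h2, Bundle.Trivialization.linearMapAt_symmₗ _
    (FiberBundle.mem_baseSet_trivializationAt F E x)]
  exact congrArg a h1

theorem flat_dbarE (u : EForm W E) (x : X) :
    flat F x (dbarE F u) x = dol Complex.I (lf F x u) (chartAt W x x) := by
  funext k
  cases k with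
  | zero =>
    ext w
    exact map_zero ((trivializationAt F E x).linearMapAt ℂ x)
  | succ k =>
    rw [flat_fromLocal x (rfl : dbarE F u x (k + 1) = fromLocal F x
      (dbarLocal (localForm F x k u) (chartAt W x x)))]
    have h : dbarLocal (localForm F x k u) (chartAt W x x) = toCont (dol Complex.I (lf F x u)
        (chartAt W x x) (k + 1)) := by
      rw [toCont_dol_I, dbarLocal, dbarLocal, (localForm_eventuallyEq x k u).fderiv_eq]
    rw [h]
    rfl

theorem lf_dbarE {u : EForm W E} (hu : IsSmooth F u) {x₀ : X} {y : W}
    (hy : y ∈ localDomain W F E x₀) : lf F x₀ (dbarE F u) y = dol Complex.I (lf F x₀ u) y := by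
  have hz := mem_overlapE_symm hy
  have hs : chartTrans x₀ ((chartAt W x₀).symm y) y = chartAt W _ ((chartAt W x₀).symm y) := rfl
  rw [lf_eq hz, dol_I_lf hu hz (by rw [hs]; exact chart_mem_localDomain _), hs, lf_self, flat_dbarE]

theorem lf_dbarE_eventuallyEq {u : EForm W E} (hu : IsSmooth F u) (x : X) :
    lf F x (dbarE F u) =ᶠ[nhds (chartAt W x x)] dol Complex.I (lf F x u) := by
  filter_upwards [localDomain_mem_nhds (F := F) (E := E) x] with z hz
  exact lf_dbarE hu hz

theorem IsSmooth.dbarE {u : EForm W E} (hu : IsSmooth F u) : IsSmooth F (dbarE F u) := fun x =>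
  ((hu x).dol Complex.I).congr (lf_dbarE_eventuallyEq hu x)

theorem dbarE_dbarE {u : EForm W E} (hu : IsSmooth F u) : dbarE F (dbarE F u) = 0 := by
  refine ext_flat (F := F) fun x => ?_
  rw [flat_dbarE, dol_congr _ (lf_dbarE_eventuallyEq hu x), dol_dol (hu x)]
  exact (map_zero (mapV (M := Tan W x) _)).symm

end Holomorphic

end BundleForms

section Connection

variable {W : Type*} [NormedAddCommGroup W] [NormedSpace ℂ W]
  {X : Type*} [TopologicalSpace X] [ChartedSpace W X]
  {F : Type*} [NormedAddCommGroup F] [NormedSpace ℂ F] [FiniteDimensional ℂ F]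
  {E : X → Type*} [∀ x, AddCommGroup (E x)] [∀ x, Module ℂ (E x)]
  [∀ x, TopologicalSpace (E x)] [TopologicalSpace (Bundle.TotalSpace F E)]
  [FiberBundle F E] [VectorBundle ℂ F E]

theorem symmₗ_injective {x p : X} (h : p ∈ (trivializationAt F E x).baseSet) :
    Function.Injective ((trivializationAt F E x).symmₗ ℂ p) := fun s t hst => by
  rw [← Bundle.Trivialization.linearMapAt_symmₗ (R := ℂ) (trivializationAt F E x) h s, hst,
    Bundle.Trivialization.linearMapAt_symmₗ _ h]

namespace HermitianMetric

variable (h : HermitianMetric (W := W) F E)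

theorem gram_apply (x p : X) (s : F) (j : Fin (Module.finrank ℂ F)) :
    h.gram x p s j = h.toFun p ((trivializationAt F E x).symmₗ ℂ p s)
      ((trivializationAt F E x).symmₗ ℂ p (Module.finBasis ℂ F j)) := rfl

theorem toFun_symmₗ (x p : X) (s t : F) :
    h.toFun p ((trivializationAt F E x).symmₗ ℂ p s) ((trivializationAt F E x).symmₗ ℂ p t) =
      ∑ j, conj ((Module.finBasis ℂ F).repr t j) * h.gram x p s j := by
  conv_lhs => rw [← (Module.finBasis ℂ F).sum_repr t]
  simp only [map_sum, LinearMap.map_smulₛₗ, RingHom.id_apply, gram_apply, smul_eq_mul]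

theorem gram_bijective {x p : X} (hp : p ∈ (trivializationAt F E x).baseSet) :
    Function.Bijective (h.gram x p) := by
  have hinj : Function.Injective (h.gram x p) := by
    refine (injective_iff_map_eq_zero _).2 fun s hs => ?_
    by_contra hne
    have h1 := h.toFun_symmₗ x p s s
    simp only [hs, Pi.zero_apply, mul_zero, Finset.sum_const_zero] at h1
    have h2 := h.pos p ((trivializationAt F E x).symmₗ ℂ p s) fun h0 =>
      hne (symmₗ_injective hp (h0.trans (map_zero _).symm))
    rw [h1] at h2
    exact lt_irrefl _ h2
  refine ⟨hinj, ?_⟩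
  exact (LinearMap.injective_iff_surjective_of_finrank_eq_finrank (by simp)).1 hinj

/-- The matrix by which the lowered components of a section transform. -/
def frameConj (F : Type*) [NormedAddCommGroup F] [NormedSpace ℂ F] [FiniteDimensional ℂ F]
    (E : X → Type*) [∀ x, AddCommGroup (E x)] [∀ x, Module ℂ (E x)]
    [∀ x, TopologicalSpace (E x)] [TopologicalSpace (Bundle.TotalSpace F E)]
    [FiberBundle F E] [VectorBundle ℂ F E] (x₀ x₁ p : X) :
    (Fin (Module.finrank ℂ F) → ℂ) →ₗ[ℂ] (Fin (Module.finrank ℂ F) → ℂ) :=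
  LinearMap.pi fun j => ∑ i, conj ((Module.finBasis ℂ F).repr
    (frameChange F E x₀ x₁ p (Module.finBasis ℂ F j)) i) • LinearMap.proj i

theorem frameConj_apply (x₀ x₁ p : X) (v : Fin (Module.finrank ℂ F) → ℂ)
    (j : Fin (Module.finrank ℂ F)) : frameConj F E x₀ x₁ p v j =
      ∑ i, conj ((Module.finBasis ℂ F).repr
        (frameChange F E x₀ x₁ p (Module.finBasis ℂ F j)) i) * v i := by
  simp [frameConj]

theorem gram_eq_frameConj {x₀ x₁ p : X} (h₀ : p ∈ (trivializationAt F E x₀).baseSet)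
    (h₁ : p ∈ (trivializationAt F E x₁).baseSet) (s : F) :
    h.gram x₁ p s = frameConj F E x₀ x₁ p (h.gram x₀ p (frameChange F E x₀ x₁ p s)) := by
  funext j
  rw [frameConj_apply, ← toFun_symmₗ, symmₗ_frameChange h₀ h₁, symmₗ_frameChange h₀ h₁, gram_apply]

theorem frameConj_injective (h : HermitianMetric (W := W) F E) {x₀ x₁ p : X} (h₀ : p ∈ (trivializationAt F E x₀).baseSet)
    (h₁ : p ∈ (trivializationAt F E x₁).baseSet) : Function.Injective (frameConj F E x₀ x₁ p) := by
  rw [LinearMap.injective_iff_surjective]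
  intro v
  obtain ⟨s, hs⟩ := (h.gram_bijective h₁).2 v
  exact ⟨_, (h.gram_eq_frameConj h₀ h₁ s).symm.trans hs⟩

/-- The form `u` with its bundle index lowered by the metric, in the preferred chart and
trivialization at `x₀`. -/
def lower (x₀ : X) (u : EForm W E) (z : W) : GForm W (Fin (Module.finrank ℂ F) → ℂ) :=
  mapV ((h.gram x₀ ((chartAt W x₀).symm z)).restrictScalars ℝ) (lf F x₀ u z)

theorem contDiffAt_gram {x₀ : X} {z : W} (hz : z ∈ localDomain W F E x₀) (s : F) :
    ContDiffAt ℝ ∞ (fun z => h.gram x₀ ((chartAt W x₀).symm z) s) z := by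
  refine contDiffAt_pi.2 fun j => ?_
  refine ((h.smooth x₀ s (Module.finBasis ℂ F j)).contDiffAt
    ((isOpen_localDomain x₀).mem_nhds hz)).congr_of_eventuallyEq ?_
  filter_upwards [(isOpen_localDomain x₀).mem_nhds hz] with y hy
  have e : ⇑((trivializationAt F E x₀).symmₗ ℂ ((chartAt W x₀).symm y)) = _ :=
    Bundle.Trivialization.coe_symmₗ _ hy.2
  rw [gram_apply, e]

end HermitianMetric

theorem mapV_injective {M N N' : Type*} [AddCommGroup M] [Module ℝ M] [AddCommGroup N] [Module ℝ N]
    [AddCommGroup N'] [Module ℝ N'] {g : N →ₗ[ℝ] N'} (hg : Function.Injective g) :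
    Function.Injective (mapV (M := M) g) := fun u v huv => by
  funext k
  ext w
  exact hg (DFunLike.congr_fun (congrFun huv k) w)

variable [IsManifold 𝓘(ℂ, W) ω X] [ContMDiffVectorBundle ω F E 𝓘(ℂ, W)] [FiniteDimensional ℂ W]

namespace HermitianMetric

variable (h : HermitianMetric (W := W) F E)

theorem smoothAt_lower {u : EForm W E} (hu : IsSmooth F u) {x₀ : X} {z : W}
    (hz : z ∈ localDomain W F E x₀) : SmoothAt (h.lower x₀ u) z :=
  SmoothAt.mapV_var (h.contDiffAt_gram hz) (hu.smoothAt hz)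

theorem flat_delE (u : EForm W E) (x : X) :
    mapV ((h.gram x x).restrictScalars ℝ) (flat F x (delE h u) x) =
      dol (-Complex.I) (h.lower x u) (chartAt W x x) := by
  funext k
  cases k with
  | zero =>
    ext1 w
    exact (congrArg (h.gram x x) (map_zero ((trivializationAt F E x).linearMapAt ℂ x))).trans
      (map_zero _)
  | succ k =>
    have hb := h.gram_bijective (FiberBundle.mem_baseSet_trivializationAt F E x)
    let e := (LinearEquiv.ofBijective (h.gram x x) hb).toContinuousLinearEquiv
    have he : (h.gram x x).toContinuousLinearMap = e := by ext; rfl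
    have h0 := flat_fromLocal (F := F) x (rfl : delE h u x (k + 1) = _)
    have h1 : mapV ((h.gram x x).restrictScalars ℝ) (flat F x (delE h u) x) (k + 1) =
        ((h.gram x x).restrictScalars ℝ).compAlternatingMap (flat F x (delE h u) x (k + 1)) := rfl
    rw [h1, h0, he, ContinuousLinearMap.inverse_equiv]
    have h2 : (fun y => ((h.gram x ((chartAt W x).symm y)).toContinuousLinearMap.restrictScalars
        ℝ).compContinuousAlternatingMap (localForm F x k u y)) =ᶠ[nhds (chartAt W x x)]
        fun z => toCont (h.lower x u z k) := by
      filter_upwards [localForm_eventuallyEq (F := F) x k u] with z hz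
      rw [hz]
      rfl
    have h3 : delLocal (fun y => ((h.gram x
        ((chartAt W x).symm y)).toContinuousLinearMap.restrictScalars
        ℝ).compContinuousAlternatingMap (localForm F x k u y)) (chartAt W x x) =
        toCont (dol (-Complex.I) (h.lower x u) (chartAt W x x) (k + 1)) := by
      rw [toCont_dol_neg_I, delLocal, delLocal, h2.fderiv_eq]
    rw [h3]
    ext w
    exact congrFun (e.apply_symm_apply _) _

theorem lower_eq {x₀ x₁ : X} {z : W} (hz : z ∈ overlapE W F E x₀ x₁) (u : EForm W E) :
    pull (fderiv ℝ (chartTrans x₀ x₁) z).toLinearMap (h.lower x₁ u (chartTrans x₀ x₁ z)) =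
      mapV ((frameConj F E x₀ x₁ ((chartAt W x₀).symm z)).restrictScalars ℝ)
        (h.lower x₀ u z) := by
  rw [lower, lower, pull_mapV, lf_eq hz, symm_chartTrans hz.1]
  funext k
  ext1 w
  exact h.gram_eq_frameConj hz.2.2.1 hz.2.2.2 _

theorem contDiffAt_frameConj {x₀ x₁ : X} {z : W} (hz : z ∈ overlapE W F E x₀ x₁)
    (v : Fin (Module.finrank ℂ F) → ℂ) :
    ContDiffAt ℝ ∞ (fun z => frameConj F E x₀ x₁ ((chartAt W x₀).symm z) v) z ∧
    ∀ w, fderiv ℝ (fun z => frameConj F E x₀ x₁ ((chartAt W x₀).symm z) v) z (Complex.I • w) =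
      -Complex.I • fderiv ℝ (fun z => frameConj F E x₀ x₁ ((chartAt W x₀).symm z) v) z w := by
  have hc : ∀ i j, ContDiffAt ℂ ω (fun z => (Module.finBasis ℂ F).repr
      (frameChange F E x₀ x₁ ((chartAt W x₀).symm z) (Module.finBasis ℂ F j)) i) z := fun i j =>
    ((Module.finBasis ℂ F).coord i).toContinuousLinearMap.contDiff.contDiffAt.comp z
      (contDiffAt_frameChange_apply hz _)
  have hd : ∀ j, ContDiffAt ℝ ∞
      (fun z => frameConj F E x₀ x₁ ((chartAt W x₀).symm z) v j) z := by
    intro j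
    simp only [frameConj_apply]
    exact ContDiffAt.sum fun i _ => (Complex.conjCLE.contDiff.contDiffAt.comp z
      (contDiffAt_real_of_complex (hc i j))).mul contDiffAt_const
  refine ⟨contDiffAt_pi.2 hd, fun w => ?_⟩
  have hp := hasFDerivAt_pi.2 fun j => ((hd j).differentiableAt (by simp)).hasFDerivAt
  have hp' : ∀ w j, fderiv ℝ (fun z => frameConj F E x₀ x₁ ((chartAt W x₀).symm z) v) z w j =
      fderiv ℝ (fun z => frameConj F E x₀ x₁ ((chartAt W x₀).symm z) v j) z w := fun w j =>
    congrFun (DFunLike.congr_fun hp.fderiv w) j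
  funext j
  rw [Pi.smul_apply, hp', hp']
  simp only [frameConj_apply]
  have hi : ∀ i, HasFDerivAt (fun z => conj ((Module.finBasis ℂ F).repr
      (frameChange F E x₀ x₁ ((chartAt W x₀).symm z) (Module.finBasis ℂ F j)) i) * v i)
      (v i • (Complex.conjCLE.toContinuousLinearMap.comp (fderiv ℝ (fun z =>
        (Module.finBasis ℂ F).repr
        (frameChange F E x₀ x₁ ((chartAt W x₀).symm z) (Module.finBasis ℂ F j)) i) z))) z := by
    intro i
    exact (Complex.conjCLE.toContinuousLinearMap.hasFDerivAt.comp z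
      ((contDiffAt_real_of_complex (hc i j)).differentiableAt (by simp)).hasFDerivAt).mul_const _
  have hs := HasFDerivAt.fun_sum (u := Finset.univ) fun i _ => hi i
  rw [hs.fderiv]
  simp only [_root_.sum_apply, ContinuousLinearMap.smul_apply, ContinuousLinearMap.comp_apply,
    fderiv_real_I_smul (hc _ j), smul_eq_mul, Finset.mul_sum]
  refine Finset.sum_congr rfl fun i _ => ?_
  simp
  ring

theorem dol_neg_I_lower {u : EForm W E} (hu : IsSmooth F u) {x₀ x₁ : X} {z : W}
    (hz : z ∈ overlapE W F E x₀ x₁) (hz₀ : z ∈ localDomain W F E x₀)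
    (hz₁ : chartTrans x₀ x₁ z ∈ localDomain W F E x₁) :
    pull (fderiv ℝ (chartTrans x₀ x₁) z).toLinearMap
        (dol (-Complex.I) (h.lower x₁ u) (chartTrans x₀ x₁ z)) =
      mapV ((frameConj F E x₀ x₁ ((chartAt W x₀).symm z)).restrictScalars ℝ)
        (dol (-Complex.I) (h.lower x₀ u) z) := by
  have h1 := h.smoothAt_lower hu hz₁
  rw [← dol_pull_chartTrans hz.1 h1]
  have h2 : (fun z => pull (fderiv ℝ (chartTrans x₀ x₁) z).toLinearMap
      (h.lower x₁ u (chartTrans x₀ x₁ z))) =ᶠ[nhds z] fun z =>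
      mapV ((frameConj F E x₀ x₁ ((chartAt W x₀).symm z)).restrictScalars ℝ) (h.lower x₀ u z) := by
    filter_upwards [(isOpen_overlapE x₀ x₁).mem_nhds hz] with z' hz'
    exact h.lower_eq hz' u
  rw [dol_congr _ h2]
  exact dol_mapV_var (by rw [neg_mul_neg, Complex.I_mul_I])
    (fun v => (contDiffAt_frameConj hz v).1) (fun v => (contDiffAt_frameConj hz v).2)
    (h.smoothAt_lower hu hz₀)

theorem lower_delE {u : EForm W E} (hu : IsSmooth F u) {x₀ : X} {y : W}
    (hy : y ∈ localDomain W F E x₀) :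
    h.lower x₀ (delE h u) y = dol (-Complex.I) (h.lower x₀ u) y := by
  have hz := mem_overlapE_symm hy
  have hs : chartTrans x₀ ((chartAt W x₀).symm y) y = chartAt W _ ((chartAt W x₀).symm y) := rfl
  refine mapV_injective (g := (frameConj F E x₀ ((chartAt W x₀).symm y)
    ((chartAt W x₀).symm y)).restrictScalars ℝ) (h.frameConj_injective hz.2.2.1 hz.2.2.2) ?_
  rw [← h.dol_neg_I_lower hu hz hy (by rw [hs]; exact chart_mem_localDomain _), ← h.lower_eq hz, hs,
    lower, lf_self, (chartAt W _).left_inv (mem_chart_source W _), flat_delE]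

theorem lower_delE_eventuallyEq {u : EForm W E} (hu : IsSmooth F u) (x : X) :
    h.lower x (delE h u) =ᶠ[nhds (chartAt W x x)] dol (-Complex.I) (h.lower x u) := by
  filter_upwards [localDomain_mem_nhds (F := F) (E := E) x] with z hz
  exact h.lower_delE hu hz

theorem isSmooth_of_lower {u : EForm W E} (hu : ∀ x, SmoothAt (h.lower x u) (chartAt W x x)) :
    IsSmooth F u := fun x => by
  refine SmoothAt.of_mapV_var (h.contDiffAt_gram (chart_mem_localDomain x)) ?_ (hu x)
  filter_upwards [localDomain_mem_nhds (F := F) (E := E) x] with z hz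
  exact h.gram_bijective hz.2

theorem isSmooth_delE {u : EForm W E} (hu : IsSmooth F u) : IsSmooth F (delE h u) :=
  h.isSmooth_of_lower fun x => ((h.smoothAt_lower hu (chart_mem_localDomain x)).dol _).congr
    (h.lower_delE_eventuallyEq hu x)

theorem ext_lower {u v : EForm W E}
    (huv : ∀ x, mapV ((h.gram x x).restrictScalars ℝ) (flat F x u x) =
      mapV ((h.gram x x).restrictScalars ℝ) (flat F x v x)) : u = v :=
  ext_flat (F := F) fun x => mapV_injective (g := (h.gram x x).restrictScalars ℝ)
    (h.gram_bijective (FiberBundle.mem_baseSet_trivializationAt F E x)).1 (huv x)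

theorem delE_delE {u : EForm W E} (hu : IsSmooth F u) : delE h (delE h u) = 0 := by
  refine h.ext_lower fun x => ?_
  rw [flat_delE, dol_congr _ (h.lower_delE_eventuallyEq hu x),
    dol_dol (h.smoothAt_lower hu (chart_mem_localDomain x))]
  have h1 : flat F x (0 : EForm W E) x = 0 := map_zero (mapV (M := Tan W x) _)
  rw [h1, map_zero]

end HermitianMetric

end Connection

section DolLemmas

variable {W : Type*} [NormedAddCommGroup W] [NormedSpace ℂ W] [FiniteDimensional ℂ W]
  {G G₁ G₂ : Type*} [NormedAddCommGroup G] [NormedSpace ℂ G] [FiniteDimensional ℂ G]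
  [NormedAddCommGroup G₁] [NormedSpace ℂ G₁] [FiniteDimensional ℂ G₁]
  [NormedAddCommGroup G₂] [NormedSpace ℂ G₂] [FiniteDimensional ℂ G₂]

theorem SmoothAt.csmul {a : W → GForm W G} {y : W} (h : SmoothAt a y) (k : ℂ) :
    SmoothAt (fun z => k • a z) y := h.mapV (smulBilin G k)

theorem dol_csmul (c : ℂ) {a : W → GForm W G} {y : W} (h : SmoothAt a y) (k : ℂ) :
    dol c (fun z => k • a z) y = k • dol c a y :=
  dol_mapV (c' := c) c h (g := smulBilin G k) fun x => smul_comm k c x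

theorem isDeg_dol (c : ℂ) {a : W → GForm W G} {k : ℕ} (h : ∀ z, IsDeg k (a z)) (y : W) :
    IsDeg (k + 1) (dol c a y) := by
  intro j hj
  cases j with
  | zero => rfl
  | succ j =>
    have h1 : ∀ v, dirDeriv a y v j = 0 := by
      intro v
      have h2 : (fun z => toCont (a z j)) = fun _ => toCont 0 := by
        funext z
        rw [h z j (by omega)]
      refine congrArg ContinuousAlternatingMap.toAlternatingMap
        (DFunLike.congr_fun (?_ : fderiv ℝ (fun z => toCont (a z j)) y = 0) v)
      rw [h2, fderiv_fun_const]
      rfl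
    ext w
    rw [dol, altG_succ_apply]
    refine Finset.sum_eq_zero fun i _ => ?_
    have h3 : partL c (dirDeriv a y) (w i) j = 0 := by
      rw [partL_apply]
      change (1 / 2 : ℂ) • (dirDeriv a y _ j + c • dirDeriv a y _ j) = 0
      rw [h1, h1, smul_zero, add_zero, smul_zero]
    rw [h3]
    exact smul_zero _

theorem dol_zero (c : ℂ) (y : W) : dol c (fun _ => (0 : GForm W G)) y = 0 := by
  funext k
  have h0 := isDeg_dol c (a := fun _ => (0 : GForm W G)) (k := k) (fun _ _ _ => rfl) y
  exact h0 k (by omega)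

theorem SmoothAt.single {a : W → GForm W G} {y : W} (h : SmoothAt a y) (k : ℕ) :
    SmoothAt (fun z => Pi.single k (a z k)) y := by
  intro j
  by_cases hj : j = k
  · subst hj
    simpa using h j
  · simp only [Pi.single_eq_of_ne hj]
    exact (contDiffAt_const : ContDiffAt ℝ ∞ (fun _ : W => (0 : W [⋀^Fin j]→L[ℝ] G)) y)

end DolLemmas

section ScalarForms

variable {W : Type*} [NormedAddCommGroup W] [NormedSpace ℂ W]
  {X : Type*} [TopologicalSpace X] [ChartedSpace W X]
  {G : Type*} [AddCommGroup G] [Module ℝ G]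

theorem jf_loc (x₀ : X) (a : X → GForm W G) (y : W) :
    jf (loc x₀ a y) = loc x₀ (fun p => jf (a p)) y := jf_pull (dC x₀ y).toLinearMap _

/-- A complex valued form on `X` as a family of forms on `W`. -/
def untan (a : ∀ x : X, GForm (Tan W x) ℂ) : X → GForm W ℂ := a

variable [IsManifold 𝓘(ℂ, W) ω X] [FiniteDimensional ℂ W]

/-- Smoothness of a complex valued form on `X`. -/
def IsSmoothForm (a : X → GForm W ℂ) : Prop := ∀ x : X, SmoothAt (loc x a) (chartAt W x x)

theorem IsSmoothForm.smoothAt {a : X → GForm W ℂ} (ha : IsSmoothForm a) {x₀ : X} {y : W}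
    (hy : y ∈ (chartAt W x₀).target) : SmoothAt (loc x₀ a) y := by
  have hz : y ∈ overlap W x₀ ((chartAt W x₀).symm y) := ⟨hy, mem_chart_source W _⟩
  have h1 : SmoothAt (loc ((chartAt W x₀).symm y) a)
    (chartTrans x₀ ((chartAt W x₀).symm y) y) := ha _
  refine (smoothAt_pull_chartTrans hz h1).congr ?_
  filter_upwards [(isOpen_overlap x₀ _).mem_nhds hz] with z hz'
  exact loc_eq_pull hz' a

/-- Smooth forms of even degree that are invariant under the Weil operator and closed. -/
structure IsClosedInvariant (a : X → GForm W ℂ) : Prop where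
  smooth : IsSmoothForm a
  sgn_eq : ∀ x, sgn (a x) = a x
  dol_I : ∀ x, dol Complex.I (loc x a) (chartAt W x x) = 0
  dol_neg_I : ∀ x, dol (-Complex.I) (loc x a) (chartAt W x x) = 0
  jf_eq : ∀ x, jf (a x) = a x

theorem chartPull_eq (x₀ : X) (a : ∀ x : X, GForm (Tan W x) ℂ) (k : ℕ) {y : W}
    (hy : y ∈ (chartAt W x₀).target) :
    chartPull x₀ (fun x => a x k) y = toCont (loc x₀ (untan a) y k) := by
  ext w
  have h : (fun i => dChartSymm x₀ y (w i)) = fun i => dC x₀ y (w i) :=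
    funext fun i => dChartSymm_apply x₀ hy (w i)
  exact congrArg (fun w' => a ((chartAt W x₀).symm y) k w') h

theorem IsDClosed.isClosedInvariant {a : ∀ x : X, GForm (Tan W x) ℂ} (ha : IsDClosed a)
    (hs : IsSmoothForm (untan a)) (hj : ∀ x, jf (untan a x) = untan a x)
    (hsgn : ∀ x, sgn (untan a x) = untan a x) : IsClosedInvariant (untan a) := by
  have key : ∀ x, dol Complex.I (loc x (untan a)) (chartAt W x x) = 0 ∧
      dol (-Complex.I) (loc x (untan a)) (chartAt W x x) = 0 := by
    intro x
    refine dol_eq_zero_of_closed (hs x) (fun k => ?_) (Filter.Eventually.of_forall fun z => ?_)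
    · rw [← ha x k]
      refine Filter.EventuallyEq.extDeriv_eq ?_
      filter_upwards [(chartAt W x).open_target.mem_nhds (mem_chart_target W x)] with z hz
      exact (chartPull_eq x a k hz).symm
    · exact (jf_loc x _ z).trans (congrArg (fun b => loc x b z) (funext hj))
  exact ⟨hs, hsgn, fun x => (key x).1, fun x => (key x).2, hj⟩

end ScalarForms

section Operators

variable {W : Type*} [NormedAddCommGroup W] [NormedSpace ℂ W]
  {X : Type*} [TopologicalSpace X] [ChartedSpace W X]
  {F : Type*} [NormedAddCommGroup F] [NormedSpace ℂ F] [FiniteDimensional ℂ F]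
  {E : X → Type*} [∀ x, AddCommGroup (E x)] [∀ x, Module ℂ (E x)]
  [∀ x, TopologicalSpace (E x)] [TopologicalSpace (Bundle.TotalSpace F E)]
  [FiberBundle F E] [VectorBundle ℂ F E]

theorem flat_wedgeE (a : ∀ x : X, GForm (Tan W x) ℂ) (u : EForm W E) (x p : X) :
    flat F x (wedgeE E a u) p = wedge (smulBilin F) (untan a p) (flat F x u p) := by
  have hg : ∀ (c : ℂ) (s : E p), (((trivializationAt F E x).linearMapAt ℂ p).restrictScalars ℝ)
      (smulBilin (E p) c s) = smulBilin F (LinearMap.id (R := ℝ) c)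
        (((trivializationAt F E x).linearMapAt ℂ p).restrictScalars ℝ s) := fun c s =>
    map_smul ((trivializationAt F E x).linearMapAt ℂ p) c s
  exact mapV_wedge (M := Tan W p) hg (a p) (u p)

theorem lf_wedgeE (a : ∀ x : X, GForm (Tan W x) ℂ) (u : EForm W E) (x : X) (z : W) :
    lf F x (wedgeE E a u) z = wedge (smulBilin F) (loc x (untan a) z) (lf F x u z) := by
  rw [lf, loc, flat_wedgeE, pull_wedge]
  rfl

theorem flat_weil (u : EForm W E) (x p : X) : flat F x (weil u) p = jf (flat F x u p) := rfl

theorem lf_weil (u : EForm W E) (x : X) (z : W) : lf F x (weil u) z = jf (lf F x u z) :=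
  (jf_loc x (flat F x u) z).symm

theorem lf_add (u v : EForm W E) (x : X) (z : W) :
    lf F x (u + v) z = lf F x u z + lf F x v z := by
  have h : flat F x (u + v) ((chartAt W x).symm z) =
    flat F x u ((chartAt W x).symm z) + flat F x v ((chartAt W x).symm z) := map_add (mapV _) _ _
  rw [lf, loc, h, map_add]
  rfl

theorem flat_smul (c : ℂ) (u : EForm W E) (x p : X) : flat F x (c • u) p = c • flat F x u p := by
  funext k
  ext w
  exact map_smul ((trivializationAt F E x).linearMapAt ℂ p) c _

theorem lf_smul (c : ℂ) (u : EForm W E) (x : X) (z : W) : lf F x (c • u) z = c • lf F x u z := by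
  rw [lf, loc, flat_smul]
  rfl

theorem lf_comp (k : ℕ) (u : EForm W E) (x : X) (z : W) :
    lf F x (comp k u) z = Pi.single k (lf F x u z k) := by
  funext j
  by_cases hj : j = k
  · subst hj
    rw [Pi.single_eq_same]
    ext w
    change (trivializationAt F E x).linearMapAt ℂ _ ((Pi.single j (u _ j) : GForm _ _) j _) = _
    rw [Pi.single_eq_same]
    rfl
  · rw [Pi.single_eq_of_ne hj]
    ext w
    change (trivializationAt F E x).linearMapAt ℂ _ ((Pi.single k (u _ k) : GForm _ _) j _) = _
    rw [Pi.single_eq_of_ne hj]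
    exact map_zero _

theorem HermitianMetric.lower_wedgeE (h : HermitianMetric (W := W) F E)
    (a : ∀ x : X, GForm (Tan W x) ℂ) (u : EForm W E) (x : X) (z : W) :
    h.lower x (wedgeE E a u) z = wedge (smulBilin _) (loc x (untan a) z) (h.lower x u z) := by
  rw [lower, lf_wedgeE]
  exact mapV_wedge (f := LinearMap.id) (fun c s => map_smul (h.gram x _) c s) _ _

theorem HermitianMetric.lower_weil (h : HermitianMetric (W := W) F E)
    (u : EForm W E) (x : X) (z : W) : h.lower x (weil u) z = jf (h.lower x u z) := by
  rw [lower, lf_weil]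
  rfl

theorem HermitianMetric.lower_add (h : HermitianMetric (W := W) F E)
    (u v : EForm W E) (x : X) (z : W) : h.lower x (u + v) z = h.lower x u z + h.lower x v z := by
  rw [lower, lf_add, map_add]
  rfl

theorem HermitianMetric.lower_smul (h : HermitianMetric (W := W) F E)
    (c : ℂ) (u : EForm W E) (x : X) (z : W) : h.lower x (c • u) z = c • h.lower x u z := by
  rw [lower, lf_smul]
  funext k
  ext1 w
  exact map_smul (h.gram x _) c _

theorem mem_homogeneous_iff {k : ℕ} {u : EForm W E} :
    u ∈ homogeneous W E k ↔ ∀ x, IsDeg (M := Tan W x) k (u x) := Iff.rfl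

theorem comp_mem_homogeneous (k : ℕ) (u : EForm W E) : comp k u ∈ homogeneous W E k :=
  fun x => IsDeg.single (M := Tan W x) k (u x k)

theorem comp_of_mem {k : ℕ} {u : EForm W E} (hu : u ∈ homogeneous W E k) : comp k u = u :=
  funext fun x => (IsDeg.eq_single (M := Tan W x) (hu x)).symm

theorem comp_of_mem_of_ne {k j : ℕ} {u : EForm W E} (hu : u ∈ homogeneous W E k) (hj : j ≠ k) :
    comp j u = 0 := funext fun x => by
  rw [comp, hu x j hj, Pi.single_zero]
  rfl

theorem flat_of_eq_zero {u : EForm W E} {p : X} (x : X) (hu : u p = 0) : flat F x u p = 0 := by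
  rw [flat, hu]
  exact map_zero (mapV (M := Tan W p) _)

theorem isDeg_flat {k : ℕ} {u : EForm W E} (hu : u ∈ homogeneous W E k) (x p : X) :
    IsDeg k (flat F x u p) := IsDeg.mapV (M := Tan W p) (hu p) _

theorem isDeg_lf {k : ℕ} {u : EForm W E} (hu : u ∈ homogeneous W E k) (x : X) (z : W) :
    IsDeg k (lf F x u z) := (isDeg_flat hu x _).pull _

theorem mem_homogeneous_of_flat {k : ℕ} {u : EForm W E} (hu : ∀ x, IsDeg k (flat F x u x)) :
    u ∈ homogeneous W E k := by
  have h : comp k u = u := by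
    refine ext_flat (F := F) fun x => ?_
    refine (isDeg_flat (comp_mem_homogeneous k u) x x).ext (hu x) ?_
    ext w
    change (trivializationAt F E x).linearMapAt ℂ _ ((Pi.single k (u x k) : GForm _ _) k _) = _
    rw [Pi.single_eq_same]
    rfl
  rw [← h]
  exact comp_mem_homogeneous k u

variable [IsManifold 𝓘(ℂ, W) ω X] [ContMDiffVectorBundle ω F E 𝓘(ℂ, W)] [FiniteDimensional ℂ W]

theorem IsSmooth.comp {u : EForm W E} (hu : IsSmooth F u) (k : ℕ) : IsSmooth F (comp k u) :=
  fun x => SmoothAt.congr ((hu x).single k) (Filter.Eventually.of_forall fun z => lf_comp k u x z)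

theorem IsSmooth.weil {u : EForm W E} (hu : IsSmooth F u) : IsSmooth F (weil u) :=
  fun x => SmoothAt.congr ((hu x).pullConst (jmap W))
    (Filter.Eventually.of_forall fun z => lf_weil u x z)

theorem IsSmooth.wedgeE {u : EForm W E} (hu : IsSmooth F u) {a : ∀ x : X, GForm (Tan W x) ℂ}
    (ha : IsSmoothForm (untan a)) : IsSmooth F (wedgeE E a u) := fun x =>
  SmoothAt.congr ((ha x).wedge (hu x) (smulBilin F))
    (Filter.Eventually.of_forall fun z => lf_wedgeE a u x z)

theorem dbarE_add {u v : EForm W E} (hu : IsSmooth F u) (hv : IsSmooth F v) :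
    dbarE F (u + v) = dbarE F u + dbarE F v := by
  refine ext_flat (F := F) fun x => ?_
  have h : lf F x (u + v) = fun z => lf F x u z + lf F x v z := funext fun z => lf_add u v x z
  rw [flat_dbarE, h, dol_add _ (hu x) (hv x), ← flat_dbarE, ← flat_dbarE]
  exact (map_add (mapV (M := Tan W x) _) _ _).symm

theorem dbarE_smul {u : EForm W E} (hu : IsSmooth F u) (c : ℂ) :
    dbarE F (c • u) = c • dbarE F u := by
  refine ext_flat (F := F) fun x => ?_
  have h : lf F x (c • u) = fun z => c • lf F x u z := funext fun z => lf_smul c u x z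
  rw [flat_dbarE, h, dol_csmul _ (hu x), ← flat_dbarE, flat_smul]

theorem dbarE_weil {u : EForm W E} (hu : IsSmooth F u) :
    weil (dbarE F u) = -Complex.I • dbarE F (weil u) := by
  refine ext_flat (F := F) fun x => ?_
  have h : lf F x (weil u) = fun z => jf (lf F x u z) := funext fun z => lf_weil u x z
  rw [flat_weil, flat_dbarE, jf_dol Complex.I_mul_I (hu x), flat_smul, flat_dbarE, h]

theorem dbarE_wedgeE {u : EForm W E} (hu : IsSmooth F u) {a : ∀ x : X, GForm (Tan W x) ℂ}
    (ha : IsClosedInvariant (untan a)) :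
    dbarE F (wedgeE E a u) = wedgeE E a (dbarE F u) := by
  refine ext_flat (F := F) fun x => ?_
  have h : lf F x (wedgeE E a u) = fun z => wedge (smulBilin F) (loc x (untan a) z) (lf F x u z) :=
    funext fun z => lf_wedgeE a u x z
  rw [flat_dbarE, h, dol_wedge (c' := Complex.I) (ha.smooth x) (hu x)
    (fun c s => by simp only [smulBilin_apply, smul_assoc])
    (fun c s => by simp only [smulBilin_apply, smul_comm c]), ha.dol_I, flat_wedgeE, flat_dbarE,
    loc_self, ha.sgn_eq]
  refine add_eq_right.2 ?_
  exact LinearMap.map_zero₂ (wedgeL (smulBilin F)) _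

theorem dbarE_mem_homogeneous {k : ℕ} {u : EForm W E} (hu : u ∈ homogeneous W E k) :
    dbarE F u ∈ homogeneous W E (k + 1) := by
  refine mem_homogeneous_of_flat (F := F) fun x => ?_
  rw [flat_dbarE]
  exact isDeg_dol _ (fun z => isDeg_lf hu x z) _

theorem lf_eventuallyEq_zero {u : EForm W E} {K : Set X} (hK : IsClosed K)
    (hu : ∀ x ∉ K, u x = 0) {x : X} (hx : x ∉ K) :
    lf F x u =ᶠ[nhds (chartAt W x x)] fun _ => 0 := by
  have h1 : ContinuousAt (chartAt W x).symm (chartAt W x x) :=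
    (chartAt W x).continuousAt_symm (mem_chart_target W x)
  have h2 : Kᶜ ∈ nhds ((chartAt W x).symm (chartAt W x x)) := by
    rw [(chartAt W x).left_inv (mem_chart_source W x)]
    exact hK.isOpen_compl.mem_nhds hx
  filter_upwards [h1 h2] with z hz
  rw [lf, loc, flat_of_eq_zero x (hu _ hz), map_zero]

theorem dbarE_eq_zero {u : EForm W E} {K : Set X} (hK : IsClosed K)
    (hu : ∀ x ∉ K, u x = 0) {x : X} (hx : x ∉ K) : dbarE F u x = 0 := by
  refine flat_injective (v := 0) (FiberBundle.mem_baseSet_trivializationAt F E x) ?_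
  rw [flat_dbarE, dol_congr _ (lf_eventuallyEq_zero hK hu hx), dol_zero]
  exact (map_zero (mapV (M := Tan W x) _)).symm

namespace HermitianMetric

variable (h : HermitianMetric (W := W) F E)

theorem delE_add {u v : EForm W E} (hu : IsSmooth F u) (hv : IsSmooth F v) :
    delE h (u + v) = delE h u + delE h v := by
  refine h.ext_lower fun x => ?_
  have e : h.lower x (u + v) = fun z => h.lower x u z + h.lower x v z :=
    funext fun z => h.lower_add u v x z
  have hf : flat F x (delE h u + delE h v) x = flat F x (delE h u) x + flat F x (delE h v) x :=
    map_add (mapV (M := Tan W x) _) _ _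
  rw [flat_delE, e, dol_add _ (h.smoothAt_lower hu (chart_mem_localDomain x))
    (h.smoothAt_lower hv (chart_mem_localDomain x)), ← flat_delE, ← flat_delE, hf, map_add]

theorem mapV_gram_smul (x p : X) (c : ℂ) (u : GForm W F) :
    mapV ((h.gram x p).restrictScalars ℝ) (c • u) = c • mapV ((h.gram x p).restrictScalars ℝ) u := by
  funext k
  ext1 w
  exact map_smul (h.gram x p) c _

theorem delE_smul {u : EForm W E} (hu : IsSmooth F u) (c : ℂ) :
    delE h (c • u) = c • delE h u := by
  refine h.ext_lower fun x => ?_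
  have e : h.lower x (c • u) = fun z => c • h.lower x u z :=
    funext fun z => h.lower_smul c u x z
  rw [flat_delE, e, dol_csmul _ (h.smoothAt_lower hu (chart_mem_localDomain x)), ← flat_delE,
    flat_smul, mapV_gram_smul]

theorem delE_weil {u : EForm W E} (hu : IsSmooth F u) :
    weil (delE h u) = Complex.I • delE h (weil u) := by
  refine h.ext_lower fun x => ?_
  have e : h.lower x (weil u) = fun z => jf (h.lower x u z) :=
    funext fun z => h.lower_weil u x z
  have hj : mapV ((h.gram x x).restrictScalars ℝ) (flat F x (weil (delE h u)) x) =
    jf (mapV ((h.gram x x).restrictScalars ℝ) (flat F x (delE h u) x)) := rfl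
  rw [hj, flat_delE, jf_dol (by rw [neg_mul_neg, Complex.I_mul_I])
    (h.smoothAt_lower hu (chart_mem_localDomain x)), neg_neg, flat_smul, mapV_gram_smul, flat_delE, e]

theorem delE_wedgeE {u : EForm W E} (hu : IsSmooth F u) {a : ∀ x : X, GForm (Tan W x) ℂ}
    (ha : IsClosedInvariant (untan a)) :
    delE h (wedgeE E a u) = wedgeE E a (delE h u) := by
  refine h.ext_lower fun x => ?_
  have e : h.lower x (wedgeE E a u) =
      fun z => wedge (smulBilin _) (loc x (untan a) z) (h.lower x u z) :=
    funext fun z => h.lower_wedgeE a u x z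
  have hw : mapV ((h.gram x x).restrictScalars ℝ) (flat F x (wedgeE E a (delE h u)) x) =
      wedge (smulBilin _) (untan a x)
        (mapV ((h.gram x x).restrictScalars ℝ) (flat F x (delE h u) x)) := by
    rw [flat_wedgeE]
    have hg : ∀ (c : ℂ) (s : F), ((h.gram x x).restrictScalars ℝ)
        (smulBilin F c s) = smulBilin _ (LinearMap.id (R := ℝ) c)
          ((h.gram x x).restrictScalars ℝ s) := fun c s => map_smul (h.gram x x) c s
    exact mapV_wedge hg _ _
  rw [hw, flat_delE, flat_delE, e, dol_wedge (c' := -Complex.I) (ha.smooth x)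
    (h.smoothAt_lower hu (chart_mem_localDomain x))
    (fun c s => by simp only [smulBilin_apply, smul_assoc])
    (fun c s => by simp only [smulBilin_apply, smul_comm c]), ha.dol_neg_I,
    loc_self, ha.sgn_eq]
  refine add_eq_right.2 ?_
  exact LinearMap.map_zero₂ (wedgeL (smulBilin _)) _

theorem delE_mem_homogeneous {k : ℕ} {u : EForm W E} (hu : u ∈ homogeneous W E k) :
    delE h u ∈ homogeneous W E (k + 1) := by
  refine mem_homogeneous_of_flat (F := F) fun x => ?_
  have h1 : IsDeg (k + 1) (mapV ((h.gram x x).restrictScalars ℝ) (flat F x (delE h u) x)) := by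
    rw [flat_delE]
    exact isDeg_dol _ (fun z => (isDeg_lf hu x z).mapV _) _
  intro j hj
  ext w
  have hb := (h.gram_bijective (FiberBundle.mem_baseSet_trivializationAt F E x)).1
  exact hb ((DFunLike.congr_fun (h1 j hj) w).trans (map_zero (h.gram x x)).symm)

theorem delE_eq_zero {u : EForm W E} {K : Set X} (hK : IsClosed K)
    (hu : ∀ x ∉ K, u x = 0) {x : X} (hx : x ∉ K) : delE h u x = 0 := by
  refine flat_injective (v := 0) (FiberBundle.mem_baseSet_trivializationAt F E x) ?_
  refine mapV_injective (g := (h.gram x x).restrictScalars ℝ)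
    (h.gram_bijective (FiberBundle.mem_baseSet_trivializationAt F E x)).1 ?_
  have e : h.lower x u =ᶠ[nhds (chartAt W x x)] fun _ => 0 := by
    filter_upwards [lf_eventuallyEq_zero (F := F) hK hu hx] with z hz
    rw [lower, hz, map_zero]
  have h0 : flat F x (0 : EForm W E) x = 0 := map_zero (mapV (M := Tan W x) _)
  rw [flat_delE, dol_congr _ e, dol_zero, h0, map_zero]

end HermitianMetric

section Compact

variable [T2Space X]

theorem dbarE_mem_V {u : EForm W E} (hu : u ∈ V W F E) : dbarE F u ∈ V W F E := by
  rw [mem_V_iff] at hu ⊢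
  obtain ⟨hs, K, hK, hKu⟩ := hu
  exact ⟨hs.dbarE, K, hK, fun x hx => dbarE_eq_zero (F := F) hK.isClosed hKu hx⟩

theorem delE_mem_V (h : HermitianMetric (W := W) F E) {u : EForm W E} (hu : u ∈ V W F E) :
    delE h u ∈ V W F E := by
  rw [mem_V_iff] at hu ⊢
  obtain ⟨hs, K, hK, hKu⟩ := hu
  exact ⟨h.isSmooth_delE hs, K, hK, fun x hx => h.delE_eq_zero hK.isClosed hKu hx⟩

end Compact

theorem weil_mem_V {u : EForm W E} (hu : u ∈ V W F E) : weil u ∈ V W F E := by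
  rw [mem_V_iff] at hu ⊢
  obtain ⟨hs, K, hK, hKu⟩ := hu
  refine ⟨IsSmooth.weil (F := F) hs, K, hK, fun x hx => ?_⟩
  have h1 : weil u x = jf (W := W) (u x) := rfl
  rw [h1, hKu x hx]
  exact map_zero (jf (W := W))

theorem comp_mem_V {u : EForm W E} (hu : u ∈ V W F E) (k : ℕ) : comp k u ∈ V W F E := by
  rw [mem_V_iff] at hu ⊢
  obtain ⟨hs, K, hK, hKu⟩ := hu
  refine ⟨hs.comp k, K, hK, fun x hx => ?_⟩
  rw [comp, hKu x hx]
  exact Pi.single_zero k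

theorem wedgeE_mem_V {u : EForm W E} (hu : u ∈ V W F E) {a : ∀ x : X, GForm (Tan W x) ℂ}
    (ha : IsSmoothForm (untan a)) : wedgeE E a u ∈ V W F E := by
  rw [mem_V_iff] at hu ⊢
  obtain ⟨hs, K, hK, hKu⟩ := hu
  refine ⟨hs.wedgeE ha, K, hK, fun x hx => ?_⟩
  have h1 : wedgeE E a u x = wedgeL (M := Tan W x) (smulBilin (E x)) (a x) (u x) := rfl
  rw [h1, hKu x hx, map_zero]

end Operators

section WedgeDegree

variable {M N₁ N₂ N₃ : Type*} [AddCommGroup M] [Module ℝ M]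
  [AddCommGroup N₁] [Module ℝ N₁] [AddCommGroup N₂] [Module ℝ N₂] [AddCommGroup N₃] [Module ℝ N₃]

theorem wedge_apply_eq_sum (B : N₁ →ₗ[ℝ] N₂ →ₗ[ℝ] N₃) (t : GForm M N₁) (u : GForm M N₂) (k : ℕ) :
    wedge B t u k = ∑ j ∈ Finset.range (k + 1), wedge B t (Pi.single j (u j) : GForm M N₂) k := by
  have h1 : wedge B t u k =
      wedge B t (∑ j ∈ Finset.range (k + 1), (Pi.single j (u j) : GForm M N₂)) k := by
    refine wedge_congr_deg B (fun _ _ => rfl) fun i hi => ?_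
    rw [Finset.sum_apply, Finset.sum_eq_single i]
    · rw [Pi.single_eq_same]
    · intro j _ hj
      exact Pi.single_eq_of_ne hj.symm _
    · intro h
      exact absurd (Finset.mem_range.2 (by omega)) h
  rw [h1, ← wedgeL_apply, map_sum, Finset.sum_apply]
  rfl

theorem wedge_apply_of_lt (B : N₁ →ₗ[ℝ] N₂ →ₗ[ℝ] N₃) {q : ℕ} {t : GForm M N₁} (ht : IsDeg q t)
    (u : GForm M N₂) {k : ℕ} (hk : k < q) : wedge B t u k = 0 := by
  rw [wedge_apply_eq_sum]
  exact Finset.sum_eq_zero fun j _ => ht.wedge (IsDeg.single j (u j)) B k (by omega)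

theorem single_wedge_apply (B : N₁ →ₗ[ℝ] N₂ →ₗ[ℝ] N₃) {q : ℕ} {t : GForm M N₁} (ht : IsDeg q t)
    (u : GForm M N₂) (d : ℕ) : (Pi.single (d + q) (wedge B t u (d + q)) : GForm M N₃) =
      wedge B t (Pi.single d (u d) : GForm M N₂) := by
  refine (IsDeg.single _ _).ext (k := d + q) ?_ ?_
  · rw [add_comm]
    exact ht.wedge (IsDeg.single d (u d)) B
  · rw [Pi.single_eq_same, wedge_apply_eq_sum]
    refine Finset.sum_eq_single d (fun j _ hj => ?_) fun h => ?_
    · exact ht.wedge (IsDeg.single j (u j)) B _ (by omega)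
    · exact absurd (Finset.mem_range.2 (by omega)) h

end WedgeDegree

section ProductForms

variable {W : Type*} [NormedAddCommGroup W] [NormedSpace ℂ W]
  {X : Type*} [TopologicalSpace X] [ChartedSpace W X]

/-- A real two-form on `X` as a family of two-forms on `W`. -/
def untan₂ (a : ∀ x : X, Tan W x [⋀^Fin 2]→ₗ[ℝ] ℝ) : X → W [⋀^Fin 2]→ₗ[ℝ] ℝ := a

/-- The exterior product of a list of real two-forms. -/
def prodForm (l : List (X → W [⋀^Fin 2]→ₗ[ℝ] ℝ)) (x : X) : GForm W ℂ := bigT (l.map fun a => a x)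

theorem IsPositiveForm.isPos {a : ∀ x : X, Tan W x [⋀^Fin 2]→ₗ[ℝ] ℝ} [FiniteDimensional ℂ W]
    (ha : IsPositiveForm a) (x : X) : IsPos (untan₂ a x) :=
  ⟨ha.invariant x, ha.pos x⟩

theorem untan_wedgeProd {r : ℕ} (α : Fin r → ∀ x : X, Tan W x [⋀^Fin 2]→ₗ[ℝ] ℝ) :
    untan (wedgeProd α) = prodForm (List.ofFn fun j => untan₂ (α j)) := by
  funext x
  rw [prodForm, List.map_ofFn, bigT, List.map_ofFn]
  rfl

theorem isDeg_prodForm (l : List (X → W [⋀^Fin 2]→ₗ[ℝ] ℝ)) (x : X) :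
    IsDeg (2 * l.length) (prodForm l x) := by
  have h := isDeg_bigT (l.map fun a => a x)
  rwa [List.length_map] at h

variable [IsManifold 𝓘(ℂ, W) ω X] [FiniteDimensional ℂ W]

theorem IsPositiveForm.isSmoothForm {a : ∀ x : X, Tan W x [⋀^Fin 2]→ₗ[ℝ] ℝ}
    (ha : IsPositiveForm a) : IsSmoothForm fun x => ofTwoForm (untan₂ a x) := by
  intro x
  have h1 : SmoothAt (fun z => Pi.single 2 (pull ((dC x z).restrictScalars ℝ).toLinearMap
      (ofTwoForm (untan₂ a ((chartAt W x).symm z))) 2)) (chartAt W x x) := by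
    intro k
    by_cases hk : k = 2
    · subst hk
      simp only [Pi.single_eq_same]
      refine ((ha.smooth x).contDiffAt ((chartAt W x).open_target.mem_nhds
        (mem_chart_target W x))).congr_of_eventuallyEq ?_
      filter_upwards [(chartAt W x).open_target.mem_nhds (mem_chart_target W x)] with z hz
      ext w
      have h : (fun i => dChartSymm x z (w i)) = fun i => dC x z (w i) :=
        funext fun i => dChartSymm_apply x hz (w i)
      have h2 : ofTwoForm (untan₂ a ((chartAt W x).symm z)) 2 =
          Complex.ofRealLI.toLinearMap.compAlternatingMap (untan₂ a ((chartAt W x).symm z)) :=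
        Pi.single_eq_same _ _
      rw [toCont_apply]
      change ofTwoForm (untan₂ a ((chartAt W x).symm z)) 2 (fun i => dC x z (w i)) = _
      rw [h2]
      exact congrArg (fun w' => (a ((chartAt W x).symm z) w' : ℂ)) h.symm
    · simp only [Pi.single_eq_of_ne hk]
      exact (contDiffAt_const : ContDiffAt ℝ ∞ (fun _ : W => (0 : W [⋀^Fin k]→L[ℝ] ℂ)) _)
  refine h1.congr (Filter.Eventually.of_forall fun z => ?_)
  exact ((IsDeg.single 2 _).pull _).eq_single

theorem SmoothAt.const (b : GForm W ℂ) (y : W) : SmoothAt (fun _ => b) y := fun k =>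
  (contDiffAt_const : ContDiffAt ℝ ∞ (fun _ : W => toCont (b k)) y)

theorem isSmoothForm_prodForm {l : List (X → W [⋀^Fin 2]→ₗ[ℝ] ℝ)}
    (hl : ∀ a ∈ l, IsSmoothForm fun x => ofTwoForm (a x)) : IsSmoothForm (prodForm l) := by
  induction l with
  | nil =>
    intro x
    refine (SmoothAt.const (oneForm W) _).congr (Filter.Eventually.of_forall fun z => ?_)
    funext k
    rcases k with _ | k
    · ext w
      rfl
    · exact IsDeg.pull (IsDeg.single 0 _) _ (k + 1) (by omega)
  | cons a l ih =>
    intro x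
    refine ((hl a List.mem_cons_self x).wedge
      (ih (fun b hb => hl b (List.mem_cons_of_mem _ hb)) x) (smulBilin ℂ)).congr
        (Filter.Eventually.of_forall fun z => ?_)
    exact pull_wedge _ _ _ _

theorem loc_prodForm (l : List (X → W [⋀^Fin 2]→ₗ[ℝ] ℝ)) (x : X) (z : W) :
    loc x (prodForm l) z = bigT (l.map fun a => (a ((chartAt W x).symm z)).compLinearMap
      ((dC x z).restrictScalars ℝ).toLinearMap) := by
  rw [loc, prodForm, pull_bigT, List.map_map]
  rfl

theorem jf_prodForm {l : List (X → W [⋀^Fin 2]→ₗ[ℝ] ℝ)} (hl : ∀ a ∈ l, ∀ x, IsPos (a x)) (x : X) :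
    jf (prodForm l x) = prodForm l x := by
  refine jf_bigT fun b hb => ?_
  obtain ⟨a, ha, rfl⟩ := List.mem_map.1 hb
  exact hl a ha x

variable {F : Type*} [NormedAddCommGroup F] [NormedSpace ℂ F] [FiniteDimensional ℂ F]
  {E : X → Type*} [∀ x, AddCommGroup (E x)] [∀ x, Module ℂ (E x)]
  [∀ x, TopologicalSpace (E x)] [TopologicalSpace (Bundle.TotalSpace F E)]
  [FiberBundle F E] [VectorBundle ℂ F E] [ContMDiffVectorBundle ω F E 𝓘(ℂ, W)]

theorem fibre_eq_zero {n : ℕ} (hn : Module.finrank ℂ W = n) {l : List (X → W [⋀^Fin 2]→ₗ[ℝ] ℝ)}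
    (hl : ∀ a ∈ l, ∀ x, IsPos (a x)) {k : ℕ} (hk : l.length + k = n) (x : X)
    {u : GForm W F} (hu : IsDeg k u) (h : wedge (smulBilin F) (prodForm l x) u = 0) : u = 0 := by
  have hl' : ∀ b ∈ l.map fun a => a x, IsPos b := by
    intro b hb
    obtain ⟨a, ha, rfl⟩ := List.mem_map.1 hb
    exact hl a ha x
  have hk' : (l.map fun a => a x).length + k = n := by rwa [List.length_map]
  have h' : wedge (smulBilin F) (bigT (l.map fun a => a x)) u = 0 := h
  exact eq_zero_of_wedge_bigT hn hl' hk' hu h'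

theorem eq_zero_of_wedgeE {n : ℕ} (hn : Module.finrank ℂ W = n)
    {l : List (X → W [⋀^Fin 2]→ₗ[ℝ] ℝ)} (hl : ∀ a ∈ l, ∀ x, IsPos (a x)) {k : ℕ}
    (hk : l.length + k = n) {u : EForm W E} (hu : u ∈ Vdeg W F E k)
    (h : wedgeE E (prodForm l) u = 0) : u = 0 := by
  refine ext_flat (F := F) fun x => ?_
  have h0 : flat F x (0 : EForm W E) x = 0 := flat_of_eq_zero x rfl
  rw [h0]
  refine fibre_eq_zero hn hl hk x (isDeg_flat hu.2 x x) ?_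
  have h1 := flat_wedgeE (F := F) (prodForm l) u x x
  rw [h, h0] at h1
  exact h1.symm

theorem exists_wedgeE_eq {n : ℕ} (hn : Module.finrank ℂ W = n)
    {l : List (X → W [⋀^Fin 2]→ₗ[ℝ] ℝ)} (hl : ∀ a ∈ l, ∀ x, IsPos (a x))
    (hs : ∀ a ∈ l, IsSmoothForm fun x => ofTwoForm (a x)) {k : ℕ}
    (hk : l.length + k = n) {w : EForm W E} (hw : w ∈ Vdeg W F E (2 * l.length + k)) :
    ∃ u ∈ Vdeg W F E k, wedgeE E (prodForm l) u = w := by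
  obtain ⟨hwV, hwd⟩ := hw
  have hex : ∀ x : X, ∃ u : GForm W F, IsDeg k u ∧
      wedge (smulBilin F) (prodForm l x) u = flat F x w x := by
    intro x
    have hl' : ∀ b ∈ l.map fun a => a x, IsPos b := by
      intro b hb
      obtain ⟨a, ha, rfl⟩ := List.mem_map.1 hb
      exact hl a ha x
    have hk' : (l.map fun a => a x).length + k = n := by rwa [List.length_map]
    have hd' : IsDeg (2 * (l.map fun a => a x).length + k) (flat F x w x) := by
      rw [List.length_map]
      exact isDeg_flat hwd x x
    exact exists_wedge_bigT_eq hn hl' hk' hd'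
  choose uF huF hwF using hex
  let u : EForm W E := fun x => mapV (M := Tan W x)
    (((trivializationAt F E x).symmₗ ℂ x).restrictScalars ℝ) (uF x)
  have hflat : ∀ x, flat F x u x = uF x := by
    intro x
    funext k
    ext v
    exact Bundle.Trivialization.linearMapAt_symmₗ (R := ℂ) _
      (FiberBundle.mem_baseSet_trivializationAt F E x) _
  have hdeg : u ∈ homogeneous W E k :=
    mem_homogeneous_of_flat (F := F) fun x => by rw [hflat]; exact huF x
  have hwu : wedgeE E (prodForm l) u = w := by
    refine ext_flat (F := F) fun x => ?_
    refine (flat_wedgeE (F := F) (prodForm l) u x x).trans ?_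
    rw [hflat]
    exact hwF x
  obtain ⟨hws, K, hK, hKw⟩ := mem_V_iff.1 hwV
  refine ⟨u, ⟨mem_V_iff.2 ⟨fun x => ?_, K, hK, fun x hx => ?_⟩, hdeg⟩, hwu⟩
  · have hsol : ∀ z, wedge (smulBilin F) (loc x (prodForm l) z) (lf F x u z) = lf F x w z := by
      intro z
      rw [← hwu]
      exact (lf_wedgeE (prodForm l) u x z).symm
    have ht : SmoothAt (loc x (prodForm l)) (chartAt W x x) := isSmoothForm_prodForm hs x
    have htd : ∀ z, IsDeg (2 * l.length) (loc x (prodForm l) z) := fun z =>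
      (isDeg_prodForm l _).pull _
    have hud : ∀ z, IsDeg k (lf F x u z) := fun z => isDeg_lf hdeg x z
    intro j
    by_cases hj : j = k
    · subst hj
      let g : W → (W [⋀^Fin j]→L[ℝ] F) →ₗ[ℝ] W [⋀^Fin (2 * l.length + j)]→L[ℝ] F := fun z =>
        (toContₗ W F (2 * l.length + j)).toLinearMap ∘ₗ
          wedgeDeg F (2 * l.length) j (loc x (prodForm l) z (2 * l.length)) ∘ₗ
            (toContₗ W F j).symm.toLinearMap
      refine contDiffAt_of_apply (g := g) (fun s => ?_) ?_ ?_
      · have h1 : SmoothAt (fun _ : W => (Pi.single j s.toAlternatingMap : GForm W F))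
            (chartAt W x x) := fun i => contDiffAt_const
        refine (((ht.single (2 * l.length)).wedge h1 (smulBilin F)) (2 * l.length + j)).congr_of_eventuallyEq
          (Filter.Eventually.of_forall fun z => rfl)
      · filter_upwards [(chartAt W x).open_target.mem_nhds (mem_chart_target W x)] with z hz
        have hl' : ∀ b ∈ l.map fun a => (a ((chartAt W x).symm z)).compLinearMap
            ((dC x z).restrictScalars ℝ).toLinearMap, IsPos b := by
          intro b hb
          obtain ⟨a, ha, rfl⟩ := List.mem_map.1 hb
          exact (hl a ha _).comp (dC x z).toLinearMap (isUnit_dC hz).1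
        have hlen : (l.map fun a => (a ((chartAt W x).symm z)).compLinearMap
            ((dC x z).restrictScalars ℝ).toLinearMap).length = l.length := List.length_map _
        have hk' : (l.map fun a => (a ((chartAt W x).symm z)).compLinearMap
            ((dC x z).restrictScalars ℝ).toLinearMap).length + j = n := by rw [hlen]; exact hk
        have hb := bijective_wedgeDeg_bigT (N := F) hn hl' hk'
        rw [hlen, ← loc_prodForm] at hb
        exact (toContₗ W F (2 * l.length + j)).bijective.comp
          (hb.comp (toContₗ W F j).symm.bijective)
      · refine (hws x (2 * l.length + j)).congr_of_eventuallyEq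
          (Filter.Eventually.of_forall fun z => ?_)
        have h1 := single_wedgeDeg (htd z) (hud z)
        rw [hsol z] at h1
        have h2 := congrFun h1 (2 * l.length + j)
        rw [Pi.single_eq_same] at h2
        exact congrArg toCont h2.symm
    · refine (contDiffAt_const : ContDiffAt ℝ ∞
        (fun _ : W => (0 : W [⋀^Fin j]→L[ℝ] F)) _).congr_of_eventuallyEq
          (Filter.Eventually.of_forall fun z => ?_)
      change toCont (lf F x u z j) = 0
      rw [hud z j hj]
      rfl
  · refine flat_injective (F := F) (v := 0) (FiberBundle.mem_baseSet_trivializationAt F E x) ?_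
    have h0 : flat F x (0 : EForm W E) x = 0 := flat_of_eq_zero x rfl
    rw [h0, hflat]
    refine fibre_eq_zero hn hl hk x (huF x) ?_
    rw [hwF, flat_of_eq_zero x (hKw x hx)]

end ProductForms

section VT

variable {W : Type*} [NormedAddCommGroup W] [NormedSpace ℂ W]
  {X : Type*} [TopologicalSpace X] [ChartedSpace W X]
  [IsManifold 𝓘(ℂ, W) ω X] [FiniteDimensional ℂ W]

/-- The form `T` is the product of the smooth positive `(1,1)`-forms of the list `l`, whose length
is `n - m`, the form `Ω` is smooth and positive, and `T` and `Ω` are closed. -/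
structure LefschetzData (m : ℕ) (l : List (X → W [⋀^Fin 2]→ₗ[ℝ] ℝ))
    (T : ∀ x : X, GForm (Tan W x) ℂ) (Ω : ∀ x : X, Tan W x [⋀^Fin 2]→ₗ[ℝ] ℝ) : Prop where
  length_add : l.length + m = Module.finrank ℂ W
  eq_prodForm : T = prodForm l
  isPos : ∀ a ∈ l, ∀ x, IsPos (a x)
  isSmooth : ∀ a ∈ l, IsSmoothForm fun x => ofTwoForm (a x)
  isPos' : ∀ x, IsPos (untan₂ Ω x)
  isSmooth' : IsSmoothForm fun x => ofTwoForm (untan₂ Ω x)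
  closed : IsClosedInvariant (untan T)
  closed' : IsClosedInvariant (untan fun x => ofTwoForm (Ω x))

variable {F : Type*} [NormedAddCommGroup F] [NormedSpace ℂ F] [FiniteDimensional ℂ F]
  {E : X → Type*} [∀ x, AddCommGroup (E x)] [∀ x, Module ℂ (E x)]
  [∀ x, TopologicalSpace (E x)] [TopologicalSpace (Bundle.TotalSpace F E)]
  [FiberBundle F E] [VectorBundle ℂ F E]

theorem restrictsTo_onVT {T : ∀ x : X, GForm (Tan W x) ℂ} {P P' : EForm W E → EForm W E}
    (hT : VT W F E T ≤ V W F E)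
    (hV : ∀ u ∈ V W F E, P' u ∈ V W F E)
    (hadd : ∀ u ∈ V W F E, ∀ v ∈ V W F E, P (u + v) = P u + P v)
    (hsmul : ∀ (c : ℂ), ∀ u ∈ V W F E, P (c • u) = c • P u)
    (hcomm : ∀ u ∈ V W F E, P (wedgeE E T u) = wedgeE E T (P' u)) :
    RestrictsTo P (onVT F T P) := by
  have hP : ∀ u ∈ VT W F E T, P u ∈ VT W F E T := by
    rintro u ⟨a, ha, rfl⟩
    exact ⟨P' a, hV a ha, (hcomm a ha).symm⟩
  have h : ∃ Q : Module.End ℂ (VT W F E T), RestrictsTo P Q :=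
    ⟨{ toFun := fun u => ⟨P u, hP u u.2⟩
       map_add' := fun u v => Subtype.ext (hadd u (hT u.2) v (hT v.2))
       map_smul' := fun c u => Subtype.ext (hsmul c u (hT u.2)) }, fun u => rfl⟩
  rw [onVT, dif_pos h]
  exact h.choose_spec

theorem comp_add (k : ℕ) (u v : EForm W E) : comp k (u + v) = comp k u + comp k v := by
  funext x
  exact (Pi.single_add (f := fun k => Tan W x [⋀^Fin k]→ₗ[ℝ] E x) k (u x k) (v x k))

theorem comp_smul (k : ℕ) (c : ℂ) (u : EForm W E) : comp k (c • u) = c • comp k u := by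
  funext x
  exact (Pi.single_smul (f := fun k => Tan W x [⋀^Fin k]→ₗ[ℝ] E x) k c (u x k))

theorem weil_wedgeE {a : ∀ x : X, GForm (Tan W x) ℂ} (ha : ∀ x, jf (untan a x) = untan a x)
    (u : EForm W E) : weil (wedgeE E a u) = wedgeE E a (weil u) := by
  funext x
  refine (pull_wedge _ (smulBilin (E x)) (a x) (u x)).trans ?_
  exact congrArg (fun t => wedge (M := Tan W x) (smulBilin (E x)) t (weil u x)) (ha x)

theorem wedgeE_comm {a b : ∀ x : X, GForm (Tan W x) ℂ} (ha : ∀ x, sgn (untan a x) = untan a x)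
    (u : EForm W E) : wedgeE E a (wedgeE E b u) = wedgeE E b (wedgeE E a u) := by
  funext x
  exact wedge_smul_comm (W := Tan W x) (N := E x) (b x) (ha x) (u x)

namespace LefschetzData

variable [T2Space X] [ContMDiffVectorBundle ω F E 𝓘(ℂ, W)]
  {m : ℕ} {l : List (X → W [⋀^Fin 2]→ₗ[ℝ] ℝ)}
  {T : ∀ x : X, GForm (Tan W x) ℂ} {Ω : ∀ x : X, Tan W x [⋀^Fin 2]→ₗ[ℝ] ℝ}

theorem length_eq (hd : LefschetzData m l T Ω) : l.length = Module.finrank ℂ W - m := by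
  have := hd.length_add
  omega

theorem le_finrank (hd : LefschetzData m l T Ω) : m ≤ Module.finrank ℂ W := by
  have := hd.length_add
  omega

theorem isDeg (hd : LefschetzData m l T Ω) (x : X) :
    IsDeg (M := Tan W x) (2 * (Module.finrank ℂ W - m)) (T x) := by
  have h : IsDeg (2 * l.length) (prodForm l x) := isDeg_prodForm l x
  rw [hd.length_eq] at h
  rw [hd.eq_prodForm]
  exact h

theorem VT_le (hd : LefschetzData m l T Ω) : VT W F E T ≤ V W F E := by
  rintro u ⟨a, ha, rfl⟩
  exact wedgeE_mem_V ha hd.closed.smooth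

theorem comp_wedgeE (hd : LefschetzData m l T Ω) (d : ℕ) (a : EForm W E) :
    comp (d + 2 * (Module.finrank ℂ W - m)) (wedgeE E T a) = wedgeE E T (comp d a) :=
  funext fun x => single_wedge_apply (smulBilin (E x)) (hd.isDeg x) (a x) d

theorem mem_VTdeg_iff (hd : LefschetzData m l T Ω) {d : ℕ} {w : EForm W E} :
    w ∈ VTdeg W F E T d ↔
      w ∈ VT W F E T ∧ w ∈ homogeneous W E (d + 2 * (Module.finrank ℂ W - m)) := by
  constructor
  · rintro ⟨a, ha, rfl⟩
    refine ⟨⟨a, ha.1, rfl⟩, ?_⟩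
    have h := hd.comp_wedgeE d a
    rw [comp_of_mem ha.2] at h
    rw [← h]
    exact comp_mem_homogeneous _ _
  · rintro ⟨⟨a, ha, rfl⟩, hw⟩
    exact ⟨comp d a, ⟨comp_mem_V ha d, comp_mem_homogeneous d a⟩,
      (hd.comp_wedgeE d a).symm.trans (comp_of_mem hw)⟩

theorem restrictsTo_comp (hd : LefschetzData m l T Ω) (d : ℕ) :
    RestrictsTo (comp (d + 2 * (Module.finrank ℂ W - m)))
      (onVT F T (comp (E := E) (d + 2 * (Module.finrank ℂ W - m)))) :=
  restrictsTo_onVT (P' := comp d) hd.VT_le (fun _ hu => comp_mem_V hu d)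
    (fun _ _ _ _ => comp_add _ _ _) (fun _ _ _ => comp_smul _ _ _)
    fun a _ => hd.comp_wedgeE d a

theorem restrictsTo_lefschetz (hd : LefschetzData m l T Ω) :
    RestrictsTo (wedgeE E fun x => ofTwoForm (Ω x)) (lefschetz F E T Ω) :=
  restrictsTo_onVT (P' := wedgeE E fun x => ofTwoForm (Ω x)) hd.VT_le
    (fun _ hu => wedgeE_mem_V hu hd.closed'.smooth)
    (fun _ _ _ _ => map_add _ _ _) (fun _ _ _ => map_smul _ _ _)
    fun a _ => wedgeE_comm hd.closed'.sgn_eq a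

theorem restrictsTo_weil (hd : LefschetzData m l T Ω) :
    RestrictsTo weil (onVT F T (weil (E := E))) :=
  restrictsTo_onVT (P' := weil) hd.VT_le (fun _ hu => weil_mem_V hu)
    (fun _ _ _ _ => rfl) (fun _ _ _ => rfl)
    fun a _ => weil_wedgeE hd.closed.jf_eq a

theorem restrictsTo_dbarT (hd : LefschetzData m l T Ω) :
    RestrictsTo (dbarE F) (dbarT F E T) :=
  restrictsTo_onVT (P' := dbarE F) hd.VT_le (fun _ hu => dbarE_mem_V hu)
    (fun _ hu _ hv => dbarE_add (mem_V_iff.1 hu).1 (mem_V_iff.1 hv).1)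
    (fun c _ hu => dbarE_smul (mem_V_iff.1 hu).1 c)
    fun _ ha => dbarE_wedgeE (mem_V_iff.1 ha).1 hd.closed

theorem restrictsTo_delT (hd : LefschetzData m l T Ω) (h : HermitianMetric (W := W) F E) :
    RestrictsTo (delE h) (delT T h) :=
  restrictsTo_onVT (P' := delE h) hd.VT_le (fun _ hu => delE_mem_V h hu)
    (fun _ hu _ hv => HermitianMetric.delE_add h (mem_V_iff.1 hu).1 (mem_V_iff.1 hv).1)
    (fun c _ hu => HermitianMetric.delE_smul h (mem_V_iff.1 hu).1 c)
    fun _ ha => HermitianMetric.delE_wedgeE h (mem_V_iff.1 ha).1 hd.closed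

theorem wedgeE_prodForm_cons {E : X → Type*} [∀ x, AddCommGroup (E x)] [∀ x, Module ℂ (E x)] (a : ∀ x : X, Tan W x [⋀^Fin 2]→ₗ[ℝ] ℝ)
    (l' : List (X → W [⋀^Fin 2]→ₗ[ℝ] ℝ)) (u : EForm W E) :
    wedgeE E (prodForm (untan₂ a :: l')) u
      = wedgeE E (fun x => ofTwoForm (a x)) (wedgeE E (prodForm l') u) := by
  funext x
  have h := wedge_bigT_cons (W := Tan W x) (N := E x) (a x) (l'.map fun b => b x) (u x)
  exact h

theorem lefschetz_pow (hd : LefschetzData m l T Ω) (r : ℕ) {a : EForm W E} {u : VT W F E T}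
    (hu : wedgeE E T a = u) :
    ((lefschetz F E T Ω ^ r) u : EForm W E) =
      wedgeE E (prodForm (List.replicate r (untan₂ Ω) ++ l)) a := by
  induction r with
  | zero =>
    rw [pow_zero, Module.End.one_apply, ← hu, hd.eq_prodForm]
    rfl
  | succ r ih =>
    rw [pow_succ', Module.End.mul_apply, hd.restrictsTo_lefschetz, ih, List.replicate_succ,
      List.cons_append, wedgeE_prodForm_cons]

/-- The graded pieces of `V_T`. -/
def _root_.THodge.degVT (F : Type*) [NormedAddCommGroup F] [NormedSpace ℂ F]
    (E : X → Type*) [∀ x, AddCommGroup (E x)] [∀ x, Module ℂ (E x)]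
    [∀ x, TopologicalSpace (E x)] [TopologicalSpace (Bundle.TotalSpace F E)]
    [FiberBundle F E] [VectorBundle ℂ F E] (T : ∀ x : X, GForm (Tan W x) ℂ) (d : ℕ) :
    Submodule ℂ (VT W F E T) :=
  (VTdeg W F E T d).comap (VT W F E T).subtype

theorem mem_degVT (hd : LefschetzData m l T Ω) {d : ℕ} {u : VT W F E T} :
    u ∈ degVT F E T d ↔
      (u : EForm W E) ∈ homogeneous W E (d + 2 * (Module.finrank ℂ W - m)) :=
  hd.mem_VTdeg_iff.trans ⟨fun h => h.2, fun h => ⟨u.2, h⟩⟩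

theorem isPos_append (hd : LefschetzData m l T Ω) (r : ℕ) :
    ∀ a ∈ List.replicate r (untan₂ Ω) ++ l, ∀ x, IsPos (a x) := by
  intro a ha x
  rcases List.mem_append.1 ha with h | h
  · rw [List.eq_of_mem_replicate h]
    exact hd.isPos' x
  · exact hd.isPos a h x

theorem isSmooth_append (hd : LefschetzData m l T Ω) (r : ℕ) :
    ∀ a ∈ List.replicate r (untan₂ Ω) ++ l, IsSmoothForm fun x => ofTwoForm (a x) := by
  intro a ha
  rcases List.mem_append.1 ha with h | h
  · rw [List.eq_of_mem_replicate h]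
    exact hd.isSmooth'
  · exact hd.isSmooth a h

theorem apply_eq_zero_of_lt {u : EForm W E} (x : X) {k : ℕ} (hk : 2 * Module.finrank ℂ W < k) :
    u x k = 0 := by
  have h : (Pi.single k (u x k) : GForm (Tan W x) (E x)) = 0 :=
    (IsDeg.single k _).eq_zero_of_lt (Module.finBasis ℂ W) hk
  have := congrFun h k
  rwa [Pi.single_eq_same] at this

theorem lefschetzModule (hd : LefschetzData m l T Ω) :
    LefschetzModule m (degVT F E T)
      (fun d => onVT F T (comp (E := E) (d + 2 * (Module.finrank ℂ W - m))))
      (lefschetz F E T Ω) where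
  proj_mem d u := by
    rw [hd.mem_degVT, hd.restrictsTo_comp]
    exact comp_mem_homogeneous _ _
  proj_self d u hu := by
    rw [hd.mem_degVT] at hu
    exact Subtype.ext ((hd.restrictsTo_comp d u).trans (comp_of_mem hu))
  proj_of_ne d d' hne u hu := by
    rw [hd.mem_degVT] at hu
    exact Subtype.ext ((hd.restrictsTo_comp d u).trans (comp_of_mem_of_ne hu (by omega)))
  sum_proj u := by
    have hle := hd.le_finrank
    refine Subtype.ext ?_
    rw [AddSubmonoidClass.coe_finset_sum]
    refine (Finset.sum_congr rfl fun d _ => hd.restrictsTo_comp d u).trans ?_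
    funext x k
    rw [Finset.sum_apply, Finset.sum_apply]
    by_cases hk : ∃ d ∈ Finset.range (2 * m + 1), k = d + 2 * (Module.finrank ℂ W - m)
    · obtain ⟨d, hdm, rfl⟩ := hk
      rw [Finset.sum_eq_single_of_mem d hdm fun j _ hj => ?_]
      · exact Pi.single_eq_same _ _
      · exact Pi.single_eq_of_ne (by omega) _
    · rw [Finset.sum_eq_zero fun d hdm => ?_]
      · rcases lt_or_ge k (2 * (Module.finrank ℂ W - m)) with h1 | h1
        · obtain ⟨a, -, ha⟩ := u.2
          rw [← ha]
          exact (wedge_apply_of_lt (smulBilin (E x)) (hd.isDeg x) (a x) h1).symm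
        · refine (apply_eq_zero_of_lt x ?_).symm
          by_contra h2
          exact hk ⟨k - 2 * (Module.finrank ℂ W - m), Finset.mem_range.2 (by omega), by omega⟩
      · exact Pi.single_eq_of_ne (fun h => hk ⟨d, hdm, h⟩) _
  map_mem d u hu := by
    obtain ⟨a, ha, hau⟩ := hu
    refine ⟨wedgeE E (fun x => ofTwoForm (Ω x)) a, ⟨wedgeE_mem_V ha.1 hd.closed'.smooth, ?_⟩, ?_⟩
    · intro x
      have h := single_wedge_apply (M := Tan W x) (smulBilin (E x))
        (IsDeg.single 2 _ : IsDeg 2 (ofTwoForm (Ω x))) (a x) d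
      rw [← (mem_homogeneous_iff.1 ha.2 x).eq_single] at h
      exact fun j hj => by
        have h' := congrFun h j
        rw [Pi.single_eq_of_ne hj] at h'
        exact h'.symm
    · rw [wedgeE_comm hd.closed.sgn_eq, hau]
      exact (hd.restrictsTo_lefschetz u).symm
  inj d hdm u hu h0 := by
    obtain ⟨a, ha, hau⟩ := hu
    have h1 := hd.lefschetz_pow (m - d) hau
    rw [h0] at h1
    have h2 := eq_zero_of_wedgeE (n := Module.finrank ℂ W) rfl (hd.isPos_append (m - d))
      (k := d) (by
        have := hd.length_add
        rw [List.length_append, List.length_replicate]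
        omega) ha h1.symm
    refine Subtype.ext ?_
    change (u : EForm W E) = 0
    exact hau.symm.trans (by rw [h2, map_zero])
  surj d hdm w hw := by
    have h3 := hd.length_add
    have hlen : (List.replicate (m - d) (untan₂ Ω) ++ l).length + d = Module.finrank ℂ W := by
      rw [List.length_append, List.length_replicate]
      omega
    rw [hd.mem_degVT] at hw
    have hw' : (w : EForm W E) ∈
        Vdeg W F E (2 * (List.replicate (m - d) (untan₂ Ω) ++ l).length + d) := by
      refine ⟨hd.VT_le w.2, ?_⟩
      rwa [show 2 * (List.replicate (m - d) (untan₂ Ω) ++ l).length + d =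
        2 * m - d + 2 * (Module.finrank ℂ W - m) by omega]
    obtain ⟨a, ha, haw⟩ := exists_wedgeE_eq rfl (hd.isPos_append (m - d))
      (hd.isSmooth_append (m - d)) hlen hw'
    refine ⟨⟨wedgeE E T a, a, ha.1, rfl⟩, ⟨a, ha, rfl⟩, Subtype.ext ?_⟩
    exact (hd.lefschetz_pow (m - d) rfl).trans haw

theorem isLefschetzStar_iff {s : VT W F E T ≃ₗ[ℂ] VT W F E T} :
    IsLefschetzStar m Ω s ↔ IsStar m (degVT F E T) (lefschetz F E T Ω) s.toLinearMap :=
  ⟨fun h k r hrk u hu => h k r u ⟨hu.1, by omega, hu.2⟩ hrk,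
    fun h k r u hu hrk => h k r hrk u ⟨hu.1, hu.2.2⟩⟩

theorem isLefschetzStar (hd : LefschetzData m l T Ω) :
    IsLefschetzStar m Ω (lefschetzStar F E T m Ω) := by
  obtain ⟨s, hs⟩ := (hd.lefschetzModule (F := F) (E := E)).exists_star
  have h : ∃ s : VT W F E T ≃ₗ[ℂ] VT W F E T, IsLefschetzStar m Ω s := by
    refine ⟨LinearEquiv.ofLinear s s ?_ ?_, isLefschetzStar_iff.2 hs⟩ <;>
    exact LinearMap.ext fun u => hd.lefschetzModule.star_star hs u
  rw [lefschetzStar, dif_pos h]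
  exact h.choose_spec

theorem isStar (hd : LefschetzData m l T Ω) :
    IsStar m (degVT F E T) (lefschetz F E T Ω) (lefschetzStar F E T m Ω).toLinearMap :=
  isLefschetzStar_iff.1 hd.isLefschetzStar

theorem eq_lefschetzStar (hd : LefschetzData m l T Ω) {s : VT W F E T ≃ₗ[ℂ] VT W F E T}
    (hs : IsLefschetzStar m Ω s) : s = lefschetzStar F E T m Ω :=
  LinearEquiv.toLinearMap_injective
    (hd.lefschetzModule.star_unique (isLefschetzStar_iff.1 hs) hd.isStar)

end LefschetzData

end VT

section Integration

open MeasureTheory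

theorem integrableOn_of_compact {Z : Type*} [TopologicalSpace Z] [T2Space Z] [MeasurableSpace Z]
    [OpensMeasurableSpace Z] {μ : Measure Z} [IsFiniteMeasureOnCompacts μ]
    {U C : Set Z} (hU : MeasurableSet U) (hC : IsCompact C) (hCU : C ⊆ U) {f : Z → ℂ}
    (hf : ContinuousOn f U) (h0 : ∀ z ∈ U, z ∉ C → f z = 0) : IntegrableOn f U μ :=
  ((hf.mono hCU).integrableOn_compact' hC hC.measurableSet).of_forall_sdiff_eq_zero hU
    fun z hz => h0 z hz.1 hz.2

variable {W : Type*} [NormedAddCommGroup W] [NormedSpace ℂ W] [FiniteDimensional ℂ W]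

/-- The linear coordinates of `W`, as a continuous map. -/
def coordL (W : Type*) [NormedAddCommGroup W] [NormedSpace ℂ W] [FiniteDimensional ℂ W] :
    (Fin (Module.finrank ℂ W) → ℂ) ≃L[ℂ] W :=
  (coord W).toContinuousLinearEquiv

theorem continuous_coord : Continuous (coord W) := (coordL W).continuous

theorem integral_image {U : Set W} (hU : IsOpen U) {φ : W → W}
    (hφ : ∀ y ∈ U, DifferentiableAt ℂ φ y) (hinj : Set.InjOn φ U) (g : W → ℂ) :
    ∫ z in coord W ⁻¹' (φ '' U), g (coord W z) = ∫ z in coord W ⁻¹' U,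
      (Complex.normSq (LinearMap.det (fderiv ℂ φ (coord W z)).toLinearMap) : ℂ) *
        g (φ (coord W z)) := by
  let f : (Fin (Module.finrank ℂ W) → ℂ) → Fin (Module.finrank ℂ W) → ℂ :=
    fun z => (coordL W).symm (φ (coord W z))
  let A : (Fin (Module.finrank ℂ W) → ℂ) →
      (Fin (Module.finrank ℂ W) → ℂ) →L[ℂ] Fin (Module.finrank ℂ W) → ℂ := fun z =>
    ((coordL W).symm : W →L[ℂ] _).comp ((fderiv ℂ φ (coord W z)).comp (coordL W : _ →L[ℂ] W))
  have himg : coord W ⁻¹' (φ '' U) = f '' (coord W ⁻¹' U) := by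
    ext z
    constructor
    · rintro ⟨y, hy, hyz⟩
      refine ⟨(coord W).symm y, by simpa using hy, ?_⟩
      change (coord W).symm (φ (coord W ((coord W).symm y))) = z
      rw [LinearEquiv.apply_symm_apply, hyz, LinearEquiv.symm_apply_apply]
    · rintro ⟨z', hz', rfl⟩
      exact ⟨coord W z', hz', ((coord W).apply_symm_apply _).symm⟩
  have hder : ∀ z ∈ coord W ⁻¹' U, HasFDerivWithinAt f ((A z).restrictScalars ℝ)
      (coord W ⁻¹' U) z := by
    intro z hz
    have h1 : HasFDerivAt f (A z) z :=
      (coordL W).symm.hasFDerivAt.comp z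
        ((hφ _ hz).hasFDerivAt.comp z (coordL W).hasFDerivAt)
    exact (h1.restrictScalars ℝ).hasFDerivWithinAt
  have hfinj : Set.InjOn f (coord W ⁻¹' U) := fun z hz z' hz' h =>
    (coord W).injective (hinj hz hz' ((coordL W).symm.injective h))
  have hdet : ∀ z, ((A z).restrictScalars ℝ).det =
      Complex.normSq (LinearMap.det (fderiv ℂ φ (coord W z)).toLinearMap) := by
    intro z
    have h1 := det_restrictScalars_complex (A z).toLinearMap
    have h2 : (A z).toLinearMap = ((coord W).symm : W →ₗ[ℂ] _) ∘ₗ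
        (fderiv ℂ φ (coord W z)).toLinearMap ∘ₗ ((coord W).symm.symm : _ →ₗ[ℂ] W) := rfl
    rw [h2, LinearMap.det_conj, ← h2] at h1
    exact h1
  rw [himg, integral_image_eq_integral_abs_det_fderiv_smul volume
    (hU.preimage continuous_coord).measurableSet hder hfinj]
  refine integral_congr_ae (Filter.Eventually.of_forall fun z => ?_)
  change |((A z).restrictScalars ℝ).det| • g (coord W ((coord W).symm (φ (coord W z)))) = _
  rw [hdet, abs_of_nonneg (Complex.normSq_nonneg _), LinearEquiv.apply_symm_apply,
    Complex.real_smul]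

variable {X : Type*} [TopologicalSpace X] [ChartedSpace W X]

/-- The coefficient of a form of top degree in a chart. -/
def dens (i : X) (η : X → GForm W ℂ) (y : W) : ℂ :=
  loc i η y (2 * Module.finrank ℂ W) (stdFrame W)

theorem dens_of_eq_zero {i : X} {η : X → GForm W ℂ} {y : W}
    (h : η ((chartAt W i).symm y) = 0) : dens i η y = 0 := by
  rw [dens, loc, h, map_zero]
  rfl

variable [IsManifold 𝓘(ℂ, W) ω X]

theorem dens_eq {i j : X} {z : W} (hz : z ∈ overlap W i j) (η : X → GForm W ℂ) :
    dens i η z = (Complex.normSq (LinearMap.det (fderiv ℂ (chartTrans i j) z).toLinearMap) : ℂ) *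
      dens j η (chartTrans i j z) := by
  rw [dens, loc_eq_pull hz, fderiv_real_eq (contDiffAt_chartTrans hz)]
  have h1 := topv_pull (fderiv ℂ (chartTrans i j) z).toLinearMap
    (Module.finBasis ℂ W) (loc j η (chartTrans i j z))
  rw [topv_comp] at h1
  exact h1.trans (Complex.real_smul)

variable [T2Space X] [SigmaCompactSpace X]

/-- The integral of the component of top degree. -/
def integralTop (η : X → GForm W ℂ) : ℂ :=
  integralForm fun x => (η x (2 * Module.finrank ℂ W) :
    Tan W x [⋀^Fin (2 * Module.finrank ℂ W)]→ₗ[ℝ] ℂ)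

theorem integralTop_eq (η : X → GForm W ℂ) : integralTop η =
    ∑ᶠ i : X, ∫ z in coord W ⁻¹' (chartAt W i).target,
      (chartPartition W X i ((chartAt W i).symm (coord W z)) : ℂ) * dens i η (coord W z) := by
  refine finsum_congr fun i => setIntegral_congr_fun
    (((chartAt W i).open_target.preimage continuous_coord).measurableSet) fun z hz => ?_
  have h := chartPull_eq i (fun x => (η x : GForm (Tan W x) ℂ)) (2 * Module.finrank ℂ W) hz
  exact congrArg (fun t : W [⋀^Fin (2 * Module.finrank ℂ W)]→L[ℝ] ℂ =>
    (chartPartition W X i ((chartAt W i).symm (coord W z)) : ℂ) * t (stdFrame W)) h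

theorem tsupport_chartPartition (i : X) :
    tsupport (chartPartition W X i) ⊆ (chartAt W i).source :=
  haveI : IsManifold 𝓘(ℝ, W) ∞ X := isManifold_real
  (SmoothPartitionOfUnity.exists_isSubordinate_chartAt_source 𝓘(ℝ, W) X).choose_spec i

/-- Smooth forms with compact support. -/
structure IsTestForm (η : X → GForm W ℂ) : Prop where
  smooth : IsSmoothForm η
  compact : ∃ K : Set X, IsCompact K ∧ ∀ x ∉ K, η x = 0

theorem IsSmoothForm.continuousOn_dens {η : X → GForm W ℂ} (hη : IsSmoothForm η) (i : X) :
    ContinuousOn (dens i η) (chartAt W i).target := fun _ hy =>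
  ((hη.smoothAt hy).eval (2 * Module.finrank ℂ W) (stdFrame W)).continuousAt.continuousWithinAt

theorem integrableOn_dens {η : X → GForm W ℂ} (hη : IsTestForm η) {ρ : X → ℝ}
    (hρ : Continuous ρ) {i : X} (hi : ∃ C : Set X, IsClosed C ∧ C ⊆ (chartAt W i).source ∧
      ∀ x ∉ C, ρ x = 0 ∨ η x = 0) :
    IntegrableOn (fun z => (ρ ((chartAt W i).symm (coord W z)) : ℂ) * dens i η (coord W z))
      (coord W ⁻¹' (chartAt W i).target) := by
  obtain ⟨K, hK, hK0⟩ := hη.compact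
  obtain ⟨C, hC, hCi, hC0⟩ := hi
  have hc : IsCompact (K ∩ C) := hK.inter_right hC
  have hc' : IsCompact (chartAt W i '' (K ∩ C)) :=
    hc.image_of_continuousOn ((chartAt W i).continuousOn.mono fun x hx => hCi hx.2)
  refine integrableOn_of_compact
    ((chartAt W i).open_target.preimage continuous_coord).measurableSet
    ((coordL W).toHomeomorph.isCompact_preimage.2 hc') ?_ ?_ ?_
  · rintro z ⟨x, hx, hxz⟩
    change chartAt W i x = coord W z at hxz
    rw [Set.mem_preimage, ← hxz]
    exact (chartAt W i).map_source (hCi hx.2)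
  · refine ContinuousOn.mul ?_ ?_
    · exact Complex.continuous_ofReal.comp_continuousOn (hρ.comp_continuousOn
        ((chartAt W i).continuousOn_symm.comp continuous_coord.continuousOn fun z hz => hz))
    · exact (hη.smooth.continuousOn_dens i).comp continuous_coord.continuousOn fun z hz => hz
  · intro z hz hzC
    by_cases h1 : (chartAt W i).symm (coord W z) ∈ C
    · rw [dens_of_eq_zero (hK0 _ fun h => hzC ⟨_, ⟨h, h1⟩, (chartAt W i).right_inv hz⟩), mul_zero]
    · rcases hC0 _ h1 with h | h
      · rw [h, Complex.ofReal_zero, zero_mul]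
      · rw [dens_of_eq_zero h, mul_zero]

theorem integrableOn_chartPartition {η : X → GForm W ℂ} (hη : IsTestForm η) (i : X) :
    IntegrableOn (fun z => (chartPartition W X i ((chartAt W i).symm (coord W z)) : ℂ) *
      dens i η (coord W z)) (coord W ⁻¹' (chartAt W i).target) :=
  integrableOn_dens hη (chartPartition W X i).contMDiff.continuous
    ⟨_, isClosed_tsupport _, tsupport_chartPartition i, fun _ hx =>
      Or.inl (image_eq_zero_of_notMem_tsupport hx)⟩

theorem finite_chartPartition {K : Set X} (hK : IsCompact K) :
    {i | (Function.support (chartPartition W X i) ∩ K).Nonempty}.Finite :=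
  (chartPartition W X).locallyFinite.finite_nonempty_inter_compact hK

theorem support_integral_subset {η : X → GForm W ℂ} {K : Set X} (hK0 : ∀ x ∉ K, η x = 0) :
    (Function.support fun i : X => ∫ z in coord W ⁻¹' (chartAt W i).target,
      (chartPartition W X i ((chartAt W i).symm (coord W z)) : ℂ) * dens i η (coord W z)) ⊆
    {i | (Function.support (chartPartition W X i) ∩ K).Nonempty} := by
  intro i hi
  by_contra hne
  refine hi ((setIntegral_congr_fun
    (((chartAt W i).open_target.preimage continuous_coord).measurableSet)
      fun z _ => ?_).trans (integral_zero _ _))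
  by_cases h1 : (chartAt W i).symm (coord W z) ∈ K
  · have h2 : chartPartition W X i ((chartAt W i).symm (coord W z)) = 0 := by
      by_contra h
      exact hne ⟨_, h, h1⟩
    simp [h2]
  · simp [dens_of_eq_zero (hK0 _ h1)]

theorem IsTestForm.add {η η' : X → GForm W ℂ} (hη : IsTestForm η) (hη' : IsTestForm η') :
    IsTestForm (η + η') := by
  obtain ⟨K, hK, hK0⟩ := hη.compact
  obtain ⟨K', hK', hK0'⟩ := hη'.compact
  refine ⟨fun x => (hη.smooth x).add (hη'.smooth x), K ∪ K', hK.union hK', fun x hx => ?_⟩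
  rw [Pi.add_apply, hK0 x fun h => hx (Or.inl h), hK0' x fun h => hx (Or.inr h), add_zero]

theorem integralTop_add {η η' : X → GForm W ℂ} (hη : IsTestForm η) (hη' : IsTestForm η') :
    integralTop (η + η') = integralTop η + integralTop η' := by
  obtain ⟨K, hK, hK0⟩ := hη.compact
  obtain ⟨K', hK', hK0'⟩ := hη'.compact
  rw [integralTop_eq, integralTop_eq, integralTop_eq, ← finsum_add_distrib]
  · refine finsum_congr fun i => ?_
    rw [← integral_add (integrableOn_chartPartition hη i)
      (integrableOn_chartPartition hη' i)]
    refine setIntegral_congr_fun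
      (((chartAt W i).open_target.preimage continuous_coord).measurableSet) fun z _ => ?_
    exact mul_add _ _ _
  · exact (finite_chartPartition hK).subset (support_integral_subset hK0)
  · exact (finite_chartPartition hK').subset (support_integral_subset hK0')

theorem integralTop_eq_of_support {η : X → GForm W ℂ} (hη : IsTestForm η) {j : X} {K : Set X}
    (hK : IsCompact K) (hKj : K ⊆ (chartAt W j).source) (hK0 : ∀ x ∉ K, η x = 0) :
    integralTop η = ∫ z in coord W ⁻¹' (chartAt W j).target, dens j η (coord W z) := by
  have hmeas : ∀ i : X, MeasurableSet (coord W ⁻¹' (chartAt W i).target) := fun i =>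
    ((chartAt W i).open_target.preimage continuous_coord).measurableSet
  have hcv : ∀ i : X, (∫ z in coord W ⁻¹' (chartAt W i).target,
      (chartPartition W X i ((chartAt W i).symm (coord W z)) : ℂ) * dens i η (coord W z)) =
      ∫ z in coord W ⁻¹' (chartAt W j).target,
        (chartPartition W X i ((chartAt W j).symm (coord W z)) : ℂ) * dens j η (coord W z) := by
    intro i
    rw [setIntegral_eq_of_subset_of_forall_sdiff_eq_zero (hmeas i)
      (s := coord W ⁻¹' overlap W i j) (fun z hz => hz.1) fun z hz => ?_,
      setIntegral_eq_of_subset_of_forall_sdiff_eq_zero (hmeas j)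
      (s := coord W ⁻¹' overlap W j i) (fun z hz => hz.1) fun z hz => ?_]
    · have himg : overlap W i j = chartTrans j i '' overlap W j i := by
        ext y
        constructor
        · exact fun hy => ⟨chartTrans i j y, chartTrans_mem hy, chartTrans_chartTrans hy⟩
        · rintro ⟨y', hy', rfl⟩
          exact chartTrans_mem hy'
      rw [himg, integral_image (isOpen_overlap j i)
        (fun y hy => (contDiffAt_chartTrans hy).differentiableAt (by decide))
        (fun y hy y' hy' h => by
          rw [← chartTrans_chartTrans hy, h, chartTrans_chartTrans hy'])
        fun y => (chartPartition W X i ((chartAt W i).symm y) : ℂ) * dens i η y]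
      refine setIntegral_congr_fun
        ((isOpen_overlap j i).preimage continuous_coord).measurableSet fun z hz => ?_
      change _ = (chartPartition W X i ((chartAt W j).symm (coord W z)) : ℂ) * dens j η (coord W z)
      rw [dens_eq hz, ← symm_chartTrans hz]
      ring
    · have h1 : chartPartition W X i ((chartAt W j).symm (coord W z)) = 0 :=
        image_eq_zero_of_notMem_tsupport fun h => hz.2 ⟨hz.1, tsupport_chartPartition i h⟩
      rw [h1, Complex.ofReal_zero, zero_mul]
    · rw [dens_of_eq_zero (hK0 _ fun h => hz.2 ⟨hz.1, hKj h⟩), mul_zero]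
  have hfin := finite_chartPartition (W := W) hK
  rw [integralTop_eq, finsum_eq_sum_of_support_subset _
    ((support_integral_subset hK0).trans_eq hfin.coe_toFinset.symm),
    Finset.sum_congr rfl fun i _ => hcv i, ← integral_finsetSum _ fun i _ => ?_]
  · refine setIntegral_congr_fun (hmeas j) fun z hz => ?_
    change ∑ i ∈ hfin.toFinset, (chartPartition W X i ((chartAt W j).symm (coord W z)) : ℂ) *
      dens j η (coord W z) = dens j η (coord W z)
    rw [← Finset.sum_mul, ← Complex.ofReal_sum]
    by_cases h1 : (chartAt W j).symm (coord W z) ∈ K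
    · have h2 : (chartPartition W X).finsupport ((chartAt W j).symm (coord W z)) ⊆
          hfin.toFinset := by
        intro i hi
        rw [SmoothPartitionOfUnity.mem_finsupport] at hi
        exact hfin.mem_toFinset.2 ⟨_, hi, h1⟩
      rw [(chartPartition W X).sum_finsupport' _ (Set.mem_univ _) h2, Complex.ofReal_one, one_mul]
    · rw [dens_of_eq_zero (hK0 _ h1), mul_zero]
  · exact integrableOn_dens hη (chartPartition W X i).contMDiff.continuous
      ⟨K, hK.isClosed, hKj, fun x hx => Or.inr (hK0 x hx)⟩

end Integration

section LocalStokes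

open MeasureTheory

variable {W : Type*} [NormedAddCommGroup W] [NormedSpace ℂ W] [FiniteDimensional ℂ W]

theorem integral_fderiv_eq_zero {f : W → ℂ} (hf : ContDiff ℝ ∞ f) {C : Set W} (hC : IsCompact C)
    (h0 : ∀ z ∉ C, f z = 0) (v : W) :
    Integrable (fun z : Fin (Module.finrank ℂ W) → ℂ => fderiv ℝ f (coord W z) v) ∧
      ∫ z, fderiv ℝ f (coord W z) v = 0 := by
  let e : (Fin (Module.finrank ℂ W) → ℂ) →L[ℝ] W := (coordL W : _ →L[ℂ] W).restrictScalars ℝ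
  have hg : ContDiff ℝ ∞ (f ∘ e) := hf.comp e.contDiff
  have hder : ∀ z, fderiv ℝ (f ∘ e) z ((coord W).symm v) = fderiv ℝ f (coord W z) v := by
    intro z
    rw [fderiv_comp z ((hf.differentiable (by decide)).differentiableAt) e.differentiableAt,
      ContinuousLinearMap.fderiv]
    change fderiv ℝ f (coord W z) (coord W ((coord W).symm v)) = _
    rw [LinearEquiv.apply_symm_apply]
  have hC' : IsCompact (coord W ⁻¹' C) := (coordL W).toHomeomorph.isCompact_preimage.2 hC
  have hsupp : HasCompactSupport (f ∘ e) := HasCompactSupport.intro hC' fun z hz => h0 _ hz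
  have hint : Integrable (f ∘ e) := hg.continuous.integrable_of_hasCompactSupport hsupp
  have hint' : Integrable fun z => fderiv ℝ (f ∘ e) z ((coord W).symm v) := by
    refine Continuous.integrable_of_hasCompactSupport ?_ ?_
    · exact (hg.continuous_fderiv (by decide)).clm_apply continuous_const
    · exact hsupp.fderiv_apply ℝ _
  have h := integral_mul_fderiv_eq_neg_fderiv_mul_of_integrable (𝕜 := ℂ)
    (μ := (volume : Measure (Fin (Module.finrank ℂ W) → ℂ)))
    (f := fun _ => 1) (g := f ∘ e) (v := (coord W).symm v) (by simp) (by simpa using hint')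
    (by simpa [Function.comp_def] using hint) (fun z _ => differentiableAt_const _)
    fun z _ => (hg.differentiable (by decide)).differentiableAt
  simp only [hder] at h hint'
  exact ⟨hint', by simpa using h⟩

theorem integral_dol_eq_zero {β : W → GForm W ℂ} (hβ : ∀ z, SmoothAt β z) {C : Set W}
    (hC : IsCompact C) (h0 : ∀ z ∉ C, β z = 0) (c : ℂ) {N : ℕ} (e : Fin N → W) :
    ∫ z : Fin (Module.finrank ℂ W) → ℂ, dol c β (coord W z) N e = 0 := by
  cases N with
  | zero =>
    simp only [dol_zero_apply]
    exact integral_zero _ _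
  | succ k =>
    have hf : ∀ w : Fin k → W, ContDiff ℝ ∞ fun z => β z k w := fun w =>
      contDiff_iff_contDiffAt.2 fun z => (hβ z).eval k w
    have hz : ∀ w : Fin k → W, ∀ z ∉ C, β z k w = 0 := by
      intro w z hz
      rw [h0 z hz]
      rfl
    have hI := fun w v => integral_fderiv_eq_zero (hf w) hC (hz w) v
    have hexp : ∀ z, dol c β z (k + 1) e = ∑ i : Fin (k + 1), (-1 : ℝ) ^ (i : ℕ) •
        ((1 / 2 : ℂ) • (fderiv ℝ (fun y => β y k (i.removeNth e)) z (e i) +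
          c • fderiv ℝ (fun y => β y k (i.removeNth e)) z (Complex.I • e i))) := by
      intro z
      rw [dol, altG_succ_apply]
      refine Finset.sum_congr rfl fun i _ => ?_
      rw [partL_apply, ← dirDeriv_apply (hβ z), ← dirDeriv_apply (hβ z)]
      rfl
    simp only [hexp]
    rw [integral_finsetSum]
    · refine Finset.sum_eq_zero fun i _ => ?_
      have hA := hI (i.removeNth e) (e i)
      have hB := hI (i.removeNth e) (Complex.I • e i)
      have hB' : ∫ z : Fin (Module.finrank ℂ W) → ℂ,
          c • fderiv ℝ (fun y => β y k (i.removeNth e)) (coord W z) (Complex.I • e i) = 0 := by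
        rw [MeasureTheory.integral_smul, hB.2, smul_zero]
      have hAB := integral_add hA.1 (hB.1.smul c)
      rw [hA.2, zero_add] at hAB
      rw [MeasureTheory.integral_smul, MeasureTheory.integral_smul]
      refine (congrArg (fun t : ℂ => (-1 : ℝ) ^ (i : ℕ) • (1 / 2 : ℂ) • t) (hAB.trans hB')).trans ?_
      rw [smul_zero, smul_zero]
    · intro i _
      exact (((hI _ _).1.add ((hI _ _).1.smul c)).smul (1 / 2 : ℂ)).smul ((-1 : ℝ) ^ (i : ℕ))

end LocalStokes

section Pairing

variable {W : Type*} [NormedAddCommGroup W] [NormedSpace ℂ W]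
  {X : Type*} [TopologicalSpace X] [ChartedSpace W X]
  {F : Type*} [NormedAddCommGroup F] [NormedSpace ℂ F] [FiniteDimensional ℂ F]
  {E : X → Type*} [∀ x, AddCommGroup (E x)] [∀ x, Module ℂ (E x)]
  [∀ x, TopologicalSpace (E x)] [TopologicalSpace (Bundle.TotalSpace F E)]
  [FiberBundle F E] [VectorBundle ℂ F E]

/-- The pairing `(v, t) ↦ ∑ vⱼ conj tⱼ`. -/
def coeffPair (F : Type*) [NormedAddCommGroup F] [NormedSpace ℂ F] [FiniteDimensional ℂ F] :
    (Fin (Module.finrank ℂ F) → ℂ) →ₗ[ℝ] F →ₗ[ℝ] ℂ :=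
  LinearMap.mk₂ ℝ (fun v t => ∑ j, conj ((Module.finBasis ℂ F).repr t j) * v j)
    (fun v v' t => by simp [mul_add, Finset.sum_add_distrib])
    (fun r v t => by
      simp only [Pi.smul_apply, Complex.real_smul, Finset.mul_sum]
      exact Finset.sum_congr rfl fun j _ => by ring)
    (fun v t t' => by simp [add_mul, Finset.sum_add_distrib])
    (fun r v t => by
      rw [← Complex.coe_smul r t, map_smul]
      simp only [Finsupp.smul_apply, smul_eq_mul, map_mul, Complex.conj_ofReal,
        Complex.real_smul, Finset.mul_sum]
      exact Finset.sum_congr rfl fun j _ => by ring)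

theorem coeffPair_apply (v : Fin (Module.finrank ℂ F) → ℂ) (t : F) :
    coeffPair F v t = ∑ j, conj ((Module.finBasis ℂ F).repr t j) * v j := rfl

theorem coeffPair_smul_left (c : ℂ) (v : Fin (Module.finrank ℂ F) → ℂ) (t : F) :
    coeffPair F (c • v) t = c • coeffPair F v t := by
  simp only [coeffPair_apply, Pi.smul_apply, smul_eq_mul, Finset.mul_sum]
  exact Finset.sum_congr rfl fun j _ => by ring

theorem coeffPair_smul_right (c : ℂ) (v : Fin (Module.finrank ℂ F) → ℂ) (t : F) :
    coeffPair F v (conj c • t) = c • coeffPair F v t := by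
  simp only [coeffPair_apply, map_smul, Finsupp.smul_apply, smul_eq_mul, map_mul,
    Complex.conj_conj, Finset.mul_sum]
  exact Finset.sum_congr rfl fun j _ => by ring

/-- The pairing `(s, v) ↦ ∑ sⱼ conj vⱼ`. -/
def coeffPairConj (F : Type*) [NormedAddCommGroup F] [NormedSpace ℂ F] [FiniteDimensional ℂ F] :
    F →ₗ[ℝ] (Fin (Module.finrank ℂ F) → ℂ) →ₗ[ℝ] ℂ :=
  (coeffPair F).flip.compr₂ Complex.conjAe.toLinearMap

theorem coeffPairConj_apply (s : F) (v : Fin (Module.finrank ℂ F) → ℂ) :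
    coeffPairConj F s v = conj (coeffPair F v s) := rfl

namespace HermitianMetric

variable (h : HermitianMetric (W := W) F E)

theorem bilin_eq_coeffPair {x p : X} (hp : p ∈ (trivializationAt F E x).baseSet) (s t : E p) :
    h.bilin p s t = coeffPair F (h.gram x p ((trivializationAt F E x).linearMapAt ℂ p s))
      ((trivializationAt F E x).linearMapAt ℂ p t) := by
  rw [coeffPair_apply, ← toFun_symmₗ]
  have e : ∀ s : E p, (trivializationAt F E x).symmₗ ℂ p
      ((trivializationAt F E x).linearMapAt ℂ p s) = s := fun s => by
    exact (trivializationAt F E x).symmₗ_linearMapAt (R := ℂ) hp s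
  rw [e, e]
  rfl

theorem bilin_eq_coeffPairConj {x p : X} (hp : p ∈ (trivializationAt F E x).baseSet)
    (s t : E p) :
    h.bilin p s t = coeffPairConj F ((trivializationAt F E x).linearMapAt ℂ p s)
      (h.gram x p ((trivializationAt F E x).linearMapAt ℂ p t)) := by
  rw [coeffPairConj_apply, ← bilin_eq_coeffPair h hp]
  exact (h.conj_symm p t s).symm

theorem loc_pair (u w : EForm W E) {x : X} {z : W}
    (hz : (chartAt W x).symm z ∈ (trivializationAt F E x).baseSet) :
    loc x (untan (h.pair u w)) z = wedge (coeffPair F) (h.lower x u z) (lf F x w z) := by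
  refine (congrArg (pull ((dC x z).restrictScalars ℝ).toLinearMap)
    ((mapV_id (g := LinearMap.id) (fun _ => rfl) _).symm.trans
      (mapV_wedge (M := Tan W ((chartAt W x).symm z)) (g := LinearMap.id)
        (f := ((h.gram x ((chartAt W x).symm z)).restrictScalars ℝ) ∘ₗ
          ((trivializationAt F E x).linearMapAt ℂ ((chartAt W x).symm z)).restrictScalars ℝ)
        (f' := ((trivializationAt F E x).linearMapAt ℂ ((chartAt W x).symm z)).restrictScalars ℝ)
        (h.bilin_eq_coeffPair hz) (u _) (w _)))).trans ?_
  exact pull_wedge _ _ _ _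

theorem loc_pair_conj (u w : EForm W E) {x : X} {z : W}
    (hz : (chartAt W x).symm z ∈ (trivializationAt F E x).baseSet) :
    loc x (untan (h.pair u w)) z = wedge (coeffPairConj F) (lf F x u z) (h.lower x w z) := by
  refine (congrArg (pull ((dC x z).restrictScalars ℝ).toLinearMap)
    ((mapV_id (g := LinearMap.id) (fun _ => rfl) _).symm.trans
      (mapV_wedge (M := Tan W ((chartAt W x).symm z)) (g := LinearMap.id)
        (f := ((trivializationAt F E x).linearMapAt ℂ ((chartAt W x).symm z)).restrictScalars ℝ)
        (f' := ((h.gram x ((chartAt W x).symm z)).restrictScalars ℝ) ∘ₗ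
          ((trivializationAt F E x).linearMapAt ℂ ((chartAt W x).symm z)).restrictScalars ℝ)
        (h.bilin_eq_coeffPairConj hz) (u _) (w _)))).trans ?_
  exact pull_wedge _ _ _ _

theorem pair_add_left (u u' w : EForm W E) : h.pair (u + u') w = h.pair u w + h.pair u' w :=
  funext fun x => LinearMap.map_add₂ (wedgeL (M := Tan W x) (h.bilin x)) (u x) (u' x) (w x)

theorem pair_add_right (u w w' : EForm W E) : h.pair u (w + w') = h.pair u w + h.pair u w' :=
  funext fun x => map_add (wedgeL (M := Tan W x) (h.bilin x) (u x)) (w x) (w' x)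

variable [IsManifold 𝓘(ℂ, W) ω X] [ContMDiffVectorBundle ω F E 𝓘(ℂ, W)] [FiniteDimensional ℂ W]

theorem isSmoothForm_pair {u w : EForm W E} (hu : IsSmooth F u) (hw : IsSmooth F w) :
    IsSmoothForm (untan (h.pair u w)) := by
  intro x
  refine ((smoothAt_lower h hu (chart_mem_localDomain x)).wedge (hw x) (coeffPair F)).congr ?_
  filter_upwards [localDomain_mem_nhds (F := F) (E := E) x] with z hz
  exact h.loc_pair u w hz.2

variable [T2Space X] [SigmaCompactSpace X]

theorem isTestForm_pair {u w : EForm W E} (hu : u ∈ V W F E) (hw : w ∈ V W F E) :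
    IsTestForm (untan (h.pair u w)) := by
  obtain ⟨hus, K, hK, hK0⟩ := mem_V_iff.1 hu
  refine ⟨h.isSmoothForm_pair hus (mem_V_iff.1 hw).1, K, hK, fun x hx => ?_⟩
  change wedge (M := Tan W x) (h.bilin x) (u x) (w x) = 0
  rw [hK0 x hx]
  exact LinearMap.map_zero₂ (wedgeL (M := Tan W x) (h.bilin x)) (w x)

/-- The integral of the pairing `{u, w}`. -/
def pairInt (u w : EForm W E) : ℂ := integralTop (untan (h.pair u w))

theorem pairInt_add_left {u u' w : EForm W E} (hu : u ∈ V W F E) (hu' : u' ∈ V W F E)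
    (hw : w ∈ V W F E) : h.pairInt (u + u') w = h.pairInt u w + h.pairInt u' w := by
  rw [pairInt, pair_add_left]
  exact integralTop_add (h.isTestForm_pair hu hw) (h.isTestForm_pair hu' hw)

theorem pairInt_add_right {u w w' : EForm W E} (hu : u ∈ V W F E) (hw : w ∈ V W F E)
    (hw' : w' ∈ V W F E) : h.pairInt u (w + w') = h.pairInt u w + h.pairInt u w' := by
  rw [pairInt, pair_add_right]
  exact integralTop_add (h.isTestForm_pair hu hw) (h.isTestForm_pair hu hw')

end HermitianMetric

end Pairing

section Stokes

open MeasureTheory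

theorem SmoothAt.realSmul {W G : Type*} [NormedAddCommGroup W] [NormedSpace ℂ W]
    [FiniteDimensional ℂ W] [NormedAddCommGroup G] [NormedSpace ℂ G] [FiniteDimensional ℂ G]
    {f : W → ℝ} {a : W → GForm W G} {y : W} (hf : ContDiffAt ℝ ∞ f y) (ha : SmoothAt a y) :
    SmoothAt (fun z => f z • a z) y := fun k =>
  (hf.smul (ha k)).congr_of_eventuallyEq (Filter.Eventually.of_forall fun _ => rfl)

variable {W : Type*} [NormedAddCommGroup W] [NormedSpace ℂ W]
  {X : Type*} [TopologicalSpace X] [ChartedSpace W X]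
  {F : Type*} [NormedAddCommGroup F] [NormedSpace ℂ F] [FiniteDimensional ℂ F]
  {E : X → Type*} [∀ x, AddCommGroup (E x)] [∀ x, Module ℂ (E x)]

theorem contDiffAt_comp_chart_symm {χ : X → ℝ} (hχ : ContMDiff 𝓘(ℝ, W) 𝓘(ℝ, ℝ) ∞ χ) (x : X) :
    ContDiffAt ℝ ∞ (fun z => χ ((chartAt W x).symm z)) (chartAt W x x) := by
  have h := (contMDiffAt_iff.1 (hχ x)).2
  simp only [mfld_simps] at h
  exact h.contDiffAt Filter.univ_mem

/-- Multiplication of a form by a function. -/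
def cut (χ : X → ℝ) (u : EForm W E) : EForm W E := fun x => χ x • u x

/-- The sign `(-1) ^ k` on forms of degree `k`. -/
def sgnE (u : EForm W E) : EForm W E := fun x => sgn (u x)

variable [∀ x, TopologicalSpace (E x)] [TopologicalSpace (Bundle.TotalSpace F E)]
  [FiberBundle F E] [VectorBundle ℂ F E]

theorem flat_cut (χ : X → ℝ) (u : EForm W E) (x p : X) :
    flat F x (cut χ u) p = χ p • flat F x u p :=
  map_smul (mapV (M := Tan W p)
    (((trivializationAt F E x).linearMapAt ℂ p).restrictScalars ℝ)) (χ p) (u p)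

theorem lf_cut (χ : X → ℝ) (u : EForm W E) (x : X) (z : W) :
    lf F x (cut χ u) z = χ ((chartAt W x).symm z) • lf F x u z := by
  rw [lf, loc, flat_cut, map_smul]
  rfl

theorem lf_sgnE (u : EForm W E) (x : X) (z : W) : lf F x (sgnE u) z = sgn (lf F x u z) := by
  funext k
  ext w
  exact map_smul (((trivializationAt F E x).linearMapAt ℂ
    ((chartAt W x).symm z)).restrictScalars ℝ) ((-1 : ℝ) ^ k) _

variable [IsManifold 𝓘(ℂ, W) ω X] [ContMDiffVectorBundle ω F E 𝓘(ℂ, W)] [FiniteDimensional ℂ W]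

theorem cut_mem_V {χ : X → ℝ} (hχ : ContMDiff 𝓘(ℝ, W) 𝓘(ℝ, ℝ) ∞ χ) {u : EForm W E}
    (hu : u ∈ V W F E) : cut χ u ∈ V W F E := by
  obtain ⟨hus, K, hK, hK0⟩ := mem_V_iff.1 hu
  refine mem_V_iff.2 ⟨fun x => ?_, K, hK, fun x hx => ?_⟩
  · exact ((hus x).realSmul (contDiffAt_comp_chart_symm hχ x)).congr
      (Filter.Eventually.of_forall fun z => lf_cut χ u x z)
  · rw [cut, hK0 x hx, smul_zero]

theorem sgnE_mem_V {u : EForm W E} (hu : u ∈ V W F E) : sgnE u ∈ V W F E := by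
  obtain ⟨hus, K, hK, hK0⟩ := mem_V_iff.1 hu
  refine mem_V_iff.2 ⟨fun x => ?_, K, hK, fun x hx => ?_⟩
  · exact (hus x).sgn.congr (Filter.Eventually.of_forall fun z => lf_sgnE u x z)
  · rw [sgnE, hK0 x hx, map_zero]

variable [T2Space X] [SigmaCompactSpace X]

theorem eq_zero_of_local {S : EForm W E → ℂ}
    (hadd : ∀ u ∈ V W F E, ∀ v ∈ V W F E, S (u + v) = S u + S v)
    (hloc : ∀ u ∈ V W F E, ∀ (j : X) (K : Set X), IsCompact K → K ⊆ (chartAt W j).source →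
      K ⊆ (trivializationAt F E j).baseSet → (∀ x ∉ K, u x = 0) → S u = 0) :
    ∀ u ∈ V W F E, S u = 0 := by
  intro u hu
  haveI : IsManifold 𝓘(ℝ, W) ∞ X := isManifold_real
  obtain ⟨-, K, hK, hK0⟩ := mem_V_iff.1 hu
  obtain ⟨ρ, hρ⟩ := SmoothPartitionOfUnity.exists_isSubordinate 𝓘(ℝ, W) isClosed_univ
    (fun x : X => (chartAt W x).source ∩ (trivializationAt F E x).baseSet)
    (fun x => (chartAt W x).open_source.inter (trivializationAt F E x).open_baseSet)
    (fun x _ => Set.mem_iUnion.2 ⟨x, mem_chart_source W x,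
      FiberBundle.mem_baseSet_trivializationAt F E x⟩)
  have hfin := ρ.locallyFinite.finite_nonempty_inter_compact hK
  have hsum : ∑ j ∈ hfin.toFinset, cut (ρ j) u = u := by
    funext x
    rw [Finset.sum_apply]
    change ∑ j ∈ hfin.toFinset, ρ j x • u x = u x
    rw [← Finset.sum_smul]
    by_cases hx : x ∈ K
    · have h2 : ρ.finsupport x ⊆ hfin.toFinset := by
        intro i hi
        rw [SmoothPartitionOfUnity.mem_finsupport] at hi
        exact hfin.mem_toFinset.2 ⟨_, hi, hx⟩
      rw [ρ.sum_finsupport' _ (Set.mem_univ _) h2, one_smul]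
    · rw [hK0 x hx, smul_zero]
  have hmem : ∀ j, cut (ρ j) u ∈ V W F E := fun j => cut_mem_V (ρ j).contMDiff hu
  have h0 : S 0 = 0 := by
    have h := hadd 0 (zero_mem _) 0 (zero_mem _)
    rw [add_zero] at h
    exact left_eq_add.1 h
  have key : ∀ s : Finset X, S (∑ j ∈ s, cut (ρ j) u) = 0 := by
    intro s
    classical
    induction s using Finset.induction_on with
    | empty => rw [Finset.sum_empty, h0]
    | insert j s hj ih =>
      rw [Finset.sum_insert hj, hadd _ (hmem j) _ (sum_mem fun i _ => hmem i), ih, add_zero]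
      refine hloc _ (hmem j) j (K ∩ tsupport (ρ j)) (hK.inter_right (isClosed_tsupport _))
        (fun x hx => (hρ j hx.2).1) (fun x hx => (hρ j hx.2).2) fun x hx => ?_
      by_cases hxK : x ∈ K
      · rw [cut, image_eq_zero_of_notMem_tsupport fun h => hx ⟨hxK, h⟩, zero_smul]
      · rw [cut, hK0 x hxK, smul_zero]
  rw [← hsum]
  exact key _

theorem integralTop_eq_zero_of_local {η : X → GForm W ℂ} (hη : IsTestForm η) {j : X} {K : Set X}
    (hK : IsCompact K) (hKj : K ⊆ (chartAt W j).source)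
    (hKb : K ⊆ (trivializationAt F E j).baseSet) (hK0 : ∀ x ∉ K, η x = 0)
    {β : W → GForm W ℂ} (hβ : ∀ z ∈ localDomain W F E j, SmoothAt β z)
    (hβ0 : ∀ z ∈ localDomain W F E j, (chartAt W j).symm z ∉ K → β z = 0) (c : ℂ)
    (hηβ : ∀ z ∈ localDomain W F E j, loc j η z = dol c β z) : integralTop η = 0 := by
  classical
  have hC : IsCompact (chartAt W j '' K) :=
    hK.image_of_continuousOn ((chartAt W j).continuousOn.mono hKj)
  have hCloc : ∀ z ∈ chartAt W j '' K, z ∈ localDomain W F E j := by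
    rintro _ ⟨x, hx, rfl⟩
    refine ⟨(chartAt W j).map_source (hKj hx), ?_⟩
    rw [Set.mem_preimage, (chartAt W j).left_inv (hKj hx)]
    exact hKb hx
  have hCK : ∀ z ∈ (chartAt W j).target, (chartAt W j).symm z ∈ K → z ∈ chartAt W j '' K :=
    fun z hz hx => ⟨_, hx, (chartAt W j).right_inv hz⟩
  let γ : W → GForm W ℂ := fun z => if z ∈ chartAt W j '' K then β z else 0
  have hγ : ∀ z ∈ localDomain W F E j, γ z = β z := by
    intro z hz
    by_cases h : z ∈ chartAt W j '' K
    · exact if_pos h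
    · exact (if_neg h).trans (hβ0 z hz fun hx => h (hCK z hz.1 hx)).symm
  have hγev : ∀ z ∈ localDomain W F E j, γ =ᶠ[nhds z] β := fun z hz => by
    filter_upwards [(isOpen_localDomain j).mem_nhds hz] with z' hz' using hγ z' hz'
  have hγ0 : ∀ z ∉ chartAt W j '' K, γ =ᶠ[nhds z] fun _ => 0 := fun z hz => by
    filter_upwards [hC.isClosed.isOpen_compl.mem_nhds hz] with z' hz' using if_neg hz'
  have hsm : ∀ z, SmoothAt γ z := by
    intro z
    by_cases h : z ∈ chartAt W j '' K
    · exact (hβ z (hCloc z h)).congr (hγev z (hCloc z h))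
    · exact (SmoothAt.const 0 z).congr (hγ0 z h)
  have hd0 : ∀ z ∉ chartAt W j '' K, dol c γ z = 0 := fun z hz => by
    rw [dol_congr c (hγ0 z hz), dol_zero]
  have hdens : ∀ z ∈ (chartAt W j).target,
      dens j η z = dol c γ z (2 * Module.finrank ℂ W) (stdFrame W) := by
    intro z hz
    by_cases h : z ∈ localDomain W F E j
    · rw [dens, hηβ z h, dol_congr c (hγev z h)]
    · have h1 : z ∉ chartAt W j '' K := fun h' => h (hCloc z h')
      rw [dens_of_eq_zero (hK0 _ fun h' => h1 (hCK z hz h')), hd0 z h1]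
      rfl
  have hmeas : MeasurableSet (coord W ⁻¹' (chartAt W j).target) :=
    ((chartAt W j).open_target.preimage continuous_coord).measurableSet
  rw [integralTop_eq_of_support hη hK hKj hK0,
    setIntegral_congr_fun hmeas fun z hz => hdens (coord W z) hz,
    setIntegral_eq_integral_of_forall_compl_eq_zero fun z hz => ?_]
  · exact integral_dol_eq_zero hsm hC (fun z hz => if_neg hz) c (stdFrame W)
  · rw [hd0 _ fun h => hz (hCloc _ h).1]
    rfl

namespace HermitianMetric

variable (h : HermitianMetric (W := W) F E)

theorem pair_eq_zero_left {u : EForm W E} {x : X} (hu : u x = 0) (w : EForm W E) :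
    untan (h.pair u w) x = 0 := by
  change wedge (M := Tan W x) (h.bilin x) (u x) (w x) = 0
  rw [hu]
  exact LinearMap.map_zero₂ (wedgeL (M := Tan W x) (h.bilin x)) (w x)

theorem lf_eq_zero {u : EForm W E} {x : X} {z : W} (hu : u ((chartAt W x).symm z) = 0) :
    lf F x u z = 0 := by
  rw [lf, loc, flat_of_eq_zero x hu, map_zero]

theorem pairInt_dbarE {u w : EForm W E} (hu : u ∈ V W F E) (hw : w ∈ V W F E) :
    h.pairInt (dbarE F u) w + h.pairInt (sgnE u) (delE h w) = 0 := by
  have hw' := delE_mem_V h hw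
  refine eq_zero_of_local (F := F)
    (S := fun u => h.pairInt (dbarE F u) w + h.pairInt (sgnE u) (delE h w))
    (fun u hu v hv => ?_) (fun u hu j K hK hKj hKb hK0 => ?_) u hu
  · have h1 : sgnE (u + v) = sgnE u + sgnE v := funext fun x => map_add sgn (u x) (v x)
    rw [dbarE_add (mem_V_iff.1 hu).1 (mem_V_iff.1 hv).1, h1,
      h.pairInt_add_left (dbarE_mem_V hu) (dbarE_mem_V hv) hw,
      h.pairInt_add_left (sgnE_mem_V hu) (sgnE_mem_V hv) hw']
    ring
  · have hus := (mem_V_iff.1 hu).1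
    have hws := (mem_V_iff.1 hw).1
    have ht1 := h.isTestForm_pair (dbarE_mem_V hu) hw
    have ht2 := h.isTestForm_pair (sgnE_mem_V hu) hw'
    refine (integralTop_add ht1 ht2).symm.trans
      (integralTop_eq_zero_of_local (F := F) (E := E) (ht1.add ht2) hK hKj hKb (fun x hx => ?_)
        (β := fun z => wedge (coeffPairConj F) (lf F j u z) (h.lower j w z))
        (fun z hz => (hus.smoothAt hz).wedge (smoothAt_lower h hws hz) _)
        (fun z hz hzK => ?_) Complex.I fun z hz => ?_)
    · rw [Pi.add_apply, h.pair_eq_zero_left (dbarE_eq_zero hK.isClosed hK0 hx),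
        h.pair_eq_zero_left, add_zero]
      rw [sgnE, hK0 x hx, map_zero]
    · rw [lf_eq_zero (hK0 _ hzK)]
      exact LinearMap.map_zero₂ (wedgeL (coeffPairConj F)) _
    · rw [dol_wedge (c' := -Complex.I) (hus.smoothAt hz) (smoothAt_lower h hws hz)
        (fun x y => ?_) fun x y => ?_]
      · rw [← lf_dbarE hus hz, ← lower_delE h hws hz, ← lf_sgnE]
        exact congrArg₂ (· + ·) (h.loc_pair_conj _ _ hz.2) (h.loc_pair_conj _ _ hz.2)
      · rw [coeffPairConj_apply, coeffPairConj_apply, ← Complex.conj_conj Complex.I,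
          coeffPair_smul_right, smul_eq_mul, map_mul, Complex.conj_conj]
        simp
      · rw [coeffPairConj_apply, coeffPairConj_apply, coeffPair_smul_left, smul_eq_mul, map_mul]
        simp

theorem pairInt_delE {u w : EForm W E} (hu : u ∈ V W F E) (hw : w ∈ V W F E) :
    h.pairInt (delE h u) w + h.pairInt (sgnE u) (dbarE F w) = 0 := by
  have hw' := dbarE_mem_V hw
  refine eq_zero_of_local (F := F)
    (S := fun u => h.pairInt (delE h u) w + h.pairInt (sgnE u) (dbarE F w))
    (fun u hu v hv => ?_) (fun u hu j K hK hKj hKb hK0 => ?_) u hu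
  · have h1 : sgnE (u + v) = sgnE u + sgnE v := funext fun x => map_add sgn (u x) (v x)
    rw [delE_add h (mem_V_iff.1 hu).1 (mem_V_iff.1 hv).1, h1,
      h.pairInt_add_left (delE_mem_V h hu) (delE_mem_V h hv) hw,
      h.pairInt_add_left (sgnE_mem_V hu) (sgnE_mem_V hv) hw']
    ring
  · have hus := (mem_V_iff.1 hu).1
    have hws := (mem_V_iff.1 hw).1
    have ht1 := h.isTestForm_pair (delE_mem_V h hu) hw
    have ht2 := h.isTestForm_pair (sgnE_mem_V hu) hw'
    have hlow : ∀ z, h.lower j (sgnE u) z = sgn (h.lower j u z) := fun z => by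
      rw [lower, lf_sgnE]
      funext k
      ext v
      exact congrFun (map_smul ((h.gram j ((chartAt W j).symm z)).restrictScalars ℝ)
        ((-1 : ℝ) ^ k) _) _
    refine (integralTop_add ht1 ht2).symm.trans
      (integralTop_eq_zero_of_local (F := F) (E := E) (ht1.add ht2) hK hKj hKb (fun x hx => ?_)
        (β := fun z => wedge (coeffPair F) (h.lower j u z) (lf F j w z))
        (fun z hz => (smoothAt_lower h hus hz).wedge (hws.smoothAt hz) _)
        (fun z hz hzK => ?_) (-Complex.I) fun z hz => ?_)
    · rw [Pi.add_apply, h.pair_eq_zero_left (delE_eq_zero h hK.isClosed hK0 hx),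
        h.pair_eq_zero_left, add_zero]
      rw [sgnE, hK0 x hx, map_zero]
    · rw [lower, lf_eq_zero (hK0 _ hzK), map_zero]
      exact LinearMap.map_zero₂ (wedgeL (coeffPair F)) _
    · rw [dol_wedge (c' := Complex.I) (smoothAt_lower h hus hz) (hws.smoothAt hz)
        (fun x y => coeffPair_smul_left _ x y) fun x y => ?_]
      · rw [← lf_dbarE hws hz, ← lower_delE h hus hz, ← hlow]
        exact congrArg₂ (· + ·) (h.loc_pair _ _ hz.2) (h.loc_pair _ _ hz.2)
      · rw [← coeffPair_smul_right]
        simp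

end HermitianMetric

end Stokes

section Nondegenerate

open MeasureTheory

variable {W : Type*} [NormedAddCommGroup W] [NormedSpace ℂ W] [FiniteDimensional ℂ W]
  {X : Type*} [TopologicalSpace X] [ChartedSpace W X]
  {F : Type*} [NormedAddCommGroup F] [NormedSpace ℂ F] [FiniteDimensional ℂ F]
  {E : X → Type*} [∀ x, AddCommGroup (E x)] [∀ x, Module ℂ (E x)]
  [∀ x, TopologicalSpace (E x)] [TopologicalSpace (Bundle.TotalSpace F E)]
  [FiberBundle F E] [VectorBundle ℂ F E]

theorem exists_wedge_coeffPairConj_ne_zero {t : GForm W (Fin (Module.finrank ℂ F) → ℂ)} {k : ℕ}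
    (hk : k ≤ 2 * Module.finrank ℂ W) (ht : t k ≠ 0) :
    ∃ s : GForm W F, wedge (coeffPairConj F) s t (2 * Module.finrank ℂ W) (stdFrame W) ≠ 0 := by
  have hx : (Pi.single k (t k) : GForm W (Fin (Module.finrank ℂ F) → ℂ)) ≠ 0 := fun h0 => by
    have h1 := congrFun h0 k
    rw [Pi.single_eq_same] at h1
    exact ht h1
  obtain ⟨y, hy, hne⟩ : ∃ y : GForm W ℝ, IsDeg (2 * Module.finrank ℂ W - k) y ∧
      wedge (LinearMap.lsmul ℝ _) y (Pi.single k (t k) : GForm W (Fin (Module.finrank ℂ F) → ℂ))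
        (2 * Module.finrank ℂ W) (stdFrame W) ≠ 0 := by
    by_contra hcon
    push Not at hcon
    refine hx (eq_zero_of_wedge_eq_zero (frameBasis (Module.finBasis ℂ W))
      (Nat.add_sub_cancel' hk) (IsDeg.single k _) fun y hy => ?_)
    rw [coe_frameBasis]
    exact hcon y hy
  obtain ⟨j, hj⟩ := Function.ne_iff.1 hne
  let f : ℝ →ₗ[ℝ] F := LinearMap.toSpanSingleton ℝ F (Module.finBasis ℂ F j)
  let g : (Fin (Module.finrank ℂ F) → ℂ) →ₗ[ℝ] ℂ :=
    Complex.conjAe.toLinearMap ∘ₗ LinearMap.proj j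
  have hg : ∀ (r : ℝ) (v : Fin (Module.finrank ℂ F) → ℂ),
      g (LinearMap.lsmul ℝ _ r v) = coeffPairConj F (f r) (LinearMap.id (R := ℝ) v) := by
    intro r v
    rw [coeffPairConj_apply, coeffPair_apply]
    have e1 : f r = (r : ℂ) • Module.finBasis ℂ F j := (Complex.coe_smul _ _).symm
    rw [e1, map_smul, Module.Basis.repr_self, Finset.sum_eq_single j]
    · simp [g]
    · intro i _ hi
      simp [Finsupp.single_eq_of_ne hi]
    · simp
  refine ⟨mapV f y, fun h0 => hj ?_⟩
  have hd : IsDeg (2 * Module.finrank ℂ W - k) (mapV f y) := hy.mapV f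
  have h1 := mapV_wedge hg y (Pi.single k (t k) : GForm W (Fin (Module.finrank ℂ F) → ℂ))
  rw [mapV_id (fun _ => rfl), ← single_wedge_apply _ hd t k, Nat.add_sub_cancel' hk] at h1
  have h2 := congrFun h1 (2 * Module.finrank ℂ W)
  rw [Pi.single_eq_same] at h2
  have h3 := congrArg (fun φ : W [⋀^Fin (2 * Module.finrank ℂ W)]→ₗ[ℝ] ℂ => φ (stdFrame W)) h2
  simp only [h0, mapV_apply] at h3
  exact (starRingEnd ℂ).injective (h3.trans (map_zero _).symm)

variable [IsManifold 𝓘(ℂ, W) ω X] [ContMDiffVectorBundle ω F E 𝓘(ℂ, W)]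

theorem smoothAt_lf_of_mem_overlapE {u : EForm W E} {x₀ x₁ : X} {z : W}
    (hz : z ∈ overlapE W F E x₀ x₁) (h : SmoothAt (lf F x₁ u) (chartTrans x₀ x₁ z)) :
    SmoothAt (lf F x₀ u) z := by
  refine SmoothAt.congr (SmoothAt.mapV_var
    (fun s => contDiffAt_real_of_complex (contDiffAt_frameChange_apply hz s))
    (smoothAt_pull_chartTrans hz.1 h)) ?_
  filter_upwards [(isOpen_overlapE x₀ _).mem_nhds hz] with z hz'
  exact lf_eq hz' u

theorem cut_mem_V_of_local {χ : X → ℝ} (hχ : ContMDiff 𝓘(ℝ, W) 𝓘(ℝ, ℝ) ∞ χ) {j : X}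
    (hc : HasCompactSupport χ) (hj : tsupport χ ⊆ (chartAt W j).source)
    (hb : tsupport χ ⊆ (trivializationAt F E j).baseSet) {u : EForm W E}
    (hu : ∀ z ∈ localDomain W F E j, SmoothAt (lf F j u) z) : cut χ u ∈ V W F E := by
  refine mem_V_iff.2 ⟨fun x => ?_, tsupport χ, hc, fun x hx => ?_⟩
  · by_cases hx : x ∈ tsupport χ
    · have hz : chartAt W x x ∈ overlapE W F E x j := by
        refine ⟨⟨mem_chart_target W x, ?_⟩, mem_chart_target W x, ?_⟩ <;>
        rw [Set.mem_preimage, (chartAt W x).left_inv (mem_chart_source W x)]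
        · exact hj hx
        · exact ⟨FiberBundle.mem_baseSet_trivializationAt F E x, hb hx⟩
      have hct : chartTrans x j (chartAt W x x) = chartAt W j x := by
        rw [chartTrans, Function.comp_apply, (chartAt W x).left_inv (mem_chart_source W x)]
      refine ((smoothAt_lf_of_mem_overlapE hz ?_).realSmul
        (contDiffAt_comp_chart_symm hχ x)).congr
          (Filter.Eventually.of_forall fun z => lf_cut χ u x z)
      rw [hct]
      refine hu _ ⟨(chartAt W j).map_source (hj hx), ?_⟩
      rw [Set.mem_preimage, (chartAt W j).left_inv (hj hx)]
      exact hb hx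
    · refine (SmoothAt.csmul (G := F) (a := fun _ => 0) (fun k => contDiffAt_const) 1).congr
        ((lf_eventuallyEq_zero (F := F) (isClosed_tsupport χ) (fun y hy => ?_) hx).trans
          (Filter.Eventually.of_forall fun z => (smul_zero _).symm))
      rw [cut, image_eq_zero_of_notMem_tsupport hy, zero_smul]
  · rw [cut, image_eq_zero_of_notMem_tsupport hx, zero_smul]

/-- The form that is constant in the frame and the chart at `j`. -/
theorem exists_lf_eq (j : X) (s : GForm W F) :
    ∃ u : EForm W E, ∀ z ∈ localDomain W F E j, lf F j u z = s := by
  have h : ∀ p : X, ∃ g : W →ₗ[ℝ] W, p ∈ (chartAt W j).source →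
      g ∘ₗ ((dC j (chartAt W j p)).restrictScalars ℝ).toLinearMap = LinearMap.id := by
    intro p
    by_cases hp : p ∈ (chartAt W j).source
    · obtain ⟨g, hg⟩ := LinearMap.exists_leftInverse_of_injective
        ((dC j (chartAt W j p)).restrictScalars ℝ).toLinearMap
        (LinearMap.ker_eq_bot.2 (isUnit_dC ((chartAt W j).map_source hp)).1)
      exact ⟨g, fun _ => hg⟩
    · exact ⟨0, fun h => absurd h hp⟩
  choose g hg using h
  refine ⟨fun p => mapV (M := Tan W p)
    (((trivializationAt F E j).symmₗ ℂ p).restrictScalars ℝ) (pull (g p) s), fun z hz => ?_⟩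
  have hp := (chartAt W j).map_target hz.1
  have h1 : flat F j (fun p => mapV (M := Tan W p)
      (((trivializationAt F E j).symmₗ ℂ p).restrictScalars ℝ) (pull (g p) s) : EForm W E)
      ((chartAt W j).symm z) = pull (g ((chartAt W j).symm z)) s := by
    funext k
    ext v
    exact (trivializationAt F E j).linearMapAt_symmₗ (R := ℂ) hz.2 _
  rw [lf, loc, h1, pull_pull]
  have h2 := hg _ hp
  rw [(chartAt W j).right_inv hz.1] at h2
  rw [h2]
  exact pull_id s

variable [T2Space X] [SigmaCompactSpace X]

namespace HermitianMetric

variable (h : HermitianMetric (W := W) F E)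

theorem eq_zero_of_pairInt {w : EForm W E} (hw : w ∈ V W F E)
    (h0 : ∀ a ∈ V W F E, h.pairInt a w = 0) : w = 0 := by
  by_contra hne
  obtain ⟨x, hx⟩ := Function.ne_iff.1 hne
  have hws := (mem_V_iff.1 hw).1
  have hlow : h.lower x w (chartAt W x x) ≠ 0 := by
    intro h1
    rw [lower, lf_self, (chartAt W x).left_inv (mem_chart_source W x)] at h1
    have h2 : flat F x w x = 0 := mapV_injective
      (h.gram_bijective (FiberBundle.mem_baseSet_trivializationAt F E x)).1
      (h1.trans (map_zero _).symm)
    exact hx (flat_injective (F := F) (v := 0) (FiberBundle.mem_baseSet_trivializationAt F E x)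
      (h2.trans (flat_of_eq_zero x rfl).symm))
  obtain ⟨k, hk⟩ := Function.ne_iff.1 hlow
  have hk2 : k ≤ 2 * Module.finrank ℂ W := by
    by_contra hlt
    have h1 := (IsDeg.single k (h.lower x w (chartAt W x x) k)).eq_zero_of_lt
      (Module.finBasis ℂ W) (not_le.1 hlt)
    have h2 := congrFun h1 k
    rw [Pi.single_eq_same] at h2
    exact hk h2
  obtain ⟨s, hs⟩ := exists_wedge_coeffPairConj_ne_zero hk2 hk
  set c : ℂ := wedge (coeffPairConj F) s (h.lower x w (chartAt W x x))
    (2 * Module.finrank ℂ W) (stdFrame W) with hc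
  let G : W → ℂ := fun z => wedge (coeffPairConj F) s (h.lower x w z)
    (2 * Module.finrank ℂ W) (stdFrame W)
  have hsc : ∀ z, SmoothAt (fun _ : W => s) z := fun z k => contDiffAt_const
  have hG : ContinuousAt G (chartAt W x x) :=
    (((hsc _).wedge (smoothAt_lower h hws (chart_mem_localDomain x)) (coeffPairConj F)).eval
      _ _).continuousAt
  have hG0 : 0 < (conj c * G (chartAt W x x)).re := by
    change 0 < (conj c * c).re
    rw [mul_comm, Complex.mul_conj, Complex.ofReal_re]
    exact Complex.normSq_pos.2 hs
  have hGpos : ∀ᶠ z in nhds (chartAt W x x), 0 < (conj c * G z).re :=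
    (Complex.continuous_re.continuousAt.comp (continuousAt_const.mul hG)).eventually_const_lt hG0
  obtain ⟨u, hu⟩ := exists_lf_eq (E := E) x s
  haveI : IsManifold 𝓘(ℝ, W) ∞ X := isManifold_real
  obtain ⟨χ, -, hχ⟩ := (SmoothBumpFunction.nhds_basis_tsupport (I := 𝓘(ℝ, W)) x).mem_iff.1
    (Filter.inter_mem (Filter.inter_mem
      ((chartAt W x).open_source.mem_nhds (mem_chart_source W x))
      ((trivializationAt F E x).open_baseSet.mem_nhds
        (FiberBundle.mem_baseSet_trivializationAt F E x)))
      (((chartAt W x).continuousAt (mem_chart_source W x)).eventually hGpos))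
  have hχs : ContMDiff 𝓘(ℝ, W) 𝓘(ℝ, ℝ) ∞ χ := χ.contMDiff
  have ha : cut χ u ∈ V W F E := cut_mem_V_of_local (j := x) hχs χ.hasCompactSupport
    (fun p hp => (hχ hp).1.1) (fun p hp => (hχ hp).1.2) fun z hz =>
      (hsc z).congr (by
        filter_upwards [(isOpen_localDomain x).mem_nhds hz] with z' hz' using hu z' hz')
  have hη := h.isTestForm_pair ha hw
  have hηK : ∀ p ∉ tsupport χ, untan (h.pair (cut χ u) w) p = 0 := fun p hp =>
    h.pair_eq_zero_left (by rw [cut, image_eq_zero_of_notMem_tsupport hp, zero_smul]) w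
  have hdens : ∀ z ∈ (chartAt W x).target, conj c * dens x (untan (h.pair (cut χ u) w)) z =
      (χ ((chartAt W x).symm z) : ℂ) * (conj c * G z) := by
    intro z hz
    by_cases hzK : (chartAt W x).symm z ∈ tsupport χ
    · have hzl : z ∈ localDomain W F E x := ⟨hz, (hχ hzK).1.2⟩
      rw [dens, h.loc_pair_conj _ _ hzl.2, lf_cut, hu z hzl]
      have h1 := LinearMap.map_smul₂ (wedgeL (coeffPairConj F)) (χ ((chartAt W x).symm z)) s
        (h.lower x w z)
      rw [wedgeL_apply, wedgeL_apply] at h1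
      rw [h1]
      change conj c * ((χ ((chartAt W x).symm z) : ℝ) • G z) = _
      rw [Complex.real_smul]
      ring
    · rw [dens_of_eq_zero (hηK _ hzK), image_eq_zero_of_notMem_tsupport hzK]
      simp
  have hI := integralTop_eq_of_support hη χ.hasCompactSupport (fun p hp => (hχ hp).1.1) hηK
  have hint : IntegrableOn (fun z => dens x (untan (h.pair (cut χ u) w)) (coord W z))
      (coord W ⁻¹' (chartAt W x).target) := by
    have := integrableOn_dens (i := x) hη (ρ := fun _ => 1) continuous_const
      ⟨tsupport χ, isClosed_tsupport _, fun p hp => (hχ hp).1.1, fun p hp => Or.inr (hηK p hp)⟩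
    simpa using this
  have hmeas : MeasurableSet (coord W ⁻¹' (chartAt W x).target) :=
    ((chartAt W x).open_target.preimage continuous_coord).measurableSet
  have hre : ∫ z in coord W ⁻¹' (chartAt W x).target,
      (conj c * dens x (untan (h.pair (cut χ u) w)) (coord W z)).re = 0 := by
    have h1 := Complex.reCLM.integral_comp_comm (hint.const_mul (conj c))
    refine h1.trans ?_
    rw [MeasureTheory.integral_const_mul, ← hI]
    change (conj c * h.pairInt (cut χ u) w).re = 0
    rw [h0 _ ha, mul_zero, Complex.zero_re]
  refine absurd hre (ne_of_gt ((setIntegral_pos_iff_support_of_nonneg_ae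
    ((ae_restrict_iff' hmeas).2 (Filter.Eventually.of_forall fun z hz => ?_))
    (hint.const_mul (conj c)).re).2 ?_))
  · change 0 ≤ (conj c * dens x (untan (h.pair (cut χ u) w)) (coord W z)).re
    rw [hdens _ hz, Complex.re_ofReal_mul]
    by_cases hzK : (chartAt W x).symm (coord W z) ∈ tsupport χ
    · have h2 : 0 < (conj c * G (chartAt W x ((chartAt W x).symm (coord W z)))).re := (hχ hzK).2
      rw [(chartAt W x).right_inv hz] at h2
      exact mul_nonneg χ.nonneg h2.le
    · rw [image_eq_zero_of_notMem_tsupport hzK, zero_mul]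
  · refine Measure.measure_pos_of_mem_nhds volume (x := (coord W).symm (chartAt W x x)) ?_
    have hz0 : coord W ((coord W).symm (chartAt W x x)) = chartAt W x x :=
      LinearEquiv.apply_symm_apply _ _
    have hcoord : Filter.Tendsto (coord W) (nhds ((coord W).symm (chartAt W x x)))
        (nhds (chartAt W x x)) := by
      have := (continuous_coord (W := W)).continuousAt (x := (coord W).symm (chartAt W x x))
      rwa [ContinuousAt, hz0] at this
    have h3 : ∀ᶠ z in nhds (chartAt W x x), χ ((chartAt W x).symm z) = 1 := by
      have h4 := (chartAt W x).continuousAt_symm (mem_chart_target W x)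
      rw [ContinuousAt, (chartAt W x).left_inv (mem_chart_source W x)] at h4
      exact h4.eventually χ.eventuallyEq_one
    filter_upwards [hcoord.eventually h3, hcoord.eventually hGpos, hcoord.eventually
      ((chartAt W x).open_target.mem_nhds (mem_chart_target W x))] with z hz1 hz2 hz3
    refine ⟨?_, hz3⟩
    change (conj c * dens x (untan (h.pair (cut χ u) w)) (coord W z)).re ≠ 0
    rw [hdens _ hz3, hz1, Complex.ofReal_one, one_mul]
    exact hz2.ne'

end HermitianMetric

end Nondegenerate

section Inner

variable {W : Type*} [NormedAddCommGroup W] [NormedSpace ℂ W] [FiniteDimensional ℂ W]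
  {X : Type*} [TopologicalSpace X] [ChartedSpace W X] [IsManifold 𝓘(ℂ, W) ω X]
  [T2Space X] [SigmaCompactSpace X]

theorem integralTop_congr {η η' : X → GForm W ℂ}
    (h : ∀ x, η x (2 * Module.finrank ℂ W) = η' x (2 * Module.finrank ℂ W)) :
    integralTop η = integralTop η' :=
  congrArg (fun t : ∀ x : X, Tan W x [⋀^Fin (2 * Module.finrank ℂ W)]→ₗ[ℝ] ℂ => integralForm t)
    (funext h)

theorem integralTop_smul (c : ℂ) (η : X → GForm W ℂ) :
    integralTop (c • η) = c * integralTop η := by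
  rw [integralTop_eq, integralTop_eq, ← smul_eq_mul, smul_finsum]
  refine finsum_congr fun i => ?_
  rw [smul_eq_mul, ← MeasureTheory.integral_const_mul]
  refine MeasureTheory.setIntegral_congr_fun
    (((chartAt W i).open_target.preimage continuous_coord).measurableSet) fun z _ => ?_
  change (chartPartition W X i ((chartAt W i).symm (coord W z)) : ℂ) *
    (c * dens i η (coord W z)) = c * (_ * dens i η (coord W z))
  ring

variable {F : Type*} [NormedAddCommGroup F] [NormedSpace ℂ F] [FiniteDimensional ℂ F]
  {E : X → Type*} [∀ x, AddCommGroup (E x)] [∀ x, Module ℂ (E x)]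
  [∀ x, TopologicalSpace (E x)] [TopologicalSpace (Bundle.TotalSpace F E)]
  [FiberBundle F E] [VectorBundle ℂ F E] [ContMDiffVectorBundle ω F E 𝓘(ℂ, W)]

theorem sgnE_of_mem {k : ℕ} {u : EForm W E} (hu : u ∈ homogeneous W E k) :
    sgnE u = (-1 : ℂ) ^ k • u := by
  funext x j
  by_cases hj : j = k
  · subst hj
    change (-1 : ℝ) ^ j • u x j = (-1 : ℂ) ^ j • u x j
    rw [← Complex.coe_smul]
    push_cast
    rfl
  · change (-1 : ℝ) ^ j • u x j = (-1 : ℂ) ^ k • u x j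
    rw [hu x j hj, smul_zero, smul_zero]

theorem sgnE_sgnE (u : EForm W E) : sgnE (sgnE u) = u := funext fun x => sgn_sgn (u x)

theorem weil_weil (u : EForm W E) : weil (weil u) = sgnE u :=
  funext fun x => jf_jf (W := Tan W x) (N := E x) (u x)

theorem sum_comp (u : EForm W E) :
    ∑ k ∈ Finset.range (2 * Module.finrank ℂ W + 1), comp k u = u := by
  funext x k
  rw [Finset.sum_apply, Finset.sum_apply]
  by_cases hk : k ∈ Finset.range (2 * Module.finrank ℂ W + 1)
  · rw [Finset.sum_eq_single_of_mem k hk fun j _ hj => Pi.single_eq_of_ne hj.symm _]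
    exact Pi.single_eq_same _ _
  · rw [LefschetzData.apply_eq_zero_of_lt (W := W) (u := u) x (by rw [Finset.mem_range] at hk; omega)]
    exact Finset.sum_eq_zero fun j hj => Pi.single_eq_of_ne (fun h : k = j => hk (h ▸ hj)) _

namespace HermitianMetric

variable (h : HermitianMetric (W := W) F E)

theorem pairInt_smul_left (c : ℂ) (u w : EForm W E) :
    h.pairInt (c • u) w = c * h.pairInt u w := by
  rw [pairInt, pairInt, ← integralTop_smul]
  refine congrArg integralTop (funext fun x => ?_)
  refine (congrArg (fun t => wedge (M := Tan W x) (h.bilin x) t (w x))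
    (csmul_eq_mapV c (u x))).trans ?_
  have h1 := mapV_wedge (M := Tan W x) (B := h.bilin x) (B' := h.bilin x) (g := smulBilin ℂ c)
    (f := smulBilin (E x) c) (f' := LinearMap.id) (fun s t => ?_) (u x) (w x)
  · rw [mapV_id (g := LinearMap.id) (fun _ => rfl), ← csmul_eq_mapV] at h1
    exact h1.symm
  · change c • h.toFun x s t = h.toFun x (c • s) t
    rw [LinearMap.map_smul₂]

theorem pairInt_smul_right (c : ℂ) (u w : EForm W E) :
    h.pairInt u (c • w) = conj c * h.pairInt u w := by
  rw [pairInt, pairInt, ← integralTop_smul]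
  refine congrArg integralTop (funext fun x => ?_)
  refine (congrArg (fun t => wedge (M := Tan W x) (h.bilin x) (u x) t)
    (csmul_eq_mapV c (w x))).trans ?_
  have h1 := mapV_wedge (M := Tan W x) (B := h.bilin x) (B' := h.bilin x)
    (g := smulBilin ℂ (conj c))
    (f := LinearMap.id) (f' := smulBilin (E x) c) (fun s t => ?_) (u x) (w x)
  · rw [mapV_id (g := LinearMap.id) (fun _ => rfl), ← csmul_eq_mapV] at h1
    exact h1.symm
  · change conj c • h.toFun x s t = h.toFun x s (c • t)
    rw [LinearMap.map_smulₛₗ]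

theorem pairInt_sgnE (u w : EForm W E) : h.pairInt (sgnE u) w = h.pairInt u (sgnE w) := by
  refine integralTop_congr fun x => ?_
  have h1 := sgn_wedge (M := Tan W x) (h.bilin x) (sgn (u x)) (w x)
  rw [sgn_sgn] at h1
  have h2 := congrFun h1 (2 * Module.finrank ℂ W)
  rw [sgn_apply, pow_mul, neg_one_sq, one_pow, one_smul] at h2
  exact h2

theorem pairInt_sum_left {ι : Type*} (s : Finset ι) {u : ι → EForm W E} {w : EForm W E}
    (hu : ∀ i, u i ∈ V W F E) (hw : w ∈ V W F E) :
    h.pairInt (∑ i ∈ s, u i) w = ∑ i ∈ s, h.pairInt (u i) w := by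
  classical
  induction s using Finset.induction_on with
  | empty =>
    have h1 := h.pairInt_smul_left 0 0 w
    rwa [zero_smul, zero_mul] at h1
  | insert j s hj ih =>
    rw [Finset.sum_insert hj, Finset.sum_insert hj,
      h.pairInt_add_left (hu j) (sum_mem fun i _ => hu i) hw, ih]

theorem pairInt_comp (k : ℕ) (hk : k ≤ 2 * Module.finrank ℂ W) (u w : EForm W E) :
    h.pairInt (comp k u) w = h.pairInt (comp k u) (comp (2 * Module.finrank ℂ W - k) w) := by
  refine integralTop_congr fun x => ?_
  have h1 := single_wedge_apply (M := Tan W x) (h.bilin x) (IsDeg.single k (u x k)) (w x)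
    (2 * Module.finrank ℂ W - k)
  rw [Nat.sub_add_cancel hk] at h1
  have h2 := congrFun h1 (2 * Module.finrank ℂ W)
  rw [Pi.single_eq_same] at h2
  exact h2

end HermitianMetric

namespace LefschetzData

variable (h : HermitianMetric (W := W) F E)
  {m : ℕ} {l : List (X → W [⋀^Fin 2]→ₗ[ℝ] ℝ)}
  {T : ∀ x : X, GForm (Tan W x) ℂ} {Ω : ∀ x : X, Tan W x [⋀^Fin 2]→ₗ[ℝ] ℝ}

theorem _root_.THodge.wedge_bigT_symm {M N₁ N₂ : Type*} [AddCommGroup M] [Module ℂ M]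
    [AddCommGroup N₁] [Module ℂ N₁] [AddCommGroup N₂] [Module ℂ N₂]
    (B : N₁ →ₗ[ℝ] N₂ →ₗ[ℝ] ℂ) (l : List (M [⋀^Fin 2]→ₗ[ℝ] ℝ)) (a : GForm M N₁)
    (b : GForm M N₂) : wedge B (wedge (smulBilin N₁) (bigT l) a) b =
      wedge B a (wedge (smulBilin N₂) (bigT l) b) := by
  have hs : sgn (prodTwo l) = prodTwo l := sgn_prodTwo l
  rw [wedge_bigT, wedge_bigT, ← wedge_assoc (B₁ := LinearMap.lsmul ℝ ℂ) (B₂ := B) (B₃ := B)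
    (B₄ := LinearMap.lsmul ℝ N₁) (fun x y z => by simp)]
  have e₁ := wedge_comm_of_even (LinearMap.lsmul ℝ ℂ).flip (wedge B a b) hs
  have e₂ := wedge_comm_of_even (LinearMap.lsmul ℝ N₂).flip b hs
  rw [LinearMap.flip_flip] at e₁ e₂
  rw [← e₁, ← e₂, wedge_assoc (B₁ := B) (B₂ := (LinearMap.lsmul ℝ N₂).flip)
    (B₃ := (LinearMap.lsmul ℝ ℂ).flip) (B₄ := B) (fun x y z => by simp)]

theorem pair_wedgeE (hd : LefschetzData m l T Ω) (u w : EForm W E) :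
    h.pair (wedgeE E T u) w = h.pair u (wedgeE E T w) := by
  have e := hd.eq_prodForm
  subst e
  funext x
  have h1 := wedge_bigT_symm (M := Tan W x) (h.bilin x) (l.map fun a => a x) (u x) (w x)
  exact h1

theorem pairInt_wedgeE (hd : LefschetzData m l T Ω) (u w : EForm W E) :
    h.pairInt (wedgeE E T u) w = h.pairInt u (wedgeE E T w) := by
  rw [HermitianMetric.pairInt, hd.pair_wedgeE h]
  rfl

theorem fTinv_spec {k : ℕ} {u : EForm W E} (hu : u ∈ VTdeg W F E T k) :
    fTinv F T k u ∈ Vdeg W F E k ∧ wedgeE E T (fTinv F T k u) = u :=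
  ⟨Function.invFunOn_mem hu, Function.invFunOn_eq hu⟩

theorem innerT_eq (hd : LefschetzData m l T Ω) {a : EForm W E} (ha : a ∈ V W F E)
    {u : VT W F E T} (hu : wedgeE E T a = u) (v : VT W F E T) :
    innerT m h Ω u v = h.pairInt a (hodgeStar F E T m Ω v) := by
  have hle := hd.le_finrank
  set w := hodgeStar F E T m Ω v with hw
  obtain ⟨b, hb, hbw⟩ := w.2
  have hcu : ∀ k, comp (k + 2 * (Module.finrank ℂ W - m)) (u : EForm W E) =
      wedgeE E T (comp k a) := fun k => by rw [← hu, hd.comp_wedgeE]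
  have hcw : ∀ k, comp (k + 2 * (Module.finrank ℂ W - m)) (w : EForm W E) =
      wedgeE E T (comp k b) := fun k => by rw [← hbw, hd.comp_wedgeE]
  have hVa : ∀ k, comp k a ∈ Vdeg W F E k := fun k =>
    ⟨comp_mem_V ha k, comp_mem_homogeneous k a⟩
  have hVb : ∀ k, comp k b ∈ Vdeg W F E k := fun k =>
    ⟨comp_mem_V hb k, comp_mem_homogeneous k b⟩
  have hterm : ∀ k ∈ Finset.range (2 * m + 1), (if k ≤ m then
      integralForm fun x =>
        h.pair (fTinv F T k (comp (k + 2 * (Module.finrank ℂ W - m)) (u : EForm W E)))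
          (comp (2 * m - k + 2 * (Module.finrank ℂ W - m)) (w : EForm W E)) x
          (2 * Module.finrank ℂ W)
    else
      integralForm fun x =>
        h.pair (comp (k + 2 * (Module.finrank ℂ W - m)) (u : EForm W E))
          (fTinv F T (2 * m - k)
            (comp (2 * m - k + 2 * (Module.finrank ℂ W - m)) (w : EForm W E))) x
              (2 * Module.finrank ℂ W)) = h.pairInt (comp k a) w := by
    intro k hk
    have hk' : k ≤ 2 * m := by
      rw [Finset.mem_range] at hk
      omega
    have hk2 : k ≤ 2 * Module.finrank ℂ W := by omega
    rw [h.pairInt_comp k hk2, show 2 * Module.finrank ℂ W - k =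
      2 * m - k + 2 * (Module.finrank ℂ W - m) by omega, hcu, hcw]
    split_ifs
    · change h.pairInt (fTinv F T k (wedgeE E T (comp k a))) _ = _
      obtain ⟨-, h2⟩ := fTinv_spec (F := F) (T := T) ⟨_, hVa k, rfl⟩
      rw [← hd.pairInt_wedgeE, h2, hd.pairInt_wedgeE]
    · change h.pairInt _ (fTinv F T (2 * m - k) (wedgeE E T (comp (2 * m - k) b))) = _
      obtain ⟨-, h2⟩ := fTinv_spec (F := F) (T := T) ⟨_, hVb (2 * m - k), rfl⟩
      rw [hd.pairInt_wedgeE, h2]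
  rw [innerT, Finset.sum_congr rfl hterm]
  conv_rhs => rw [← sum_comp a, h.pairInt_sum_left _ (comp_mem_V ha) (hd.VT_le w.2)]
  refine Finset.sum_subset (fun k hk => ?_) fun k hk hkm => ?_
  · rw [Finset.mem_range] at hk ⊢
    omega
  · rw [Finset.mem_range] at hk hkm
    have hk2 : k ≤ 2 * Module.finrank ℂ W := by omega
    rw [h.pairInt_comp k hk2]
    have hlt : 2 * Module.finrank ℂ W - k < 2 * (Module.finrank ℂ W - m) := by omega
    have h0 : comp (2 * Module.finrank ℂ W - k) (w : EForm W E) = 0 := by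
      funext x
      change (Pi.single _ ((w : EForm W E) x _) : GForm (Tan W x) (E x)) = 0
      have h1 : (w : EForm W E) x (2 * Module.finrank ℂ W - k) = 0 := by
        rw [← hbw]
        exact wedge_apply_of_lt (smulBilin (E x)) (hd.isDeg x) (b x) hlt
      rw [h1, Pi.single_zero]
    rw [h0]
    have h1 := h.pairInt_smul_right 0 (comp k a) 0
    rwa [smul_zero, map_zero, zero_mul] at h1

theorem innerT_add_left (hd : LefschetzData m l T Ω) (u u' v : VT W F E T) :
    innerT m h Ω (u + u') v = innerT m h Ω u v + innerT m h Ω u' v := by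
  obtain ⟨a, ha, hau⟩ := u.2
  obtain ⟨a', ha', hau'⟩ := u'.2
  rw [hd.innerT_eq h ha hau, hd.innerT_eq h ha' hau',
    hd.innerT_eq h (a := a + a') (u := u + u') (add_mem ha ha') (by
      rw [map_add, hau, hau']; rfl), h.pairInt_add_left ha ha' (hd.VT_le (Subtype.coe_prop _))]

theorem innerT_smul_left (hd : LefschetzData m l T Ω) (c : ℂ) (u v : VT W F E T) :
    innerT m h Ω (c • u) v = c * innerT m h Ω u v := by
  obtain ⟨a, ha, hau⟩ := u.2
  rw [hd.innerT_eq h ha hau, hd.innerT_eq h (a := c • a) (u := c • u)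
    (Submodule.smul_mem _ c ha) (by rw [map_smul, hau]; rfl), h.pairInt_smul_left]

theorem innerT_add_right (hd : LefschetzData m l T Ω) (u v v' : VT W F E T) :
    innerT m h Ω u (v + v') = innerT m h Ω u v + innerT m h Ω u v' := by
  obtain ⟨a, ha, hau⟩ := u.2
  rw [hd.innerT_eq h ha hau, hd.innerT_eq h ha hau, hd.innerT_eq h ha hau, map_add,
    ← h.pairInt_add_right ha (hd.VT_le (Subtype.coe_prop _)) (hd.VT_le (Subtype.coe_prop _))]
  rfl

theorem innerT_smul_right (hd : LefschetzData m l T Ω) (c : ℂ) (u v : VT W F E T) :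
    innerT m h Ω u (c • v) = conj c * innerT m h Ω u v := by
  obtain ⟨a, ha, hau⟩ := u.2
  rw [hd.innerT_eq h ha hau, hd.innerT_eq h ha hau, map_smul, ← h.pairInt_smul_right]
  rfl

theorem hodgeStar_injective (hd : LefschetzData m l T Ω) :
    Function.Injective (hodgeStar F E T m Ω) := by
  intro v v' hvv
  have h1 : onVT F T weil v = onVT F T weil v' :=
    (lefschetzStar F E T m Ω).injective hvv
  have h2 : weil (v : EForm W E) = weil (v' : EForm W E) := by
    rw [← hd.restrictsTo_weil, ← hd.restrictsTo_weil, h1]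
  have h3 := congrArg weil h2
  rw [weil_weil, weil_weil] at h3
  refine Subtype.ext ?_
  rw [← sgnE_sgnE (v : EForm W E), h3, sgnE_sgnE]

theorem eq_of_innerT (hd : LefschetzData m l T Ω) {v v' : VT W F E T}
    (hv : ∀ u, innerT m h Ω u v = innerT m h Ω u v') : v = v' := by
  rw [← sub_eq_zero]
  refine hd.hodgeStar_injective ?_
  rw [map_zero]
  refine Subtype.ext (h.eq_zero_of_pairInt (hd.VT_le (Subtype.coe_prop _)) fun a ha => ?_)
  rw [← hd.innerT_eq h ha (u := ⟨wedgeE E T a, a, ha, rfl⟩) rfl, sub_eq_add_neg,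
    ← neg_one_smul ℂ v', hd.innerT_add_right, hd.innerT_smul_right, hv]
  simp

theorem isAdjoint_unique (hd : LefschetzData m l T Ω) {P Q Q' : Module.End ℂ (VT W F E T)}
    (hQ : IsAdjoint m h Ω P Q) (hQ' : IsAdjoint m h Ω P Q') : Q = Q' :=
  LinearMap.ext fun v => hd.eq_of_innerT h fun u => (hQ u v).symm.trans (hQ' u v)

theorem adj_eq (hd : LefschetzData m l T Ω) {P Q : Module.End ℂ (VT W F E T)}
    (hQ : IsAdjoint m h Ω P Q) : adj m h Ω P = Q := by
  have hex : ∃ Q, IsAdjoint m h Ω P Q := ⟨Q, hQ⟩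
  rw [adj, dif_pos hex]
  exact hd.isAdjoint_unique h hex.choose_spec hQ

theorem isAdjoint_add (hd : LefschetzData m l T Ω) {P Q P' Q' : Module.End ℂ (VT W F E T)}
    (hQ : IsAdjoint m h Ω P Q) (hQ' : IsAdjoint m h Ω P' Q') :
    IsAdjoint m h Ω (P + P') (Q + Q') := fun u v => by
  rw [LinearMap.add_apply, LinearMap.add_apply, hd.innerT_add_left, hd.innerT_add_right, hQ, hQ']

theorem isAdjoint_smul (hd : LefschetzData m l T Ω) (c : ℂ) {P Q : Module.End ℂ (VT W F E T)}
    (hQ : IsAdjoint m h Ω P Q) : IsAdjoint m h Ω (c • P) (conj c • Q) := fun u v => by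
  rw [LinearMap.smul_apply, LinearMap.smul_apply, hd.innerT_smul_left, hd.innerT_smul_right, hQ,
    Complex.conj_conj]

end LefschetzData

end Inner

section Adjoint

variable {W : Type*} [NormedAddCommGroup W] [NormedSpace ℂ W] [FiniteDimensional ℂ W]
  {X : Type*} [TopologicalSpace X] [ChartedSpace W X] [IsManifold 𝓘(ℂ, W) ω X]
  [T2Space X] [SigmaCompactSpace X]
  {F : Type*} [NormedAddCommGroup F] [NormedSpace ℂ F] [FiniteDimensional ℂ F]
  {E : X → Type*} [∀ x, AddCommGroup (E x)] [∀ x, Module ℂ (E x)]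
  [∀ x, TopologicalSpace (E x)] [TopologicalSpace (Bundle.TotalSpace F E)]
  [FiberBundle F E] [VectorBundle ℂ F E] [ContMDiffVectorBundle ω F E 𝓘(ℂ, W)]
  (h : HermitianMetric (W := W) F E)
  {m : ℕ} {l : List (X → W [⋀^Fin 2]→ₗ[ℝ] ℝ)}
  {T : ∀ x : X, GForm (Tan W x) ℂ} {Ω : ∀ x : X, Tan W x [⋀^Fin 2]→ₗ[ℝ] ℝ}

namespace LefschetzData

theorem lefschetzStar_symm (hd : LefschetzData m l T Ω) (u : VT W F E T) :
    (lefschetzStar F E T m Ω).symm u = lefschetzStar F E T m Ω u := by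
  rw [LinearEquiv.symm_apply_eq]
  exact (hd.lefschetzModule.star_star hd.isStar u).symm

theorem Lam_apply (hd : LefschetzData m l T Ω) (u : VT W F E T) :
    Lam F E T m Ω u = lefschetzStar F E T m Ω
      (lefschetz F E T Ω (lefschetzStar F E T m Ω u)) := hd.lefschetzStar_symm _

theorem weil_lefschetz (hd : LefschetzData m l T Ω) (u : VT W F E T) :
    onVT F T weil (lefschetz F E T Ω u) = lefschetz F E T Ω (onVT F T weil u) := by
  refine Subtype.ext ?_
  rw [hd.restrictsTo_weil, hd.restrictsTo_lefschetz, hd.restrictsTo_lefschetz,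
    hd.restrictsTo_weil]
  exact weil_wedgeE hd.closed'.jf_eq _

theorem weil_mem_degVT (hd : LefschetzData m l T Ω) {d : ℕ} {u : VT W F E T}
    (hu : u ∈ degVT F E T d) : onVT F T weil u ∈ degVT F E T d := by
  rw [hd.mem_degVT] at hu ⊢
  rw [hd.restrictsTo_weil]
  exact mem_homogeneous_iff.2 fun x => (mem_homogeneous_iff.1 hu x).pull _

theorem weil_lefschetzStar (hd : LefschetzData m l T Ω) (u : VT W F E T) :
    onVT F T weil (lefschetzStar F E T m Ω u) = lefschetzStar F E T m Ω (onVT F T weil u) :=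
  (hd.lefschetzModule.star_comm hd.isStar (fun _ _ hu => hd.weil_mem_degVT hu)
    hd.weil_lefschetz u).symm

theorem weil_Lam (hd : LefschetzData m l T Ω) (u : VT W F E T) :
    onVT F T weil (Lam F E T m Ω u) = Lam F E T m Ω (onVT F T weil u) := by
  rw [hd.Lam_apply, hd.Lam_apply, hd.weil_lefschetzStar, hd.weil_lefschetz,
    hd.weil_lefschetzStar]

theorem dbarT_mem (hd : LefschetzData m l T Ω) (d : ℕ) (u : VT W F E T)
    (hu : u ∈ degVT F E T d) : dbarT F E T u ∈ degVT F E T (d + 1) := by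
  rw [hd.mem_degVT] at hu ⊢
  rw [hd.restrictsTo_dbarT, add_right_comm]
  exact dbarE_mem_homogeneous hu

theorem delT_mem (hd : LefschetzData m l T Ω) (d : ℕ) (u : VT W F E T)
    (hu : u ∈ degVT F E T d) : delT T h u ∈ degVT F E T (d + 1) := by
  rw [hd.mem_degVT] at hu ⊢
  rw [hd.restrictsTo_delT, add_right_comm]
  exact h.delE_mem_homogeneous hu

theorem isSmooth_coe (hd : LefschetzData m l T Ω) (u : VT W F E T) :
    IsSmooth F (u : EForm W E) := (mem_V_iff.1 (hd.VT_le u.2)).1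

theorem dbarT_lefschetz (hd : LefschetzData m l T Ω) (u : VT W F E T) :
    dbarT F E T (lefschetz F E T Ω u) = lefschetz F E T Ω (dbarT F E T u) := by
  refine Subtype.ext ?_
  rw [hd.restrictsTo_dbarT, hd.restrictsTo_lefschetz, hd.restrictsTo_lefschetz,
    hd.restrictsTo_dbarT]
  exact dbarE_wedgeE (hd.isSmooth_coe u) hd.closed'

theorem delT_lefschetz (hd : LefschetzData m l T Ω) (u : VT W F E T) :
    delT T h (lefschetz F E T Ω u) = lefschetz F E T Ω (delT T h u) := by
  refine Subtype.ext ?_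
  rw [hd.restrictsTo_delT, hd.restrictsTo_lefschetz, hd.restrictsTo_lefschetz,
    hd.restrictsTo_delT]
  exact h.delE_wedgeE (hd.isSmooth_coe u) hd.closed'

theorem weil_dbarT (hd : LefschetzData m l T Ω) (u : VT W F E T) :
    onVT F T weil (dbarT F E T u) = -Complex.I • dbarT F E T (onVT F T weil u) := by
  refine Subtype.ext ?_
  rw [hd.restrictsTo_weil, Submodule.coe_smul, hd.restrictsTo_dbarT, hd.restrictsTo_dbarT,
    hd.restrictsTo_weil]
  exact dbarE_weil (hd.isSmooth_coe u)

theorem weil_delT (hd : LefschetzData m l T Ω) (u : VT W F E T) :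
    onVT F T weil (delT T h u) = Complex.I • delT T h (onVT F T weil u) := by
  refine Subtype.ext ?_
  rw [hd.restrictsTo_weil, Submodule.coe_smul, hd.restrictsTo_delT, hd.restrictsTo_delT,
    hd.restrictsTo_weil]
  exact h.delE_weil (hd.isSmooth_coe u)

theorem dbarT_dbarT (hd : LefschetzData m l T Ω) : dbarT F E T * dbarT F E T = 0 :=
  LinearMap.ext fun u => Subtype.ext (by
    rw [Module.End.mul_apply, hd.restrictsTo_dbarT, hd.restrictsTo_dbarT]
    exact dbarE_dbarE (hd.isSmooth_coe u))

theorem delT_delT (hd : LefschetzData m l T Ω) : delT T h * delT T h = 0 :=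
  LinearMap.ext fun u => Subtype.ext (by
    rw [Module.End.mul_apply, hd.restrictsTo_delT, hd.restrictsTo_delT]
    exact h.delE_delE (hd.isSmooth_coe u))

theorem hodgeStar_commutator (hd : LefschetzData m l T Ω) {D : Module.End ℂ (VT W F E T)}
    (hD : ∀ d, ∀ u ∈ degVT F E T d, D u ∈ degVT F E T (d + 1))
    (hDL : ∀ u, D (lefschetz F E T Ω u) = lefschetz F E T Ω (D u)) {c : ℂ}
    (hJD : ∀ u, onVT F T weil (D u) = c • D (onVT F T weil u)) (v : VT W F E T) :
    c • sgnE (D (hodgeStar F E T m Ω v) : EForm W E) =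
      -(hodgeStar F E T m Ω (commutator (Lam F E T m Ω) D v) : EForm W E) := by
  have hle := hd.le_finrank
  have key : ∀ d ≤ 2 * m, ∀ v ∈ degVT F E T d,
      c • sgnE (D (hodgeStar F E T m Ω v) : EForm W E) =
        -(hodgeStar F E T m Ω (commutator (Lam F E T m Ω) D v) : EForm W E) := by
    intro d hdm v hv
    have hJv := hd.weil_mem_degVT hv
    have hst : hodgeStar F E T m Ω v ∈ degVT F E T (2 * m - d) :=
      hd.lefschetzModule.star_mem hd.isStar hdm hJv
    have h1 := hD _ _ hst
    rw [hd.mem_degVT] at h1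
    rw [sgnE_of_mem h1]
    have h2 := hd.lefschetzModule.star_conj hd.isStar hD hDL hJv
    have h3 : D (hodgeStar F E T m Ω v) = (-1 : ℂ) ^ d • lefschetzStar F E T m Ω
        (Lam F E T m Ω (D (onVT F T weil v)) - D (Lam F E T m Ω (onVT F T weil v))) := by
      rw [← map_smul, hd.Lam_apply, hd.Lam_apply]
      exact (hd.lefschetzModule.star_star hd.isStar _).symm.trans
        (congrArg (lefschetzStar F E T m Ω) h2)
    have h4 : hodgeStar F E T m Ω (commutator (Lam F E T m Ω) D v) =
        c • lefschetzStar F E T m Ω (Lam F E T m Ω (D (onVT F T weil v)) -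
          D (Lam F E T m Ω (onVT F T weil v))) := by
      rw [← map_smul]
      refine congrArg (lefschetzStar F E T m Ω) ?_
      change onVT F T weil (Lam F E T m Ω (D v) - D (Lam F E T m Ω v)) = _
      rw [map_sub, hd.weil_Lam, hJD, hJD, hd.weil_Lam, map_smul, smul_sub]
    rw [h4, h3, Submodule.coe_smul, Submodule.coe_smul, smul_smul, smul_smul, ← neg_smul]
    congr 1
    rw [mul_assoc, ← pow_add, Odd.neg_one_pow]
    · ring
    · exact ⟨Module.finrank ℂ W, by omega⟩
  have hsum := hd.lefschetzModule.sum_proj v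
  have key2 : ∀ s ⊆ Finset.range (2 * m + 1),
      c • sgnE (D (hodgeStar F E T m Ω (∑ d ∈ s,
        onVT F T (comp (E := E) (d + 2 * (Module.finrank ℂ W - m))) v)) : EForm W E) =
      -(hodgeStar F E T m Ω (commutator (Lam F E T m Ω) D (∑ d ∈ s,
        onVT F T (comp (E := E) (d + 2 * (Module.finrank ℂ W - m))) v)) : EForm W E) := by
    classical
    intro s
    induction s using Finset.induction_on with
    | empty =>
      intro _
      rw [Finset.sum_empty, map_zero, map_zero, map_zero, map_zero]
      have h0 : sgnE (0 : EForm W E) = 0 := funext fun x => map_zero sgn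
      refine (congrArg (fun t => c • t) h0).trans ?_
      rw [smul_zero]
      exact neg_zero.symm
    | insert d s hds ih =>
      intro hs
      rw [Finset.sum_insert hds, map_add, map_add, map_add, map_add, Submodule.coe_add,
        Submodule.coe_add, neg_add, ← ih fun i hi => hs (Finset.mem_insert_of_mem hi),
        ← key d (by have := Finset.mem_range.1 (hs (Finset.mem_insert_self d s)); omega) _
          (hd.lefschetzModule.proj_mem d v), ← smul_add]
      exact congrArg (fun t => c • t) (funext fun x => map_add sgn _ _)
  have := key2 _ subset_rfl
  rwa [hsum] at this

theorem isAdjoint_dbarT (hd : LefschetzData m l T Ω) :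
    IsAdjoint m h Ω (dbarT F E T) (-Complex.I • commutator (Lam F E T m Ω) (delT T h)) := by
  intro u v
  obtain ⟨a, ha, hau⟩ := u.2
  have hu : wedgeE E T (dbarE F a) = (dbarT F E T u : EForm W E) := by
    rw [hd.restrictsTo_dbarT, ← hau]
    exact (dbarE_wedgeE (mem_V_iff.1 ha).1 hd.closed).symm
  have h1 := h.pairInt_dbarE ha (hd.VT_le (hodgeStar F E T m Ω v).2)
  rw [← hd.restrictsTo_delT, h.pairInt_sgnE] at h1
  have h2 := hd.hodgeStar_commutator (hd.delT_mem h) (hd.delT_lefschetz h) (hd.weil_delT h) v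
  rw [hd.innerT_eq h (dbarE_mem_V ha) hu, hd.innerT_eq h ha hau, eq_neg_of_add_eq_zero_left h1,
    LinearMap.smul_apply, map_smul, Submodule.coe_smul, neg_smul, ← smul_neg, ← h2, smul_smul,
    Complex.I_mul_I, h.pairInt_smul_right]
  simp

theorem isAdjoint_delT (hd : LefschetzData m l T Ω) :
    IsAdjoint m h Ω (delT T h) (Complex.I • commutator (Lam F E T m Ω) (dbarT F E T)) := by
  intro u v
  obtain ⟨a, ha, hau⟩ := u.2
  have hu : wedgeE E T (delE h a) = (delT T h u : EForm W E) := by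
    rw [hd.restrictsTo_delT, ← hau]
    exact (h.delE_wedgeE (mem_V_iff.1 ha).1 hd.closed).symm
  have h1 := h.pairInt_delE ha (hd.VT_le (hodgeStar F E T m Ω v).2)
  rw [← hd.restrictsTo_dbarT, h.pairInt_sgnE] at h1
  have h2 := hd.hodgeStar_commutator hd.dbarT_mem hd.dbarT_lefschetz hd.weil_dbarT v
  rw [hd.innerT_eq h (delE_mem_V h ha) hu, hd.innerT_eq h ha hau, eq_neg_of_add_eq_zero_left h1,
    LinearMap.smul_apply, map_smul, Submodule.coe_smul, ← neg_neg (hodgeStar F E T m Ω _ :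
    EForm W E), ← h2, neg_smul, neg_neg, smul_smul, Complex.I_mul_I, h.pairInt_smul_right]
  simp

end LefschetzData

end Adjoint

section Algebra

variable {U : Type*} [AddCommGroup U] [Module ℂ U] {A B Λ : Module.End ℂ U}

theorem commutator_add_right (P Q Q' : Module.End ℂ U) :
    commutator P (Q + Q') = commutator P Q + commutator P Q' := by
  rw [commutator, commutator, commutator]
  noncomm_ring

theorem commutator_smul_right (c : ℂ) (P Q : Module.End ℂ U) :
    commutator P (c • Q) = c • commutator P Q := by
  rw [commutator, commutator, mul_smul_comm, smul_mul_assoc, smul_sub]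

theorem commutator_smul_left (c : ℂ) (P Q : Module.End ℂ U) :
    commutator (c • P) Q = c • commutator P Q := by
  rw [commutator, commutator, mul_smul_comm, smul_mul_assoc, smul_sub]

theorem bochner_kodaira_nakano (hA : A * A = 0) (hB : B * B = 0) :
    A * (-Complex.I • commutator Λ B) + -Complex.I • commutator Λ B * A =
      B * (Complex.I • commutator Λ A) + Complex.I • commutator Λ A * B +
        commutator (Complex.I • (A + B) ^ 2) Λ := by
  have h : (A + B) ^ 2 = A * B + B * A := by
    rw [pow_two, add_mul, mul_add, mul_add, hA, hB, zero_add, add_zero]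
  rw [commutator_smul_left, h, mul_smul_comm, mul_smul_comm, smul_mul_assoc, smul_mul_assoc,
    neg_smul, neg_smul, ← neg_add, ← smul_add, ← smul_add, ← smul_neg, ← smul_add]
  congr 1
  rw [commutator, commutator, commutator]
  noncomm_ring

theorem mul_commutator_add (hA : A * A = 0) : A * commutator Λ A + commutator Λ A * A = 0 := by
  rw [commutator, mul_sub, sub_mul, mul_assoc Λ, hA, ← mul_assoc A A, hA, mul_assoc A]
  simp

end Algebra

section Laplacian

variable {U : Type*} [AddCommGroup U] [Module ℂ U] {A B Λ : Module.End ℂ U}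

theorem laplacian_add (hA : A * A = 0) (hB : B * B = 0) :
    (A + B) * (-Complex.I • commutator Λ B + Complex.I • commutator Λ A) +
        (-Complex.I • commutator Λ B + Complex.I • commutator Λ A) * (A + B) =
      A * (-Complex.I • commutator Λ B) + -Complex.I • commutator Λ B * A +
        (B * (Complex.I • commutator Λ A) + Complex.I • commutator Λ A * B) := by
  have h1 : A * (Complex.I • commutator Λ A) + Complex.I • commutator Λ A * A = 0 := by
    rw [mul_smul_comm, smul_mul_assoc, ← smul_add, mul_commutator_add hA, smul_zero]
  have h2 : B * (-Complex.I • commutator Λ B) + -Complex.I • commutator Λ B * B = 0 := by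
    rw [mul_smul_comm, smul_mul_assoc, ← smul_add, mul_commutator_add hB, smul_zero]
  generalize -Complex.I • commutator Λ B = P at *
  generalize Complex.I • commutator Λ A = Q at *
  rw [add_mul, mul_add, mul_add, mul_add, add_mul, add_mul]
  refine Eq.trans (b := A * P + P * A + (B * Q + Q * B) +
    ((A * Q + Q * A) + (B * P + P * B))) (by abel) ?_
  rw [h1, h2, add_zero, add_zero]

theorem sub_commutator :
    -Complex.I • commutator Λ B + Complex.I • commutator Λ A =
      commutator Λ (Complex.I • A - Complex.I • B) := by
  rw [sub_eq_add_neg, ← neg_smul, commutator_add_right, commutator_smul_right,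
    commutator_smul_right, add_comm]

theorem neg_commutator_sub : -commutator Λ B - commutator Λ A = commutator (A + B) Λ := by
  rw [commutator, commutator, commutator]
  noncomm_ring

theorem conj_smul_commutator_add :
    conj Complex.I • -Complex.I • commutator Λ B +
        conj (-Complex.I) • Complex.I • commutator Λ A =
      commutator (A + B) Λ := by
  rw [← neg_commutator_sub, smul_smul, smul_smul, map_neg, Complex.conj_I, neg_neg, neg_mul_neg,
    Complex.I_mul_I, neg_one_smul, neg_one_smul, sub_eq_add_neg]

theorem smul_add_neg_smul :
    Complex.I • A + -Complex.I • B = Complex.I • A - Complex.I • B := by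
  rw [neg_smul, sub_eq_add_neg]

theorem laplacian_sub (hA : A * A = 0) (hB : B * B = 0) :
    (Complex.I • A - Complex.I • B) * commutator (A + B) Λ +
        commutator (A + B) Λ * (Complex.I • A - Complex.I • B) =
      A * (-Complex.I • commutator Λ B) + -Complex.I • commutator Λ B * A +
        (B * (Complex.I • commutator Λ A) + Complex.I • commutator Λ A * B) := by
  have h1 := mul_commutator_add (Λ := Λ) hA
  have h2 := mul_commutator_add (Λ := Λ) hB
  rw [← neg_commutator_sub]
  generalize commutator Λ B = P at *
  generalize commutator Λ A = Q at *
  rw [neg_smul, mul_neg, neg_mul]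
  simp only [mul_smul_comm, smul_mul_assoc, ← smul_sub, ← smul_add, ← smul_neg]
  congr 1
  rw [sub_mul, mul_sub, mul_sub, mul_sub, sub_mul, sub_mul]
  simp only [mul_neg, neg_mul]
  refine Eq.trans (b := -(A * P + P * A) + (B * Q + Q * B) +
    ((B * P + P * B) - (A * Q + Q * A))) (by abel) ?_
  rw [h1, h2, sub_zero, add_zero, neg_add]

end Laplacian

section Data

variable {W : Type*} [NormedAddCommGroup W] [NormedSpace ℂ W] [FiniteDimensional ℂ W]
  {X : Type*} [TopologicalSpace X] [ChartedSpace W X] [IsManifold 𝓘(ℂ, W) ω X]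

theorem isClosedInvariant_prodForm {l : List (X → W [⋀^Fin 2]→ₗ[ℝ] ℝ)}
    (hl : ∀ a ∈ l, ∀ x, IsPos (a x)) (hs : ∀ a ∈ l, IsSmoothForm fun x => ofTwoForm (a x))
    {T : ∀ x : X, GForm (Tan W x) ℂ} (hT : untan T = prodForm l) (hc : IsDClosed T) :
    IsClosedInvariant (untan T) :=
  hc.isClosedInvariant (hT ▸ isSmoothForm_prodForm hs) (hT ▸ jf_prodForm hl)
    (hT ▸ fun _ => sgn_bigT _)

theorem prodForm_singleton (a : X → W [⋀^Fin 2]→ₗ[ℝ] ℝ) :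
    prodForm [a] = fun x => ofTwoForm (a x) := by
  funext x
  exact (bigT_cons (a x) []).trans (((wedge_const_right _ (ofTwoForm (a x)) (1 : ℂ))).trans
    (funext fun k => AlternatingMap.ext fun v => mul_one _))

theorem lefschetzData {n m : ℕ} (hn : Module.finrank ℂ W = n) (hm : m ≤ n)
    {Ω : ∀ x : X, Tan W x [⋀^Fin 2]→ₗ[ℝ] ℝ} (hΩ : IsPositiveForm Ω)
    {α : Fin (n - m) → ∀ x : X, Tan W x [⋀^Fin 2]→ₗ[ℝ] ℝ} (hα : ∀ j, IsPositiveForm (α j))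
    (hTclosed : IsDClosed (wedgeProd α)) (hΩclosed : IsDClosed fun x => ofTwoForm (Ω x)) :
    LefschetzData m (List.ofFn fun j => untan₂ (α j)) (wedgeProd α) Ω := by
  have hpos : ∀ a ∈ List.ofFn fun j => untan₂ (α j), ∀ x, IsPos (a x) := by
    intro a ha
    obtain ⟨j, rfl⟩ := List.mem_ofFn.1 ha
    exact (hα j).isPos
  have hsm : ∀ a ∈ List.ofFn fun j => untan₂ (α j), IsSmoothForm fun x => ofTwoForm (a x) := by
    intro a ha
    obtain ⟨j, rfl⟩ := List.mem_ofFn.1 ha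
    exact (hα j).isSmoothForm
  have hpos' : ∀ a ∈ [untan₂ Ω], ∀ x, IsPos (a x) := by
    intro a ha
    rw [List.mem_singleton.1 ha]
    exact hΩ.isPos
  have hsm' : ∀ a ∈ [untan₂ Ω], IsSmoothForm fun x => ofTwoForm (a x) := by
    intro a ha
    rw [List.mem_singleton.1 ha]
    exact hΩ.isSmoothForm
  exact
    { length_add := by rw [List.length_ofFn, hn, Nat.sub_add_cancel hm]
      eq_prodForm := untan_wedgeProd α
      isPos := hpos
      isSmooth := hsm
      isPos' := hΩ.isPos
      isSmooth' := hΩ.isSmoothForm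
      closed := isClosedInvariant_prodForm hpos hsm (untan_wedgeProd α) hTclosed
      closed' := isClosedInvariant_prodForm hpos' hsm' (prodForm_singleton _).symm hΩclosed }

end Data

end THodge

end

theorem theorem4p8
    {W : Type*} [NormedAddCommGroup W] [NormedSpace ℂ W] [FiniteDimensional ℂ W]
    {n m : ℕ} (hn : Module.finrank ℂ W = n) (hm : m ≤ n)
    {X : Type*} [TopologicalSpace X] [T2Space X] [SigmaCompactSpace X]
    [ChartedSpace W X] [IsManifold 𝓘(ℂ, W) ω X]
    {F : Type*} [NormedAddCommGroup F] [NormedSpace ℂ F] [FiniteDimensional ℂ F]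
    {E : X → Type*} [∀ x, AddCommGroup (E x)] [∀ x, Module ℂ (E x)]
    [∀ x, TopologicalSpace (E x)] [TopologicalSpace (Bundle.TotalSpace F E)]
    [FiberBundle F E] [VectorBundle ℂ F E]
    [ContMDiffVectorBundle ω F E 𝓘(ℂ, W)]
    (h : THodge.HermitianMetric (W := W) F E)
    (Ω : ∀ x : X, THodge.Tan W x [⋀^Fin 2]→ₗ[ℝ] ℝ) (hΩ : THodge.IsPositiveForm Ω)
    (α : Fin (n - m) → ∀ x : X, THodge.Tan W x [⋀^Fin 2]→ₗ[ℝ] ℝ)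
    (hα : ∀ j, THodge.IsPositiveForm (α j))
    (T : ∀ x : X, THodge.GForm (THodge.Tan W x) ℂ) (hT : T = THodge.wedgeProd α)
    (hTclosed : THodge.IsDClosed T)
    (hΩclosed : THodge.IsDClosed fun x => THodge.ofTwoForm (Ω x)) :
    -- the operators are well defined
    THodge.RestrictsTo (THodge.wedgeE E fun x => THodge.ofTwoForm (Ω x))
      (THodge.lefschetz F E T Ω) ∧
    THodge.RestrictsTo THodge.weil (THodge.onVT F T (THodge.weil (E := E))) ∧
    THodge.RestrictsTo (THodge.dbarE F) (THodge.dbarT F E T) ∧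
    THodge.RestrictsTo (THodge.delE h) (THodge.delT T h) ∧
    THodge.IsLefschetzStar m Ω (THodge.lefschetzStar F E T m Ω) ∧
    (∀ s, THodge.IsLefschetzStar m Ω s → s = THodge.lefschetzStar F E T m Ω) ∧
    (∀ P ∈ ({THodge.dbarT F E T, THodge.delT T h, THodge.DT T h, THodge.DcT T h} :
        Set (Module.End ℂ (THodge.VT W F E T))),
      THodge.IsAdjoint m h Ω P (THodge.adj m h Ω P) ∧
      ∀ Q, THodge.IsAdjoint m h Ω P Q → Q = THodge.adj m h Ω P) ∧
    -- the Kähler identities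
    THodge.adj m h Ω (THodge.DT T h) = THodge.commutator (THodge.Lam F E T m Ω) (THodge.DcT T h) ∧
    THodge.adj m h Ω (THodge.DcT T h) = THodge.commutator (THodge.DT T h) (THodge.Lam F E T m Ω) ∧
    -- the Bochner–Kodaira–Nakano identity
    THodge.laplacian m h Ω (THodge.dbarT F E T) =
      THodge.laplacian m h Ω (THodge.delT T h) +
        THodge.commutator (Complex.I • THodge.curvT T h) (THodge.Lam F E T m Ω) ∧
    -- the equality of the Laplacians
    THodge.laplacian m h Ω (THodge.DcT T h) = THodge.laplacian m h Ω (THodge.DT T h) ∧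
    THodge.laplacian m h Ω (THodge.DT T h) =
      THodge.laplacian m h Ω (THodge.dbarT F E T) + THodge.laplacian m h Ω (THodge.delT T h) := by
  subst hT
  have hd := THodge.lefschetzData hn hm hΩ hα hTclosed hΩclosed
  have hA := hd.isAdjoint_dbarT h
  have hB := hd.isAdjoint_delT h
  have hAA := hd.dbarT_dbarT (F := F) (E := E)
  have hBB := hd.delT_delT h
  have hD := hd.isAdjoint_add h hA hB
  have hDc := hd.isAdjoint_add h (hd.isAdjoint_smul h Complex.I hA)
    (hd.isAdjoint_smul h (-Complex.I) hB)
  replace hDc : THodge.IsAdjoint m h Ω (THodge.DcT (THodge.wedgeProd α) h)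
      (THodge.commutator (THodge.DT (THodge.wedgeProd α) h)
        (THodge.Lam F E (THodge.wedgeProd α) m Ω)) :=
    THodge.smul_add_neg_smul.subst (motive := fun P => THodge.IsAdjoint m h Ω P _)
      (THodge.conj_smul_commutator_add.subst (motive := fun Q => THodge.IsAdjoint m h Ω _ Q) hDc)
  have hunique : ∀ {P Q}, THodge.IsAdjoint m h Ω P Q → THodge.IsAdjoint m h Ω P
      (THodge.adj m h Ω P) ∧ ∀ Q, THodge.IsAdjoint m h Ω P Q → Q = THodge.adj m h Ω P :=
    fun hQ => ⟨(hd.adj_eq h hQ).symm ▸ hQ, fun _ hQ' => (hd.adj_eq h hQ').symm⟩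
  refine ⟨hd.restrictsTo_lefschetz, hd.restrictsTo_weil, hd.restrictsTo_dbarT,
    hd.restrictsTo_delT h, hd.isLefschetzStar, fun s hs => hd.eq_lefschetzStar hs, ?_, ?_, ?_, ?_,
    ?_, ?_⟩
  · rintro P (rfl | rfl | rfl | rfl)
    exacts [hunique hA, hunique hB, hunique hD, hunique hDc]
  · exact (hd.adj_eq h hD).trans THodge.sub_commutator
  · exact hd.adj_eq h hDc
  · rw [THodge.laplacian, THodge.laplacian, hd.adj_eq h hA, hd.adj_eq h hB, THodge.curvT, THodge.DT]
    exact THodge.bochner_kodaira_nakano hAA hBB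
  · rw [THodge.laplacian, THodge.laplacian, hd.adj_eq h hDc, THodge.DT, hd.adj_eq h hD,
      THodge.DcT]
    exact (THodge.laplacian_sub hAA hBB).trans (THodge.laplacian_add hAA hBB).symm
  · rw [THodge.laplacian, THodge.laplacian, THodge.laplacian, THodge.DT, hd.adj_eq h hD,
      hd.adj_eq h hA, hd.adj_eq h hB]
    exact THodge.laplacian_add hAA hBB
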